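/- **Setting.** Fix $T,w_0>0$, $\nu^{\max}>w_0/T$, $\rho\ge 0$, $K\in\mathbb N$; a generator matrix $(q^{ij})_{i,j\le K}$ (nonnegative off-diagonal entries, zero row sums); a continuous, increasing $f\ge 0$ on $[0,\nu^{\max}]$; a continuous, increasing, concave $h$ on $[0,w_0]$ with $h(0)=0$, $h(w)\le w$. Let $\eta^j(t,\nu;dz)$ ($j\le K$, $t\in[0,T]$, $\nu\in[0,\nu^{\max}]$) be measures on $\mathbb R$. *Assumption 1.* There is a finite measure $\eta^{\mathbf Q}$ on $\mathbb R$ with compact support $\operatorname{supp}(\eta)\subset(-1,\infty)$ such that $\eta^j(t,\nu;dz)=d_j(t,\nu,z)\,\eta^{\mathbf Q}(dz)$ with jointly measurable densities $d_j$ and, for some constant $M>0$ and all $j,t,\nu$, $M^{-1}<d_j(t,\nu,z)<M$ for $\eta^{\mathbf Q}$-a.e. $z$. For $\pi$ in the simplex $\mathcal S^K$ put $u^i(t,\nu,\pi,z)=d_i(t,\nu,z)/\sum_j\pi^jd_j(t,\nu,z)-1$. *Assumption 2.* (i) For each $j$ and each bounded continuous $\phi$, $(t,\nu)\mapsto\int\phi\,d\eta^j(t,\nu)$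 is continuous on $[0,T]\times[0,\nu^{\max}]$. (ii) If $(t^n,\nu^n,\pi^n)\in[0,T)\times[0,\nu^{\max}]\times\mathcal S^K$ converges to $(t,\nu,\pi)$, then $u^j(t^n,\nu^n,\pi^n,\cdot)\to u^j(t,\nu,\pi,\cdot)$ uniformly on $\operatorname{supp}(\eta)$, for each $j$. **The controlled process.** States are $x=(t,w,s,\pi)\in\widetilde{\mathcal X}=[0,T]\times[0,w_0]\times[0,\infty)\times\mathcal S^K$. Let $$g(x,\nu)=\Big(1,-\nu,0,\big(\textstyle\sum_jq^{jk}\pi^j-\pi^k\sum_j\pi^j\int u^k(t,\nu,\pi,z)\,\eta^j(t,\nu;dz)\big)_{k\le K}\Big),\qquad \lambda(x,\nu)=\sum_j\pi^j\eta^j(t,\nu;\mathbb R),$$ $$\overline Qv(x,\nu)=\sum_j\pi^j\int v\big(t,w,s(1+z),(\pi^i(1+u^i(t,\nu,\pi,z)))_i\big)\,\eta^j(t,\nu;dz).$$ Let $\mathcal A$ be the set of measurable $\alpha:[0,T]\to[0,\nu^{\max}]$. For $\alpha\in\mathcal A$ let $\varphi^\alpha_v(x)$ be the solution of $\dot y=g(y,\alpha_v)$,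 $y_0=x$ (in integrated form, filter component in $\mathcal S^K$); $\Lambda^\alpha_v(x)=\int_0^v\lambda(\varphi^\alpha_r(x),\alpha_r)\,dr$; and let $\tau^\varphi=\tau^\varphi(x,\alpha)$ be the first time at which the flow reaches the lateral boundary $\{w=0\}$ or the terminal boundary $\{t=T\}$ of $\widetilde{\mathcal X}$. A strategy is a sequence $\{\nu^n\}$ of maps $\nu^n:\widetilde{\mathcal X}\to\mathcal A$ (jointly measurable in state and elapsed time). Started in $x=(t,w,s,\pi)$, the state process $(r,W_r,S_r,\pi_r)$, $r\in[t,T]$, is the piecewise deterministic Markov process with characteristics $g$, $\lambda$, $\overline Q/\lambda$, controlled by the rate $\nu_r=\nu^n(r-T_n,\widetilde X_{T_n})$ from the $n$-th jump time $T_n$ (with $T_0=t$) to the next one, selling being stopped once the inventory is zero. With $\tau=\inf\{r\ge t:W_r\le0\}\wedge T$, the value function is $$V(x)=\sup_{\{\nu^n\}}\mathbb E^{\{\nu^n\}}_x\Big[\int_t^\tau e^{-\rho(r-t)}\nu_rS_r(1-f(\nu_r))\,dr+e^{-\rho(\tau-t)}h(W_\tau)S_\tau\Big].$$ **The decision model.**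 For $\alpha\in\mathcal A$ let, with $w_{\tau^\varphi}$ the inventory component of $\varphi^\alpha_{\tau^\varphi}(x)$, $$r(x,\alpha)=\int_0^{\tau^\varphi}e^{-\rho v-\Lambda^\alpha_v(x)}\alpha_v\,s\,(1-f(\alpha_v))\,dv+e^{-\rho\tau^\varphi-\Lambda^\alpha_{\tau^\varphi}(x)}h(w_{\tau^\varphi})s,$$ $$Q_Lv(x,\alpha)=\int_0^{\tau^\varphi}e^{-\rho r-\Lambda^\alpha_r(x)}\,\overline Qv(\varphi^\alpha_r(x),\alpha_r)\,dr,\qquad \mathcal Tv(x)=\sup_{\alpha\in\mathcal A}\big(r(x,\alpha)+Q_Lv(x,\alpha)\big).$$ For $\gamma>0$ let $b(t,w,s,\pi)=sw\,e^{\gamma(T-t)}$ and let $\mathcal B_b$ be the set of measurable $v:\widetilde{\mathcal X}\to\mathbb R$ with $|v|\le Cb$ for some constant $C$. **Theorem 4.1.** Suppose that Assumptions 1 and 2 hold. Then the flow (unique), the controlled process and the expectations above are well defined, the supremum $V$ is finite, and: 1. $V$ is continuous on $\widetilde{\mathcal X}$. 2. $V(t,0,s,\pi)=0$ and $V(T,w,s,\pi)=s\,h(w)$.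 3. For all sufficiently large $\gamma$ the decision model is contracting with bounding function $b$: there are constants $c_r$ and $c_Q<1$ with $|r(x,\alpha)|\le c_rb(x)$ and $Q_Lb(x,\alpha)\le c_Qb(x)$ for all $x\in\widetilde{\mathcal X}$, $\alpha\in\mathcal A$. 4. For every $\gamma>0$, $V$ is the unique solution in $\mathcal B_b$ of the Bellman equation $V=\mathcal TV$. -/

import Mathlib

open MeasureTheory Set Filter Topology ProbabilityTheory

/-- States `(t, w, s, π)`: time, inventory, bid price, conditional state probabilities (filter). -/
abbrev PState (K : ℕ) : Type := ℝ × ℝ × ℝ × (Fin K → ℝ)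

namespace PState

/-- The time component. -/
def time {K : ℕ} (x : PState K) : ℝ := x.1

/-- The inventory component. -/
def inv {K : ℕ} (x : PState K) : ℝ := x.2.1

/-- The bid price component. -/
def price {K : ℕ} (x : PState K) : ℝ := x.2.2.1

/-- The filter component. -/
def filt {K : ℕ} (x : PState K) : Fin K → ℝ := x.2.2.2

end PState

/-- States of the embedded chain of jump times and post-jump states; the extra point means that
no further jump occurs before the horizon. -/
abbrev ChainState (K : ℕ) : Type := PState K ⊕ Unit

/-- The data of the liquidation problem, with the standing assumptions on the scalar parameters,
the price impact function `f`, the terminal liquidation function `h` and the generator `q` of the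
hidden `K`-state Markov chain.  `etaP t j ν` is the compensator `η^P(t, e_j, ν; dz)` of the jumps of
the return process, `etaQ` the reference measure, and `dens t j ν z` (a version of) the density of
`etaP t j ν` with respect to `etaQ`; they are tied together by `Assumption1`. -/
structure LiquidationModel (K : ℕ) where
  /-- horizon -/
  T : ℝ
  /-- initial inventory -/
  w₀ : ℝ
  /-- maximal liquidation rate -/
  νmax : ℝ
  /-- discount rate -/
  ρ : ℝ
  /-- temporary price impact -/
  f : ℝ → ℝ
  /-- liquidation value of the terminal inventory, per unit of the bid price -/
  h : ℝ → ℝ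
  /-- generator matrix of the hidden Markov chain -/
  q : Matrix (Fin K) (Fin K) ℝ
  /-- compensator of the return process -/
  etaP : ℝ → Fin K → ℝ → Measure ℝ
  /-- reference measure -/
  etaQ : Measure ℝ
  /-- density of the compensator with respect to the reference measure -/
  dens : ℝ → Fin K → ℝ → ℝ → ℝ
  T_pos : 0 < T
  w₀_pos : 0 < w₀
  lt_νmax : w₀ / T < νmax
  ρ_nonneg : 0 ≤ ρ
  f_nonneg : ∀ ν ∈ Icc 0 νmax, 0 ≤ f ν
  f_cont : ContinuousOn f (Icc 0 νmax)
  f_mono : MonotoneOn f (Icc 0 νmax)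
  h_zero : h 0 = 0
  h_le : ∀ w ∈ Icc 0 w₀, h w ≤ w
  h_cont : ContinuousOn h (Icc 0 w₀)
  h_mono : MonotoneOn h (Icc 0 w₀)
  h_concave : ConcaveOn ℝ (Icc 0 w₀) h
  q_offdiag : ∀ i j, i ≠ j → 0 ≤ q i j
  q_rowsum : ∀ i, ∑ j, q i j = 0

namespace LiquidationModel

variable {K : ℕ} (M : LiquidationModel K)

/-! ### The characteristics of the state process -/

/-- The state space `[0,T] × [0,w₀] × [0,∞) × simplex`. -/
def stateSpace : Set (PState K) :=
  Icc 0 M.T ×ˢ Icc 0 M.w₀ ×ˢ Ici 0 ×ˢ stdSimplex ℝ (Fin K)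

/-- The lateral boundary: no inventory left. -/
def lateral : Set (PState K) := {x ∈ M.stateSpace | x.inv = 0}

/-- The terminal boundary: the horizon is reached. -/
def terminal : Set (PState K) := {x ∈ M.stateSpace | x.time = M.T}

/-- The function `u^i(t, ν, π, z)`: relative jump of the `i`-th filter component when the return
process jumps by `z`. -/
noncomputable def u (i : Fin K) (t ν : ℝ) (p : Fin K → ℝ) (z : ℝ) : ℝ :=
  M.dens t i ν z / (∑ j, p j * M.dens t j ν z) - 1

/-- The vector field `g` that drives the state between jumps. -/
noncomputable def g (x : PState K) (ν : ℝ) : PState K :=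
  (1, -ν, 0, fun k => ∑ j, M.q j k * x.filt j
    - x.filt k * ∑ j, x.filt j * ∫ z, M.u k x.time ν x.filt z ∂(M.etaP x.time j ν))

/-- The jump rate `λ(x, ν)`. -/
noncomputable def jumpRate (x : PState K) (ν : ℝ) : ℝ :=
  ∑ j, x.filt j * (M.etaP x.time j ν).real univ

/-- The state after a jump of the return process of size `z` in state `x`. -/
noncomputable def postJump (x : PState K) (ν z : ℝ) : PState K :=
  (x.time, x.inv, x.price * (1 + z), fun i => x.filt i * (1 + M.u i x.time ν x.filt z))

/-- The unnormalized transition kernel of the jumps,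
`∑ j, π^j * (image of η^P(t, e_j, ν; dz) under the jump map)`; its total mass is the jump rate. -/
noncomputable def jumpMeasure (x : PState K) (ν : ℝ) : Measure (PState K) :=
  ∑ j, ENNReal.ofReal (x.filt j) • (M.etaP x.time j ν).map (M.postJump x ν)

/-! ### Assumptions -/

/-- Properties of the compensator: it has a density with respect to a finite reference measure with
compact support in `(-1, ∞)`, bounded above and away from zero, uniformly in `(t, e_j, ν)`.
In particular all these measures are equivalent. -/
structure Assumption1 : Prop where
  finite : IsFiniteMeasure M.etaQ
  compact_support : IsCompact M.etaQ.support
  support_subset : M.etaQ.support ⊆ Ioi (-1)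
  dens_measurable : ∀ j, Measurable (fun y : ℝ × ℝ × ℝ => M.dens y.1 j y.2.1 y.2.2)
  etaP_eq : ∀ t ∈ Icc 0 M.T, ∀ j, ∀ ν ∈ Icc 0 M.νmax,
    M.etaP t j ν = M.etaQ.withDensity (fun z => ENNReal.ofReal (M.dens t j ν z))
  dens_bounds : ∃ C > 0, ∀ t ∈ Icc 0 M.T, ∀ j, ∀ ν ∈ Icc 0 M.νmax,
    ∀ᵐ z ∂M.etaQ, C⁻¹ < M.dens t j ν z ∧ M.dens t j ν z < C

/-- Continuity of the compensator in the weak topology, and continuity of the functions `u^j` in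
`(t, ν, π)`, uniformly over the support of the reference measure. -/
structure Assumption2 : Prop where
  weak_cont : ∀ (j : Fin K) (φ : BoundedContinuousFunction ℝ ℝ),
    ContinuousOn (fun y : ℝ × ℝ => ∫ z, φ z ∂(M.etaP y.1 j y.2)) (Icc 0 M.T ×ˢ Icc 0 M.νmax)
  u_cont : ∀ (j : Fin K) (y : ℕ → ℝ × ℝ × (Fin K → ℝ)) (y' : ℝ × ℝ × (Fin K → ℝ)),
    (∀ n, y n ∈ Ico 0 M.T ×ˢ Icc 0 M.νmax ×ˢ stdSimplex ℝ (Fin K)) →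
    Tendsto y atTop (𝓝 y') →
    TendstoUniformlyOn (fun n z => M.u j (y n).1 (y n).2.1 (y n).2.2 z)
      (fun z => M.u j y'.1 y'.2.1 y'.2.2 z) atTop M.etaQ.support

/-! ### Controls and the deterministic flow -/

/-- Measurable liquidation rates with values in `[0, νmax]`, as a function of the time elapsed
since the last jump (only the values on `[0, T]` matter). -/
def Control : Type :=
  {α : ℝ → ℝ // Measurable α ∧ ∀ v, α v ∈ Icc 0 M.νmax}

/-- Admissible open loop strategies: after the `n`-th jump, in the state `x`, the rate
`ν n x v` is used when time `v` has elapsed since that jump. -/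
def Strategy : Type :=
  {ν : ℕ → PState K → ℝ → ℝ //
    ∀ n, Measurable (fun y : PState K × ℝ => ν n y.1 y.2) ∧ ∀ x v, ν n x v ∈ Icc 0 M.νmax}

/-- `y` is the (Carathéodory) solution of `dy/dv = g(y, α_v)`, `y(0) = x`, up to the horizon. -/
structure IsFlow (α : ℝ → ℝ) (x : PState K) (y : ℝ → PState K) : Prop where
  cont : ContinuousOn y (Icc 0 (M.T - x.time))
  filt_mem : ∀ v ∈ Icc 0 (M.T - x.time), (y v).filt ∈ stdSimplex ℝ (Fin K)
  integrable : IntervalIntegrable (fun v => M.g (y v) (α v)) volume 0 (M.T - x.time)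
  eq : ∀ v ∈ Icc 0 (M.T - x.time), y v = x + ∫ r in (0 : ℝ)..v, M.g (y r) (α r)

open Classical in
/-- The flow `φ^α_v(x)`. -/
noncomputable def flow (α : ℝ → ℝ) (x : PState K) : ℝ → PState K :=
  if hy : ∃ y, M.IsFlow α x y then hy.choose else fun _ => x

/-- The cumulated jump rate `Λ^α_v(x)`. -/
noncomputable def cumRate (α : ℝ → ℝ) (x : PState K) (v : ℝ) : ℝ :=
  ∫ r in (0 : ℝ)..v, M.jumpRate (M.flow α x r) (α r)

/-- The time `τ^φ(x, α)` at which the flow reaches the lateral or the terminal boundary. -/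
noncomputable def exitTime (α : ℝ → ℝ) (x : PState K) : ℝ :=
  sInf {v | 0 ≤ v ∧ M.flow α x v ∈ M.lateral ∪ M.terminal}

/-! ### The controlled piecewise deterministic Markov process and the value function -/

open Classical in
/-- Selling stops when the inventory is exhausted. -/
noncomputable def stopped (α : ℝ → ℝ) (x : PState K) : ℝ → ℝ :=
  fun v => if v ≤ M.exitTime α x then α v else 0

/-- Distribution of the next jump time and post-jump state before the horizon, if the rate `α`
is used from the state `x` on: `exp (-Λ_v) * jumpMeasure (φ_v, α_v) dv` for `0 < v ≤ T - t`.
A sub-probability measure. -/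
noncomputable def nextJump (α : ℝ → ℝ) (x : PState K) : Measure (PState K) :=
  (volume.restrict (Ioc 0 (M.T - x.time))).bind fun v =>
    ENNReal.ofReal (Real.exp (-M.cumRate α x v)) • M.jumpMeasure (M.flow α x v) (α v)

open Classical in
/-- One step of the embedded chain under the decision rule `a` (a rate for each state): from the
state `x`, the rate `a x` is used until the inventory is exhausted and the rate zero from then on;
with the survival probability `exp (-Λ_{T-t})` there is no further jump before the horizon. -/
noncomputable def stepMeasure (a : PState K → ℝ → ℝ) : ChainState K → Measure (ChainState K)
  | Sum.inl x =>
      if x ∈ M.stateSpace then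
        (M.nextJump (M.stopped (a x) x) x).map Sum.inl
          + ENNReal.ofReal (Real.exp (-M.cumRate (M.stopped (a x) x) x (M.T - x.time)))
            • Measure.dirac (Sum.inr ())
      else Measure.dirac (Sum.inr ())
  | Sum.inr _ => Measure.dirac (Sum.inr ())

open Classical in
/-- `stepMeasure` as a Markov kernel (the trivial kernel if it were not one). -/
noncomputable def stepKernel (a : PState K → ℝ → ℝ) : Kernel (ChainState K) (ChainState K) :=
  if ha : Measurable (M.stepMeasure a) ∧ ∀ z, IsProbabilityMeasure (M.stepMeasure a z) then
    ⟨M.stepMeasure a, ha.1⟩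
  else Kernel.const _ (Measure.dirac (Sum.inr ()))

instance (a : PState K → ℝ → ℝ) : IsMarkovKernel (M.stepKernel a) := by
  unfold stepKernel
  split_ifs with ha
  · exact ⟨ha.2⟩
  · infer_instance

/-- The kernel that produces entry `n + 1` of the embedded chain from the entries `0, …, n`. -/
noncomputable def histKernel (ν : M.Strategy) (n : ℕ) :
    Kernel (Π _ : Finset.Iic n, ChainState K) (ChainState K) :=
  (M.stepKernel (ν.1 n)).comap (fun z => z ⟨n, Finset.mem_Iic.2 le_rfl⟩) (measurable_pi_apply _)

instance (ν : M.Strategy) (n : ℕ) : IsMarkovKernel (M.histKernel ν n) := by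
  unfold histKernel
  infer_instance

/-- The law of the embedded chain (jump times and post-jump states; entry `0` is the initial state)
of the controlled process started in `x`, under the strategy `ν`. -/
noncomputable def law (ν : M.Strategy) (x : PState K) : Measure (ℕ → ChainState K) :=
  Kernel.traj (X := fun _ => ChainState K) (M.histKernel ν) 0 (fun _ => Sum.inl x)

/-- The number of jumps up to (absolute) time `r`. -/
noncomputable def jumpCount (z : ℕ → ChainState K) (r : ℝ) : ℕ :=
  sSup {n | ∃ y : PState K, z n = Sum.inl y ∧ y.time ≤ r}

/-- The liquidation rate `ν_r` in force at time `r`. -/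
noncomputable def rate (ν : M.Strategy) (z : ℕ → ChainState K) (r : ℝ) : ℝ :=
  match z (jumpCount z r) with
  | Sum.inl y => M.stopped (ν.1 (jumpCount z r) y) y (r - y.time)
  | Sum.inr _ => 0

/-- The state `(r, W_r, S_r, π_r)` of the controlled process at time `r`: since the last jump it has
followed the flow. -/
noncomputable def path (ν : M.Strategy) (z : ℕ → ChainState K) (r : ℝ) : PState K :=
  match z (jumpCount z r) with
  | Sum.inl y => M.flow (M.stopped (ν.1 (jumpCount z r) y) y) y (r - y.time)
  | Sum.inr _ => 0

/-- The liquidation time `τ = inf {r ≥ t : W_r ≤ 0} ∧ T` of the process started at time `t`. -/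
noncomputable def liqTime (ν : M.Strategy) (t : ℝ) (z : ℕ → ChainState K) : ℝ :=
  sInf ({r ∈ Icc t M.T | (M.path ν z r).inv ≤ 0} ∪ {M.T})

/-- The discounted proceeds along a trajectory of the process started at time `t`. -/
noncomputable def payoff (ν : M.Strategy) (t : ℝ) (z : ℕ → ChainState K) : ℝ :=
  (∫ r in t..M.liqTime ν t z, Real.exp (-M.ρ * (r - t)) * M.rate ν z r * (M.path ν z r).price
      * (1 - M.f (M.rate ν z r)))
    + Real.exp (-M.ρ * (M.liqTime ν t z - t))
      * M.h (M.path ν z (M.liqTime ν t z)).inv * (M.path ν z (M.liqTime ν t z)).price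

/-- The reward function `V(x, {ν^n})`. -/
noncomputable def reward (ν : M.Strategy) (x : PState K) : ℝ :=
  ∫ z, M.payoff ν x.time z ∂(M.law ν x)

/-- The value function `V(x)`. -/
noncomputable def value (x : PState K) : ℝ := ⨆ ν : M.Strategy, M.reward ν x

/-! ### The associated Markov decision model -/

/-- The one-period reward `r(x, α)`. -/
noncomputable def oneReward (x : PState K) (α : ℝ → ℝ) : ℝ :=
  (∫ v in (0 : ℝ)..M.exitTime α x, Real.exp (-M.ρ * v) * Real.exp (-M.cumRate α x v)
      * α v * x.price * (1 - M.f (α v)))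
    + Real.exp (-M.ρ * M.exitTime α x) * Real.exp (-M.cumRate α x (M.exitTime α x))
      * M.h (M.flow α x (M.exitTime α x)).inv * x.price

/-- The (discounted) transition operator `Q_L v(x, α)` of the decision model, for functions `v` on
the state space, extended by zero to the cemetery state. -/
noncomputable def QL (v : PState K → ℝ) (x : PState K) (α : ℝ → ℝ) : ℝ :=
  ∫ r in (0 : ℝ)..M.exitTime α x, Real.exp (-M.ρ * r) * Real.exp (-M.cumRate α x r)
    * ∫ y, v y ∂(M.jumpMeasure (M.flow α x r) (α r))

/-- The maximal reward operator `𝒯 v(x) = sup_α (r(x, α) + Q_L v(x, α))`. -/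
noncomputable def bellman (v : PState K → ℝ) (x : PState K) : ℝ :=
  ⨆ α : M.Control, (M.oneReward x α.1 + M.QL v x α.1)

/-- The bounding function `b(t, w, s, π) = s w exp (γ (T - t))`. -/
noncomputable def bounding (γ : ℝ) (x : PState K) : ℝ :=
  x.price * x.inv * Real.exp (γ * (M.T - x.time))

/-- The space `B_b` of measurable functions on the state space with finite weighted sup-norm
(functions are considered on the state space only; their values elsewhere are irrelevant). -/
def Bb (γ : ℝ) : Set (PState K → ℝ) :=
  {v | Measurable (fun x : M.stateSpace => v x) ∧
    ∃ C : ℝ, ∀ x ∈ M.stateSpace, |v x| ≤ C * M.bounding γ x}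

/-- `b` is a bounding function and the decision model is contracting. -/
def IsContracting (γ : ℝ) : Prop :=
  ∃ cr cQ : ℝ, cQ < 1 ∧ ∀ x ∈ M.stateSpace, ∀ α : M.Control,
    |M.oneReward x α.1| ≤ cr * M.bounding γ x ∧
    M.QL (M.bounding γ) x α.1 ≤ cQ * M.bounding γ x

end LiquidationModel

/-! The process is studied through its embedded chain of jump times and post-jump states, for which
the problem is a Markov decision problem with one decision (a rate function) per jump. The Bellman
operator of that problem has a continuous fixed point, and a verification argument identifies the
fixed point with the value function. Three ideas carry the proof.

Linearization of the filter. Between jumps the filter solves a quadratic equation, but it is the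
normalization of a solution of a linear one. After multiplication by an exponential weight the
linear system has nonnegative, bounded, measurable coefficients, so its solution is an increasing
limit of Picard iterates, jointly measurable in the state and the control. The total mass, with the
weight removed, is exactly the survival probability of the first jump (`surv_eq_exp`), and the
quotient is the filter (`filtFlow_isPrim`). Uniqueness of the flow and its dependence on the data,
uniform over all controls (`mass_close`), both follow from Gronwall's inequality.

Contraction and continuity. Along the flow `b` decays at least like `exp (-γ r)`. A jump multiplies
it by a bounded factor, and jumps occur at a bounded intensity; hence the continuation operator has
norm at most `jumpRateBound / γ` (`abs_contPart_le`). For the weight `halfRate` this is at most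
`1/2`, and on a bounded horizon all weights define the same space (`Bb_subset`). The Bellman
operator preserves continuity (`continuousOn_bellman`) for two reasons. The jump operator maps
continuous functions to continuous ones although the compensators vary only weakly continuously
(`continuousOn_jumpMean`). And a control feasible in one state becomes feasible in a neighbouring
one after multiplication by a factor close to one (`tendsto_totalReward_rescale`), so suprema in
nearby states can be compared without compactness of the set of controls. The iterates of the
operator therefore converge locally uniformly to a continuous fixed point (`exists_fixedPoint`).

Verification. A Lyapunov function of the chain has conditional mean at most one half of its current
value, so almost surely only finitely many jumps occur (`ae_isGood`) and the payoff is the sum of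
the rewards of the periods (`payoff_eq`). By integration by parts, the conditional mean of one
period's reward plus the discounted continuation is the reward of the decision model
(`integral_step`). Telescoping then bounds the reward of every strategy by the fixed point
(`reward_le`). Conversely, rates that are nearly optimal near a point are glued along a countable
cover into a measurable strategy (`exists_nearly_optimal`) whose reward comes arbitrarily close to
the fixed point (`le_reward`). -/

set_option linter.unusedSectionVars false

/-! ### Parametric interval integrals -/

/-- The moving endpoints are absorbed into an indicator on the product space, after which
measurability of parametric integrals over the whole line applies. -/
theorem measurable_intervalIntegral_param {X : Type*} [MeasurableSpace X] {F : X → ℝ → ℝ}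
    (hF : Measurable (fun p : X × ℝ => F p.1 p.2)) {a b : X → ℝ} (ha : Measurable a)
    (hb : Measurable b) : Measurable (fun x => ∫ r in a x..b x, F x r) := by
  have key : ∀ {a b : X → ℝ}, Measurable a → Measurable b →
      Measurable (fun x => ∫ r in Ioc (a x) (b x), F x r) := by
    intro a b ha hb
    have h1 : (fun x => ∫ r in Ioc (a x) (b x), F x r)
        = fun x => ∫ r, ({p : X × ℝ | a p.1 < p.2 ∧ p.2 ≤ b p.1}.indicator
            (fun p => F p.1 p.2)) (x, r) := by
      ext x
      rw [← integral_indicator measurableSet_Ioc]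
      rfl
    rw [h1]
    have hs : MeasurableSet {p : X × ℝ | a p.1 < p.2 ∧ p.2 ≤ b p.1} :=
      (measurableSet_lt (ha.comp measurable_fst) measurable_snd).inter
        (measurableSet_le measurable_snd (hb.comp measurable_fst))
    have := (hF.indicator hs).stronglyMeasurable.integral_prod_right' (ν := (volume : Measure ℝ))
    exact this.measurable
  simp only [intervalIntegral]
  exact (key ha hb).sub (key hb ha)

/-! ### A Gronwall inequality in integral form -/

/-- With the doubled rate `2 * C` in the exponential, the integral inequality turns an admissible
constant `a` into the admissible constant `ε + a / 2`. The infimum of the admissible constants is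
itself admissible, hence at most `ε` plus half of itself, that is, at most `2 * ε`. Only
integrability and an upper bound are needed, neither continuity nor a sign of `φ`. -/
theorem gronwall_integral {φ : ℝ → ℝ} {L C ε A : ℝ} (hC : 0 ≤ C) (hε : 0 ≤ ε)
    (hint : IntervalIntegrable φ volume 0 L) (hA : ∀ v ∈ Icc 0 L, φ v ≤ A)
    (h : ∀ v ∈ Icc 0 L, φ v ≤ ε + C * ∫ r in (0 : ℝ)..v, φ r) :
    ∀ v ∈ Icc 0 L, φ v ≤ 2 * ε * Real.exp (2 * C * v) := by
  set S : Set ℝ := {a | 0 ≤ a ∧ ∀ v ∈ Icc 0 L, φ v ≤ a * Real.exp (2 * C * v)} with hS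
  have hSne : S.Nonempty := by
    refine ⟨max A 0, le_max_right _ _, fun v hv => (hA v hv).trans ((le_max_left A 0).trans ?_)⟩
    exact le_mul_of_one_le_right (le_max_right _ _)
      (Real.one_le_exp (mul_nonneg (by positivity) hv.1))
  have hbdd : BddBelow S := ⟨0, fun a ha => ha.1⟩
  have hcl : sInf S ∈ S := by
    refine ⟨le_csInf hSne fun a ha => ha.1, fun v hv => ?_⟩
    have hp := Real.exp_pos (2 * C * v)
    rw [← div_le_iff₀ hp]
    refine le_csInf hSne fun a ha => ?_
    rw [div_le_iff₀ hp]
    exact ha.2 v hv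
  have hstep : ∀ a ∈ S, ε + a / 2 ∈ S := by
    intro a ha
    refine ⟨by linarith [ha.1], fun v hv => ?_⟩
    have hsub : Icc 0 v ⊆ Icc 0 L := Icc_subset_Icc_right hv.2
    have hexp : ∫ r in (0 : ℝ)..v, C * (a * Real.exp (2 * C * r))
        = a / 2 * (Real.exp (2 * C * v) - 1) := by
      have hd : ∀ r ∈ uIcc 0 v, HasDerivAt (fun r => a / 2 * Real.exp (2 * C * r))
          (C * (a * Real.exp (2 * C * r))) r := by
        intro r _
        have := (((hasDerivAt_id r).const_mul (2 * C)).exp).const_mul (a / 2)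
        exact this.congr_deriv (by simp only [id]; ring)
      rw [intervalIntegral.integral_eq_sub_of_hasDerivAt hd
        (Continuous.intervalIntegrable (by fun_prop) _ _)]
      simp; ring
    have hle : C * ∫ r in (0 : ℝ)..v, φ r ≤ ∫ r in (0 : ℝ)..v, C * (a * Real.exp (2 * C * r)) := by
      rw [← intervalIntegral.integral_const_mul]
      refine intervalIntegral.integral_mono_on hv.1 ?_
        (Continuous.intervalIntegrable (by fun_prop) _ _) ?_
      · refine (hint.mono_set ?_).const_mul C
        rw [uIcc_of_le hv.1, uIcc_of_le (hv.1.trans hv.2)]; exact hsub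
      · intro r hr
        exact mul_le_mul_of_nonneg_left (ha.2 r (hsub hr)) hC
    have h1 := h v hv
    have h2 : 1 ≤ Real.exp (2 * C * v) := Real.one_le_exp (mul_nonneg (by positivity) hv.1)
    have h3 : ε ≤ ε * Real.exp (2 * C * v) := le_mul_of_one_le_right hε h2
    nlinarith [ha.1]
  have h1 : sInf S ≤ ε + sInf S / 2 := csInf_le hbdd (hstep _ hcl)
  intro v hv
  refine (hcl.2 v hv).trans (mul_le_mul_of_nonneg_right (by linarith) (Real.exp_pos _).le)

/-! ### Indefinite integrals of bounded functions -/

/-- `y` is the indefinite integral on `[0, L]` of the bounded function `f`. -/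
structure IsPrim (y f : ℝ → ℝ) (L : ℝ) : Prop where
  integrable : IntervalIntegrable f volume 0 L
  bounded : ∃ C, ∀ v ∈ Icc 0 L, |f v| ≤ C
  eq : ∀ v ∈ Icc 0 L, y v = y 0 + ∫ r in (0 : ℝ)..v, f r

namespace IsPrim

variable {y z f g : ℝ → ℝ} {L : ℝ}

theorem mono (h : IsPrim y f L) {v : ℝ} (hv : v ∈ Icc 0 L) : IsPrim y f v := by
  refine ⟨h.integrable.mono_set ?_, ?_, fun r hr => h.eq r ⟨hr.1, hr.2.trans hv.2⟩⟩
  · rw [uIcc_of_le hv.1, uIcc_of_le (hv.1.trans hv.2)]; exact Icc_subset_Icc_right hv.2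
  · obtain ⟨C, hC⟩ := h.bounded
    exact ⟨C, fun r hr => hC r ⟨hr.1, hr.2.trans hv.2⟩⟩

theorem lipschitz (h : IsPrim y f L) : ∃ C : NNReal, LipschitzOnWith C y (Icc 0 L) := by
  obtain ⟨C, hC⟩ := h.bounded
  refine ⟨C.toNNReal, LipschitzOnWith.of_le_add_mul _ ?_⟩
  intro a ha b hb
  have h0L : (0 : ℝ) ∈ Icc 0 L := ⟨le_rfl, ha.1.trans ha.2⟩
  have hi : ∀ {a b}, a ∈ Icc 0 L → b ∈ Icc 0 L → IntervalIntegrable f volume a b :=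
    fun ha hb => h.integrable.mono_set (by
      rw [uIcc_of_le (ha.1.trans ha.2)]
      exact (Set.uIcc_subset_Icc ha hb))
  have : y a - y b = ∫ r in b..a, f r := by
    rw [h.eq a ha, h.eq b hb, ← intervalIntegral.integral_interval_sub_left (hi h0L ha) (hi h0L hb)]
    ring
  have h2 := intervalIntegral.norm_integral_le_of_norm_le_const (a := b) (b := a) (f := f) (C := C)
    (fun r hr => hC r (Set.uIcc_subset_Icc hb ha (uIoc_subset_uIcc hr)))
  rw [Real.norm_eq_abs, ← this] at h2
  have h3 : C * |a - b| ≤ (C.toNNReal : ℝ) * dist a b := by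
    rw [Real.dist_eq]
    exact mul_le_mul_of_nonneg_right (Real.le_coe_toNNReal C) (abs_nonneg _)
  linarith [le_abs_self (y a - y b)]

theorem continuousOn (h : IsPrim y f L) : ContinuousOn y (Icc 0 L) :=
  h.lipschitz.choose_spec.continuousOn

theorem ac (hL : 0 ≤ L) (h : IsPrim y f L) : AbsolutelyContinuousOnInterval y 0 L := by
  obtain ⟨C, hC⟩ := h.lipschitz
  rw [← uIcc_of_le hL] at hC
  exact hC.absolutelyContinuousOnInterval

theorem ae_hasDerivAt (hL : 0 ≤ L) (h : IsPrim y f L) :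
    ∀ᵐ v, v ∈ Ioo 0 L → HasDerivAt y (f v) v := by
  filter_upwards [h.integrable.ae_hasDerivAt_integral] with v hv hvL
  have h1 := hv (by rw [uIcc_of_le hL]; exact Ioo_subset_Icc_self hvL) 0 left_mem_uIcc
  refine (h1.const_add (y 0)).congr_of_eventuallyEq ?_
  filter_upwards [Ioo_mem_nhds hvL.1 hvL.2] with r hr
  exact h.eq r (Ioo_subset_Icc_self hr)

/-- The fundamental theorem of calculus for absolutely continuous functions. It reduces the product
and exponential rules to an almost everywhere computation of derivatives, which is all that
measurable controls permit. -/
theorem of_ac {hh : ℝ → ℝ} (hL : 0 ≤ L) (hac : AbsolutelyContinuousOnInterval y 0 L)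
    (hd : ∀ᵐ v, v ∈ Ioo 0 L → HasDerivAt y (hh v) v)
    (hb : ∃ C, ∀ v ∈ Icc 0 L, |hh v| ≤ C) : IsPrim y hh L := by
  -- The derivative is known on the open interval only; the right endpoint is discarded as a null
  -- set.
  have hnull : ∀ᵐ v : ℝ, v ≠ L := by simp [ae_iff, measure_singleton]
  have hcong : ∀ v ∈ Icc 0 L, ∀ᵐ r, r ∈ uIoc 0 v → deriv y r = hh r := by
    intro v hv
    filter_upwards [hd, hnull] with r hr hrL hr2
    rw [uIoc_of_le hv.1] at hr2
    exact (hr ⟨hr2.1, lt_of_le_of_ne (hr2.2.trans hv.2) hrL⟩).deriv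
  refine ⟨?_, hb, fun v hv => ?_⟩
  · refine hac.intervalIntegrable_deriv.congr_ae ?_
    exact (ae_restrict_iff' measurableSet_uIoc).2 (hcong L ⟨hL, le_rfl⟩)
  · rw [← intervalIntegral.integral_congr_ae (hcong v hv)]
    have := (hac.mono (c := 0) (d := v) (by
      rw [uIcc_of_le hv.1, uIcc_of_le hL]; exact Icc_subset_Icc_right hv.2)).integral_deriv_eq_sub
    rw [this]; ring

theorem exists_bound (h : IsPrim y f L) : ∃ C, ∀ v ∈ Icc 0 L, |y v| ≤ C :=
  isCompact_Icc.exists_bound_of_continuousOn h.continuousOn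

/-- Products of absolutely continuous functions are absolutely continuous, so the product rule may
be integrated. It supplies the integrating factor in `totalMass_mul_exp`, the quotient rule in
`filtFlow_isPrim` and the integration by parts in `integral_step`. -/
theorem mul (hL : 0 ≤ L) (hy : IsPrim y f L) (hz : IsPrim z g L) :
    IsPrim (fun v => y v * z v) (fun v => f v * z v + y v * g v) L := by
  refine of_ac hL ((hy.ac hL).mul (hz.ac hL)) ?_ ?_
  · filter_upwards [hy.ae_hasDerivAt hL, hz.ae_hasDerivAt hL] with v h1 h2 hv
    exact (h1 hv).mul (h2 hv)
  · obtain ⟨A, hA⟩ := hy.bounded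
    obtain ⟨B, hB⟩ := hz.bounded
    obtain ⟨A', hA'⟩ := hy.exists_bound
    obtain ⟨B', hB'⟩ := hz.exists_bound
    refine ⟨A * B' + A' * B, fun v hv => (abs_add_le _ _).trans ?_⟩
    rw [abs_mul, abs_mul]
    exact add_le_add (mul_le_mul (hA v hv) (hB' v hv) (abs_nonneg _) ((abs_nonneg _).trans (hA v hv)))
      (mul_le_mul (hA' v hv) (hB v hv) (abs_nonneg _) ((abs_nonneg _).trans (hA' v hv)))

/-- On the bounded range of `y` the exponential is Lipschitz, so the composition is Lipschitz, hence
absolutely continuous. -/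
theorem exp (hL : 0 ≤ L) (hy : IsPrim y f L) :
    IsPrim (fun v => Real.exp (y v)) (fun v => Real.exp (y v) * f v) L := by
  obtain ⟨A, hA⟩ := hy.bounded
  obtain ⟨A', hA'⟩ := hy.exists_bound
  obtain ⟨C, hC⟩ := hy.lipschitz
  have hE : LipschitzOnWith (Real.exp A').toNNReal Real.exp (Icc (-A') A') := by
    refine Convex.lipschitzOnWith_of_nnnorm_deriv_le (fun _ _ => Real.differentiableAt_exp) ?_
      (convex_Icc _ _)
    intro r hr
    rw [← NNReal.coe_le_coe, coe_nnnorm, Real.deriv_exp, Real.norm_eq_abs,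
      abs_of_pos (Real.exp_pos _), Real.coe_toNNReal _ (Real.exp_pos _).le]
    exact Real.exp_le_exp.2 hr.2
  have hcomp := hE.comp hC (fun v hv => abs_le.1 (hA' v hv))
  rw [← uIcc_of_le hL] at hcomp
  refine of_ac hL hcomp.absolutelyContinuousOnInterval ?_ ?_
  · filter_upwards [hy.ae_hasDerivAt hL] with v h1 hv
    exact (h1 hv).exp
  · refine ⟨Real.exp A' * A, fun v hv => ?_⟩
    rw [abs_mul, abs_of_pos (Real.exp_pos _)]
    exact mul_le_mul (Real.exp_le_exp.2 (abs_le.1 (hA' v hv)).2) (hA v hv) (abs_nonneg _)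
      (Real.exp_pos _).le

theorem congr (hL : 0 ≤ L) (h : IsPrim y f L) {g : ℝ → ℝ} (hfg : ∀ v ∈ Icc 0 L, f v = g v) :
    IsPrim y g L := by
  have hc : ∀ v ∈ Icc 0 L, ∀ r ∈ uIcc 0 v, f r = g r := fun v hv r hr => by
    rw [uIcc_of_le hv.1] at hr
    exact hfg r ⟨hr.1, hr.2.trans hv.2⟩
  refine ⟨h.integrable.congr fun r hr => hc L ⟨hL, le_rfl⟩ r (uIoc_subset_uIcc hr), ?_,
    fun v hv => ?_⟩
  · obtain ⟨C, hC⟩ := h.bounded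
    exact ⟨C, fun v hv => hfg v hv ▸ hC v hv⟩
  · rw [h.eq v hv, intervalIntegral.integral_congr (hc v hv)]

theorem congr_left (h : IsPrim y f L) (hL : 0 ≤ L) (hyz : ∀ v ∈ Icc 0 L, y v = z v) :
    IsPrim z f L :=
  ⟨h.integrable, h.bounded, fun v hv => by
    rw [← hyz v hv, ← hyz 0 ⟨le_rfl, hL⟩, h.eq v hv]⟩

end IsPrim

theorem intervalIntegrable_of_bounded {f : ℝ → ℝ} (hf : Measurable f) {L C : ℝ} (hL : 0 ≤ L)
    (hC : ∀ v ∈ Icc 0 L, |f v| ≤ C) : IntervalIntegrable f volume 0 L := by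
  rw [intervalIntegrable_iff_integrableOn_Icc_of_le hL]
  exact Measure.integrableOn_of_bounded (by simp) hf.aestronglyMeasurable
    ((ae_restrict_iff' measurableSet_Icc).2 (Eventually.of_forall hC))

theorem IsPrim.of_measurable (y0 : ℝ) {f : ℝ → ℝ} (hf : Measurable f) {L C : ℝ} (hL : 0 ≤ L)
    (hC : ∀ v ∈ Icc 0 L, |f v| ≤ C) : IsPrim (fun v => y0 + ∫ r in (0 : ℝ)..v, f r) f L :=
  ⟨intervalIntegrable_of_bounded hf hL hC, ⟨C, hC⟩, fun v _ => by simp⟩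

theorem IsPrim.sum {ι : Type*} (s : Finset ι) {y f : ι → ℝ → ℝ} {L : ℝ}
    (h : ∀ i ∈ s, IsPrim (y i) (f i) L) :
    IsPrim (fun v => ∑ i ∈ s, y i v) (fun v => ∑ i ∈ s, f i v) L := by
  have hint : IntervalIntegrable (fun v => ∑ i ∈ s, f i v) volume 0 L := by
    have := IntervalIntegrable.sum s (fun i hi => (h i hi).integrable)
    exact this.congr fun v _ => by simp
  refine ⟨hint, ?_, fun v hv => ?_⟩
  · classical
    refine ⟨∑ i ∈ s, if hi : i ∈ s then (h i hi).bounded.choose else 0, fun v hv => ?_⟩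
    refine (Finset.abs_sum_le_sum_abs _ _).trans (Finset.sum_le_sum fun i hi => ?_)
    rw [dif_pos hi]
    exact (h i hi).bounded.choose_spec v hv
  · rw [intervalIntegral.integral_finsetSum fun i hi => ((h i hi).mono hv).integrable,
      ← Finset.sum_add_distrib]
    exact Finset.sum_congr rfl fun i hi => (h i hi).eq v hv

/-! ### Linear systems with nonnegative measurable coefficients -/

section LinearSystem

variable {ι : Type*} [Fintype ι]

/-- The Picard iterates of the linear system `y' = B y`, `y 0 = p`. -/
noncomputable def picardIter (B : ℝ → ι → ι → ℝ) (p : ι → ℝ) : ℕ → ℝ → ι → ℝ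
  | 0 => fun _ => 0
  | n + 1 => fun v k => p k + ∫ r in (0 : ℝ)..v, ∑ j, B r k j * picardIter B p n r j

/-- The solution of the linear system `y' = B y`, `y 0 = p`, for nonnegative `B` and `p`. -/
noncomputable def linearFlow (B : ℝ → ι → ι → ℝ) (p : ι → ℝ) (v : ℝ) (k : ι) : ℝ :=
  ⨆ n, picardIter B p n v k

theorem measurable_picardIter {X : Type*} [MeasurableSpace X] {B : X → ℝ → ι → ι → ℝ}
    {p : X → ι → ℝ} (hB : ∀ k j, Measurable (fun y : X × ℝ => B y.1 y.2 k j))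
    (hp : ∀ k, Measurable (fun x => p x k)) (n : ℕ) (k : ι) :
    Measurable (fun y : X × ℝ => picardIter (B y.1) (p y.1) n y.2 k) := by
  induction n generalizing k with
  | zero => exact measurable_const
  | succ n ih =>
    refine ((hp k).comp measurable_fst).add ?_
    refine measurable_intervalIntegral_param (X := X × ℝ)
      (F := fun y r => ∑ j, B y.1 r k j * picardIter (B y.1) (p y.1) n r j) ?_ measurable_const
      measurable_snd
    have hm : Measurable (fun q : (X × ℝ) × ℝ => (q.1.1, q.2)) := by fun_prop
    exact Finset.measurable_sum _ fun j _ => ((hB k j).comp hm).mul ((ih j).comp hm)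

theorem measurable_linearFlow {X : Type*} [MeasurableSpace X] {B : X → ℝ → ι → ι → ℝ}
    {p : X → ι → ℝ} (hB : ∀ k j, Measurable (fun y : X × ℝ => B y.1 y.2 k j))
    (hp : ∀ k, Measurable (fun x => p x k)) (k : ι) :
    Measurable (fun y : X × ℝ => linearFlow (B y.1) (p y.1) y.2 k) :=
  Measurable.iSup fun n => measurable_picardIter hB hp n k

variable {B : ℝ → ι → ι → ℝ} {p : ι → ℝ} {C : ℝ}

theorem measurable_picardIter_time (hB : ∀ k j, Measurable (fun r => B r k j)) (n : ℕ) (k : ι) :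
    Measurable (fun v => picardIter B p n v k) :=
  (measurable_picardIter (X := Unit) (B := fun _ => B) (p := fun _ => p)
    (fun k j => (hB k j).comp measurable_snd) (fun _ => measurable_const) n k).comp
    (measurable_const.prodMk measurable_id : Measurable fun v : ℝ => (((), v) : Unit × ℝ))

theorem measurable_linearFlow_time (hB : ∀ k j, Measurable (fun r => B r k j)) (k : ι) :
    Measurable (fun v => linearFlow B p v k) :=
  Measurable.iSup fun n => measurable_picardIter_time hB n k

theorem picardIter_nonneg (hB0 : ∀ r k j, 0 ≤ B r k j) (hp : ∀ k, 0 ≤ p k) (n : ℕ) {v : ℝ}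
    (hv : 0 ≤ v) (k : ι) : 0 ≤ picardIter B p n v k := by
  induction n generalizing v k with
  | zero => exact le_rfl
  | succ n ih =>
    refine add_nonneg (hp k) (intervalIntegral.integral_nonneg hv fun r hr => ?_)
    exact Finset.sum_nonneg fun j _ => mul_nonneg (hB0 r k j) (ih hr.1 j)

/-- Summation over the components gives a scalar inequality with rate `card ι * C`, and the
exponential with this rate solves the corresponding integral equation exactly. The bound therefore
passes from one iterate to the next. -/
theorem picardIter_sum_le (hBm : ∀ k j, Measurable (fun r => B r k j))
    (hB0 : ∀ r k j, 0 ≤ B r k j) (hBC : ∀ r k j, B r k j ≤ C) (hp : ∀ k, 0 ≤ p k) (n : ℕ)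
    {v : ℝ} (hv : 0 ≤ v) :
    ∑ k, picardIter B p n v k ≤ (∑ k, p k) * Real.exp (Fintype.card ι * C * v) := by
  -- Without indices the bound on the entries says nothing about the sign of `C`, so this case is
  -- separated.
  rcases isEmpty_or_nonempty ι with hι | ⟨⟨i₀⟩⟩
  · simp
  have hC : 0 ≤ C := (hB0 0 i₀ i₀).trans (hBC 0 i₀ i₀)
  have hP : 0 ≤ ∑ k, p k := Finset.sum_nonneg fun k _ => hp k
  induction n generalizing v with
  | zero => simpa [picardIter] using mul_nonneg hP (Real.exp_pos _).le
  | succ n ih =>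
    set D := Fintype.card ι * C with hD
    have hD0 : 0 ≤ D := by positivity
    set a := ∑ k, p k
    have hterm : ∀ k, ∀ r ∈ Icc 0 v, |∑ j, B r k j * picardIter B p n r j|
        ≤ C * (a * Real.exp (D * r)) := by
      intro k r hr
      rw [abs_of_nonneg (Finset.sum_nonneg fun j _ =>
        mul_nonneg (hB0 r k j) (picardIter_nonneg hB0 hp n hr.1 j))]
      calc _ ≤ ∑ j, C * picardIter B p n r j := Finset.sum_le_sum fun j _ =>
            mul_le_mul_of_nonneg_right (hBC r k j) (picardIter_nonneg hB0 hp n hr.1 j)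
        _ = C * ∑ j, picardIter B p n r j := by rw [Finset.mul_sum]
        _ ≤ _ := mul_le_mul_of_nonneg_left (ih hr.1) hC
    have hle : ∀ k, picardIter B p (n + 1) v k
        ≤ p k + ∫ r in (0 : ℝ)..v, C * (a * Real.exp (D * r)) := by
      intro k
      refine add_le_add_right (intervalIntegral.integral_mono_on hv ?_
        (Continuous.intervalIntegrable (by fun_prop) _ _)
        fun r hr => (le_abs_self _).trans (hterm k r hr)) _
      refine intervalIntegrable_of_bounded ?_ hv (C := C * (a * Real.exp (D * v))) ?_
      · exact Finset.measurable_sum _ fun j _ => (hBm k j).mul (measurable_picardIter_time hBm n j)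
      · intro r hr
        refine (hterm k r hr).trans ?_
        gcongr
        exact hr.2
    have hexp : D * ∫ r in (0 : ℝ)..v, a * Real.exp (D * r) = a * (Real.exp (D * v) - 1) := by
      rw [← intervalIntegral.integral_const_mul]
      have hd : ∀ r ∈ uIcc 0 v, HasDerivAt (fun r => a * Real.exp (D * r))
          (D * (a * Real.exp (D * r))) r := by
        intro r _
        have := (((hasDerivAt_id r).const_mul D).exp).const_mul a
        exact this.congr_deriv (by simp only [id]; ring)
      rw [intervalIntegral.integral_eq_sub_of_hasDerivAt hd
        (Continuous.intervalIntegrable (by fun_prop) _ _)]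
      simp; ring
    calc _ ≤ ∑ k, (p k + ∫ r in (0 : ℝ)..v, C * (a * Real.exp (D * r))) :=
          Finset.sum_le_sum fun k _ => hle k
      _ = a + D * ∫ r in (0 : ℝ)..v, a * Real.exp (D * r) := by
          rw [Finset.sum_add_distrib, intervalIntegral.integral_const_mul]
          simp [hD, a, mul_assoc]
      _ = _ := by rw [hexp]; ring

theorem picardIter_le (hBm : ∀ k j, Measurable (fun r => B r k j))
    (hB0 : ∀ r k j, 0 ≤ B r k j) (hBC : ∀ r k j, B r k j ≤ C) (hp : ∀ k, 0 ≤ p k) (n : ℕ)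
    {v : ℝ} (hv : 0 ≤ v) (k : ι) :
    picardIter B p n v k ≤ (∑ k, p k) * Real.exp (Fintype.card ι * C * v) :=
  (Finset.single_le_sum (fun j _ => picardIter_nonneg hB0 hp n hv j) (Finset.mem_univ k)).trans
    (picardIter_sum_le hBm hB0 hBC hp n hv)

theorem picardIter_integrable (hBm : ∀ k j, Measurable (fun r => B r k j))
    (hB0 : ∀ r k j, 0 ≤ B r k j) (hBC : ∀ r k j, B r k j ≤ C) (hp : ∀ k, 0 ≤ p k) (n : ℕ)
    {v : ℝ} (hv : 0 ≤ v) (k : ι) :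
    IntervalIntegrable (fun r => ∑ j, B r k j * picardIter B p n r j) volume 0 v := by
  have hC : 0 ≤ C := (hB0 0 k k).trans (hBC 0 k k)
  refine intervalIntegrable_of_bounded ?_ hv
    (C := ∑ j : ι, C * ((∑ k, p k) * Real.exp (Fintype.card ι * C * v))) ?_
  · exact Finset.measurable_sum _ fun j _ => (hBm k j).mul (measurable_picardIter_time hBm n j)
  · intro r hr
    rw [abs_of_nonneg (Finset.sum_nonneg fun j _ =>
      mul_nonneg (hB0 r k j) (picardIter_nonneg hB0 hp n hr.1 j))]
    refine Finset.sum_le_sum fun j _ => mul_le_mul (hBC r k j) ?_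
      (picardIter_nonneg hB0 hp n hr.1 j) hC
    refine (picardIter_le hBm hB0 hBC hp n hr.1 j).trans ?_
    have : 0 ≤ ∑ k, p k := Finset.sum_nonneg fun k _ => hp k
    gcongr
    exact hr.2

/-- The iteration starts at zero, below its nonnegative successor, and the integral operator is
monotone because the coefficients are nonnegative. -/
theorem picardIter_mono (hBm : ∀ k j, Measurable (fun r => B r k j))
    (hB0 : ∀ r k j, 0 ≤ B r k j) (hBC : ∀ r k j, B r k j ≤ C) (hp : ∀ k, 0 ≤ p k) {v : ℝ}
    (hv : 0 ≤ v) (k : ι) : Monotone (fun n => picardIter B p n v k) := by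
  refine monotone_nat_of_le_succ fun n => ?_
  induction n generalizing v k with
  | zero => exact picardIter_nonneg hB0 hp 1 hv k
  | succ n ih =>
    refine add_le_add_right (intervalIntegral.integral_mono_on hv
      (picardIter_integrable hBm hB0 hBC hp n hv k)
      (picardIter_integrable hBm hB0 hBC hp (n + 1) hv k) fun r hr => ?_) _
    exact Finset.sum_le_sum fun j _ => mul_le_mul_of_nonneg_left (ih hr.1 j) (hB0 r k j)

theorem tendsto_picardIter (hBm : ∀ k j, Measurable (fun r => B r k j))
    (hB0 : ∀ r k j, 0 ≤ B r k j) (hBC : ∀ r k j, B r k j ≤ C) (hp : ∀ k, 0 ≤ p k) {v : ℝ}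
    (hv : 0 ≤ v) (k : ι) :
    Tendsto (fun n => picardIter B p n v k) atTop (𝓝 (linearFlow B p v k)) :=
  tendsto_atTop_ciSup (picardIter_mono hBm hB0 hBC hp hv k)
    ⟨_, by rintro _ ⟨n, rfl⟩; exact picardIter_le hBm hB0 hBC hp n hv k⟩

theorem linearFlow_le (hBm : ∀ k j, Measurable (fun r => B r k j))
    (hB0 : ∀ r k j, 0 ≤ B r k j) (hBC : ∀ r k j, B r k j ≤ C) (hp : ∀ k, 0 ≤ p k)
    {v : ℝ} (hv : 0 ≤ v) (k : ι) :
    linearFlow B p v k ≤ (∑ k, p k) * Real.exp (Fintype.card ι * C * v) :=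
  le_of_tendsto' (tendsto_picardIter hBm hB0 hBC hp hv k)
    fun n => picardIter_le hBm hB0 hBC hp n hv k

theorem linearFlow_nonneg (hBm : ∀ k j, Measurable (fun r => B r k j))
    (hB0 : ∀ r k j, 0 ≤ B r k j) (hBC : ∀ r k j, B r k j ≤ C) (hp : ∀ k, 0 ≤ p k)
    {v : ℝ} (hv : 0 ≤ v) (k : ι) : 0 ≤ linearFlow B p v k :=
  ge_of_tendsto' (tendsto_picardIter hBm hB0 hBC hp hv k)
    fun n => picardIter_nonneg hB0 hp n hv k

/-- The Picard recursion passes to the limit by dominated convergence, the exponential bound on the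
iterates being the majorant. -/
theorem linearFlow_eq (hBm : ∀ k j, Measurable (fun r => B r k j))
    (hB0 : ∀ r k j, 0 ≤ B r k j) (hBC : ∀ r k j, B r k j ≤ C) (hp : ∀ k, 0 ≤ p k)
    {v : ℝ} (hv : 0 ≤ v) (k : ι) :
    linearFlow B p v k = p k + ∫ r in (0 : ℝ)..v, ∑ j, B r k j * linearFlow B p r j := by
  have hC : 0 ≤ C := (hB0 0 k k).trans (hBC 0 k k)
  have hP : 0 ≤ ∑ k, p k := Finset.sum_nonneg fun k _ => hp k
  refine tendsto_nhds_unique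
    ((tendsto_picardIter hBm hB0 hBC hp hv k).comp (tendsto_add_atTop_nat 1)) ?_
  refine tendsto_const_nhds.add ?_
  refine intervalIntegral.tendsto_integral_filter_of_dominated_convergence
    (fun _ => ∑ j : ι, C * ((∑ k, p k) * Real.exp (Fintype.card ι * C * v))) ?_ ?_ ?_ ?_
  · exact Eventually.of_forall fun n => (Finset.measurable_sum _ fun j _ =>
      (hBm k j).mul (measurable_picardIter_time hBm n j)).aestronglyMeasurable
  · refine Eventually.of_forall fun n => Eventually.of_forall fun r hr => ?_
    rw [uIoc_of_le hv] at hr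
    rw [Real.norm_eq_abs, abs_of_nonneg (Finset.sum_nonneg fun j _ =>
      mul_nonneg (hB0 r k j) (picardIter_nonneg hB0 hp n hr.1.le j))]
    refine Finset.sum_le_sum fun j _ => mul_le_mul (hBC r k j) ?_
      (picardIter_nonneg hB0 hp n hr.1.le j) hC
    refine (picardIter_le hBm hB0 hBC hp n hr.1.le j).trans ?_
    gcongr
    exact hr.2
  · simp
  · refine Eventually.of_forall fun r hr => ?_
    rw [uIoc_of_le hv] at hr
    exact tendsto_finsetSum _ fun j _ =>
      (tendsto_picardIter hBm hB0 hBC hp hr.1.le j).const_mul _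

theorem linearFlow_isPrim (hBm : ∀ k j, Measurable (fun r => B r k j))
    (hB0 : ∀ r k j, 0 ≤ B r k j) (hBC : ∀ r k j, B r k j ≤ C) (hp : ∀ k, 0 ≤ p k)
    {L : ℝ} (hL : 0 ≤ L) (k : ι) :
    IsPrim (fun v => linearFlow B p v k) (fun v => ∑ j, B v k j * linearFlow B p v j) L := by
  have hC : 0 ≤ C := (hB0 0 k k).trans (hBC 0 k k)
  have hP : 0 ≤ ∑ k, p k := Finset.sum_nonneg fun k _ => hp k
  refine (IsPrim.of_measurable (p k) (L := L)
    (C := ∑ j : ι, C * ((∑ k, p k) * Real.exp (Fintype.card ι * C * L))) ?_ hL ?_).congr_left hL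
    fun v hv => (linearFlow_eq hBm hB0 hBC hp hv.1 k).symm
  · exact Finset.measurable_sum _ fun j _ => (hBm k j).mul (measurable_linearFlow_time hBm j)
  · intro r hr
    rw [abs_of_nonneg (Finset.sum_nonneg fun j _ =>
      mul_nonneg (hB0 r k j) (linearFlow_nonneg hBm hB0 hBC hp hr.1 j))]
    refine Finset.sum_le_sum fun j _ => mul_le_mul (hBC r k j) ?_
      (linearFlow_nonneg hBm hB0 hBC hp hr.1 j) hC
    refine (linearFlow_le hBm hB0 hBC hp hr.1 j).trans ?_
    gcongr
    exact hr.2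

/-- Nonnegative coefficients only add to the initial value. This later keeps the total mass of the
unnormalized filter at least one. -/
theorem le_linearFlow (hBm : ∀ k j, Measurable (fun r => B r k j))
    (hB0 : ∀ r k j, 0 ≤ B r k j) (hBC : ∀ r k j, B r k j ≤ C) (hp : ∀ k, 0 ≤ p k)
    {v : ℝ} (hv : 0 ≤ v) (k : ι) : p k ≤ linearFlow B p v k := by
  rw [linearFlow_eq hBm hB0 hBC hp hv k]
  refine le_add_of_nonneg_right (intervalIntegral.integral_nonneg hv fun r hr => ?_)
  exact Finset.sum_nonneg fun j _ => mul_nonneg (hB0 r k j)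
    (linearFlow_nonneg hBm hB0 hBC hp hr.1 j)

end LinearSystem

namespace LiquidationModel

variable {K : ℕ} {M : LiquidationModel K}

/-! ### Clamped coefficients -/

theorem νmax_pos (M : LiquidationModel K) : 0 < M.νmax :=
  (div_pos M.w₀_pos M.T_pos).trans M.lt_νmax

/-- Projection of the time onto `[0, T]`. -/
noncomputable def clampT (M : LiquidationModel K) (t : ℝ) : ℝ := max 0 (min t M.T)

/-- Projection of the rate onto `[0, νmax]`. -/
noncomputable def clampN (M : LiquidationModel K) (ν : ℝ) : ℝ := max 0 (min ν M.νmax)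

theorem clampT_mem (t : ℝ) : M.clampT t ∈ Icc 0 M.T :=
  ⟨le_max_left _ _, max_le M.T_pos.le (min_le_right _ _)⟩

theorem clampN_mem (ν : ℝ) : M.clampN ν ∈ Icc 0 M.νmax :=
  ⟨le_max_left _ _, max_le M.νmax_pos.le (min_le_right _ _)⟩

theorem clampT_of_mem {t : ℝ} (ht : t ∈ Icc 0 M.T) : M.clampT t = t := by
  rw [clampT, min_eq_left ht.2, max_eq_right ht.1]

theorem clampN_of_mem {ν : ℝ} (hν : ν ∈ Icc 0 M.νmax) : M.clampN ν = ν := by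
  rw [clampN, min_eq_left hν.2, max_eq_right hν.1]

theorem continuous_clampT : Continuous M.clampT := by unfold clampT; fun_prop

theorem continuous_clampN : Continuous M.clampN := by unfold clampN; fun_prop

/-- The density of the compensator at the clamped time and rate. -/
noncomputable def cdens (M : LiquidationModel K) (t : ℝ) (j : Fin K) (ν z : ℝ) : ℝ :=
  M.dens (M.clampT t) j (M.clampN ν) z

/-- The total jump intensity in the hidden state `k`, at the clamped time and rate. -/
noncomputable def stateRate (M : LiquidationModel K) (k : Fin K) (t ν : ℝ) : ℝ :=
  (M.etaP (M.clampT t) k (M.clampN ν)).real univ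

namespace Assumption1

variable (h1 : M.Assumption1)
include h1

/-- The constant bounding the densities. -/
noncomputable def C : ℝ := h1.dens_bounds.choose

theorem C_pos : 0 < h1.C := h1.dens_bounds.choose_spec.1

/-- Clamping makes the bounds available for all real `t` and `ν`. The exceptional null set is common
to the finitely many hidden states but still depends on `(t, ν)`. -/
theorem cdens_bounds (t ν : ℝ) :
    ∀ᵐ z ∂M.etaQ, ∀ j, h1.C⁻¹ < M.cdens t j ν z ∧ M.cdens t j ν z < h1.C :=
  ae_all_iff.2 fun j => h1.dens_bounds.choose_spec.2 _ (clampT_mem t) j _ (clampN_mem ν)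

theorem measurable_cdens (j : Fin K) :
    Measurable (fun y : ℝ × ℝ × ℝ => M.cdens y.1 j y.2.1 y.2.2) :=
  (h1.dens_measurable j).comp <| (continuous_clampT.measurable.comp measurable_fst).prodMk <|
    (continuous_clampN.measurable.comp (measurable_fst.comp measurable_snd)).prodMk
      (measurable_snd.comp measurable_snd)

theorem measurable_cdens_right (t : ℝ) (j : Fin K) (ν : ℝ) : Measurable (M.cdens t j ν) :=
  (h1.measurable_cdens j).comp (measurable_const.prodMk (measurable_const.prodMk measurable_id))

theorem integrable_of_ae_bounded {F : ℝ → ℝ} (hF : Measurable F) {A : ℝ}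
    (hA : ∀ᵐ z ∂M.etaQ, |F z| ≤ A) : Integrable F M.etaQ := by
  have := h1.finite
  exact Integrable.of_bound hF.aestronglyMeasurable A hA

theorem cdens_integrable (t : ℝ) (j : Fin K) (ν : ℝ) : Integrable (M.cdens t j ν) M.etaQ := by
  refine h1.integrable_of_ae_bounded (h1.measurable_cdens_right t j ν) (A := h1.C) ?_
  filter_upwards [h1.cdens_bounds t ν] with z hz
  rw [abs_of_pos ((inv_pos.2 h1.C_pos).trans (hz j).1)]
  exact (hz j).2.le

theorem etaP_clamp (t : ℝ) (j : Fin K) (ν : ℝ) : M.etaP (M.clampT t) j (M.clampN ν)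
    = M.etaQ.withDensity (fun z => ENNReal.ofReal (M.cdens t j ν z)) :=
  h1.etaP_eq _ (clampT_mem t) j _ (clampN_mem ν)

theorem etaP_eq_cdens {t ν : ℝ} (ht : t ∈ Icc 0 M.T) (hν : ν ∈ Icc 0 M.νmax) (j : Fin K) :
    M.etaP t j ν = M.etaQ.withDensity (fun z => ENNReal.ofReal (M.cdens t j ν z)) := by
  rw [← h1.etaP_clamp, clampT_of_mem ht, clampN_of_mem hν]

theorem integral_withDensity_cdens (t : ℝ) (j : Fin K) (ν : ℝ) (F : ℝ → ℝ) :
    ∫ z, F z ∂(M.etaQ.withDensity (fun z => ENNReal.ofReal (M.cdens t j ν z)))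
      = ∫ z, M.cdens t j ν z * F z ∂M.etaQ := by
  rw [integral_withDensity_eq_integral_toReal_smul
    (h1.measurable_cdens_right t j ν).ennreal_ofReal (by simp)]
  refine integral_congr_ae ?_
  filter_upwards [h1.cdens_bounds t ν] with z hz
  rw [ENNReal.toReal_ofReal ((inv_pos.2 h1.C_pos).trans (hz j).1).le, smul_eq_mul]

theorem stateRate_eq (k : Fin K) (t ν : ℝ) :
    M.stateRate k t ν = ∫ z, M.cdens t k ν z ∂M.etaQ := by
  have := h1.integral_withDensity_cdens t k ν (fun _ => 1)
  rw [integral_const, smul_eq_mul, mul_one] at this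
  rw [stateRate, h1.etaP_clamp, this]
  simp

theorem stateRate_nonneg (k : Fin K) (t ν : ℝ) : 0 ≤ M.stateRate k t ν := measureReal_nonneg

theorem stateRate_le (k : Fin K) (t ν : ℝ) :
    M.stateRate k t ν ≤ h1.C * M.etaQ.real univ := by
  have := h1.finite
  rw [h1.stateRate_eq]
  calc _ ≤ ∫ _, h1.C ∂M.etaQ := integral_mono_ae (h1.cdens_integrable t k ν)
        (integrable_const _) (by filter_upwards [h1.cdens_bounds t ν] with z hz using (hz k).2.le)
    _ = _ := by simp [mul_comm]

theorem measurable_stateRate (k : Fin K) :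
    Measurable (fun y : ℝ × ℝ => M.stateRate k y.1 y.2) := by
  have := h1.finite
  have h : (fun y : ℝ × ℝ => M.stateRate k y.1 y.2)
      = fun y => ∫ z, M.cdens y.1 k y.2 z ∂M.etaQ := by
    ext y; exact h1.stateRate_eq k y.1 y.2
  rw [h]
  have hm : Measurable (fun p : (ℝ × ℝ) × ℝ => M.cdens p.1.1 k p.1.2 p.2) :=
    (h1.measurable_cdens k).comp (by fun_prop :
      Measurable (fun p : (ℝ × ℝ) × ℝ => (p.1.1, p.1.2, p.2)))
  exact (hm.stronglyMeasurable.integral_prod_right' (ν := M.etaQ)).measurable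

end Assumption1

/-- The constant 1 is an admissible test function for weak continuity, so total masses are
continuous; clamping extends this to the whole plane. -/
theorem Assumption2.continuous_stateRate (h2 : M.Assumption2) (k : Fin K) :
    Continuous (fun y : ℝ × ℝ => M.stateRate k y.1 y.2) := by
  have h := h2.weak_cont k (BoundedContinuousFunction.const ℝ 1)
  have hc : Continuous (fun y : ℝ × ℝ => (M.clampT y.1, M.clampN y.2)) :=
    (continuous_clampT.comp continuous_fst).prodMk (continuous_clampN.comp continuous_snd)
  have := h.comp_continuous hc (fun y => ⟨clampT_mem y.1, clampN_mem y.2⟩)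
  refine this.congr fun y => ?_
  simp [stateRate]

/-! ### The vector field on the simplex -/

/-- The weighted density `∑ j, p j * d_j` at the clamped time and rate. -/
noncomputable def mixDens (M : LiquidationModel K) (t ν : ℝ) (p : Fin K → ℝ) (z : ℝ) : ℝ :=
  ∑ j, p j * M.cdens t j ν z

/-- The filter component of the vector field, written as a polynomial in the filter. -/
noncomputable def filterField (M : LiquidationModel K) (t ν : ℝ) (p : Fin K → ℝ) (k : Fin K) : ℝ :=
  ∑ j, M.q j k * p j - p k * (M.stateRate k t ν - ∑ j, p j * M.stateRate j t ν)

theorem simplex_sum_bounds {p : Fin K → ℝ} (hp : p ∈ stdSimplex ℝ (Fin K)) {a : Fin K → ℝ}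
    {l r : ℝ} (h : ∀ j, l ≤ a j ∧ a j ≤ r) : l ≤ ∑ j, p j * a j ∧ ∑ j, p j * a j ≤ r := by
  constructor
  · calc l = ∑ j, p j * l := by rw [← Finset.sum_mul, hp.2, one_mul]
      _ ≤ _ := Finset.sum_le_sum fun j _ => mul_le_mul_of_nonneg_left (h j).1 (hp.1 j)
  · calc _ ≤ ∑ j, p j * r := Finset.sum_le_sum fun j _ =>
          mul_le_mul_of_nonneg_left (h j).2 (hp.1 j)
      _ = r := by rw [← Finset.sum_mul, hp.2, one_mul]

namespace Assumption1

variable (h1 : M.Assumption1)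
include h1

theorem measurable_mixDens : Measurable (fun y : ℝ × ℝ × (Fin K → ℝ) × ℝ =>
    M.mixDens y.1 y.2.1 y.2.2.1 y.2.2.2) := by
  refine Finset.measurable_sum _ fun j _ => Measurable.mul (by fun_prop) ?_
  exact (h1.measurable_cdens j).comp (by fun_prop :
    Measurable (fun y : ℝ × ℝ × (Fin K → ℝ) × ℝ => (y.1, y.2.1, y.2.2.2)))

theorem measurable_mixDens_right (t ν : ℝ) (p : Fin K → ℝ) : Measurable (M.mixDens t ν p) :=
  Finset.measurable_sum _ fun j _ => (h1.measurable_cdens_right t j ν).const_mul _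

theorem mixDens_bounds {p : Fin K → ℝ} (hp : p ∈ stdSimplex ℝ (Fin K)) (t ν : ℝ) :
    ∀ᵐ z ∂M.etaQ, h1.C⁻¹ ≤ M.mixDens t ν p z ∧ M.mixDens t ν p z ≤ h1.C := by
  filter_upwards [h1.cdens_bounds t ν] with z hz
  exact simplex_sum_bounds hp fun j => ⟨(hz j).1.le, (hz j).2.le⟩

theorem mixDens_integrable (t ν : ℝ) (p : Fin K → ℝ) : Integrable (M.mixDens t ν p) M.etaQ :=
  integrable_finsetSum _ fun j _ => (h1.cdens_integrable t j ν).const_mul _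

theorem integral_mixDens (t ν : ℝ) (p : Fin K → ℝ) :
    ∫ z, M.mixDens t ν p z ∂M.etaQ = ∑ j, p j * M.stateRate j t ν := by
  simp only [mixDens]
  rw [integral_finsetSum _ fun j _ => (h1.cdens_integrable t j ν).const_mul _]
  exact Finset.sum_congr rfl fun j _ => by rw [integral_const_mul, h1.stateRate_eq]

theorem u_eq {t ν : ℝ} (ht : t ∈ Icc 0 M.T) (hν : ν ∈ Icc 0 M.νmax) (p : Fin K → ℝ) (k : Fin K)
    (z : ℝ) : M.u k t ν p z = M.cdens t k ν z / M.mixDens t ν p z - 1 := by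
  simp only [u, mixDens, cdens, clampT_of_mem ht, clampN_of_mem hν]

/-- The weights `p j` turn the densities into the mixture density, which is precisely the
denominator of `u`. After the cancellation only differences of total intensities remain, so the
drift of the filter is quadratic in the filter. -/
theorem sum_integral_u {t ν : ℝ} (ht : t ∈ Icc 0 M.T) (hν : ν ∈ Icc 0 M.νmax) {p : Fin K → ℝ}
    (hp : p ∈ stdSimplex ℝ (Fin K)) (k : Fin K) :
    ∑ j, p j * ∫ z, M.u k t ν p z ∂(M.etaP t j ν)
      = M.stateRate k t ν - ∑ j, p j * M.stateRate j t ν := by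
  have hC := h1.C_pos
  have e1 : ∀ j, ∫ z, M.u k t ν p z ∂(M.etaP t j ν)
      = ∫ z, M.cdens t j ν z * (M.cdens t k ν z / M.mixDens t ν p z - 1) ∂M.etaQ := by
    intro j
    rw [h1.etaP_eq_cdens ht hν, h1.integral_withDensity_cdens]
    exact integral_congr_ae (Eventually.of_forall fun z => by simp only [h1.u_eq ht hν])
  have hint : ∀ j, Integrable
      (fun z => M.cdens t j ν z * (M.cdens t k ν z / M.mixDens t ν p z - 1)) M.etaQ := by
    intro j
    refine h1.integrable_of_ae_bounded ?_ (A := h1.C * (h1.C * h1.C + 1)) ?_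
    · exact (h1.measurable_cdens_right t j ν).mul
        (((h1.measurable_cdens_right t k ν).div (h1.measurable_mixDens_right t ν p)).sub_const 1)
    · filter_upwards [h1.cdens_bounds t ν, h1.mixDens_bounds hp t ν] with z hz hD
      have hpos := inv_pos.2 hC
      have hD0 : 0 < M.mixDens t ν p z := hpos.trans_le hD.1
      have hk0 := hpos.trans (hz k).1
      rw [abs_mul, abs_of_pos (hpos.trans (hz j).1)]
      refine mul_le_mul (hz j).2.le ?_ (abs_nonneg _) hC.le
      refine (abs_sub _ _).trans ?_
      rw [abs_of_pos (div_pos hk0 hD0), abs_one]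
      gcongr
      rw [div_eq_mul_inv]
      refine mul_le_mul (hz k).2.le ?_ (inv_pos.2 hD0).le hC.le
      exact inv_le_of_inv_le₀ hC hD.1
  calc _ = ∑ j, ∫ z, p j *
        (M.cdens t j ν z * (M.cdens t k ν z / M.mixDens t ν p z - 1)) ∂M.etaQ := by
        exact Finset.sum_congr rfl fun j _ => by rw [e1, integral_const_mul]
    _ = ∫ z, ∑ j, p j *
        (M.cdens t j ν z * (M.cdens t k ν z / M.mixDens t ν p z - 1)) ∂M.etaQ := by
        rw [integral_finsetSum _ fun j _ => (hint j).const_mul _]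
    _ = ∫ z, (M.cdens t k ν z - M.mixDens t ν p z) ∂M.etaQ := by
        refine integral_congr_ae ?_
        filter_upwards [h1.mixDens_bounds hp t ν] with z hD
        have hD0 : M.mixDens t ν p z ≠ 0 := ((inv_pos.2 hC).trans_le hD.1).ne'
        simp only [← mul_assoc]
        rw [← Finset.sum_mul]
        change M.mixDens t ν p z * _ = _
        field_simp
    _ = _ := by
        rw [integral_sub (h1.cdens_integrable t k ν) (h1.mixDens_integrable t ν p),
          h1.integral_mixDens, h1.stateRate_eq]

theorem g_eq {x : PState K} {ν : ℝ} (ht : x.time ∈ Icc 0 M.T) (hν : ν ∈ Icc 0 M.νmax)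
    (hp : x.filt ∈ stdSimplex ℝ (Fin K)) :
    M.g x ν = (1, -ν, 0, M.filterField x.time ν x.filt) := by
  simp only [g, h1.sum_integral_u ht hν hp]
  rfl

theorem jumpRate_eq {x : PState K} {ν : ℝ} (ht : x.time ∈ Icc 0 M.T) (hν : ν ∈ Icc 0 M.νmax) :
    M.jumpRate x ν = ∑ j, x.filt j * M.stateRate j x.time ν := by
  simp only [jumpRate, stateRate, clampT_of_mem ht, clampN_of_mem hν]

end Assumption1

/-- Measurable rates with values in `[0, νmax]`. -/
def IsControl (M : LiquidationModel K) (α : ℝ → ℝ) : Prop :=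
  Measurable α ∧ ∀ v, α v ∈ Icc 0 M.νmax

theorem Control.isControl (α : M.Control) : M.IsControl α.1 := α.2

theorem filt_mem {x : PState K} (hx : x ∈ M.stateSpace) : x.filt ∈ stdSimplex ℝ (Fin K) :=
  hx.2.2.2

theorem time_mem {x : PState K} (hx : x ∈ M.stateSpace) : x.time ∈ Icc 0 M.T := hx.1

theorem inv_mem {x : PState K} (hx : x ∈ M.stateSpace) : x.inv ∈ Icc 0 M.w₀ := hx.2.1

theorem price_nonneg {x : PState K} (hx : x ∈ M.stateSpace) : 0 ≤ x.price := hx.2.2.1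

theorem horizon_nonneg {x : PState K} (hx : x ∈ M.stateSpace) : 0 ≤ M.T - x.time :=
  sub_nonneg.2 (time_mem hx).2

theorem time_add_mem {x : PState K} (hx : x ∈ M.stateSpace) {v : ℝ}
    (hv : v ∈ Icc 0 (M.T - x.time)) : x.time + v ∈ Icc 0 M.T :=
  ⟨add_nonneg (time_mem hx).1 hv.1, by linarith [hv.2]⟩

/-! ### The filter as the normalization of a linear system -/

namespace Assumption1

/-- The exponential weight that makes the coefficients of the unnormalized filter equation
nonnegative. -/
noncomputable def β (h1 : M.Assumption1) : ℝ :=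
  h1.C * M.etaQ.real univ + ∑ i, ∑ j, |M.q i j|

/-- A bound for the coefficients of the unnormalized filter equation. -/
noncomputable def bd (h1 : M.Assumption1) : ℝ := h1.β + ∑ i, ∑ j, |M.q i j|

/-- The coefficients of the weighted unnormalized filter equation. -/
noncomputable def coef (h1 : M.Assumption1) (α : ℝ → ℝ) (x : PState K) (r : ℝ) (k j : Fin K) : ℝ :=
  M.q j k + if k = j then h1.β - M.stateRate k (x.time + r) (α r) else 0

/-- The weighted unnormalized filter. -/
noncomputable def mass (h1 : M.Assumption1) (α : ℝ → ℝ) (x : PState K) (v : ℝ) (k : Fin K) : ℝ :=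
  linearFlow (h1.coef α x) (fun k => |x.filt k|) v k

/-- The total mass of the weighted unnormalized filter. -/
noncomputable def totalMass (h1 : M.Assumption1) (α : ℝ → ℝ) (x : PState K) (v : ℝ) : ℝ :=
  ∑ k, h1.mass α x v k

/-- The survival probability of the first jump time. -/
noncomputable def surv (h1 : M.Assumption1) (α : ℝ → ℝ) (x : PState K) (v : ℝ) : ℝ :=
  Real.exp (-h1.β * v) * h1.totalMass α x v

/-- The filter along the flow. -/
noncomputable def filtFlow (h1 : M.Assumption1) (α : ℝ → ℝ) (x : PState K) (v : ℝ) (k : Fin K) : ℝ :=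
  h1.mass α x v k / h1.totalMass α x v

/-- An explicit version of the flow. -/
noncomputable def expFlow (h1 : M.Assumption1) (α : ℝ → ℝ) (x : PState K) (v : ℝ) : PState K :=
  (x.time + v, x.inv - ∫ r in (0 : ℝ)..v, α r, x.price, h1.filtFlow α x v)

/-- The jump rate along the flow. -/
noncomputable def flowRate (h1 : M.Assumption1) (α : ℝ → ℝ) (x : PState K) (v : ℝ) : ℝ :=
  ∑ j, h1.filtFlow α x v j * M.stateRate j (x.time + v) (α v)

variable (h1 : M.Assumption1)
include h1

theorem abs_q_le (i j : Fin K) : |M.q i j| ≤ ∑ i, ∑ j, |M.q i j| :=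
  (Finset.single_le_sum (f := fun j => |M.q i j|) (fun _ _ => abs_nonneg _)
    (Finset.mem_univ j)).trans
    (Finset.single_le_sum (f := fun i => ∑ j, |M.q i j|)
      (fun _ _ => Finset.sum_nonneg fun _ _ => abs_nonneg _) (Finset.mem_univ i))

theorem sum_abs_q_nonneg : 0 ≤ ∑ i, ∑ j, |M.q i j| :=
  Finset.sum_nonneg fun _ _ => Finset.sum_nonneg fun _ _ => abs_nonneg _

theorem stateRate_le_β (k : Fin K) (t ν : ℝ) : M.stateRate k t ν ≤ h1.β := by
  have := h1.stateRate_le k t ν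
  have := h1.sum_abs_q_nonneg
  unfold β; linarith

theorem β_nonneg : 0 ≤ h1.β := by
  have := h1.C_pos
  exact add_nonneg (mul_nonneg this.le measureReal_nonneg) h1.sum_abs_q_nonneg

/-- Off the diagonal the entries are those of a generator. On the diagonal `β` dominates both the
intensity and `|q k k|`. Adding `β` to the diagonal corresponds to the factor `exp (β * v)` in the
unnormalized filter, which is removed again in `surv` and cancels in `filtFlow`. -/
theorem coef_nonneg (α : ℝ → ℝ) (x : PState K) (r : ℝ) (k j : Fin K) : 0 ≤ h1.coef α x r k j := by
  unfold coef
  split_ifs with h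
  · subst h
    have := h1.stateRate_le k (x.time + r) (α r)
    have := h1.abs_q_le k k
    have := neg_abs_le (M.q k k)
    unfold β; linarith
  · rw [add_zero]; exact M.q_offdiag j k (Ne.symm h)

theorem coef_le (α : ℝ → ℝ) (x : PState K) (r : ℝ) (k j : Fin K) : h1.coef α x r k j ≤ h1.bd := by
  have h2 := h1.abs_q_le j k
  have h3 := le_abs_self (M.q j k)
  have h4 := h1.β_nonneg
  unfold coef bd
  split_ifs with h
  · have := h1.stateRate_nonneg k (x.time + r) (α r); linarith
  · linarith

theorem measurable_coef_param {X : Type*} [MeasurableSpace X] {a : X → ℝ → ℝ} {s : X → PState K}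
    (ha : Measurable (fun y : X × ℝ => a y.1 y.2)) (hs : Measurable s) (k j : Fin K) :
    Measurable (fun y : X × ℝ => h1.coef (a y.1) (s y.1) y.2 k j) := by
  unfold coef
  refine measurable_const.add ?_
  split_ifs with h
  · refine measurable_const.sub ((h1.measurable_stateRate k).comp (Measurable.prodMk ?_ ha))
    exact ((measurable_fst.comp hs).comp measurable_fst).add measurable_snd
  · exact measurable_const

theorem measurable_coef {α : ℝ → ℝ} (hα : Measurable α) (x : PState K) (k j : Fin K) :
    Measurable (fun r => h1.coef α x r k j) := by
  unfold coef
  refine measurable_const.add ?_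
  split_ifs with h
  · exact measurable_const.sub ((h1.measurable_stateRate k).comp
      ((measurable_const.add measurable_id).prodMk hα))
  · exact measurable_const

theorem measurable_mass_param {X : Type*} [MeasurableSpace X] {a : X → ℝ → ℝ} {s : X → PState K}
    (ha : Measurable (fun y : X × ℝ => a y.1 y.2)) (hs : Measurable s) (k : Fin K) :
    Measurable (fun y : X × ℝ => h1.mass (a y.1) (s y.1) y.2 k) := by
  have hs' : ∀ k, Measurable (fun x => |(s x).filt k|) := fun k => by
    have h : Measurable (fun x : PState K => x.filt k) := by unfold PState.filt; fun_prop
    exact continuous_abs.measurable.comp (h.comp hs)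
  exact measurable_linearFlow (B := fun x => h1.coef (a x) (s x))
    (p := fun x k => |(s x).filt k|) (h1.measurable_coef_param ha hs) hs' k

theorem measurable_totalMass_param {X : Type*} [MeasurableSpace X] {a : X → ℝ → ℝ}
    {s : X → PState K} (ha : Measurable (fun y : X × ℝ => a y.1 y.2)) (hs : Measurable s) :
    Measurable (fun y : X × ℝ => h1.totalMass (a y.1) (s y.1) y.2) :=
  Finset.measurable_sum _ fun k _ => h1.measurable_mass_param ha hs k

theorem measurable_surv_param {X : Type*} [MeasurableSpace X] {a : X → ℝ → ℝ}
    {s : X → PState K} (ha : Measurable (fun y : X × ℝ => a y.1 y.2)) (hs : Measurable s) :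
    Measurable (fun y : X × ℝ => h1.surv (a y.1) (s y.1) y.2) := by
  refine Measurable.mul ?_ (h1.measurable_totalMass_param ha hs)
  fun_prop

theorem measurable_filtFlow_param {X : Type*} [MeasurableSpace X] {a : X → ℝ → ℝ}
    {s : X → PState K} (ha : Measurable (fun y : X × ℝ => a y.1 y.2)) (hs : Measurable s) :
    Measurable (fun y : X × ℝ => h1.filtFlow (a y.1) (s y.1) y.2) :=
  measurable_pi_lambda _ fun k =>
    (h1.measurable_mass_param ha hs k).div (h1.measurable_totalMass_param ha hs)

theorem measurable_expFlow_param {X : Type*} [MeasurableSpace X] {a : X → ℝ → ℝ}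
    {s : X → PState K} (ha : Measurable (fun y : X × ℝ => a y.1 y.2)) (hs : Measurable s) :
    Measurable (fun y : X × ℝ => h1.expFlow (a y.1) (s y.1) y.2) := by
  have ht : Measurable (fun x => (s x).time) := measurable_fst.comp hs
  have hw : Measurable (fun x => (s x).inv) := (measurable_fst.comp measurable_snd).comp hs
  have hp : Measurable (fun x => (s x).price) :=
    (measurable_fst.comp (measurable_snd.comp measurable_snd)).comp hs
  refine ((ht.comp measurable_fst).add measurable_snd).prodMk
    (((hw.comp measurable_fst).sub ?_).prodMk ((hp.comp measurable_fst).prodMk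
      (h1.measurable_filtFlow_param ha hs)))
  exact measurable_intervalIntegral_param (X := X × ℝ) (F := fun y r => a y.1 r)
    (ha.comp (by fun_prop : Measurable fun q : (X × ℝ) × ℝ => (q.1.1, q.2)))
    measurable_const measurable_snd

section Flow

variable {α : ℝ → ℝ} {x : PState K}

theorem filt_abs (hx : x.filt ∈ stdSimplex ℝ (Fin K)) : ∑ k, |x.filt k| = 1 := by
  rw [← hx.2]
  exact Finset.sum_congr rfl fun k _ => abs_of_nonneg (hx.1 k)

/-- The initial value is taken in absolute value, so the theory of nonnegative systems applies to
every state, including those with a filter component outside the simplex. -/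
theorem mass_isPrim (hα : Measurable α) {L : ℝ} (hL : 0 ≤ L) (k : Fin K) :
    IsPrim (fun v => h1.mass α x v k) (fun v => ∑ j, h1.coef α x v k j * h1.mass α x v j) L :=
  linearFlow_isPrim (h1.measurable_coef hα x) (h1.coef_nonneg α x) (h1.coef_le α x)
    (fun _ => abs_nonneg _) hL k

theorem mass_nonneg (hα : Measurable α) {v : ℝ} (hv : 0 ≤ v) (k : Fin K) : 0 ≤ h1.mass α x v k :=
  linearFlow_nonneg (h1.measurable_coef hα x) (h1.coef_nonneg α x) (h1.coef_le α x)
    (fun _ => abs_nonneg _) hv k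

theorem mass_le (hα : Measurable α) (hx : x.filt ∈ stdSimplex ℝ (Fin K)) {v : ℝ} (hv : 0 ≤ v)
    (k : Fin K) : h1.mass α x v k ≤ Real.exp (K * h1.bd * v) := by
  have := linearFlow_le (h1.measurable_coef hα x) (h1.coef_nonneg α x) (h1.coef_le α x)
    (p := fun k => |x.filt k|) (fun _ => abs_nonneg _) hv k
  rwa [h1.filt_abs hx, one_mul, Fintype.card_fin] at this

/-- All components stay above their initial values, which sum to one. The denominators of `filtFlow`
are thus bounded below uniformly over states and controls. -/
theorem one_le_totalMass (hα : Measurable α) (hx : x.filt ∈ stdSimplex ℝ (Fin K)) {v : ℝ}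
    (hv : 0 ≤ v) : 1 ≤ h1.totalMass α x v := by
  rw [← h1.filt_abs hx]
  exact Finset.sum_le_sum fun k _ => le_linearFlow (h1.measurable_coef hα x) (h1.coef_nonneg α x)
    (h1.coef_le α x) (fun _ => abs_nonneg _) hv k

theorem totalMass_pos (hα : Measurable α) (hx : x.filt ∈ stdSimplex ℝ (Fin K)) {v : ℝ}
    (hv : 0 ≤ v) : 0 < h1.totalMass α x v :=
  zero_lt_one.trans_le (h1.one_le_totalMass hα hx hv)

theorem filtFlow_mem (hα : Measurable α) (hx : x.filt ∈ stdSimplex ℝ (Fin K)) {v : ℝ}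
    (hv : 0 ≤ v) : h1.filtFlow α x v ∈ stdSimplex ℝ (Fin K) := by
  have hpos := h1.totalMass_pos hα hx hv
  refine ⟨fun k => div_nonneg (h1.mass_nonneg hα hv k) hpos.le, ?_⟩
  simp only [filtFlow]
  rw [← Finset.sum_div]
  exact div_self hpos.ne'

theorem mass_zero (k : Fin K) (hα : Measurable α) : h1.mass α x 0 k = |x.filt k| := by
  have := linearFlow_eq (h1.measurable_coef hα x) (h1.coef_nonneg α x) (h1.coef_le α x)
    (p := fun k => |x.filt k|) (fun _ => abs_nonneg _) le_rfl k
  simpa [mass] using this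

theorem totalMass_zero (hα : Measurable α) (hx : x.filt ∈ stdSimplex ℝ (Fin K)) :
    h1.totalMass α x 0 = 1 := by
  simp only [totalMass, h1.mass_zero _ hα]
  exact h1.filt_abs hx

theorem filtFlow_zero (hα : Measurable α) (hx : x.filt ∈ stdSimplex ℝ (Fin K)) :
    h1.filtFlow α x 0 = x.filt := by
  ext k
  rw [filtFlow, h1.totalMass_zero hα hx, h1.mass_zero _ hα, div_one, abs_of_nonneg (hx.1 k)]

theorem surv_zero (hα : Measurable α) (hx : x.filt ∈ stdSimplex ℝ (Fin K)) :
    h1.surv α x 0 = 1 := by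
  rw [surv, h1.totalMass_zero hα hx]; simp

theorem surv_pos (hα : Measurable α) (hx : x.filt ∈ stdSimplex ℝ (Fin K)) {v : ℝ}
    (hv : 0 ≤ v) : 0 < h1.surv α x v :=
  mul_pos (Real.exp_pos _) (h1.totalMass_pos hα hx hv)

theorem flowRate_nonneg (hα : Measurable α) (hx : x.filt ∈ stdSimplex ℝ (Fin K)) {v : ℝ}
    (hv : 0 ≤ v) : 0 ≤ h1.flowRate α x v :=
  Finset.sum_nonneg fun j _ => mul_nonneg ((h1.filtFlow_mem hα hx hv).1 j) (h1.stateRate_nonneg _ _ _)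

theorem flowRate_le (hα : Measurable α) (hx : x.filt ∈ stdSimplex ℝ (Fin K)) {v : ℝ}
    (hv : 0 ≤ v) : h1.flowRate α x v ≤ h1.β :=
  (simplex_sum_bounds (h1.filtFlow_mem hα hx hv) (l := 0)
    (fun _ => ⟨h1.stateRate_nonneg _ _ _, h1.stateRate_le_β _ _ _⟩)).2

theorem measurable_flowRate (hα : Measurable α) : Measurable (h1.flowRate α x) := by
  have hf : Measurable (h1.filtFlow α x) :=
    (h1.measurable_filtFlow_param (X := Unit) (a := fun _ => α) (s := fun _ => x)
      (hα.comp measurable_snd) measurable_const).comp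
      (measurable_const.prodMk measurable_id : Measurable fun v : ℝ => (((), v) : Unit × ℝ))
  refine Finset.measurable_sum _ fun j _ => ((measurable_pi_apply j).comp hf).mul ?_
  exact (h1.measurable_stateRate j).comp ((measurable_const.add measurable_id).prodMk hα)

/-- When the equations are added up, the generator drops out because its rows sum to zero. What
remains is `β` minus the intensity averaged with the normalized filter. -/
theorem totalMass_isPrim (hα : Measurable α) (hx : x.filt ∈ stdSimplex ℝ (Fin K)) {L : ℝ}
    (hL : 0 ≤ L) : IsPrim (h1.totalMass α x)
      (fun v => (h1.β - h1.flowRate α x v) * h1.totalMass α x v) L := by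
  refine (IsPrim.sum Finset.univ fun k _ => h1.mass_isPrim (x := x) hα hL k).congr hL
    fun v hv => ?_
  have hpos := h1.totalMass_pos hα hx hv.1
  rw [Finset.sum_comm]
  simp only [← Finset.sum_mul, coef, Finset.sum_add_distrib, M.q_rowsum,
    Finset.sum_ite_eq', Finset.mem_univ, if_true, zero_add]
  rw [sub_mul, flowRate, Finset.sum_mul, totalMass, Finset.mul_sum, ← Finset.sum_sub_distrib]
  refine Finset.sum_congr rfl fun k _ => ?_
  have : h1.filtFlow α x v k * h1.totalMass α x v = h1.mass α x v k :=
    div_mul_cancel₀ _ hpos.ne'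
  rw [sub_mul, ← this, totalMass]
  ring

theorem rateIntegral_isPrim (hα : Measurable α) (hx : x.filt ∈ stdSimplex ℝ (Fin K)) {L : ℝ}
    (hL : 0 ≤ L) : IsPrim (fun v => 0 + ∫ r in (0 : ℝ)..v, -(h1.β - h1.flowRate α x r))
      (fun v => -(h1.β - h1.flowRate α x v)) L := by
  have hm : Measurable (fun v => -(h1.β - h1.flowRate α x v)) :=
    (measurable_const.sub (h1.measurable_flowRate hα)).neg
  refine IsPrim.of_measurable 0 hm hL (C := h1.β) fun v hv => ?_
  rw [abs_neg, abs_of_nonneg (sub_nonneg.2 (h1.flowRate_le hα hx hv.1))]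
  linarith [h1.flowRate_nonneg hα hx hv.1]

/-- The exponential is the integrating factor of the scalar equation for the total mass, so the
product has derivative zero almost everywhere. -/
theorem totalMass_mul_exp (hα : Measurable α) (hx : x.filt ∈ stdSimplex ℝ (Fin K)) {v : ℝ}
    (hv : 0 ≤ v) :
    h1.totalMass α x v * Real.exp (0 + ∫ r in (0 : ℝ)..v, -(h1.β - h1.flowRate α x r)) = 1 := by
  have h := (h1.totalMass_isPrim hα hx hv).mul hv ((h1.rateIntegral_isPrim hα hx hv).exp hv)
  have h2 := h.eq v ⟨hv, le_rfl⟩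
  have h3 : ∀ a b c : ℝ, a * b * c + b * (c * -a) = 0 := fun a b c => by ring
  simp only [h3, intervalIntegral.integral_zero, intervalIntegral.integral_same, add_zero,
    Real.exp_zero, h1.totalMass_zero hα hx, mul_one] at h2
  exact h2

/-- This links the linear system to the jump mechanism: the total mass without its weight is the
survival probability at the rate that the filter itself determines. Regularity of the survival
probability is thereby inherited from the linear system. -/
theorem surv_eq_exp (hα : Measurable α) (hx : x.filt ∈ stdSimplex ℝ (Fin K)) {v : ℝ}
    (hv : 0 ≤ v) : h1.surv α x v = Real.exp (-∫ r in (0 : ℝ)..v, h1.flowRate α x r) := by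
  have h := h1.totalMass_mul_exp hα hx hv
  have hi : IntervalIntegrable (h1.flowRate α x) volume 0 v :=
    intervalIntegrable_of_bounded (h1.measurable_flowRate hα) hv (C := h1.β) fun r hr => by
      rw [abs_of_nonneg (h1.flowRate_nonneg hα hx hr.1)]; exact h1.flowRate_le hα hx hr.1
  rw [intervalIntegral.integral_neg, intervalIntegral.integral_sub (by simp) hi] at h
  simp only [intervalIntegral.integral_const, sub_zero, smul_eq_mul, zero_add] at h
  have h3 : h1.totalMass α x v = Real.exp (v * h1.β - ∫ r in (0 : ℝ)..v, h1.flowRate α x r) := by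
    rw [Real.exp_neg] at h
    exact (eq_of_mul_inv_eq_one h)
  rw [surv, h3, ← Real.exp_add]
  congr 1; ring

theorem surv_le_one (hα : Measurable α) (hx : x.filt ∈ stdSimplex ℝ (Fin K)) {v : ℝ}
    (hv : 0 ≤ v) : h1.surv α x v ≤ 1 := by
  rw [h1.surv_eq_exp hα hx hv, Real.exp_le_one_iff, neg_nonpos]
  exact intervalIntegral.integral_nonneg hv fun r hr => h1.flowRate_nonneg hα hx hr.1

theorem surv_isPrim (hα : Measurable α) (hx : x.filt ∈ stdSimplex ℝ (Fin K)) {L : ℝ}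
    (hL : 0 ≤ L) : IsPrim (h1.surv α x) (fun v => -(h1.flowRate α x v * h1.surv α x v)) L := by
  have hl : IsPrim (fun v => -h1.β * v) (fun _ => -h1.β) L :=
    (IsPrim.of_measurable 0 measurable_const hL (C := |(-h1.β)|) fun _ _ => le_rfl).congr_left hL
      fun v _ => by simp [mul_comm]
  refine ((hl.exp hL).mul hL (h1.totalMass_isPrim hα hx hL)).congr hL fun v _ => ?_
  simp only [surv]; ring

/-- The quotient rule for `mass / totalMass`, with the reciprocal of the total mass written as an
exponential so that the product and exponential rules suffice. Normalizing a linear equation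
produces the quadratic term of the filter equation. -/
theorem filtFlow_isPrim (hα : Measurable α) (hx : x.filt ∈ stdSimplex ℝ (Fin K)) {L : ℝ}
    (hL : 0 ≤ L) (k : Fin K) : IsPrim (fun v => h1.filtFlow α x v k)
      (fun v => M.filterField (x.time + v) (α v) (h1.filtFlow α x v) k) L := by
  have hinv : ∀ v ∈ Icc 0 L, Real.exp (0 + ∫ r in (0 : ℝ)..v, -(h1.β - h1.flowRate α x r))
      = (h1.totalMass α x v)⁻¹ := fun v hv =>
    (eq_inv_of_mul_eq_one_right (h1.totalMass_mul_exp hα hx hv.1))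
  refine (((h1.mass_isPrim (x := x) hα hL k).mul hL
    ((h1.rateIntegral_isPrim hα hx hL).exp hL)).congr hL fun v hv => ?_).congr_left hL
    fun v hv => ?_
  · have hpos := h1.totalMass_pos hα hx hv.1
    rw [hinv v hv]
    simp only [filterField, flowRate, coef, add_mul, Finset.sum_add_distrib, ite_mul, zero_mul,
      Finset.sum_ite_eq, Finset.mem_univ, if_true]
    have e : ∑ j, M.q j k * h1.filtFlow α x v j
        = (∑ j, M.q j k * h1.mass α x v j) * (h1.totalMass α x v)⁻¹ := by
      rw [Finset.sum_mul]
      exact Finset.sum_congr rfl fun j _ => by rw [filtFlow, div_eq_mul_inv, mul_assoc]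
    rw [e]
    have e2 : h1.filtFlow α x v k = h1.mass α x v k * (h1.totalMass α x v)⁻¹ := div_eq_mul_inv _ _
    rw [e2]
    ring
  · rw [hinv v hv, filtFlow, div_eq_mul_inv]

end Flow

end Assumption1

/-! ### The coordinate maps of the state space -/

theorem measurable_time : Measurable (fun x : PState K => x.time) := measurable_fst

theorem measurable_inv : Measurable (fun x : PState K => x.inv) := measurable_fst.comp measurable_snd

theorem measurable_price : Measurable (fun x : PState K => x.price) :=
  measurable_fst.comp (measurable_snd.comp measurable_snd)

theorem measurable_filt : Measurable (fun x : PState K => x.filt) :=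
  measurable_snd.comp (measurable_snd.comp measurable_snd)

theorem continuous_time : Continuous (fun x : PState K => x.time) := continuous_fst

theorem continuous_inv : Continuous (fun x : PState K => x.inv) := continuous_fst.comp continuous_snd

theorem continuous_price : Continuous (fun x : PState K => x.price) :=
  continuous_fst.comp (continuous_snd.comp continuous_snd)

theorem continuous_filt : Continuous (fun x : PState K => x.filt) :=
  continuous_snd.comp (continuous_snd.comp continuous_snd)

/-! ### Existence and uniqueness of the flow -/

theorem IsFlow.apply_eq {α : ℝ → ℝ} {x : PState K} {y : ℝ → PState K} (hy : M.IsFlow α x y)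
    {v : ℝ} (hv : v ∈ Icc 0 (M.T - x.time)) :
    (y v).time = x.time + v ∧ (y v).inv = x.inv + ∫ r in (0 : ℝ)..v, -α r ∧
    (y v).price = x.price ∧ ∀ k, (y v).filt k = x.filt k
      + ∫ r in (0 : ℝ)..v, (M.g (y r) (α r)).filt k := by
  have hint : IntervalIntegrable (fun r => M.g (y r) (α r)) volume 0 v :=
    hy.integrable.mono_set (by
      rw [uIcc_of_le hv.1, uIcc_of_le (hv.1.trans hv.2)]; exact Icc_subset_Icc_right hv.2)
  have key : ∀ (l : PState K →L[ℝ] ℝ), l (y v) = l x + ∫ r in (0 : ℝ)..v, l (M.g (y r) (α r)) := by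
    intro l
    rw [hy.eq v hv, map_add, l.intervalIntegral_comp_comm hint]
  refine ⟨?_, ?_, ?_, fun k => ?_⟩
  · have := key (ContinuousLinearMap.fst ℝ _ _)
    simpa [g, PState.time] using this
  · exact key ((ContinuousLinearMap.fst ℝ _ _).comp (ContinuousLinearMap.snd ℝ _ _))
  · have := key ((ContinuousLinearMap.fst ℝ _ _).comp
      ((ContinuousLinearMap.snd ℝ _ _).comp (ContinuousLinearMap.snd ℝ _ _)))
    simpa [g, PState.price] using this
  · exact key ((ContinuousLinearMap.proj (R := ℝ) (φ := fun _ : Fin K => ℝ) k).comp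
      ((ContinuousLinearMap.snd ℝ _ _).comp
      ((ContinuousLinearMap.snd ℝ _ _).comp (ContinuousLinearMap.snd ℝ _ _))))

namespace Assumption1

variable (h1 : M.Assumption1)
include h1

/-- On the simplex the components are at most one and the averaged intensities at most `β`, so the
quadratic term is Lipschitz in the sum norm, uniformly in time and rate. -/
theorem filterField_lipschitz {p p' : Fin K → ℝ} (hp : p ∈ stdSimplex ℝ (Fin K))
    (hp' : p' ∈ stdSimplex ℝ (Fin K)) (t ν : ℝ) (k : Fin K) :
    |M.filterField t ν p k - M.filterField t ν p' k|
      ≤ (∑ i, ∑ j, |M.q i j| + 3 * h1.β) * ∑ j, |p j - p' j| := by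
  set S := ∑ j, |p j - p' j|
  set Q := ∑ i, ∑ j, |M.q i j|
  have hβ := h1.β_nonneg
  have hk : |p k - p' k| ≤ S :=
    Finset.single_le_sum (f := fun j => |p j - p' j|) (fun _ _ => abs_nonneg _) (Finset.mem_univ k)
  have hc0 := h1.stateRate_nonneg k t ν
  have hc := h1.stateRate_le_β k t ν
  set c := M.stateRate k t ν
  set l := ∑ j, p j * M.stateRate j t ν
  set l' := ∑ j, p' j * M.stateRate j t ν
  have hl : 0 ≤ l ∧ l ≤ h1.β := simplex_sum_bounds hp fun j =>
    ⟨h1.stateRate_nonneg j t ν, h1.stateRate_le_β j t ν⟩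
  have hll : |l - l'| ≤ h1.β * S := by
    rw [← Finset.sum_sub_distrib, Finset.mul_sum]
    refine (Finset.abs_sum_le_sum_abs _ _).trans (Finset.sum_le_sum fun j _ => ?_)
    rw [← sub_mul, abs_mul, abs_of_nonneg (h1.stateRate_nonneg j t ν), mul_comm]
    exact mul_le_mul_of_nonneg_right (h1.stateRate_le_β j t ν) (abs_nonneg _)
  have hq : |∑ j, M.q j k * p j - ∑ j, M.q j k * p' j| ≤ Q * S := by
    rw [← Finset.sum_sub_distrib, Finset.mul_sum]
    refine (Finset.abs_sum_le_sum_abs _ _).trans (Finset.sum_le_sum fun j _ => ?_)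
    rw [← mul_sub, abs_mul]
    exact mul_le_mul_of_nonneg_right (h1.abs_q_le j k) (abs_nonneg _)
  have hp'k : |p' k| ≤ 1 := by
    rw [abs_of_nonneg (hp'.1 k), ← hp'.2]
    exact Finset.single_le_sum (fun j _ => hp'.1 j) (Finset.mem_univ k)
  have e : M.filterField t ν p k - M.filterField t ν p' k
      = (∑ j, M.q j k * p j - ∑ j, M.q j k * p' j) - (p k - p' k) * (c - l)
        + p' k * (l - l') := by
    simp only [filterField]; ring
  have hS : 0 ≤ S := Finset.sum_nonneg fun _ _ => abs_nonneg _
  have hcl : |c - l| ≤ h1.β := abs_le.2 ⟨by linarith [hl.2], by linarith [hl.1]⟩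
  have a1 : |(p k - p' k) * (c - l)| ≤ S * h1.β := by
    rw [abs_mul]; exact mul_le_mul hk hcl (abs_nonneg _) hS
  have a2 : |p' k * (l - l')| ≤ 1 * (h1.β * S) := by
    rw [abs_mul]; exact mul_le_mul hp'k hll (abs_nonneg _) zero_le_one
  rw [e]
  calc _ ≤ |∑ j, M.q j k * p j - ∑ j, M.q j k * p' j| + |(p k - p' k) * (c - l)|
        + |p' k * (l - l')| := (abs_add_le _ _).trans (add_le_add_left (abs_sub _ _) _)
    _ ≤ Q * S + S * h1.β + 1 * (h1.β * S) := add_le_add (add_le_add hq a1) a2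
    -- The factor 3 is generous: the two terms from the intensities contribute only `2 * β`.
    _ ≤ _ := by nlinarith [mul_nonneg hβ hS]

theorem IsFlow.filt_eq {α : ℝ → ℝ} (hα : M.IsControl α) {x : PState K} (hx : x ∈ M.stateSpace)
    {y : ℝ → PState K} (hy : M.IsFlow α x y) {v : ℝ} (hv : v ∈ Icc 0 (M.T - x.time)) (k : Fin K) :
    (y v).filt k = x.filt k
      + ∫ r in (0 : ℝ)..v, M.filterField (x.time + r) (α r) (y r).filt k := by
  rw [(hy.apply_eq hv).2.2.2 k]
  congr 1
  refine intervalIntegral.integral_congr fun r hr => ?_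
  rw [uIcc_of_le hv.1] at hr
  have hr' : r ∈ Icc 0 (M.T - x.time) := ⟨hr.1, hr.2.trans hv.2⟩
  have ht := (hy.apply_eq hr').1
  have := h1.g_eq (x := y r) (ν := α r) (by rw [ht]; exact time_add_mem hx hr') (hα.2 r)
    (hy.filt_mem r hr')
  simp only [this, ht]
  rfl

theorem IsFlow.integrable_filterField {α : ℝ → ℝ} (hα : M.IsControl α) {x : PState K}
    (hx : x ∈ M.stateSpace) {y : ℝ → PState K} (hy : M.IsFlow α x y) (k : Fin K) :
    IntervalIntegrable (fun r => M.filterField (x.time + r) (α r) (y r).filt k) volume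
      0 (M.T - x.time) := by
  have h := hy.integrable
  have hL := horizon_nonneg hx
  have : IntervalIntegrable (fun r => (M.g (y r) (α r)).filt k) volume 0 (M.T - x.time) :=
    ⟨(Integrable.snd (Integrable.snd (Integrable.snd h.1))).eval k,
     (Integrable.snd (Integrable.snd (Integrable.snd h.2))).eval k⟩
  refine this.congr fun r hr => ?_
  rw [uIoc_of_le hL] at hr
  have hr' : r ∈ Icc 0 (M.T - x.time) := Ioc_subset_Icc_self hr
  have ht := (hy.apply_eq hr').1
  have := h1.g_eq (x := y r) (ν := α r) (by rw [ht]; exact time_add_mem hx hr') (hα.2 r)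
    (hy.filt_mem r hr')
  simp only [this, ht]
  rfl

/-- Time, inventory and price are dictated by the control alone. For the filter, the sum-norm
distance of two solutions satisfies Gronwall's inequality with `ε = 0`. -/
theorem isFlow_unique {α : ℝ → ℝ} (hα : M.IsControl α) {x : PState K} (hx : x ∈ M.stateSpace)
    {y y' : ℝ → PState K} (hy : M.IsFlow α x y) (hy' : M.IsFlow α x y') :
    EqOn y y' (Icc 0 (M.T - x.time)) := by
  set L := M.T - x.time with hLdef
  have hL : 0 ≤ L := horizon_nonneg hx
  set Λ := ∑ i, ∑ j, |M.q i j| + 3 * h1.β with hΛ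
  have hΛ0 : 0 ≤ Λ := add_nonneg h1.sum_abs_q_nonneg (by have := h1.β_nonneg; positivity)
  set φ : ℝ → ℝ := fun v => ∑ k, |(y v).filt k - (y' v).filt k| with hφ
  have hcont : ContinuousOn φ (Icc 0 L) := by
    refine continuousOn_finsetSum _ fun k _ => ContinuousOn.abs (ContinuousOn.sub ?_ ?_)
    · exact ((continuous_apply k).comp continuous_filt).comp_continuousOn hy.cont
    · exact ((continuous_apply k).comp continuous_filt).comp_continuousOn hy'.cont
  have hint : IntervalIntegrable φ volume 0 L := by
    refine ContinuousOn.intervalIntegrable ?_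
    rwa [uIcc_of_le hL]
  obtain ⟨A, hA⟩ := isCompact_Icc.exists_bound_of_continuousOn hcont
  have hbound : ∀ v ∈ Icc 0 L, φ v ≤ 0 + (K * Λ) * ∫ r in (0 : ℝ)..v, φ r := by
    intro v hv
    have hsub : Icc 0 v ⊆ Icc 0 L := Icc_subset_Icc_right hv.2
    have hms : ∀ {F : ℝ → ℝ}, IntervalIntegrable F volume 0 L → IntervalIntegrable F volume 0 v :=
      fun hF => hF.mono_set (by rw [uIcc_of_le hv.1, uIcc_of_le hL]; exact hsub)
    have hk : ∀ k, |(y v).filt k - (y' v).filt k| ≤ Λ * ∫ r in (0 : ℝ)..v, φ r := by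
      intro k
      have i1 := hms (IsFlow.integrable_filterField h1 hα hx hy k)
      have i2 := hms (IsFlow.integrable_filterField h1 hα hx hy' k)
      rw [IsFlow.filt_eq h1 hα hx hy hv k, IsFlow.filt_eq h1 hα hx hy' hv k, add_sub_add_left_eq_sub,
        ← intervalIntegral.integral_sub i1 i2, ← intervalIntegral.integral_const_mul]
      refine (intervalIntegral.abs_integral_le_integral_abs hv.1).trans
        (intervalIntegral.integral_mono_on hv.1 (i1.sub i2).abs ((hms hint).const_mul _) ?_)
      intro r hr
      exact h1.filterField_lipschitz (hy.filt_mem r (hsub hr)) (hy'.filt_mem r (hsub hr)) _ _ k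
    calc φ v ≤ ∑ _k : Fin K, Λ * ∫ r in (0 : ℝ)..v, φ r := Finset.sum_le_sum fun k _ => hk k
      _ = _ := by simp [mul_assoc]
  have hg := gronwall_integral (φ := φ) (L := L) (by positivity) le_rfl hint
    (fun v hv => (le_abs_self _).trans (hA v hv)) hbound
  intro v hv
  have hv0 : φ v ≤ 0 := by simpa using hg v hv
  have hfilt : (y v).filt = (y' v).filt := by
    ext k
    have : |(y v).filt k - (y' v).filt k| ≤ 0 :=
      (Finset.single_le_sum (f := fun k => |(y v).filt k - (y' v).filt k|)
        (fun _ _ => abs_nonneg _) (Finset.mem_univ k)).trans hv0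
    exact sub_eq_zero.1 (abs_nonpos_iff.1 this)
  obtain ⟨a1, a2, a3, -⟩ := hy.apply_eq hv
  obtain ⟨b1, b2, b3, -⟩ := hy'.apply_eq hv
  exact Prod.ext (a1.trans b1.symm) (Prod.ext (a2.trans b2.symm) (Prod.ext (a3.trans b3.symm) hfilt))

theorem intervalIntegrable_control {α : ℝ → ℝ} (hα : M.IsControl α) (a b : ℝ) :
    IntervalIntegrable α volume a b := by
  rw [intervalIntegrable_iff]
  exact Measure.integrableOn_of_bounded (M := M.νmax) (by simp) hα.1.aestronglyMeasurable
    (Eventually.of_forall fun v => by rw [Real.norm_eq_abs, abs_of_nonneg (hα.2 v).1]; exact (hα.2 v).2)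

theorem isFlow_expFlow {α : ℝ → ℝ} (hα : M.IsControl α) {x : PState K} (hx : x ∈ M.stateSpace) :
    M.IsFlow α x (h1.expFlow α x) := by
  have hL := horizon_nonneg hx
  have hp := filt_mem hx
  have hF := fun k => h1.filtFlow_isPrim hα.1 hp hL k
  have hg : ∀ r ∈ Icc 0 (M.T - x.time), (1, -α r, 0,
      M.filterField (x.time + r) (α r) (h1.filtFlow α x r)) = M.g (h1.expFlow α x r) (α r) :=
    fun r hr => (h1.g_eq (x := h1.expFlow α x r) (time_add_mem hx hr) (hα.2 r)
      (h1.filtFlow_mem hα.1 hp hr.1)).symm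
  have hint : IntervalIntegrable (fun r => ((1, -α r, 0,
      M.filterField (x.time + r) (α r) (h1.filtFlow α x r)) : PState K)) volume
      0 (M.T - x.time) := by
    have i1 := intervalIntegrable_control h1 hα 0 (M.T - x.time)
    refine ⟨?_, ?_⟩
    · exact Integrable.prodMk (by simp) (Integrable.prodMk i1.1.neg (Integrable.prodMk (by simp)
        (Integrable.of_eval fun k => (hF k).integrable.1)))
    · exact Integrable.prodMk (by simp) (Integrable.prodMk i1.2.neg (Integrable.prodMk (by simp)
        (Integrable.of_eval fun k => (hF k).integrable.2)))
  refine ⟨?_, fun v hv => h1.filtFlow_mem hα.1 hp hv.1, ?_, fun v hv => ?_⟩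
  · refine ContinuousOn.prodMk (by fun_prop) (ContinuousOn.prodMk ?_ (ContinuousOn.prodMk
      continuousOn_const (continuousOn_pi.2 fun k => (hF k).continuousOn)))
    exact continuousOn_const.sub (intervalIntegral.continuous_primitive
      (fun a b => intervalIntegrable_control h1 hα a b) 0).continuousOn
  · refine hint.congr fun r hr => ?_
    rw [uIoc_of_le hL] at hr
    exact hg r (Ioc_subset_Icc_self hr)
  · have hint' := hint.mono_set (c := 0) (d := v) (by
      rw [uIcc_of_le hv.1, uIcc_of_le hL]; exact Icc_subset_Icc_right hv.2)
    rw [← intervalIntegral.integral_congr (f := fun r => ((1, -α r, 0,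
      M.filterField (x.time + r) (α r) (h1.filtFlow α x r)) : PState K)) (fun r hr => by
        rw [uIcc_of_le hv.1] at hr
        exact hg r ⟨hr.1, hr.2.trans hv.2⟩)]
    have key : ∀ (l : PState K →L[ℝ] ℝ), l (∫ r in (0 : ℝ)..v, ((1, -α r, 0,
        M.filterField (x.time + r) (α r) (h1.filtFlow α x r)) : PState K))
        = ∫ r in (0 : ℝ)..v, l (1, -α r, 0,
        M.filterField (x.time + r) (α r) (h1.filtFlow α x r)) := fun l =>
      (l.intervalIntegral_comp_comm hint').symm
    refine Prod.ext ?_ (Prod.ext ?_ (Prod.ext ?_ (funext fun k => ?_)))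
    · have := key (ContinuousLinearMap.fst ℝ _ _)
      simp only [ContinuousLinearMap.coe_fst', intervalIntegral.integral_const, smul_eq_mul,
        mul_one, sub_zero] at this
      rw [Prod.fst_add, this]; rfl
    · have := key ((ContinuousLinearMap.fst ℝ _ _).comp (ContinuousLinearMap.snd ℝ _ _))
      simp only [ContinuousLinearMap.coe_comp, Function.comp_apply, ContinuousLinearMap.coe_fst',
        ContinuousLinearMap.coe_snd', intervalIntegral.integral_neg] at this
      rw [Prod.snd_add, Prod.fst_add, this, ← sub_eq_add_neg]; rfl
    · have := key ((ContinuousLinearMap.fst ℝ _ _).comp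
        ((ContinuousLinearMap.snd ℝ _ _).comp (ContinuousLinearMap.snd ℝ _ _)))
      simp only [ContinuousLinearMap.coe_comp, Function.comp_apply, ContinuousLinearMap.coe_fst',
        ContinuousLinearMap.coe_snd', intervalIntegral.integral_zero] at this
      rw [Prod.snd_add, Prod.snd_add, Prod.fst_add, this, add_zero]; rfl
    · have := key ((ContinuousLinearMap.proj (R := ℝ) (φ := fun _ : Fin K => ℝ) k).comp
        ((ContinuousLinearMap.snd ℝ _ _).comp
        ((ContinuousLinearMap.snd ℝ _ _).comp (ContinuousLinearMap.snd ℝ _ _))))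
      simp only [ContinuousLinearMap.coe_comp, Function.comp_apply, ContinuousLinearMap.proj_apply,
        ContinuousLinearMap.coe_snd'] at this
      rw [Prod.snd_add, Prod.snd_add, Prod.snd_add, Pi.add_apply, this]
      have h := (hF k).eq v hv
      rw [h1.filtFlow_zero hα.1 hp] at h
      exact h

/-- The flow is obtained by choice and is controlled only up to the horizon; there uniqueness
identifies it with the explicit version, which is used in all further computations. -/
theorem flow_eq {α : ℝ → ℝ} (hα : M.IsControl α) {x : PState K} (hx : x ∈ M.stateSpace) {v : ℝ}
    (hv : v ∈ Icc 0 (M.T - x.time)) : M.flow α x v = h1.expFlow α x v := by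
  have hex : ∃ y, M.IsFlow α x y := ⟨_, h1.isFlow_expFlow hα hx⟩
  rw [flow, dif_pos hex]
  exact h1.isFlow_unique hα hx hex.choose_spec (h1.isFlow_expFlow hα hx) hv

theorem exp_cumRate {α : ℝ → ℝ} (hα : M.IsControl α) {x : PState K} (hx : x ∈ M.stateSpace) {v : ℝ}
    (hv : v ∈ Icc 0 (M.T - x.time)) : Real.exp (-M.cumRate α x v) = h1.surv α x v := by
  rw [h1.surv_eq_exp hα.1 (filt_mem hx) hv.1, cumRate]
  congr 2
  refine intervalIntegral.integral_congr fun r hr => ?_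
  rw [uIcc_of_le hv.1] at hr
  have hr' : r ∈ Icc 0 (M.T - x.time) := ⟨hr.1, hr.2.trans hv.2⟩
  simp only [h1.flow_eq hα hx hr']
  exact h1.jumpRate_eq (x := h1.expFlow α x r) (time_add_mem hx hr') (hα.2 r)

end Assumption1

/-! ### Exit times -/

/-- An explicit version of the exit time. -/
noncomputable def exitVersion (M : LiquidationModel K) (α : ℝ → ℝ) (x : PState K) : ℝ :=
  sInf {v | 0 ≤ v ∧ (x.inv ≤ ∫ r in (0 : ℝ)..v, α r ∨ M.T - x.time ≤ v)}

/-- The rate `α`, set to zero after the exit time. -/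
noncomputable def cut (M : LiquidationModel K) (α : ℝ → ℝ) (x : PState K) (v : ℝ) : ℝ :=
  if v ≤ M.exitVersion α x then α v else 0

section Exit

variable {α : ℝ → ℝ} {x : PState K}

theorem IsControl.intervalIntegrable (hα : M.IsControl α) (a b : ℝ) :
    IntervalIntegrable α volume a b := by
  rw [intervalIntegrable_iff]
  exact Measure.integrableOn_of_bounded (M := M.νmax) (by simp) hα.1.aestronglyMeasurable
    (Eventually.of_forall fun v => by rw [Real.norm_eq_abs, abs_of_nonneg (hα.2 v).1]; exact (hα.2 v).2)

theorem IsControl.continuous_integral (hα : M.IsControl α) :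
    Continuous (fun v => ∫ r in (0 : ℝ)..v, α r) :=
  intervalIntegral.continuous_primitive hα.intervalIntegrable 0

theorem IsControl.integral_mono (hα : M.IsControl α) {a b : ℝ} (hab : a ≤ b) :
    ∫ r in (0 : ℝ)..a, α r ≤ ∫ r in (0 : ℝ)..b, α r := by
  rw [← sub_nonneg, intervalIntegral.integral_interval_sub_left (hα.intervalIntegrable _ _)
    (hα.intervalIntegrable _ _)]
  exact intervalIntegral.integral_nonneg hab fun r _ => (hα.2 r).1

theorem IsControl.integral_nonneg (hα : M.IsControl α) {a : ℝ} (ha : 0 ≤ a) :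
    0 ≤ ∫ r in (0 : ℝ)..a, α r :=
  intervalIntegral.integral_nonneg ha fun r _ => (hα.2 r).1

theorem exitVersion_mem (hα : M.IsControl α) (x : PState K) : 0 ≤ M.exitVersion α x ∧
    (x.inv ≤ ∫ r in (0 : ℝ)..M.exitVersion α x, α r ∨ M.T - x.time ≤ M.exitVersion α x) := by
  have hcl : IsClosed {v | 0 ≤ v ∧ (x.inv ≤ ∫ r in (0 : ℝ)..v, α r ∨ M.T - x.time ≤ v)} :=
    (isClosed_le continuous_const continuous_id).inter
      ((isClosed_le continuous_const hα.continuous_integral).union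
        (isClosed_le continuous_const continuous_id))
  exact hcl.csInf_mem ⟨max 0 (M.T - x.time), le_max_left _ _, Or.inr (le_max_right _ _)⟩
    ⟨0, fun v hv => hv.1⟩

/-- Cumulated sales are continuous and nondecreasing, so the defining set is closed and upward
closed. This description of the sublevel sets makes the exit time measurable in the state. -/
theorem exitVersion_le_iff (hα : M.IsControl α) (x : PState K) (c : ℝ) : M.exitVersion α x ≤ c ↔
    0 ≤ c ∧ (x.inv ≤ ∫ r in (0 : ℝ)..c, α r ∨ M.T - x.time ≤ c) := by
  refine ⟨fun h => ?_, fun h => csInf_le ⟨0, fun v hv => hv.1⟩ h⟩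
  obtain ⟨h0, h2⟩ := exitVersion_mem hα x
  exact ⟨h0.trans h, h2.imp (fun h3 => h3.trans (hα.integral_mono h)) (fun h3 => h3.trans h)⟩

theorem lt_exitVersion (hα : M.IsControl α) {v : ℝ} (hv0 : 0 ≤ v) (hv : v < M.exitVersion α x) :
    ∫ r in (0 : ℝ)..v, α r < x.inv ∧ v < M.T - x.time := by
  have := (exitVersion_le_iff hα x v).not.1 (not_le.2 hv)
  push Not at this
  exact this hv0

theorem exitVersion_mem_Icc (hα : M.IsControl α) (hx : x ∈ M.stateSpace) :
    M.exitVersion α x ∈ Icc 0 (M.T - x.time) :=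
  ⟨(exitVersion_mem hα x).1, (exitVersion_le_iff hα x _).2 ⟨horizon_nonneg hx, Or.inr le_rfl⟩⟩

theorem integral_le_inv (hα : M.IsControl α) (hx : x ∈ M.stateSpace) {v : ℝ}
    (hv : v ≤ M.exitVersion α x) : ∫ r in (0 : ℝ)..v, α r ≤ x.inv := by
  refine (hα.integral_mono hv).trans ?_
  rcases eq_or_lt_of_le (exitVersion_mem hα x).1 with h0 | h0
  · rw [← h0, intervalIntegral.integral_same]; exact (inv_mem hx).1
  · refine le_of_tendsto (hα.continuous_integral.continuousWithinAt
      (s := Iio (M.exitVersion α x)) (x := M.exitVersion α x)).tendsto ?_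
    filter_upwards [Ioo_mem_nhdsLT h0] with r hr
    exact (lt_exitVersion hα hr.1.le hr.2).1.le

/-- If the horizon has not been reached, the inventory constraint is what ended the period, and by
continuity it is met with equality. -/
theorem integral_exitVersion (hα : M.IsControl α) (hx : x ∈ M.stateSpace)
    (h : M.exitVersion α x < M.T - x.time) :
    ∫ r in (0 : ℝ)..M.exitVersion α x, α r = x.inv :=
  le_antisymm (integral_le_inv hα hx le_rfl)
    ((exitVersion_mem hα x).2.resolve_right (not_le.2 h))

/-- Before `exitVersion` neither the inventory nor the remaining time is exhausted; at `exitVersion`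
the flow is still in the state space and one of them is. The infimum is attained there, so values of
`flow` beyond the horizon play no role. -/
theorem Assumption1.exitTime_eq (h1 : M.Assumption1) (hα : M.IsControl α) (hx : x ∈ M.stateSpace) :
    M.exitTime α x = M.exitVersion α x := by
  have hτ := exitVersion_mem_Icc hα hx
  set τ := M.exitVersion α x with hτdef
  have hmem : ∀ v ∈ Icc 0 τ, M.flow α x v = h1.expFlow α x v := fun v hv =>
    h1.flow_eq hα hx ⟨hv.1, hv.2.trans hτ.2⟩
  have hss : h1.expFlow α x τ ∈ M.stateSpace := by
    refine ⟨time_add_mem hx hτ, ⟨sub_nonneg.2 (integral_le_inv hα hx le_rfl), ?_⟩,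
      hx.2.2.1, h1.filtFlow_mem hα.1 (filt_mem hx) hτ.1⟩
    exact (sub_le_self _ (hα.integral_nonneg hτ.1)).trans (inv_mem hx).2
  refine IsLeast.csInf_eq ⟨⟨hτ.1, ?_⟩, fun v hv => ?_⟩
  · rw [hmem τ ⟨hτ.1, le_rfl⟩]
    rcases (exitVersion_mem hα x).2 with h | h
    · refine Or.inl ⟨hss, ?_⟩
      exact sub_eq_zero.2 (le_antisymm h (integral_le_inv hα hx le_rfl))
    · refine Or.inr ⟨hss, ?_⟩
      have : τ = M.T - x.time := le_antisymm hτ.2 h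
      change x.time + τ = M.T
      rw [this]; ring
  · by_contra hlt
    push Not at hlt
    obtain ⟨a1, a2⟩ := lt_exitVersion hα hv.1 hlt
    have h2 := hv.2
    rw [hmem v ⟨hv.1, hlt.le⟩] at h2
    rcases h2 with h2 | h2
    · have : x.inv - ∫ r in (0 : ℝ)..v, α r = 0 := h2.2
      linarith
    · have : x.time + v = M.T := h2.2
      linarith

theorem Assumption1.stopped_eq (h1 : M.Assumption1) (hα : M.IsControl α) (hx : x ∈ M.stateSpace) :
    M.stopped α x = M.cut α x := by
  ext v
  simp only [stopped, cut, h1.exitTime_eq hα hx]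

theorem IsControl.cut (hα : M.IsControl α) (x : PState K) : M.IsControl (M.cut α x) := by
  refine ⟨Measurable.ite measurableSet_Iic hα.1 measurable_const, fun v => ?_⟩
  unfold LiquidationModel.cut
  split_ifs
  · exact hα.2 v
  · exact ⟨le_rfl, M.νmax_pos.le⟩

theorem cut_of_le {v : ℝ} (hv : v ≤ M.exitVersion α x) : M.cut α x v = α v := if_pos hv

theorem cut_of_lt {v : ℝ} (hv : M.exitVersion α x < v) : M.cut α x v = 0 := if_neg (not_le.2 hv)

theorem integral_cut_of_le {v : ℝ} (hv0 : 0 ≤ v) (hv : v ≤ M.exitVersion α x) :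
    ∫ r in (0 : ℝ)..v, M.cut α x r = ∫ r in (0 : ℝ)..v, α r := by
  refine intervalIntegral.integral_congr fun r hr => ?_
  rw [uIcc_of_le hv0] at hr
  exact cut_of_le (hr.2.trans hv)

theorem integral_cut_of_ge (hα : M.IsControl α) {v : ℝ} (hv : M.exitVersion α x ≤ v) :
    ∫ r in (0 : ℝ)..v, M.cut α x r = ∫ r in (0 : ℝ)..M.exitVersion α x, α r := by
  have hc := hα.cut x
  rw [← intervalIntegral.integral_add_adjacent_intervals (hc.intervalIntegrable 0 (M.exitVersion α x))
    (hc.intervalIntegrable _ v), integral_cut_of_le (exitVersion_mem hα x).1 le_rfl]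
  have h0 : ∫ r in M.exitVersion α x..v, M.cut α x r = ∫ _r in M.exitVersion α x..v, (0 : ℝ) := by
    refine intervalIntegral.integral_congr_ae (Eventually.of_forall fun r hr => ?_)
    rw [uIoc_of_le hv] at hr
    exact cut_of_lt hr.1
  rw [h0, intervalIntegral.integral_zero, add_zero]

theorem integral_cut_le (hα : M.IsControl α) (hx : x ∈ M.stateSpace) {v : ℝ} (hv0 : 0 ≤ v) :
    ∫ r in (0 : ℝ)..v, M.cut α x r ≤ x.inv := by
  rcases le_total v (M.exitVersion α x) with hv | hv
  · rw [integral_cut_of_le hv0 hv]; exact integral_le_inv hα hx hv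
  · rw [integral_cut_of_ge hα hv]; exact integral_le_inv hα hx le_rfl

/-- Rates that never sell more than the inventory before the horizon. -/
def IsAdmissible (M : LiquidationModel K) (α : ℝ → ℝ) (x : PState K) : Prop :=
  M.IsControl α ∧ ∀ r ∈ Icc 0 (M.T - x.time), ∫ v in (0 : ℝ)..r, α v ≤ x.inv

theorem IsControl.isAdmissible_cut (hα : M.IsControl α) (hx : x ∈ M.stateSpace) :
    M.IsAdmissible (M.cut α x) x :=
  ⟨hα.cut x, fun _ hr => integral_cut_le hα hx hr.1⟩

end Exit

theorem measurable_exitVersion {a : PState K → ℝ → ℝ}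
    (ha : Measurable (fun y : PState K × ℝ => a y.1 y.2)) (hc : ∀ x, M.IsControl (a x)) :
    Measurable (fun x => M.exitVersion (a x) x) := by
  refine measurable_of_Iic fun c => ?_
  have : (fun x => M.exitVersion (a x) x) ⁻¹' Iic c
      = {x | 0 ≤ c ∧ (x.inv ≤ ∫ r in (0 : ℝ)..c, a x r ∨ M.T - x.time ≤ c)} := by
    ext x; exact exitVersion_le_iff (hc x) x c
  rw [this]
  refine (MeasurableSet.const _).inter (MeasurableSet.union ?_ ?_)
  · exact measurableSet_le measurable_inv
      (measurable_intervalIntegral_param ha measurable_const measurable_const)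
  · exact measurableSet_le (measurable_const.sub measurable_time) measurable_const

theorem measurable_cut {a : PState K → ℝ → ℝ}
    (ha : Measurable (fun y : PState K × ℝ => a y.1 y.2)) (hc : ∀ x, M.IsControl (a x)) :
    Measurable (fun y : PState K × ℝ => M.cut (a y.1) y.1 y.2) :=
  Measurable.ite (measurableSet_le measurable_snd
    ((measurable_exitVersion ha hc).comp measurable_fst)) ha measurable_const

/-! ### Dependence of the flow on the past of the control -/

/-- Causality: the solution up to time `L` depends only on the coefficients up to `L`. Hence a rate
and its cut version generate the same flow and survival probability until the exit time. -/
theorem picardIter_congr {ι : Type*} [Fintype ι] {B B' : ℝ → ι → ι → ℝ} {p : ι → ℝ} {L : ℝ}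
    (h : ∀ r ∈ Icc 0 L, B r = B' r) (n : ℕ) {v : ℝ} (hv : v ∈ Icc 0 L) (k : ι) :
    picardIter B p n v k = picardIter B' p n v k := by
  induction n generalizing v k with
  | zero => rfl
  | succ n ih =>
    simp only [picardIter]
    congr 1
    refine intervalIntegral.integral_congr fun r hr => ?_
    rw [uIcc_of_le hv.1] at hr
    have hr' : r ∈ Icc 0 L := ⟨hr.1, hr.2.trans hv.2⟩
    simp only [h r hr']
    exact Finset.sum_congr rfl fun j _ => by rw [ih hr' j]

namespace Assumption1

variable (h1 : M.Assumption1)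
include h1

theorem mass_congr {α α' : ℝ → ℝ} {x : PState K} {L : ℝ} (h : ∀ r ∈ Icc 0 L, α r = α' r) {v : ℝ}
    (hv : v ∈ Icc 0 L) (k : Fin K) : h1.mass α x v k = h1.mass α' x v k := by
  unfold mass linearFlow
  congr 1
  ext n
  refine picardIter_congr (fun r hr => ?_) n hv k
  ext k j
  simp only [coef, h r hr]

theorem surv_congr {α α' : ℝ → ℝ} {x : PState K} {L : ℝ} (h : ∀ r ∈ Icc 0 L, α r = α' r) {v : ℝ}
    (hv : v ∈ Icc 0 L) : h1.surv α x v = h1.surv α' x v := by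
  simp only [surv, totalMass, h1.mass_congr h hv]

theorem expFlow_congr {α α' : ℝ → ℝ} {x : PState K} {L : ℝ} (h : ∀ r ∈ Icc 0 L, α r = α' r) {v : ℝ}
    (hv : v ∈ Icc 0 L) : h1.expFlow α x v = h1.expFlow α' x v := by
  have e : ∫ r in (0 : ℝ)..v, α r = ∫ r in (0 : ℝ)..v, α' r :=
    intervalIntegral.integral_congr fun r hr => by
      rw [uIcc_of_le hv.1] at hr
      exact h r ⟨hr.1, hr.2.trans hv.2⟩
  have e2 : h1.filtFlow α x v = h1.filtFlow α' x v := by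
    ext k
    simp only [filtFlow, totalMass, h1.mass_congr h hv]
  simp only [expFlow, e, e2]

theorem expFlow_mem {α : ℝ → ℝ} {x : PState K} (hα : M.IsAdmissible α x) (hx : x ∈ M.stateSpace)
    {v : ℝ} (hv : v ∈ Icc 0 (M.T - x.time)) : h1.expFlow α x v ∈ M.stateSpace := by
  refine ⟨time_add_mem hx hv, ⟨sub_nonneg.2 (hα.2 v hv), ?_⟩,
      hx.2.2.1, h1.filtFlow_mem hα.1.1 (filt_mem hx) hv.1⟩
  exact (sub_le_self _ (hα.1.integral_nonneg hv.1)).trans (inv_mem hx).2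

theorem expFlow_cut_mem {α : ℝ → ℝ} (hα : M.IsControl α) {x : PState K} (hx : x ∈ M.stateSpace)
    {v : ℝ} (hv : v ∈ Icc 0 (M.T - x.time)) : h1.expFlow (M.cut α x) x v ∈ M.stateSpace :=
  h1.expFlow_mem (hα.isAdmissible_cut hx) hx hv

/-- Selling stops exactly when nothing is left. This permits integrals up to the random-looking exit
time to be replaced by integrals up to the fixed horizon. -/
theorem expFlow_cut_inv_of_ge {α : ℝ → ℝ} (hα : M.IsControl α) {x : PState K}
    (hx : x ∈ M.stateSpace) (hlt : M.exitVersion α x < M.T - x.time) {v : ℝ}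
    (hv : M.exitVersion α x ≤ v) : (h1.expFlow (M.cut α x) x v).inv = 0 := by
  change x.inv - ∫ r in (0 : ℝ)..v, M.cut α x r = 0
  rw [integral_cut_of_ge hα hv, integral_exitVersion hα hx hlt, sub_self]

end Assumption1

/-! ### The jump kernel -/

/-- The state after a jump, at the clamped time and rate. -/
noncomputable def jumpTo (M : LiquidationModel K) (x : PState K) (ν z : ℝ) : PState K :=
  (x.time, x.inv, x.price * (1 + z),
    fun i => x.filt i * (M.cdens x.time i ν z / M.mixDens x.time ν x.filt z))

/-- The unnormalized jump kernel, at the clamped time and rate. -/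
noncomputable def jumpKer (M : LiquidationModel K) (x : PState K) (ν : ℝ) : Measure (PState K) :=
  (M.etaQ.withDensity fun z => ENNReal.ofReal (M.mixDens x.time ν x.filt z)).map (M.jumpTo x ν)

theorem measurableSet_stateSpace : MeasurableSet M.stateSpace :=
  measurableSet_Icc.prod (measurableSet_Icc.prod (measurableSet_Ici.prod
    (isClosed_stdSimplex ℝ (Fin K)).measurableSet))

theorem postJump_eq {x : PState K} {ν : ℝ} (ht : x.time ∈ Icc 0 M.T) (hν : ν ∈ Icc 0 M.νmax) (z : ℝ) :
    M.postJump x ν z = M.jumpTo x ν z := by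
  unfold postJump jumpTo u mixDens cdens
  rw [clampT_of_mem ht, clampN_of_mem hν]
  congr 3
  ext i
  ring

namespace Assumption1

variable (h1 : M.Assumption1)
include h1

theorem measurable_jumpTo :
    Measurable (fun y : PState K × ℝ × ℝ => M.jumpTo y.1 y.2.1 y.2.2) := by
  have ht : Measurable (fun y : PState K × ℝ × ℝ => y.1.time) := measurable_time.comp measurable_fst
  have hp : Measurable (fun y : PState K × ℝ × ℝ => y.1.filt) := measurable_filt.comp measurable_fst
  refine ht.prodMk ((measurable_inv.comp measurable_fst).prodMk
    (((measurable_price.comp measurable_fst).mul (by fun_prop)).prodMk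
      (measurable_pi_lambda _ fun i => ?_)))
  refine ((measurable_pi_apply i).comp hp).mul (Measurable.div ?_ ?_)
  · exact (h1.measurable_cdens i).comp (ht.prodMk measurable_snd)
  · exact h1.measurable_mixDens.comp (ht.prodMk ((measurable_fst.comp measurable_snd).prodMk
      (hp.prodMk (measurable_snd.comp measurable_snd))))

theorem measurable_jumpTo_right (x : PState K) (ν : ℝ) : Measurable (M.jumpTo x ν) :=
  h1.measurable_jumpTo.comp (measurable_const.prodMk (measurable_const.prodMk measurable_id))

theorem lintegral_jumpKer (x : PState K) (ν : ℝ) {F : PState K → ENNReal} (hF : Measurable F) :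
    ∫⁻ y, F y ∂(M.jumpKer x ν)
      = ∫⁻ z, ENNReal.ofReal (M.mixDens x.time ν x.filt z) * F (M.jumpTo x ν z) ∂M.etaQ := by
  rw [jumpKer, lintegral_map hF (h1.measurable_jumpTo_right x ν)]
  exact lintegral_withDensity_eq_lintegral_mul _
    (h1.measurable_mixDens_right _ _ _).ennreal_ofReal (hF.comp (h1.measurable_jumpTo_right x ν))

theorem measurable_lintegral_jumpKer {F : PState K → ENNReal} (hF : Measurable F) :
    Measurable (fun y : PState K × ℝ => ∫⁻ y', F y' ∂(M.jumpKer y.1 y.2)) := by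
  have := h1.finite
  simp only [h1.lintegral_jumpKer _ _ hF]
  have hm : Measurable (fun q : (PState K × ℝ) × ℝ =>
      ENNReal.ofReal (M.mixDens q.1.1.time q.1.2 q.1.1.filt q.2) * F (M.jumpTo q.1.1 q.1.2 q.2)) := by
    refine Measurable.mul (Measurable.ennreal_ofReal ?_) (hF.comp ?_)
    · exact h1.measurable_mixDens.comp ((measurable_time.comp (by fun_prop)).prodMk
        (Measurable.prodMk (by fun_prop) ((measurable_filt.comp (by fun_prop)).prodMk
          measurable_snd)))
    · exact h1.measurable_jumpTo.comp (by fun_prop :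
        Measurable fun q : (PState K × ℝ) × ℝ => (q.1.1, q.1.2, q.2))
  exact hm.lintegral_prod_right'

/-- The jump map does not depend on the hidden state, so a mixture of image measures is the image of
one measure, whose density is the mixture of the densities. -/
theorem jumpMeasure_eq {x : PState K} {ν : ℝ} (ht : x.time ∈ Icc 0 M.T) (hν : ν ∈ Icc 0 M.νmax)
    (hp : x.filt ∈ stdSimplex ℝ (Fin K)) : M.jumpMeasure x ν = M.jumpKer x ν := by
  have hpost : M.postJump x ν = M.jumpTo x ν := funext fun z => postJump_eq ht hν z
  ext A hA
  have hA' := h1.measurable_jumpTo_right x ν hA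
  simp only [jumpMeasure, hpost, h1.etaP_eq_cdens ht hν, Measure.coe_finsetSum,
    Finset.sum_apply, Measure.smul_apply, smul_eq_mul]
  rw [jumpKer, Measure.map_apply (h1.measurable_jumpTo_right x ν) hA, withDensity_apply _ hA']
  simp only [Measure.map_apply (h1.measurable_jumpTo_right x ν) hA, withDensity_apply _ hA']
  have : ∀ j, ENNReal.ofReal (x.filt j) *
      ∫⁻ z in M.jumpTo x ν ⁻¹' A, ENNReal.ofReal (M.cdens x.time j ν z) ∂M.etaQ
      = ∫⁻ z in M.jumpTo x ν ⁻¹' A,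
        ENNReal.ofReal (x.filt j) * ENNReal.ofReal (M.cdens x.time j ν z) ∂M.etaQ := fun j =>
    (lintegral_const_mul _ (h1.measurable_cdens_right _ j _).ennreal_ofReal).symm
  simp only [this]
  rw [← lintegral_finsetSum _ fun j _ =>
    (h1.measurable_cdens_right _ j _).ennreal_ofReal.const_mul _]
  refine lintegral_congr_ae (ae_restrict_of_ae ?_)
  filter_upwards [h1.cdens_bounds x.time ν] with z hz
  have hz0 : ∀ j, 0 ≤ M.cdens x.time j ν z := fun j => ((inv_pos.2 h1.C_pos).trans (hz j).1).le
  rw [mixDens, ENNReal.ofReal_sum_of_nonneg fun j _ => mul_nonneg (hp.1 j) (hz0 j)]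
  exact Finset.sum_congr rfl fun j _ => (ENNReal.ofReal_mul (hp.1 j)).symm

theorem support_ae : ∀ᵐ z ∂M.etaQ, z ∈ M.etaQ.support := Measure.support_mem_ae

/-- The updated filter is Bayes' formula: its components are nonnegative and the common denominator
is their total weight. The price stays nonnegative because the support lies in `(-1, ∞)`. -/
theorem jumpTo_mem {x : PState K} (hx : x ∈ M.stateSpace) (ν : ℝ) :
    ∀ᵐ z ∂M.etaQ, M.jumpTo x ν z ∈ M.stateSpace := by
  filter_upwards [h1.support_ae, h1.cdens_bounds x.time ν, h1.mixDens_bounds (filt_mem hx) x.time ν]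
    with z hz hd hD
  have hi := inv_pos.2 h1.C_pos
  have hD0 : 0 < M.mixDens x.time ν x.filt z := hi.trans_le hD.1
  have hz1 : -1 < z := h1.support_subset hz
  refine ⟨hx.1, hx.2.1, mul_nonneg (price_nonneg hx) (by linarith), fun i => ?_, ?_⟩
  · exact mul_nonneg ((filt_mem hx).1 i) (div_nonneg (hi.trans (hd i).1).le hD0.le)
  · change ∑ i, x.filt i * (M.cdens x.time i ν z / M.mixDens x.time ν x.filt z) = 1
    simp only [← mul_div_assoc]
    rw [← Finset.sum_div]
    exact div_self hD0.ne'

theorem ae_jumpKer {x : PState K} (ν : ℝ) {P : PState K → Prop} (hP : MeasurableSet {y | P y})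
    (h : ∀ᵐ z ∂M.etaQ, P (M.jumpTo x ν z)) : ∀ᵐ y ∂(M.jumpKer x ν), P y := by
  rw [jumpKer, ae_map_iff (h1.measurable_jumpTo_right x ν).aemeasurable hP]
  exact (withDensity_absolutelyContinuous _ _).ae_le h

theorem jumpKer_mem {x : PState K} (hx : x ∈ M.stateSpace) (ν : ℝ) :
    ∀ᵐ y ∂(M.jumpKer x ν), y ∈ M.stateSpace ∧ y.time = x.time ∧ y.inv = x.inv := by
  refine h1.ae_jumpKer ν ?_ ?_
  · exact measurableSet_stateSpace.inter
      ((measurableSet_eq_fun measurable_time measurable_const).inter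
        (measurableSet_eq_fun measurable_inv measurable_const))
  · filter_upwards [h1.jumpTo_mem hx ν] with z hz using ⟨hz, rfl, rfl⟩

theorem jumpKer_univ {x : PState K} (hp : x.filt ∈ stdSimplex ℝ (Fin K)) (ν : ℝ) :
    M.jumpKer x ν univ = ENNReal.ofReal (∑ j, x.filt j * M.stateRate j x.time ν) := by
  rw [← lintegral_one, h1.lintegral_jumpKer x ν measurable_const, ← h1.integral_mixDens]
  simp only [mul_one]
  rw [ofReal_integral_eq_lintegral_ofReal (h1.mixDens_integrable _ _ _)]
  filter_upwards [h1.mixDens_bounds hp x.time ν] with z hz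
  exact (inv_pos.2 h1.C_pos).le.trans hz.1

theorem integral_jumpKer {x : PState K} (hp : x.filt ∈ stdSimplex ℝ (Fin K)) (ν : ℝ)
    {F : PState K → ℝ} (hF : Measurable F) :
    ∫ y, F y ∂(M.jumpKer x ν)
      = ∫ z, M.mixDens x.time ν x.filt z * F (M.jumpTo x ν z) ∂M.etaQ := by
  rw [jumpKer, integral_map (h1.measurable_jumpTo_right x ν).aemeasurable hF.aestronglyMeasurable,
    integral_withDensity_eq_integral_toReal_smul
      (h1.measurable_mixDens_right _ _ _).ennreal_ofReal (by simp)]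
  refine integral_congr_ae ?_
  filter_upwards [h1.mixDens_bounds hp x.time ν] with z hz
  rw [ENNReal.toReal_ofReal ((inv_pos.2 h1.C_pos).le.trans hz.1), smul_eq_mul]

/-- A bound for the jumps of the return process. -/
noncomputable def jumpBound : ℝ :=
  1 + max 0 (h1.compact_support.exists_bound_of_continuousOn
    (continuousOn_id (s := M.etaQ.support))).choose

theorem one_le_jumpBound : 1 ≤ h1.jumpBound := le_add_of_nonneg_right (le_max_left _ _)

theorem jump_le : ∀ z ∈ M.etaQ.support, 0 ≤ 1 + z ∧ 1 + z ≤ h1.jumpBound := by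
  intro z hz
  have h := (h1.compact_support.exists_bound_of_continuousOn
    (continuousOn_id (s := M.etaQ.support))).choose_spec z hz
  have hz1 : -1 < z := h1.support_subset hz
  refine ⟨by linarith, add_le_add_right (((le_abs_self z).trans h).trans (le_max_right _ _)) 1⟩

/-- A bound for the intensity of the jumps, weighted with the new relative price. -/
noncomputable def jumpRateBound : ℝ := h1.jumpBound * (h1.C * M.etaQ.real univ)

theorem jumpRateBound_nonneg : 0 ≤ h1.jumpRateBound :=
  mul_nonneg (zero_le_one.trans h1.one_le_jumpBound) (mul_nonneg h1.C_pos.le measureReal_nonneg)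

theorem lintegral_jumpKer_le {x : PState K} (hx : x ∈ M.stateSpace) (ν : ℝ)
    {F : PState K → ENNReal} (hF : Measurable F) {A : ℝ}
    (h : ∀ z ∈ M.etaQ.support, F (M.jumpTo x ν z) ≤ ENNReal.ofReal A * ENNReal.ofReal h1.jumpBound) :
    ∫⁻ y, F y ∂(M.jumpKer x ν) ≤ ENNReal.ofReal A * ENNReal.ofReal h1.jumpRateBound := by
  have := h1.finite
  rw [h1.lintegral_jumpKer x ν hF]
  calc _ ≤ ∫⁻ _, ENNReal.ofReal h1.C * (ENNReal.ofReal A * ENNReal.ofReal h1.jumpBound) ∂M.etaQ := by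
        refine lintegral_mono_ae ?_
        filter_upwards [h1.support_ae, h1.mixDens_bounds (filt_mem hx) x.time ν] with z hz hD
        exact mul_le_mul' (ENNReal.ofReal_le_ofReal hD.2) (h z hz)
    _ = _ := by
        rw [lintegral_const, jumpRateBound,
          ENNReal.ofReal_mul (zero_le_one.trans h1.one_le_jumpBound),
          ENNReal.ofReal_mul h1.C_pos.le, ofReal_measureReal (by simp)]
        ring

/-! ### The one-step transition -/

theorem nextJump_eq {α : ℝ → ℝ} (hα : M.IsControl α) {x : PState K} (hx : x ∈ M.stateSpace) :
    M.nextJump α x = (volume.restrict (Ioc 0 (M.T - x.time))).bind fun v =>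
      ENNReal.ofReal (h1.surv α x v) • M.jumpKer (h1.expFlow α x v) (α v) := by
  refine Measure.bind_congr_right ?_
  filter_upwards [ae_restrict_mem measurableSet_Ioc] with v hv
  have hv' := Ioc_subset_Icc_self hv
  rw [h1.exp_cumRate hα hx hv', h1.flow_eq hα hx hv',
    h1.jumpMeasure_eq (x := h1.expFlow α x v) (time_add_mem hx hv') (hα.2 v)
      (h1.filtFlow_mem hα.1 (filt_mem hx) hv'.1)]

theorem measurable_step_integrand {X : Type*} [MeasurableSpace X] {a : X → ℝ → ℝ}
    {s : X → PState K} (ha : Measurable (fun y : X × ℝ => a y.1 y.2)) (hs : Measurable s)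
    {F : PState K → ENNReal} (hF : Measurable F) :
    Measurable (fun y : X × ℝ => ENNReal.ofReal (h1.surv (a y.1) (s y.1) y.2)
      * ∫⁻ y', F y' ∂(M.jumpKer (h1.expFlow (a y.1) (s y.1) y.2) (a y.1 y.2))) :=
  (h1.measurable_surv_param ha hs).ennreal_ofReal.mul
    ((h1.measurable_lintegral_jumpKer hF).comp ((h1.measurable_expFlow_param ha hs).prodMk ha))

theorem measurable_smul_jumpKer {α : ℝ → ℝ} (hα : Measurable α) (x : PState K) :
    Measurable fun v => ENNReal.ofReal (h1.surv α x v) • M.jumpKer (h1.expFlow α x v) (α v) := by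
  refine Measure.measurable_of_measurable_coe _ fun A hA => ?_
  have h := (h1.measurable_step_integrand (X := Unit) (a := fun _ => α) (s := fun _ => x)
    (hα.comp measurable_snd) measurable_const (F := A.indicator 1)
    (measurable_one.indicator hA)).comp
    (measurable_const.prodMk measurable_id : Measurable fun v : ℝ => (((), v) : Unit × ℝ))
  simpa only [Function.comp_def, lintegral_indicator_one hA, id, Measure.smul_apply,
    smul_eq_mul] using h

theorem lintegral_nextJump {α : ℝ → ℝ} (hα : M.IsControl α) {x : PState K} (hx : x ∈ M.stateSpace)
    {F : PState K → ENNReal} (hF : Measurable F) :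
    ∫⁻ y, F y ∂(M.nextJump α x) = ∫⁻ v in Ioc 0 (M.T - x.time), ENNReal.ofReal (h1.surv α x v)
      * ∫⁻ y, F y ∂(M.jumpKer (h1.expFlow α x v) (α v)) := by
  have hmeas := h1.measurable_smul_jumpKer hα.1 x
  rw [h1.nextJump_eq hα hx, Measure.lintegral_bind hmeas.aemeasurable hF.aemeasurable]
  simp only [lintegral_smul_measure, smul_eq_mul]

theorem stepMeasure_inl {a : PState K → ℝ → ℝ} {x : PState K} (hα : M.IsControl (a x))
    (hx : x ∈ M.stateSpace) : M.stepMeasure a (Sum.inl x)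
      = (M.nextJump (M.cut (a x) x) x).map Sum.inl
        + ENNReal.ofReal (h1.surv (M.cut (a x) x) x (M.T - x.time)) • Measure.dirac (Sum.inr ()) := by
  have hL := horizon_nonneg hx
  simp only [stepMeasure, if_pos hx, h1.stopped_eq hα hx,
    h1.exp_cumRate (hα.cut x) hx ⟨hL, le_rfl⟩]

theorem lintegral_stepMeasure {a : PState K → ℝ → ℝ} {x : PState K} (hα : M.IsControl (a x))
    (hx : x ∈ M.stateSpace) {F : ChainState K → ENNReal} (hF : Measurable F) :
    ∫⁻ z, F z ∂(M.stepMeasure a (Sum.inl x))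
      = (∫⁻ v in Ioc 0 (M.T - x.time), ENNReal.ofReal (h1.surv (M.cut (a x) x) x v)
        * ∫⁻ y, F (Sum.inl y) ∂(M.jumpKer (h1.expFlow (M.cut (a x) x) x v) (M.cut (a x) x v)))
        + ENNReal.ofReal (h1.surv (M.cut (a x) x) x (M.T - x.time)) * F (Sum.inr ()) := by
  rw [h1.stepMeasure_inl hα hx, lintegral_add_measure, lintegral_smul_measure, lintegral_dirac' _ hF,
    lintegral_map hF measurable_inl, smul_eq_mul]
  congr 1
  exact h1.lintegral_nextJump (hα.cut x) hx (hF.comp measurable_inl)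

theorem measurable_stepMeasure {a : PState K → ℝ → ℝ}
    (ha : Measurable (fun y : PState K × ℝ => a y.1 y.2)) (hc : ∀ x, M.IsControl (a x)) :
    Measurable (M.stepMeasure a) := by
  classical
  have hcut := measurable_cut ha hc
  refine measurable_fun_sum ?_ (measurable_const (a := Measure.dirac (Sum.inr ())))
  refine Measure.measurable_of_measurable_coe _ fun A hA => ?_
  set F : ChainState K → ENNReal := A.indicator 1 with hFdef
  have hF : Measurable F := measurable_one.indicator hA
  have key : Measurable (fun x : PState K =>
      (∫⁻ v in Ioc 0 (M.T - x.time), ENNReal.ofReal (h1.surv (M.cut (a x) x) x v)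
        * ∫⁻ y, F (Sum.inl y) ∂(M.jumpKer (h1.expFlow (M.cut (a x) x) x v) (M.cut (a x) x v)))
        + ENNReal.ofReal (h1.surv (M.cut (a x) x) x (M.T - x.time)) * F (Sum.inr ())) := by
    refine Measurable.add ?_ (Measurable.mul_const (Measurable.ennreal_ofReal ?_) _)
    · simp only [← lintegral_indicator measurableSet_Ioc]
      have hs : MeasurableSet {y : PState K × ℝ | y.2 ∈ Ioc 0 (M.T - y.1.time)} :=
        (measurableSet_lt measurable_const measurable_snd).inter (measurableSet_le measurable_snd
          (measurable_const.sub (measurable_time.comp measurable_fst)))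
      have := (h1.measurable_step_integrand (a := fun x => M.cut (a x) x) (s := fun x => x)
        hcut measurable_id (hF.comp measurable_inl)).indicator hs
      exact this.lintegral_prod_right'
    · exact (h1.measurable_surv_param (a := fun x => M.cut (a x) x) (s := fun x => x)
        hcut measurable_id).comp
        (measurable_id.prodMk (measurable_const.sub measurable_time))
  have e : (fun x => (M.stepMeasure a ∘ Sum.inl) x A) = fun x => if x ∈ M.stateSpace then
      (∫⁻ v in Ioc 0 (M.T - x.time), ENNReal.ofReal (h1.surv (M.cut (a x) x) x v)
        * ∫⁻ y, F (Sum.inl y) ∂(M.jumpKer (h1.expFlow (M.cut (a x) x) x v) (M.cut (a x) x v)))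
        + ENNReal.ofReal (h1.surv (M.cut (a x) x) x (M.T - x.time)) * F (Sum.inr ())
      else Measure.dirac (Sum.inr ()) A := by
    ext x
    split_ifs with hx
    · rw [← h1.lintegral_stepMeasure (hc x) hx hF, lintegral_indicator_one hA]; rfl
    · simp [stepMeasure, hx]
  rw [e]
  exact Measurable.ite measurableSet_stateSpace key measurable_const

/-- The jump time has density `flowRate * surv`, which is minus the derivative of `surv`. Its
integral is therefore one minus the survival probability at the horizon, and the latter is the mass
given to the cemetery. -/
theorem isProbabilityMeasure_stepMeasure {a : PState K → ℝ → ℝ} (hc : ∀ x, M.IsControl (a x))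
    (z : ChainState K) : IsProbabilityMeasure (M.stepMeasure a z) := by
  rcases z with x | z
  · by_cases hx : x ∈ M.stateSpace
    · refine ⟨?_⟩
      have hα := (hc x).cut x
      have hL := horizon_nonneg hx
      have hp := filt_mem hx
      rw [← lintegral_one, h1.lintegral_stepMeasure (hc x) hx measurable_const]
      simp only [lintegral_one, mul_one]
      set α := M.cut (a x) x
      have h := (h1.surv_isPrim hα.1 hp hL)
      have h2 := h.eq _ ⟨hL, le_rfl⟩
      rw [h1.surv_zero hα.1 hp, intervalIntegral.integral_neg,
        intervalIntegral.integral_of_le hL] at h2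
      have hint : IntegrableOn (fun v => h1.flowRate α x v * h1.surv α x v)
          (Ioc 0 (M.T - x.time)) := by
        simpa using h.integrable.1.neg
      have h3 : ∫⁻ v in Ioc 0 (M.T - x.time), ENNReal.ofReal (h1.surv α x v)
          * M.jumpKer (h1.expFlow α x v) (α v) univ
          = ENNReal.ofReal (∫ v in Ioc 0 (M.T - x.time), h1.flowRate α x v * h1.surv α x v) := by
        rw [ofReal_integral_eq_lintegral_ofReal hint]
        · refine setLIntegral_congr_fun measurableSet_Ioc fun v hv => ?_
          rw [h1.jumpKer_univ (x := h1.expFlow α x v) (h1.filtFlow_mem hα.1 hp hv.1.le), mul_comm]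
          exact (ENNReal.ofReal_mul (h1.flowRate_nonneg hα.1 hp hv.1.le)).symm
        · filter_upwards [ae_restrict_mem measurableSet_Ioc] with v hv
          exact mul_nonneg (h1.flowRate_nonneg hα.1 hp hv.1.le) (h1.surv_pos hα.1 hp hv.1.le).le
      rw [h3, ← ENNReal.ofReal_add _ (h1.surv_pos hα.1 hp hL).le, h2]
      · simp
      · refine setIntegral_nonneg measurableSet_Ioc fun v hv => ?_
        exact mul_nonneg (h1.flowRate_nonneg hα.1 hp hv.1.le) (h1.surv_pos hα.1 hp hv.1.le).le
    · simp only [stepMeasure, if_neg hx]; infer_instance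
  · simp only [stepMeasure]; infer_instance

end Assumption1

/-! ### The decision model on the whole horizon -/

theorem measurable_bounding (γ : ℝ) : Measurable (M.bounding γ) :=
  (measurable_price.mul measurable_inv).mul
    (Real.measurable_exp.comp ((measurable_const.sub measurable_time).const_mul γ))

theorem bounding_nonneg {x : PState K} (hx : x ∈ M.stateSpace) (γ : ℝ) : 0 ≤ M.bounding γ x :=
  mul_nonneg (mul_nonneg (price_nonneg hx) (inv_mem hx).1) (Real.exp_pos _).le

theorem price_mul_inv_le_bounding {x : PState K} (hx : x ∈ M.stateSpace) {γ : ℝ} (hγ : 0 ≤ γ) :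
    x.price * x.inv ≤ M.bounding γ x :=
  le_mul_of_one_le_right (mul_nonneg (price_nonneg hx) (inv_mem hx).1)
    (Real.one_le_exp (mul_nonneg hγ (horizon_nonneg hx)))

theorem bounding_le {x : PState K} (hx : x ∈ M.stateSpace) {γ : ℝ} (hγ : 0 ≤ γ) :
    M.bounding γ x ≤ Real.exp (γ * M.T) * (x.price * x.inv) := by
  rw [bounding, mul_comm]
  refine mul_le_mul_of_nonneg_right (Real.exp_le_exp.2 (mul_le_mul_of_nonneg_left ?_ hγ))
    (mul_nonneg (price_nonneg hx) (inv_mem hx).1)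
  linarith [(time_mem hx).1]

/-- The mean of `v` after a jump, times the jump rate. -/
noncomputable def jumpMean (M : LiquidationModel K) (v : PState K → ℝ) (x : PState K) (ν : ℝ) : ℝ :=
  ∫ y, v y ∂(M.jumpKer x ν)

/-- The running gain density at the clamped rate. -/
noncomputable def gain (M : LiquidationModel K) (ν : ℝ) : ℝ := ν * (1 - M.f (M.clampN ν))

/-- The terminal value function extended continuously. -/
noncomputable def hext (M : LiquidationModel K) (w : ℝ) : ℝ := M.h (max 0 (min w M.w₀))

theorem continuous_gain : Continuous M.gain := by
  have : Continuous fun ν => M.f (M.clampN ν) :=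
    M.f_cont.comp_continuous continuous_clampN fun ν => clampN_mem ν
  unfold gain; fun_prop

theorem continuous_hext : Continuous M.hext :=
  M.h_cont.comp_continuous (by fun_prop)
    fun _ => ⟨le_max_left _ _, max_le M.w₀_pos.le (min_le_right _ _)⟩

theorem hext_of_mem {w : ℝ} (hw : w ∈ Icc 0 M.w₀) : M.hext w = M.h w := by
  rw [hext, min_eq_left hw.2, max_eq_right hw.1]

theorem h_nonneg {w : ℝ} (hw : w ∈ Icc 0 M.w₀) : 0 ≤ M.h w := by
  rw [← M.h_zero]
  exact M.h_mono ⟨le_rfl, M.w₀_pos.le⟩ hw hw.1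

theorem gain_of_mem {ν : ℝ} (hν : ν ∈ Icc 0 M.νmax) : M.gain ν = ν * (1 - M.f ν) := by
  rw [gain, clampN_of_mem hν]

theorem abs_gain_le {ν : ℝ} (hν : ν ∈ Icc 0 M.νmax) : |M.gain ν| ≤ (1 + M.f M.νmax) * ν := by
  rw [gain_of_mem hν, abs_mul, abs_of_nonneg hν.1, mul_comm]
  refine mul_le_mul_of_nonneg_right ?_ hν.1
  have h0 := M.f_nonneg ν hν
  have h1 := M.f_mono hν ⟨M.νmax_pos.le, le_rfl⟩ hν.2
  rw [abs_le]
  constructor <;> linarith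

theorem f_νmax_nonneg (M : LiquidationModel K) : 0 ≤ M.f M.νmax :=
  M.f_nonneg _ ⟨M.νmax_pos.le, le_rfl⟩

namespace Assumption1

/-- The one-period reward of a rate that respects the inventory constraint. -/
noncomputable def rewardPart (h1 : M.Assumption1) (α : ℝ → ℝ) (x : PState K) : ℝ :=
  (∫ r in (0 : ℝ)..(M.T - x.time),
    Real.exp (-M.ρ * r) * h1.surv α x r * (M.gain (α r) * x.price))
  + Real.exp (-M.ρ * (M.T - x.time)) * h1.surv α x (M.T - x.time)
    * (M.hext (h1.expFlow α x (M.T - x.time)).inv * x.price)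

/-- The continuation value under a rate that respects the inventory constraint. -/
noncomputable def contPart (h1 : M.Assumption1) (v : PState K → ℝ) (α : ℝ → ℝ) (x : PState K) : ℝ :=
  ∫ r in (0 : ℝ)..(M.T - x.time),
    Real.exp (-M.ρ * r) * h1.surv α x r * M.jumpMean v (h1.expFlow α x r) (α r)

variable (h1 : M.Assumption1)
include h1

theorem jumpMean_eq {x : PState K} (hp : x.filt ∈ stdSimplex ℝ (Fin K)) (ν : ℝ)
    {v : PState K → ℝ} (hv : Measurable v) : M.jumpMean v x ν
      = ∫ z, M.mixDens x.time ν x.filt z * v (M.jumpTo x ν z) ∂M.etaQ :=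
  h1.integral_jumpKer hp ν hv

theorem measurable_jumpMean {v : PState K → ℝ} (hv : Measurable v) :
    Measurable (fun y : PState K × ℝ => M.jumpMean v y.1 y.2) := by
  have := h1.finite
  have e : ∀ y : PState K × ℝ, M.jumpMean v y.1 y.2
      = ∫ z, (ENNReal.ofReal (M.mixDens y.1.time y.2 y.1.filt z)).toReal
        • v (M.jumpTo y.1 y.2 z) ∂M.etaQ := by
    intro y
    rw [jumpMean, jumpKer, integral_map (h1.measurable_jumpTo_right _ _).aemeasurable
      hv.aestronglyMeasurable, integral_withDensity_eq_integral_toReal_smul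
      (h1.measurable_mixDens_right _ _ _).ennreal_ofReal (by simp)]
  simp only [e]
  have hm : Measurable (fun q : (PState K × ℝ) × ℝ =>
      (ENNReal.ofReal (M.mixDens q.1.1.time q.1.2 q.1.1.filt q.2)).toReal
        • v (M.jumpTo q.1.1 q.1.2 q.2)) := by
    refine Measurable.smul (Measurable.ennreal_toReal (Measurable.ennreal_ofReal ?_)) (hv.comp ?_)
    · exact h1.measurable_mixDens.comp ((measurable_time.comp (by fun_prop)).prodMk
        (Measurable.prodMk (by fun_prop) ((measurable_filt.comp (by fun_prop)).prodMk
          measurable_snd)))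
    · exact h1.measurable_jumpTo.comp (by fun_prop :
        Measurable fun q : (PState K × ℝ) × ℝ => (q.1.1, q.1.2, q.2))
  exact (hm.stronglyMeasurable.integral_prod_right' (ν := M.etaQ)).measurable

theorem jumpMean_congr {x : PState K} (hx : x ∈ M.stateSpace) (ν : ℝ) {v v' : PState K → ℝ}
    (h : EqOn v v' M.stateSpace) : M.jumpMean v x ν = M.jumpMean v' x ν := by
  refine integral_congr_ae ?_
  filter_upwards [h1.jumpKer_mem hx ν] with y hy using h hy.1

theorem jumpMean_eq_zero {x : PState K} (hx : x ∈ M.stateSpace) (ν : ℝ) {v : PState K → ℝ}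
    (h : ∀ y ∈ M.lateral, v y = 0) (h0 : x.inv = 0) : M.jumpMean v x ν = 0 := by
  refine integral_eq_zero_of_ae ?_
  filter_upwards [h1.jumpKer_mem hx ν] with y hy using h y ⟨hy.1, hy.2.2.trans h0⟩

theorem jump_integrand_le {x : PState K} (hx : x ∈ M.stateSpace) (ν : ℝ) {v : PState K → ℝ}
    {γ C : ℝ} (hC : 0 ≤ C) (h : ∀ y ∈ M.stateSpace, |v y| ≤ C * M.bounding γ y) :
    ∀ᵐ z ∂M.etaQ, |M.mixDens x.time ν x.filt z * v (M.jumpTo x ν z)|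
      ≤ h1.C * (C * (h1.jumpBound * M.bounding γ x)) := by
  filter_upwards [h1.support_ae, h1.mixDens_bounds (filt_mem hx) x.time ν, h1.jumpTo_mem hx ν]
    with z hz hD hm
  rw [abs_mul, abs_of_nonneg ((inv_pos.2 h1.C_pos).le.trans hD.1)]
  refine mul_le_mul hD.2 ((h _ hm).trans (mul_le_mul_of_nonneg_left ?_ hC)) (abs_nonneg _)
    h1.C_pos.le
  have e : M.bounding γ (M.jumpTo x ν z) = (1 + z) * M.bounding γ x := by
    simp only [bounding, jumpTo, PState.price, PState.inv, PState.time]; ring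
  rw [e]
  exact mul_le_mul_of_nonneg_right (h1.jump_le z hz).2 (bounding_nonneg hx γ)

theorem jump_integrable {x : PState K} (hx : x ∈ M.stateSpace) (ν : ℝ) {v : PState K → ℝ}
    (hv : Measurable v) {γ C : ℝ} (hC : 0 ≤ C) (h : ∀ y ∈ M.stateSpace, |v y| ≤ C * M.bounding γ y) :
    Integrable (fun z => M.mixDens x.time ν x.filt z * v (M.jumpTo x ν z)) M.etaQ :=
  h1.integrable_of_ae_bounded ((h1.measurable_mixDens_right _ _ _).mul
    (hv.comp (h1.measurable_jumpTo_right x ν))) (h1.jump_integrand_le hx ν hC h)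

theorem abs_jumpMean_le {x : PState K} (hx : x ∈ M.stateSpace) (ν : ℝ) {v : PState K → ℝ}
    (hv : Measurable v) {γ C : ℝ} (hC : 0 ≤ C) (h : ∀ y ∈ M.stateSpace, |v y| ≤ C * M.bounding γ y) :
    |M.jumpMean v x ν| ≤ C * h1.jumpRateBound * M.bounding γ x := by
  have := h1.finite
  rw [h1.jumpMean_eq (filt_mem hx) ν hv]
  refine (norm_integral_le_of_norm_le_const (μ := M.etaQ)
    (f := fun z => M.mixDens x.time ν x.filt z * v (M.jumpTo x ν z)) (h1.jump_integrand_le hx ν hC h)).trans (le_of_eq ?_)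
  rw [jumpRateBound]; ring

theorem jumpMean_sub {x : PState K} (hx : x ∈ M.stateSpace) (ν : ℝ) {v v' : PState K → ℝ}
    (hv : Measurable v) (hv' : Measurable v') {γ C C' : ℝ} (hC : 0 ≤ C) (hC' : 0 ≤ C')
    (h : ∀ y ∈ M.stateSpace, |v y| ≤ C * M.bounding γ y)
    (h' : ∀ y ∈ M.stateSpace, |v' y| ≤ C' * M.bounding γ y) :
    M.jumpMean v x ν - M.jumpMean v' x ν = M.jumpMean (fun y => v y - v' y) x ν := by
  rw [h1.jumpMean_eq (filt_mem hx) ν hv, h1.jumpMean_eq (filt_mem hx) ν hv',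
    h1.jumpMean_eq (filt_mem hx) ν (v := fun y => v y - v' y) (hv.sub hv'),
    ← integral_sub (h1.jump_integrable hx ν hv hC h) (h1.jump_integrable hx ν hv' hC' h')]
  exact integral_congr_ae (Eventually.of_forall fun z => by simp only [mul_sub])

/-! ### The one-period problem rewritten up to the fixed horizon -/

section OnePeriod

variable {α : ℝ → ℝ} {x : PState K}

theorem measurable_surv (hα : Measurable α) (x : PState K) : Measurable (h1.surv α x) :=
  (h1.measurable_surv_param (X := Unit) (a := fun _ => α) (s := fun _ => x)
    (hα.comp measurable_snd) measurable_const).comp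
    (measurable_const.prodMk measurable_id : Measurable fun v : ℝ => (((), v) : Unit × ℝ))

theorem measurable_expFlow (hα : Measurable α) (x : PState K) : Measurable (h1.expFlow α x) :=
  (h1.measurable_expFlow_param (X := Unit) (a := fun _ => α) (s := fun _ => x)
    (hα.comp measurable_snd) measurable_const).comp
    (measurable_const.prodMk measurable_id : Measurable fun v : ℝ => (((), v) : Unit × ℝ))

theorem measurable_cont_integrand {v : PState K → ℝ} (hv : Measurable v) (hα : Measurable α)
    (x : PState K) : Measurable (fun r =>
      Real.exp (-M.ρ * r) * h1.surv α x r * M.jumpMean v (h1.expFlow α x r) (α r)) :=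
  (Measurable.mul (by fun_prop) (h1.measurable_surv hα x)).mul
    ((h1.measurable_jumpMean hv).comp ((h1.measurable_expFlow hα x).prodMk hα))

theorem discount_mem (hα : Measurable α) (hx : x ∈ M.stateSpace) {r : ℝ} (hr : 0 ≤ r) :
    0 ≤ Real.exp (-M.ρ * r) * h1.surv α x r ∧ Real.exp (-M.ρ * r) * h1.surv α x r ≤ 1 := by
  have hs := h1.surv_pos hα (filt_mem hx) hr
  refine ⟨mul_nonneg (Real.exp_pos _).le hs.le, ?_⟩
  refine mul_le_one₀ (Real.exp_le_one_iff.2 ?_) hs.le (h1.surv_le_one hα (filt_mem hx) hr)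
  have := mul_nonneg M.ρ_nonneg hr
  linarith

theorem setIntegral_exit {F : ℝ → ℝ} (hα : M.IsControl α) (hx : x ∈ M.stateSpace)
    (hF : M.exitVersion α x < M.T - x.time → ∀ r ∈ Ioc (M.exitVersion α x) (M.T - x.time), F r = 0) :
    ∫ r in (0 : ℝ)..(M.T - x.time), F r = ∫ r in (0 : ℝ)..(M.exitVersion α x), F r := by
  have hτ := exitVersion_mem_Icc hα hx
  rw [intervalIntegral.integral_of_le (horizon_nonneg hx), intervalIntegral.integral_of_le hτ.1]
  refine (setIntegral_eq_of_subset_of_forall_sdiff_eq_zero measurableSet_Ioc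
    (Ioc_subset_Ioc_right hτ.2) fun r hr => ?_)
  have h3 : M.exitVersion α x < r := by
    by_contra h
    exact hr.2 ⟨hr.1.1, not_lt.1 h⟩
  exact hF (h3.trans_le hr.1.2) r ⟨h3, hr.1.2⟩

/-- After the exit time the cut rate is zero and so is the gain, hence the running reward may be
integrated up to the horizon. -/
theorem oneReward_eq (hα : M.IsControl α) (hx : x ∈ M.stateSpace) :
    M.oneReward x α = h1.rewardPart (M.cut α x) x := by
  have hτ := exitVersion_mem_Icc hα hx
  have hc := hα.cut x
  have hL := horizon_nonneg hx
  have hcut : ∀ r ∈ Icc 0 (M.exitVersion α x), α r = M.cut α x r :=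
    fun r hr => (cut_of_le hr.2).symm
  have hinvτ : ∀ v ∈ Icc 0 (M.T - x.time), (h1.expFlow (M.cut α x) x v).inv ∈ Icc 0 M.w₀ :=
    fun v hv => inv_mem (h1.expFlow_cut_mem hα hx hv)
  rw [oneReward, rewardPart, h1.exitTime_eq hα hx]
  congr 1
  · rw [h1.setIntegral_exit hα hx fun _ r hr => by simp [cut_of_lt hr.1, gain]]
    refine intervalIntegral.integral_congr fun r hr => ?_
    rw [uIcc_of_le hτ.1] at hr
    rw [h1.exp_cumRate hα hx ⟨hr.1, hr.2.trans hτ.2⟩, h1.surv_congr hcut hr, ← hcut r hr,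
      gain_of_mem (hα.2 r)]
    ring
  · rw [h1.exp_cumRate hα hx hτ, h1.flow_eq hα hx hτ, h1.surv_congr hcut ⟨hτ.1, le_rfl⟩,
      h1.expFlow_congr hcut ⟨hτ.1, le_rfl⟩, hext_of_mem (hinvτ _ ⟨hL, le_rfl⟩)]
    -- Either the period ends at the horizon and both terminal terms coincide, or the inventory is
    -- exhausted and both vanish because `h 0 = 0`.
    rcases eq_or_lt_of_le hτ.2 with h | h
    · rw [h]; ring
    · rw [h1.expFlow_cut_inv_of_ge hα hx h le_rfl, h1.expFlow_cut_inv_of_ge hα hx h h.le, M.h_zero]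
      ring

/-- Beyond the exit time the inventory is zero and a jump does not change it, so the post-jump state
is on the lateral boundary, where `v` vanishes. -/
theorem QL_eq (hα : M.IsControl α) (hx : x ∈ M.stateSpace) {v : PState K → ℝ}
    (hv : ∀ y ∈ M.lateral, v y = 0) : M.QL v x α = h1.contPart v (M.cut α x) x := by
  have hτ := exitVersion_mem_Icc hα hx
  have hcut : ∀ r ∈ Icc 0 (M.exitVersion α x), α r = M.cut α x r :=
    fun r hr => (cut_of_le hr.2).symm
  rw [QL, contPart, h1.exitTime_eq hα hx]
  rw [h1.setIntegral_exit hα hx fun h r hr => by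
    rw [h1.jumpMean_eq_zero (h1.expFlow_cut_mem hα hx ⟨hτ.1.trans hr.1.le, hr.2⟩) _ hv
      (h1.expFlow_cut_inv_of_ge hα hx h hr.1.le), mul_zero]]
  refine intervalIntegral.integral_congr fun r hr => ?_
  rw [uIcc_of_le hτ.1] at hr
  have hr' : r ∈ Icc 0 (M.T - x.time) := ⟨hr.1, hr.2.trans hτ.2⟩
  rw [h1.exp_cumRate hα hx hr', h1.flow_eq hα hx hr', h1.jumpMeasure_eq (x := h1.expFlow α x r)
    (time_add_mem hx hr') (hα.2 r) (h1.filtFlow_mem hα.1 (filt_mem hx) hr.1),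
    h1.surv_congr hcut hr, h1.expFlow_congr hcut hr, ← hcut r hr]
  rfl

theorem contPart_congr (hα : M.IsAdmissible α x) (hx : x ∈ M.stateSpace) {v v' : PState K → ℝ}
    (h : EqOn v v' M.stateSpace) :
    h1.contPart v α x = h1.contPart v' α x := by
  refine intervalIntegral.integral_congr fun r hr => ?_
  rw [uIcc_of_le (horizon_nonneg hx)] at hr
  simp only [h1.jumpMean_congr (h1.expFlow_mem hα hx hr) _ h]

/-- The price is constant between jumps and the inventory does not increase; the decay is due
entirely to the passage of time in the exponential weight. -/
theorem bounding_expFlow_le (hα : M.IsAdmissible α x) (hx : x ∈ M.stateSpace) {r : ℝ} (hr : 0 ≤ r)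
    (γ : ℝ) : M.bounding γ (h1.expFlow α x r)
      ≤ M.bounding γ x * Real.exp (-γ * r) := by
  have e : Real.exp (γ * (M.T - (x.time + r)))
      = Real.exp (γ * (M.T - x.time)) * Real.exp (-γ * r) := by
    rw [← Real.exp_add]; congr 1; ring
  change x.price * (x.inv - ∫ r in (0 : ℝ)..r, α r) * Real.exp (γ * (M.T - (x.time + r))) ≤ _
  rw [e, bounding, ← mul_assoc]
  have := hα.1.integral_nonneg hr
  have := price_nonneg hx
  gcongr
  linarith

theorem abs_cont_integrand_le (hα : M.IsAdmissible α x) (hx : x ∈ M.stateSpace) {v : PState K → ℝ}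
    (hv : Measurable v) {γ C : ℝ} (hC : 0 ≤ C) (h : ∀ y ∈ M.stateSpace, |v y| ≤ C * M.bounding γ y)
    {r : ℝ} (hr : r ∈ Icc 0 (M.T - x.time)) :
    |Real.exp (-M.ρ * r) * h1.surv α x r
        * M.jumpMean v (h1.expFlow α x r) (α r)|
      ≤ C * h1.jumpRateBound * M.bounding γ x * Real.exp (-γ * r) := by
  have hd := h1.discount_mem hα.1.1 hx hr.1
  have hR := h1.jumpRateBound_nonneg
  rw [abs_mul, abs_of_nonneg hd.1]
  have hj := (h1.abs_jumpMean_le (h1.expFlow_mem hα hx hr) (α r) hv hC h).trans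
    (mul_le_mul_of_nonneg_left (h1.bounding_expFlow_le hα hx hr.1 γ) (mul_nonneg hC hR))
  calc _ ≤ 1 * (C * h1.jumpRateBound * (M.bounding γ x * Real.exp (-γ * r))) :=
        mul_le_mul hd.2 hj (abs_nonneg _) zero_le_one
    _ = _ := by ring

theorem intervalIntegrable_cont (hα : M.IsAdmissible α x) (hx : x ∈ M.stateSpace) {v : PState K → ℝ}
    (hv : Measurable v) {γ C : ℝ} (hγ : 0 ≤ γ) (hC : 0 ≤ C)
    (h : ∀ y ∈ M.stateSpace, |v y| ≤ C * M.bounding γ y) :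
    IntervalIntegrable (fun r => Real.exp (-M.ρ * r) * h1.surv α x r
        * M.jumpMean v (h1.expFlow α x r) (α r)) volume 0 (M.T - x.time) := by
  refine intervalIntegrable_of_bounded (h1.measurable_cont_integrand hv hα.1.1 x)
    (horizon_nonneg hx) (C := C * h1.jumpRateBound * M.bounding γ x) fun r hr => ?_
  refine (h1.abs_cont_integrand_le hα hx hv hC h hr).trans (mul_le_of_le_one_right ?_ ?_)
  · exact mul_nonneg (mul_nonneg hC h1.jumpRateBound_nonneg) (bounding_nonneg hx γ)
  · exact Real.exp_le_one_iff.2 (by nlinarith [hr.1])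

/-- The source of the contraction: jumps cost at most the factor `jumpRateBound` per unit of time,
while the weight decays like `exp (-γ r)`, whose integral is at most `1 / γ`. -/
theorem abs_contPart_le (hα : M.IsAdmissible α x) (hx : x ∈ M.stateSpace) {v : PState K → ℝ}
    (hv : Measurable v) {γ C : ℝ} (hγ : 0 < γ) (hC : 0 ≤ C)
    (h : ∀ y ∈ M.stateSpace, |v y| ≤ C * M.bounding γ y) :
    |h1.contPart v α x| ≤ C * (h1.jumpRateBound / γ) * M.bounding γ x := by
  have hL := horizon_nonneg hx
  set A := C * h1.jumpRateBound * M.bounding γ x with hA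
  have hA0 : 0 ≤ A := mul_nonneg (mul_nonneg hC h1.jumpRateBound_nonneg) (bounding_nonneg hx γ)
  have h2 : |h1.contPart v α x|
      ≤ ∫ r in (0 : ℝ)..(M.T - x.time), A * Real.exp (-γ * r) :=
    intervalIntegral.norm_integral_le_of_norm_le (f := fun r => Real.exp (-M.ρ * r)
        * h1.surv α x r * M.jumpMean v (h1.expFlow α x r) (α r)) hL
      ((Eventually.of_forall fun r hr =>
        h1.abs_cont_integrand_le hα hx hv hC h (Ioc_subset_Icc_self hr)))
      (Continuous.intervalIntegrable (by fun_prop) _ _)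
  refine h2.trans ?_
  have hd : ∀ r ∈ uIcc 0 (M.T - x.time), HasDerivAt (fun r => -(A / γ) * Real.exp (-γ * r))
      (A * Real.exp (-γ * r)) r := by
    intro r _
    have := (((hasDerivAt_id r).const_mul (-γ)).exp).const_mul (-(A / γ))
    exact this.congr_deriv (by simp only [id]; field_simp)
  rw [intervalIntegral.integral_eq_sub_of_hasDerivAt hd
    (Continuous.intervalIntegrable (by fun_prop) _ _)]
  have hpos : 0 ≤ A / γ * Real.exp (-γ * (M.T - x.time)) :=
    mul_nonneg (div_nonneg hA0 hγ.le) (Real.exp_pos _).le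
  have e : C * (h1.jumpRateBound / γ) * M.bounding γ x = A / γ := by rw [hA]; ring
  rw [e]
  simp only [mul_zero, Real.exp_zero]
  linarith

theorem contPart_sub (hα : M.IsAdmissible α x) (hx : x ∈ M.stateSpace) {v v' : PState K → ℝ}
    (hv : Measurable v) (hv' : Measurable v') {γ C C' : ℝ} (hγ : 0 ≤ γ) (hC : 0 ≤ C) (hC' : 0 ≤ C')
    (h : ∀ y ∈ M.stateSpace, |v y| ≤ C * M.bounding γ y)
    (h' : ∀ y ∈ M.stateSpace, |v' y| ≤ C' * M.bounding γ y) :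
    h1.contPart v α x - h1.contPart v' α x
      = h1.contPart (fun y => v y - v' y) α x := by
  rw [contPart, contPart, contPart,
    ← intervalIntegral.integral_sub (h1.intervalIntegrable_cont hα hx hv hγ hC h)
      (h1.intervalIntegrable_cont hα hx hv' hγ hC' h')]
  refine intervalIntegral.integral_congr fun r hr => ?_
  rw [uIcc_of_le (horizon_nonneg hx)] at hr
  rw [← mul_sub, h1.jumpMean_sub (h1.expFlow_mem hα hx hr) _ hv hv' hC hC' h h']

/-- Each unit sold earns at most `1 + f νmax` times the price in absolute value, and no more than
the inventory is sold; this gives `1 + f νmax`. The final sale contributes one more, since `h w ≤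
w`. -/
theorem abs_rewardPart_le (hα : M.IsAdmissible α x) (hx : x ∈ M.stateSpace) :
    |h1.rewardPart α x| ≤ (2 + M.f M.νmax) * (x.price * x.inv) := by
  have hL := horizon_nonneg hx
  have hc := hα.1
  have hs := price_nonneg hx
  have hF := M.f_νmax_nonneg
  have a1 : |∫ r in (0 : ℝ)..(M.T - x.time),
      Real.exp (-M.ρ * r) * h1.surv α x r * (M.gain (α r) * x.price)|
      ≤ ∫ r in (0 : ℝ)..(M.T - x.time), ((1 + M.f M.νmax) * x.price) * α r := by
    refine intervalIntegral.norm_integral_le_of_norm_le (f := fun r => Real.exp (-M.ρ * r)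
      * h1.surv α x r * (M.gain (α r) * x.price)) hL (Eventually.of_forall fun r hr => ?_)
      ((hc.intervalIntegrable _ _).const_mul _)
    have hd := h1.discount_mem hc.1 hx hr.1.le
    rw [Real.norm_eq_abs, abs_mul, abs_of_nonneg hd.1, abs_mul, abs_of_nonneg hs]
    calc _ ≤ 1 * ((1 + M.f M.νmax) * α r * x.price) :=
          mul_le_mul hd.2 (mul_le_mul_of_nonneg_right (abs_gain_le (hc.2 r)) hs)
            (mul_nonneg (abs_nonneg _) hs) zero_le_one
      _ = _ := by ring
  rw [intervalIntegral.integral_const_mul] at a1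
  have a2 : ((1 + M.f M.νmax) * x.price) * ∫ r in (0 : ℝ)..(M.T - x.time), α r
      ≤ ((1 + M.f M.νmax) * x.price) * x.inv :=
    mul_le_mul_of_nonneg_left (hα.2 _ ⟨hL, le_rfl⟩) (by positivity)
  have hd := h1.discount_mem hc.1 hx hL
  have hw := inv_mem (h1.expFlow_mem hα hx ⟨hL, le_rfl⟩)
  have hw2 : (h1.expFlow α x (M.T - x.time)).inv ≤ x.inv :=
    sub_le_self _ (hc.integral_nonneg hL)
  have a3 : |Real.exp (-M.ρ * (M.T - x.time)) * h1.surv α x (M.T - x.time)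
      * (M.hext (h1.expFlow α x (M.T - x.time)).inv * x.price)| ≤ x.inv * x.price := by
    rw [hext_of_mem hw, abs_mul, abs_of_nonneg hd.1, abs_of_nonneg (mul_nonneg (h_nonneg hw) hs)]
    calc _ ≤ 1 * (x.inv * x.price) := mul_le_mul hd.2
          (mul_le_mul_of_nonneg_right ((M.h_le _ hw).trans hw2) hs)
          (mul_nonneg (h_nonneg hw) hs) zero_le_one
      _ = _ := one_mul _
  refine (abs_add_le _ _).trans ?_
  calc _ ≤ ((1 + M.f M.νmax) * x.price) * x.inv + x.inv * x.price := add_le_add (a1.trans a2) a3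
    _ = _ := by ring

end OnePeriod

/-- The bounding function vanishes with the inventory, so every function that it dominates satisfies
the lateral boundary condition automatically. -/
theorem lateral_eq_zero {v : PState K → ℝ} {γ C : ℝ}
    (h : ∀ y ∈ M.stateSpace, |v y| ≤ C * M.bounding γ y) : ∀ y ∈ M.lateral, v y = 0 := by
  intro y hy
  have := h y hy.1
  rw [bounding, hy.2] at this
  simpa using this

theorem isContracting {γ : ℝ} (hγ : h1.jumpRateBound + 1 ≤ γ) : M.IsContracting γ := by
  have hR := h1.jumpRateBound_nonneg
  have hγ0 : 0 < γ := by linarith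
  refine ⟨2 + M.f M.νmax, h1.jumpRateBound / γ, (div_lt_one hγ0).2 (by linarith),
    fun x hx α => ⟨?_, ?_⟩⟩
  · rw [h1.oneReward_eq α.isControl hx]
    refine (h1.abs_rewardPart_le (α.isControl.isAdmissible_cut hx) hx).trans
      (mul_le_mul_of_nonneg_left (price_mul_inv_le_bounding hx hγ0.le) ?_)
    have := M.f_νmax_nonneg; linarith
  · have hb : ∀ y ∈ M.stateSpace, |M.bounding γ y| ≤ 1 * M.bounding γ y := fun y hy => by
      rw [one_mul, abs_of_nonneg (bounding_nonneg hy γ)]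
    rw [h1.QL_eq α.isControl hx (h1.lateral_eq_zero hb)]
    have := (le_abs_self _).trans
      (h1.abs_contPart_le (α.isControl.isAdmissible_cut hx) hx (measurable_bounding γ) hγ0 zero_le_one hb)
    rwa [one_mul] at this

end Assumption1

/-! ### Continuity of the jump operator -/

/-- The assumption concerns sequences with times in `[0, T)`, whose limits may have time `T`. Along
this dense part `u` has its own value as limit at every point, so on the closed set it coincides
with its continuous extension from the dense part. -/
theorem Assumption2.continuousOn_u (h2 : M.Assumption2) (j : Fin K) {z : ℝ}
    (hz : z ∈ M.etaQ.support) :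
    ContinuousOn (fun y : ℝ × ℝ × (Fin K → ℝ) => M.u j y.1 y.2.1 y.2.2 z)
      (Icc 0 M.T ×ˢ Icc 0 M.νmax ×ˢ stdSimplex ℝ (Fin K)) := by
  set A : Set (ℝ × ℝ × (Fin K → ℝ)) := Ico 0 M.T ×ˢ Icc 0 M.νmax ×ˢ stdSimplex ℝ (Fin K) with hA
  have hcl : Icc 0 M.T ×ˢ Icc 0 M.νmax ×ˢ stdSimplex ℝ (Fin K) ⊆ closure A := by
    rw [hA, closure_prod_eq, closure_Ico M.T_pos.ne]
    exact prod_mono le_rfl subset_closure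
  have ht : ∀ y', Tendsto (fun y : ℝ × ℝ × (Fin K → ℝ) => M.u j y.1 y.2.1 y.2.2 z) (𝓝[A] y')
      (𝓝 (M.u j y'.1 y'.2.1 y'.2.2 z)) := by
    intro y'
    refine tendsto_of_seq_tendsto fun s hs => ?_
    obtain ⟨hs1, hs2⟩ := tendsto_nhdsWithin_iff.1 hs
    obtain ⟨N, hN⟩ := eventually_atTop.1 hs2
    -- The sequence lies in the set only from some index on, so it is shifted before the assumption
    -- is applied.
    refine (tendsto_add_atTop_iff_nat N).1 ?_
    have := h2.u_cont j (fun n => s (n + N)) y' (fun n => hN _ (Nat.le_add_left _ _))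
      ((tendsto_add_atTop_iff_nat N).2 hs1)
    exact this.tendsto_at hz
  refine (continuousOn_extendFrom hcl fun y _ => ⟨_, ht y⟩).congr fun y hy => ?_
  exact (extendFrom_eq (hcl hy) (ht y)).symm

namespace Assumption1

variable (h1 : M.Assumption1)
include h1

/-- Weak continuity covers bounded continuous test functions. These are dense in `L¹` of the
reference measure, and since the densities are bounded by one constant, the approximation of the
integral is uniform in `(t, ν)`. -/
theorem continuous_integral_cdens (h2 : M.Assumption2) (j : Fin K) {F : ℝ → ℝ} (hF : Integrable F M.etaQ) :
    Continuous (fun y : ℝ × ℝ => ∫ z, M.cdens y.1 j y.2 z * F z ∂M.etaQ) := by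
  have := h1.finite
  have hC := h1.C_pos
  refine continuous_of_uniform_approx_of_continuous fun u hu => ?_
  obtain ⟨ε, hε, hεu⟩ := Metric.mem_uniformity_dist.1 hu
  obtain ⟨φ, hφ, hφi⟩ := hF.exists_boundedContinuous_integral_sub_le
    (show 0 < ε / (2 * h1.C) by positivity)
  refine ⟨fun y => ∫ z, M.cdens y.1 j y.2 z * φ z ∂M.etaQ, ?_, fun y => hεu ?_⟩
  · have hc : Continuous (fun y : ℝ × ℝ => (M.clampT y.1, M.clampN y.2)) :=
      (continuous_clampT.comp continuous_fst).prodMk (continuous_clampN.comp continuous_snd)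
    refine ((h2.weak_cont j φ).comp_continuous hc
      (fun y => ⟨clampT_mem y.1, clampN_mem y.2⟩)).congr fun y => ?_
    show ∫ z, φ z ∂M.etaP (M.clampT y.1) j (M.clampN y.2) = _
    rw [h1.etaP_clamp, h1.integral_withDensity_cdens]
  · have hi : ∀ {G : ℝ → ℝ}, Integrable G M.etaQ →
        Integrable (fun z => M.cdens y.1 j y.2 z * G z) M.etaQ := fun hG =>
      hG.bdd_mul (h1.measurable_cdens_right _ _ _).aestronglyMeasurable (c := h1.C) (by
        filter_upwards [h1.cdens_bounds y.1 y.2] with z hz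
        rw [Real.norm_eq_abs, abs_of_pos ((inv_pos.2 hC).trans (hz j).1)]
        exact (hz j).2.le)
    rw [Real.dist_eq, ← integral_sub (hi hF) (hi hφi)]
    have hb : ‖∫ z, (M.cdens y.1 j y.2 z * F z - M.cdens y.1 j y.2 z * φ z) ∂M.etaQ‖
        ≤ ∫ z, h1.C * ‖F z - φ z‖ ∂M.etaQ := by
      refine norm_integral_le_of_norm_le ((hF.sub hφi).norm.const_mul _) ?_
      filter_upwards [h1.cdens_bounds y.1 y.2] with z hz
      rw [← mul_sub, norm_mul, Real.norm_eq_abs, abs_of_pos ((inv_pos.2 hC).trans (hz j).1)]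
      exact mul_le_mul_of_nonneg_right (hz j).2.le (norm_nonneg _)
    rw [integral_const_mul] at hb
    calc _ ≤ h1.C * ∫ z, ‖F z - φ z‖ ∂M.etaQ := hb
      _ ≤ h1.C * (ε / (2 * h1.C)) := mul_le_mul_of_nonneg_left hφ hC.le
      _ = ε / 2 := by field_simp
      _ < ε := by linarith

/-- Both the density and the post-jump value vary, and the density is controlled only through its
integrals. The difference is split: with the moving density, the change of the post-jump value tends
to zero by dominated convergence; with the post-jump value frozen, `continuous_integral_cdens`
applies. -/
theorem continuousOn_jumpMean (h2 : M.Assumption2) {v : PState K → ℝ} (hv : Measurable v)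
    (hcont : ContinuousOn v M.stateSpace) {γ C : ℝ} (hC : 0 ≤ C)
    (h : ∀ y ∈ M.stateSpace, |v y| ≤ C * M.bounding γ y) :
    ContinuousOn (fun y : PState K × ℝ => M.jumpMean v y.1 y.2)
      (M.stateSpace ×ˢ Icc 0 M.νmax) := by
  have := h1.finite
  have hCp := h1.C_pos
  rintro ⟨x, ν⟩ ⟨hx, hν⟩
  simp only at hx hν
  set S := M.stateSpace ×ˢ Icc 0 M.νmax with hS
  set l := 𝓝[S] (x, ν) with hl
  have hmem : ∀ᶠ y in l, y ∈ S := eventually_mem_nhdsWithin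
  have hfst : Tendsto (fun y : PState K × ℝ => y.1) l (𝓝 x) :=
    (continuous_fst.tendsto _).mono_left nhdsWithin_le_nhds
  have hsnd : Tendsto (fun y : PState K × ℝ => y.2) l (𝓝 ν) :=
    (continuous_snd.tendsto _).mono_left nhdsWithin_le_nhds
  have htime : Tendsto (fun y : PState K × ℝ => y.1.time) l (𝓝 x.time) :=
    (continuous_time.tendsto x).comp hfst
  have hfilt : Tendsto (fun y : PState K × ℝ => y.1.filt) l (𝓝 x.filt) :=
    (continuous_filt.tendsto x).comp hfst
  have hbd : Continuous (M.bounding (K := K) γ) :=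
    (continuous_price.mul continuous_inv).mul (Real.continuous_exp.comp
      (continuous_const.mul (continuous_const.sub continuous_time)))
  have hb1 : ∀ᶠ y in l, M.bounding γ y.1 ≤ M.bounding γ x + 1 :=
    ((hbd.tendsto x).comp hfst).eventually (eventually_le_nhds (lt_add_one _))
  set φ : PState K × ℝ → ℝ → ℝ := fun y z => v (M.jumpTo y.1 y.2 z) with hφ
  have hφm : ∀ y, Measurable (φ y) := fun y => hv.comp (h1.measurable_jumpTo_right _ _)
  have hφb : ∀ y ∈ S, ∀ᵐ z ∂M.etaQ, |φ y z| ≤ C * (h1.jumpBound * M.bounding γ y.1) := by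
    intro y hy
    filter_upwards [h1.support_ae, h1.jumpTo_mem hy.1 y.2] with z hz hm
    refine (h _ hm).trans (mul_le_mul_of_nonneg_left ?_ hC)
    have e : M.bounding γ (M.jumpTo y.1 y.2 z) = (1 + z) * M.bounding γ y.1 := by
      simp only [bounding, jumpTo, PState.price, PState.inv, PState.time]; ring
    rw [e]
    exact mul_le_mul_of_nonneg_right (h1.jump_le z hz).2 (bounding_nonneg hy.1 γ)
  have hφi : ∀ y ∈ S, Integrable (φ y) M.etaQ := fun y hy =>
    h1.integrable_of_ae_bounded (hφm y) (hφb y hy)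
  -- pointwise convergence of the post-jump values
  have hu : ∀ i, ∀ z ∈ M.etaQ.support, Tendsto (fun y : PState K × ℝ =>
      M.cdens y.1.time i y.2 z / M.mixDens y.1.time y.2 y.1.filt z) l
      (𝓝 (M.cdens x.time i ν z / M.mixDens x.time ν x.filt z)) := by
    intro i z hz
    have hc := h2.continuousOn_u i hz (x.time, ν, x.filt) ⟨time_mem hx, hν, filt_mem hx⟩
    have ht : Tendsto (fun y : PState K × ℝ => (y.1.time, y.2, y.1.filt)) l
        (𝓝[Icc 0 M.T ×ˢ Icc 0 M.νmax ×ˢ stdSimplex ℝ (Fin K)] (x.time, ν, x.filt)) := by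
      refine tendsto_nhdsWithin_iff.2 ⟨htime.prodMk_nhds (hsnd.prodMk_nhds hfilt), ?_⟩
      filter_upwards [hmem] with y hy using ⟨time_mem hy.1, hy.2, filt_mem hy.1⟩
    have h3 := (hc.tendsto.comp ht).add_const 1
    simp only [Function.comp_def] at h3
    rw [h1.u_eq (time_mem hx) hν, sub_add_cancel] at h3
    refine h3.congr' ?_
    filter_upwards [hmem] with y hy
    rw [h1.u_eq (time_mem hy.1) hy.2, sub_add_cancel]
  have hjump : ∀ z ∈ M.etaQ.support, Tendsto (fun y : PState K × ℝ => M.jumpTo y.1 y.2 z) l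
      (𝓝 (M.jumpTo x ν z)) := by
    intro z hz
    refine htime.prodMk_nhds (((continuous_inv.tendsto x).comp hfst).prodMk_nhds
      ((((continuous_price.tendsto x).comp hfst).mul_const _).prodMk_nhds
        (tendsto_pi_nhds.2 fun i => ?_)))
    exact ((tendsto_pi_nhds.1 hfilt) i).mul (hu i z hz)
  have hmemS : ∀ z, z ∈ M.etaQ.support → M.jumpTo x ν z ∈ M.stateSpace →
      (∀ᶠ y in l, M.jumpTo y.1 y.2 z ∈ M.stateSpace) → Tendsto (fun y => φ y z) l (𝓝 (φ (x, ν) z)) := by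
    intro z hz hm hev
    exact (hcont _ hm).tendsto.comp (tendsto_nhdsWithin_iff.2 ⟨hjump z hz, hev⟩)
  -- decomposition
  have hxS : (x, ν) ∈ S := ⟨hx, hν⟩
  have hD1 : Tendsto (fun y : PState K × ℝ => ∫ z, M.mixDens y.1.time y.2 y.1.filt z *
      (φ y z - φ (x, ν) z) ∂M.etaQ) l (𝓝 0) := by
    -- The null sets where post-jump states or density bounds fail depend on the point. Along a
    -- sequence they can be united into one.
    refine tendsto_of_seq_tendsto fun s hs => ?_
    obtain ⟨N, hN⟩ := eventually_atTop.1 ((hs.eventually hmem).and (hs.eventually hb1))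
    refine (tendsto_add_atTop_iff_nat N).1 ?_
    have hs' := (tendsto_add_atTop_iff_nat N).2 hs
    have hsS : ∀ n, s (n + N) ∈ S := fun n => (hN _ (Nat.le_add_left _ _)).1
    set B := C * (h1.jumpBound * (M.bounding γ x + 1)) with hB
    have hjb : 0 ≤ h1.jumpBound := zero_le_one.trans h1.one_le_jumpBound
    have hdom := tendsto_integral_of_dominated_convergence (μ := M.etaQ)
      (F := fun n z => M.mixDens (s (n + N)).1.time (s (n + N)).2 (s (n + N)).1.filt z *
        (φ (s (n + N)) z - φ (x, ν) z)) (f := fun _ => 0) (fun _ => h1.C * (B + B)) ?_ ?_ ?_ ?_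
    · simpa using hdom
    · exact fun n => ((h1.measurable_mixDens_right _ _ _).mul
        ((hφm _).sub (hφm _))).aestronglyMeasurable
    · exact integrable_const _
    · intro n
      filter_upwards [h1.mixDens_bounds (filt_mem (hsS n).1) (s (n + N)).1.time (s (n + N)).2,
        hφb _ (hsS n), hφb _ hxS] with z hz a1 a2
      rw [norm_mul, Real.norm_eq_abs, Real.norm_eq_abs,
        abs_of_nonneg ((inv_pos.2 hCp).le.trans hz.1)]
      refine mul_le_mul hz.2 ((abs_sub _ _).trans (add_le_add (a1.trans ?_) (a2.trans ?_)))
        (abs_nonneg _) hCp.le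
      · rw [hB]; gcongr; exact (hN _ (Nat.le_add_left _ _)).2
      · rw [hB]; gcongr; linarith
    · have hall : ∀ᵐ z ∂M.etaQ, ∀ n, M.jumpTo (s (n + N)).1 (s (n + N)).2 z ∈ M.stateSpace :=
        ae_all_iff.2 fun n => h1.jumpTo_mem (hsS n).1 _
      have hmb : ∀ᵐ z ∂M.etaQ, ∀ n, h1.C⁻¹ ≤ M.mixDens (s (n + N)).1.time (s (n + N)).2
          (s (n + N)).1.filt z ∧ M.mixDens (s (n + N)).1.time (s (n + N)).2
          (s (n + N)).1.filt z ≤ h1.C :=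
        ae_all_iff.2 fun n => h1.mixDens_bounds (filt_mem (hsS n).1) _ _
      filter_upwards [h1.support_ae, h1.jumpTo_mem hx ν, hall, hmb] with z hz hm ha hmz
      have h3 : Tendsto (fun n => φ (s (n + N)) z) atTop (𝓝 (φ (x, ν) z)) :=
        (hcont _ hm).tendsto.comp (tendsto_nhdsWithin_iff.2
          ⟨(hjump z hz).comp hs', Eventually.of_forall ha⟩)
      have h4 : Tendsto (fun n => φ (s (n + N)) z - φ (x, ν) z) atTop (𝓝 0) := by
        simpa using h3.sub_const (φ (x, ν) z)
      refine squeeze_zero_norm (a := fun n => h1.C * |φ (s (n + N)) z - φ (x, ν) z|)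
        (fun n => ?_) ?_
      · rw [norm_mul, Real.norm_eq_abs, Real.norm_eq_abs,
          abs_of_nonneg ((inv_pos.2 hCp).le.trans (hmz n).1)]
        exact mul_le_mul_of_nonneg_right (hmz n).2 (abs_nonneg _)
      · simpa using h4.abs.const_mul h1.C
  have hD2 : Tendsto (fun y : PState K × ℝ => ∫ z, M.mixDens y.1.time y.2 y.1.filt z *
      φ (x, ν) z ∂M.etaQ) l (𝓝 (∫ z, M.mixDens x.time ν x.filt z * φ (x, ν) z ∂M.etaQ)) := by
    have e : ∀ (t ν' : ℝ) (p : Fin K → ℝ), ∫ z, M.mixDens t ν' p z * φ (x, ν) z ∂M.etaQ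
        = ∑ j, p j * ∫ z, M.cdens t j ν' z * φ (x, ν) z ∂M.etaQ := by
      intro t ν' p
      simp only [mixDens, Finset.sum_mul, mul_assoc]
      rw [integral_finsetSum]
      · exact Finset.sum_congr rfl fun j _ => integral_const_mul _ _
      · intro j _
        refine Integrable.const_mul ((hφi _ hxS).bdd_mul
          (h1.measurable_cdens_right _ _ _).aestronglyMeasurable (c := h1.C) ?_) _
        filter_upwards [h1.cdens_bounds t ν'] with z hz
        rw [Real.norm_eq_abs, abs_of_pos ((inv_pos.2 hCp).trans (hz j).1)]
        exact (hz j).2.le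
    simp only [e]
    refine tendsto_finsetSum _ fun j _ => ((tendsto_pi_nhds.1 hfilt) j).mul ?_
    exact ((h1.continuous_integral_cdens h2 j (hφi _ hxS)).tendsto (x.time, ν)).comp
      (htime.prodMk_nhds hsnd)
  have hsum := hD1.add hD2
  rw [zero_add] at hsum
  change Tendsto _ l (𝓝 (M.jumpMean v x ν))
  rw [h1.jumpMean_eq (filt_mem hx) ν hv]
  refine hsum.congr' ?_
  filter_upwards [hmem] with y hy
  have hi : ∀ y', y' ∈ S → Integrable
      (fun z => M.mixDens y.1.time y.2 y.1.filt z * φ y' z) M.etaQ := fun y' hy' =>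
    (hφi y' hy').bdd_mul (h1.measurable_mixDens_right _ _ _).aestronglyMeasurable (c := h1.C) (by
      filter_upwards [h1.mixDens_bounds (filt_mem hy.1) y.1.time y.2] with z hz
      rw [Real.norm_eq_abs, abs_of_nonneg ((inv_pos.2 hCp).le.trans hz.1)]
      exact hz.2)
  rw [h1.jumpMean_eq (filt_mem hy.1) y.2 hv]
  simp only [mul_sub]
  rw [integral_sub (hi y hy) (hi _ hxS), sub_add_cancel]

end Assumption1

/-! ### Continuous dependence of the flow on the initial state and the control -/

theorem abs_clampT_sub_le (t t' : ℝ) : |M.clampT t - M.clampT t'| ≤ |t - t'| := by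
  refine (abs_max_sub_max_le_max 0 _ 0 _).trans (max_le (by simp) ?_)
  exact (abs_min_sub_min_le_max _ _ _ _).trans (max_le le_rfl (by simp))

theorem abs_clampN_sub_le (t t' : ℝ) : |M.clampN t - M.clampN t'| ≤ |t - t'| := by
  refine (abs_max_sub_max_le_max 0 _ 0 _).trans (max_le (by simp) ?_)
  exact (abs_min_sub_min_le_max _ _ _ _).trans (max_le le_rfl (by simp))

/-- Clamping does not increase distances and maps into a compact rectangle, so continuity there
becomes uniform continuity on the whole plane. -/
theorem Assumption2.stateRate_close (h2 : M.Assumption2) {ε : ℝ} (hε : 0 < ε) :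
    ∃ δ > 0, ∀ k t t' ν ν', |t - t'| < δ → |ν - ν'| < δ →
      |M.stateRate k t ν - M.stateRate k t' ν'| < ε := by
  set F : ℝ × ℝ → Fin K → ℝ := fun y k => M.stateRate k y.1 y.2 with hF
  have hc : Continuous F := continuous_pi fun k => h2.continuous_stateRate k
  have hcl : ∀ t ν, F (t, ν) = F (M.clampT t, M.clampN ν) := by
    intro t ν
    ext k
    simp only [hF, stateRate, clampT_of_mem (clampT_mem _), clampN_of_mem (clampN_mem _)]
  have hu := (isCompact_Icc (a := (0 : ℝ)) (b := M.T)).prod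
    (isCompact_Icc (a := (0 : ℝ)) (b := M.νmax)) |>.uniformContinuousOn_of_continuous
    hc.continuousOn
  obtain ⟨δ, hδ, h⟩ := Metric.uniformContinuousOn_iff.1 hu ε hε
  refine ⟨δ, hδ, fun k t t' ν ν' ht hν => ?_⟩
  have h3 := h (M.clampT t, M.clampN ν) ⟨clampT_mem _, clampN_mem _⟩
    (M.clampT t', M.clampN ν') ⟨clampT_mem _, clampN_mem _⟩ (by
      rw [Prod.dist_eq]
      exact max_lt ((abs_clampT_sub_le t t').trans_lt ht) ((abs_clampN_sub_le ν ν').trans_lt hν))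
  rw [← hcl, ← hcl] at h3
  exact (dist_le_pi_dist _ _ k).trans_lt h3

/-- Normalization is stable because the total masses are at least one and each component is at most
the total. -/
theorem abs_div_sub_div_le {a b S S' : ℝ} (hb0 : 0 ≤ b) (hb : b ≤ S')
    (hS : 1 ≤ S) (hS' : 1 ≤ S') : |a / S - b / S'| ≤ |a - b| + |S - S'| := by
  have h1 : 0 < S := by linarith
  have h2 : 0 < S' := by linarith
  have e : a / S - b / S' = ((a - b) - (b / S') * (S - S')) / S := by
    field_simp
    ring
  have hq0 : 0 ≤ b / S' := by positivity
  have hq1 : b / S' ≤ 1 := (div_le_one h2).2 hb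
  rw [e, abs_div, abs_of_pos h1]
  refine (div_le_self (abs_nonneg _) hS).trans ((abs_sub _ _).trans (add_le_add le_rfl ?_))
  rw [abs_mul, abs_of_nonneg hq0]
  exact mul_le_of_le_one_left (abs_nonneg _) hq1

namespace Assumption1

variable (h1 : M.Assumption1)
include h1

theorem coef_abs_le (α : ℝ → ℝ) (x : PState K) (r : ℝ) (k j : Fin K) : |h1.coef α x r k j| ≤ h1.bd := by
  rw [abs_of_nonneg (h1.coef_nonneg α x r k j)]; exact h1.coef_le α x r k j

theorem bd_nonneg : 0 ≤ h1.bd := add_nonneg h1.β_nonneg h1.sum_abs_q_nonneg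

/-- Two linear systems are compared by Gronwall's inequality: the forcing consists of the difference
of the initial values and of the difference of the coefficients times a bound for the masses. The
modulus `δ` depends on `ε` only, not on the states or the controls. -/
theorem mass_close (h2 : M.Assumption2) {ε : ℝ} (hε : 0 < ε) :
    ∃ δ > 0, ∀ (α α' : ℝ → ℝ) (x x' : PState K), Measurable α → Measurable α' →
      x.filt ∈ stdSimplex ℝ (Fin K) → x'.filt ∈ stdSimplex ℝ (Fin K) →
      |x.time - x'.time| < δ → (∀ k, |x.filt k - x'.filt k| < δ) →
      (∀ v ∈ Icc 0 M.T, |α v - α' v| < δ) →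
      ∀ v ∈ Icc 0 M.T, ∀ k, |h1.mass α x v k - h1.mass α' x' v k| ≤ ε := by
  have hbd := h1.bd_nonneg
  have hT := M.T_pos
  set A := Real.exp (K * h1.bd * M.T) with hA
  have hA0 : 0 < A := Real.exp_pos _
  set G := 2 * Real.exp (2 * (K * h1.bd) * M.T) with hG
  have hG0 : 0 < G := by positivity
  -- `G` is the Gronwall factor and `A` bounds the masses. The tolerances for the intensities and
  -- for the initial filter are chosen so that, after summation over the `K` components and
  -- multiplication by `G`, each contributes `K / (K + 1) * (ε / 2)`.
  obtain ⟨δ, hδ, hδr⟩ := h2.stateRate_close (show 0 < ε / (2 * G * ((K + 1) * (A * M.T))) by positivity)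
  set η := ε / (2 * G * ((K + 1) * (A * M.T))) with hη
  refine ⟨min δ (ε / (2 * G * (K + 1))), lt_min hδ (by positivity), ?_⟩
  intro α α' x x' hα hα' hx hx' ht hf hαα v hv k
  have hηpos : 0 < η := by positivity
  set δ' := ε / (2 * G * (K + 1)) with hδ'
  have hδ'pos : 0 < δ' := by positivity
  set D : ℝ → ℝ := fun v => ∑ k, |h1.mass α x v k - h1.mass α' x' v k| with hD
  have hprim := fun k => h1.mass_isPrim (x := x) hα hT.le k
  have hprim' := fun k => h1.mass_isPrim (x := x') hα' hT.le k
  have hDc : ContinuousOn D (Icc 0 M.T) := continuousOn_finsetSum _ fun k _ =>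
    ((hprim k).continuousOn.sub (hprim' k).continuousOn).abs
  have hDi : ∀ v ∈ Icc 0 M.T, IntervalIntegrable D volume 0 v := fun v hv =>
    (hDc.mono (by rw [uIcc_of_le hv.1]; exact Icc_subset_Icc_right hv.2)).intervalIntegrable
  have hmle : ∀ v ∈ Icc 0 M.T, ∀ k, |h1.mass α' x' v k| ≤ A := by
    intro v hv k
    rw [abs_of_nonneg (h1.mass_nonneg hα' hv.1 k)]
    refine (h1.mass_le hα' hx' hv.1 k).trans (Real.exp_le_exp.2 ?_)
    exact mul_le_mul_of_nonneg_left hv.2 (by positivity)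
  have hstep : ∀ v ∈ Icc 0 M.T, ∀ k,
      |∑ j, h1.coef α x v k j * h1.mass α x v j - ∑ j, h1.coef α' x' v k j * h1.mass α' x' v j|
      ≤ h1.bd * D v + η * A := by
    intro v hv k
    have e : ∑ j, h1.coef α x v k j * h1.mass α x v j - ∑ j, h1.coef α' x' v k j * h1.mass α' x' v j
        = ∑ j, h1.coef α x v k j * (h1.mass α x v j - h1.mass α' x' v j)
          + (M.stateRate k (x'.time + v) (α' v) - M.stateRate k (x.time + v) (α v))
            * h1.mass α' x' v k := by
      have e2 : ∑ j, (h1.coef α x v k j - h1.coef α' x' v k j) * h1.mass α' x' v j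
          = (M.stateRate k (x'.time + v) (α' v) - M.stateRate k (x.time + v) (α v))
            * h1.mass α' x' v k := by
        have : ∀ j, (h1.coef α x v k j - h1.coef α' x' v k j) * h1.mass α' x' v j
            = if k = j then (M.stateRate k (x'.time + v) (α' v) - M.stateRate k (x.time + v) (α v))
            * h1.mass α' x' v j else 0 := by
          intro j
          simp only [coef]
          split_ifs <;> ring
        simp only [this, Finset.sum_ite_eq, Finset.mem_univ, if_true]
      rw [← e2, ← Finset.sum_add_distrib, ← Finset.sum_sub_distrib]
      exact Finset.sum_congr rfl fun j _ => by ring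
    rw [e]
    refine (abs_add_le _ _).trans (add_le_add ?_ ?_)
    · rw [hD, Finset.mul_sum]
      refine (Finset.abs_sum_le_sum_abs _ _).trans (Finset.sum_le_sum fun j _ => ?_)
      rw [abs_mul]
      exact mul_le_mul_of_nonneg_right (h1.coef_abs_le _ _ _ _ _) (abs_nonneg _)
    · rw [abs_mul]
      refine mul_le_mul (hδr _ _ _ _ _ ?_ ?_).le (hmle v hv k) (abs_nonneg _) hηpos.le
      · rw [add_sub_add_right_eq_sub, abs_sub_comm]; exact ht.trans_le (min_le_left _ _)
      · rw [abs_sub_comm]; exact (hαα v hv).trans_le (min_le_left _ _)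
  have hineq : ∀ v ∈ Icc 0 M.T, D v ≤ (K * δ' + K * (η * A * M.T))
      + (K * h1.bd) * ∫ r in (0 : ℝ)..v, D r := by
    intro v hv
    have hk : ∀ k, |h1.mass α x v k - h1.mass α' x' v k| ≤ δ' + (η * A * M.T
        + h1.bd * ∫ r in (0 : ℝ)..v, D r) := by
      intro k
      have hi := ((hprim k).mono hv).integrable
      have hi' := ((hprim' k).mono hv).integrable
      rw [(hprim k).eq v hv, (hprim' k).eq v hv, h1.mass_zero _ hα, h1.mass_zero _ hα',
        abs_of_nonneg (hx.1 k), abs_of_nonneg (hx'.1 k), add_sub_add_comm,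
        ← intervalIntegral.integral_sub hi hi']
      refine (abs_add_le _ _).trans (add_le_add ((hf k).le.trans (min_le_right _ _)) ?_)
      have hb := intervalIntegral.norm_integral_le_of_norm_le (μ := volume) hv.1
        (f := fun r => ∑ j, h1.coef α x r k j * h1.mass α x r j
          - ∑ j, h1.coef α' x' r k j * h1.mass α' x' r j)
        (g := fun r => h1.bd * D r + η * A)
        (Eventually.of_forall fun r hr => hstep r ⟨hr.1.le, hr.2.trans hv.2⟩ k)
        (((hDi v hv).const_mul _).add intervalIntegrable_const)
      refine hb.trans ?_
      rw [intervalIntegral.integral_add ((hDi v hv).const_mul _) intervalIntegrable_const,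
        intervalIntegral.integral_const_mul, intervalIntegral.integral_const, smul_eq_mul, sub_zero]
      have : v * (η * A) ≤ M.T * (η * A) := mul_le_mul_of_nonneg_right hv.2 (by positivity)
      linarith
    calc D v ≤ ∑ _k : Fin K, (δ' + (η * A * M.T + h1.bd * ∫ r in (0 : ℝ)..v, D r)) :=
          Finset.sum_le_sum fun k _ => hk k
      _ = _ := by rw [Finset.sum_const, Finset.card_univ, Fintype.card_fin, nsmul_eq_mul]; ring
  obtain ⟨B, hB⟩ := (isCompact_Icc.image_of_continuousOn hDc).bddAbove
  have hgr := gronwall_integral (by positivity) (by positivity) (hDi M.T ⟨hT.le, le_rfl⟩)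
    (fun v hv => hB (mem_image_of_mem _ hv)) hineq v hv
  calc |h1.mass α x v k - h1.mass α' x' v k| ≤ D v :=
        Finset.single_le_sum (f := fun k => |h1.mass α x v k - h1.mass α' x' v k|)
          (fun _ _ => abs_nonneg _) (Finset.mem_univ k)
    _ ≤ _ := hgr
    _ ≤ (K * δ' + K * (η * A * M.T)) * G := by
        rw [hG]
        have : Real.exp (2 * (K * h1.bd) * v) ≤ Real.exp (2 * (K * h1.bd) * M.T) :=
          Real.exp_le_exp.2 (mul_le_mul_of_nonneg_left hv.2 (by positivity))
        have h0 : 0 ≤ K * δ' + K * (η * A * M.T) := by positivity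
        nlinarith
    _ = (K / (K + 1)) * ε := by
        rw [hδ', hη]; field_simp; ring
    _ ≤ ε := mul_le_of_le_one_left hε.le ((div_le_one (by positivity)).2 (by linarith))

theorem totalMass_close {α α' : ℝ → ℝ} {x x' : PState K} {v ε : ℝ}
    (h : ∀ k, |h1.mass α x v k - h1.mass α' x' v k| ≤ ε) :
    |h1.totalMass α x v - h1.totalMass α' x' v| ≤ K * ε := by
  rw [totalMass, totalMass, ← Finset.sum_sub_distrib]
  refine (Finset.abs_sum_le_sum_abs _ _).trans ((Finset.sum_le_sum fun k _ => h k).trans ?_)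
  simp

theorem surv_close {α α' : ℝ → ℝ} {x x' : PState K} {v ε : ℝ} (hv : 0 ≤ v)
    (h : ∀ k, |h1.mass α x v k - h1.mass α' x' v k| ≤ ε) :
    |h1.surv α x v - h1.surv α' x' v| ≤ K * ε := by
  rw [surv, surv, ← mul_sub, abs_mul, abs_of_pos (Real.exp_pos _)]
  refine (mul_le_of_le_one_left (abs_nonneg _) (Real.exp_le_one_iff.2 ?_)).trans
    (h1.totalMass_close h)
  have := mul_nonneg h1.β_nonneg hv
  linarith

theorem filtFlow_close {α α' : ℝ → ℝ} {x x' : PState K} (hα : Measurable α) (hα' : Measurable α')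
    (hx : x.filt ∈ stdSimplex ℝ (Fin K)) (hx' : x'.filt ∈ stdSimplex ℝ (Fin K)) {v ε : ℝ}
    (hv : 0 ≤ v) (h : ∀ k, |h1.mass α x v k - h1.mass α' x' v k| ≤ ε) (k : Fin K) :
    |h1.filtFlow α x v k - h1.filtFlow α' x' v k| ≤ (K + 1) * ε := by
  refine (abs_div_sub_div_le (h1.mass_nonneg hα' hv k)
    (Finset.single_le_sum (f := fun k => h1.mass α' x' v k)
      (fun k _ => h1.mass_nonneg hα' hv k) (Finset.mem_univ k))
    (h1.one_le_totalMass hα hx hv) (h1.one_le_totalMass hα' hx' hv)).trans ?_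
  have h3 := h1.totalMass_close h
  calc _ ≤ ε + K * ε := add_le_add (h k) h3
    _ = _ := by ring

theorem abs_surv_sub_le {α : ℝ → ℝ} {x : PState K} (hα : Measurable α)
    (hx : x.filt ∈ stdSimplex ℝ (Fin K)) {v v' : ℝ} (hv : 0 ≤ v) (hvv : v ≤ v') :
    |h1.surv α x v' - h1.surv α x v| ≤ h1.β * (v' - v) := by
  have hp := h1.surv_isPrim hα hx (hv.trans hvv)
  have hi := hp.integrable
  have hi' := (hp.mono ⟨hv, hvv⟩).integrable
  rw [hp.eq v' ⟨hv.trans hvv, le_rfl⟩, hp.eq v ⟨hv, hvv⟩, add_sub_add_left_eq_sub,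
    intervalIntegral.integral_interval_sub_left hi hi']
  refine (intervalIntegral.norm_integral_le_of_norm_le_const (C := h1.β)
    (f := fun r => -(h1.flowRate α x r * h1.surv α x r)) fun r hr => ?_).trans
    (by rw [abs_of_nonneg (sub_nonneg.2 hvv)])
  rw [uIoc_of_le hvv] at hr
  have hr0 : 0 ≤ r := hv.trans hr.1.le
  have h3 := h1.flowRate_nonneg hα hx hr0
  have h4 := (h1.surv_pos hα hx hr0).le
  rw [norm_neg, Real.norm_eq_abs, abs_of_nonneg (mul_nonneg h3 h4)]
  calc _ ≤ h1.β * 1 := mul_le_mul (h1.flowRate_le hα hx hr0) (h1.surv_le_one hα hx hr0) h4 h1.β_nonneg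
    _ = _ := mul_one _

/-! ### Convergence of the one-period problem -/

section Convergence

variable {ι : Type*} {l : Filter ι} {x : PState K} {y : ι → PState K} {α α' : ι → ℝ → ℝ} {d : ι → ℝ}

/-- The controls `α i` are not assumed to converge; only the distance between `α i` and `α' i` tends
to zero. All statements are therefore about differences, and the uniform modulus of `mass_close` is
essential. -/
theorem tendsto_mass (h2 : M.Assumption2) (hx : x ∈ M.stateSpace) (hy : ∀ i, y i ∈ M.stateSpace)
    (hlim : Tendsto y l (𝓝 x)) (hα : ∀ i, Measurable (α i)) (hα' : ∀ i, Measurable (α' i))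
    (hd : Tendsto d l (𝓝 0)) (hαα : ∀ i, ∀ v ∈ Icc 0 M.T, |α' i v - α i v| ≤ d i) {ε : ℝ} (hε : 0 < ε) :
    ∀ᶠ i in l, ∀ v ∈ Icc 0 M.T, ∀ k,
      |h1.mass (α' i) (y i) v k - h1.mass (α i) x v k| ≤ ε := by
  obtain ⟨δ, hδ, h⟩ := h1.mass_close h2 hε
  have ht : ∀ᶠ i in l, |(y i).time - x.time| < δ :=
    ((continuous_time.tendsto x).comp hlim).eventually (Metric.ball_mem_nhds _ hδ)
  have hf : ∀ᶠ i in l, ∀ k, |(y i).filt k - x.filt k| < δ := by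
    rw [eventually_all]
    intro k
    exact (((tendsto_pi_nhds.1 (continuous_filt.tendsto x)) k).comp hlim).eventually
      (Metric.ball_mem_nhds _ hδ)
  filter_upwards [ht, hf, hd.eventually (eventually_lt_nhds hδ)] with i a1 a2 a3
  exact h _ _ _ _ (hα' i) (hα i) (filt_mem (hy i)) (filt_mem hx) a1 a2
    fun v hv => (hαα i v hv).trans_lt a3

theorem tendsto_surv (h2 : M.Assumption2) (hx : x ∈ M.stateSpace) (hy : ∀ i, y i ∈ M.stateSpace)
    (hlim : Tendsto y l (𝓝 x)) (hα : ∀ i, Measurable (α i)) (hα' : ∀ i, Measurable (α' i))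
    (hd : Tendsto d l (𝓝 0)) (hαα : ∀ i, ∀ v ∈ Icc 0 M.T, |α' i v - α i v| ≤ d i) {v : ι → ℝ}
    (hv : ∀ i, v i ∈ Icc 0 M.T) :
    Tendsto (fun i => h1.surv (α' i) (y i) (v i) - h1.surv (α i) x (v i)) l (𝓝 0) := by
  rw [Metric.tendsto_nhds]
  intro ε hε
  filter_upwards [h1.tendsto_mass h2 hx hy hlim hα hα' hd hαα
    (show 0 < ε / (K + 1) by positivity)] with i hi
  rw [Real.dist_0_eq_abs]
  refine (h1.surv_close (hv i).1 (hi _ (hv i))).trans_lt ?_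
  rw [← mul_div_assoc, div_lt_iff₀ (by positivity)]
  nlinarith

theorem tendsto_dist_expFlow (h2 : M.Assumption2) (hx : x ∈ M.stateSpace)
    (hy : ∀ i, y i ∈ M.stateSpace) (hlim : Tendsto y l (𝓝 x)) (hα : ∀ i, M.IsControl (α i))
    (hα' : ∀ i, M.IsControl (α' i)) (hd : Tendsto d l (𝓝 0))
    (hαα : ∀ i, ∀ v ∈ Icc 0 M.T, |α' i v - α i v| ≤ d i) {v : ℝ} (hv : v ∈ Icc 0 M.T) :
    Tendsto (fun i => dist (h1.expFlow (α' i) (y i) v) (h1.expFlow (α i) x v)) l (𝓝 0) := by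
  have ht : Tendsto (fun i => dist ((y i).time + v) (x.time + v)) l (𝓝 0) := by
    simp only [dist_add_right]
    exact tendsto_iff_dist_tendsto_zero.1 ((continuous_time.tendsto x).comp hlim)
  have hw : Tendsto (fun i => dist ((y i).inv - ∫ r in (0 : ℝ)..v, α' i r)
      (x.inv - ∫ r in (0 : ℝ)..v, α i r)) l (𝓝 0) := by
    have h3 := tendsto_iff_dist_tendsto_zero.1 ((continuous_inv.tendsto x).comp hlim)
    refine squeeze_zero (fun _ => dist_nonneg) (fun i => dist_sub_sub_le _ _ _ _) ?_
    have h4 : Tendsto (fun i => dist (∫ r in (0 : ℝ)..v, α' i r) (∫ r in (0 : ℝ)..v, α i r)) l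
        (𝓝 0) := by
      refine squeeze_zero (g := fun i => d i * |v - 0|) (fun _ => dist_nonneg) (fun i => ?_)
        (by simpa using hd.mul_const _)
      rw [Real.dist_eq, ← intervalIntegral.integral_sub ((hα' i).intervalIntegrable _ _)
        ((hα i).intervalIntegrable _ _)]
      refine intervalIntegral.norm_integral_le_of_norm_le_const
        (f := fun r => α' i r - α i r) fun r hr => hαα i r ?_
      rw [uIoc_of_le hv.1] at hr
      exact ⟨hr.1.le, hr.2.trans hv.2⟩
    simpa using h3.add h4
  have hp : Tendsto (fun i => dist (y i).price x.price) l (𝓝 0) :=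
    tendsto_iff_dist_tendsto_zero.1 ((continuous_price.tendsto x).comp hlim)
  have hf : Tendsto (fun i => dist (h1.filtFlow (α' i) (y i) v) (h1.filtFlow (α i) x v)) l
      (𝓝 0) := by
    rw [Metric.tendsto_nhds]
    intro ε hε
    filter_upwards [h1.tendsto_mass h2 hx hy hlim (fun i => (hα i).1) (fun i => (hα' i).1) hd hαα
      (show 0 < ε / (K + 2) by positivity)] with i hi
    rw [Real.dist_0_eq_abs, abs_of_nonneg dist_nonneg, dist_pi_lt_iff hε]
    intro k
    refine (h1.filtFlow_close (hα' i).1 (hα i).1 (filt_mem (hy i)) (filt_mem hx) hv.1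
      (hi v hv) k).trans_lt ?_
    rw [← mul_div_assoc, div_lt_iff₀ (by positivity)]
    nlinarith
  have := ht.max (hw.max (hp.max hf))
  simp only [max_self] at this
  exact this

end Convergence

end Assumption1

/-! ### Continuity of the Bellman operator -/

theorem tendsto_mul_sub_mul {ι : Type*} {l : Filter ι} {a a' b b' : ι → ℝ} {A B : ℝ}
    (ha : ∀ᶠ i in l, |a' i| ≤ A) (hb : ∀ᶠ i in l, |b i| ≤ B)
    (h : Tendsto (fun i => a' i - a i) l (𝓝 0)) (h' : Tendsto (fun i => b' i - b i) l (𝓝 0)) :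
    Tendsto (fun i => a' i * b' i - a i * b i) l (𝓝 0) := by
  refine squeeze_zero_norm' (a := fun i => A * |b' i - b i| + |a' i - a i| * B) ?_
    (by simpa using (h'.abs.const_mul A).add (h.abs.mul_const B))
  filter_upwards [ha, hb] with i h1 h2
  have e : a' i * b' i - a i * b i = a' i * (b' i - b i) + (a' i - a i) * b i := by ring
  rw [e]
  refine (norm_add_le _ _).trans (add_le_add ?_ ?_)
  · rw [norm_mul]; exact mul_le_mul_of_nonneg_right h1 (norm_nonneg _)
  · rw [norm_mul]; exact mul_le_mul_of_nonneg_left h2 (norm_nonneg _)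

/-- States with price at most `S`. -/
def cappedSpace (M : LiquidationModel K) (S : ℝ) : Set (PState K) :=
  Icc 0 M.T ×ˢ Icc 0 M.w₀ ×ˢ Icc 0 S ×ˢ stdSimplex ℝ (Fin K)

theorem isCompact_cappedSpace (S : ℝ) : IsCompact (M.cappedSpace S) :=
  isCompact_Icc.prod (isCompact_Icc.prod (isCompact_Icc.prod (isCompact_stdSimplex ℝ (Fin K))))

theorem cappedSpace_subset (S : ℝ) : M.cappedSpace S ⊆ M.stateSpace := fun _ hx =>
  ⟨hx.1, hx.2.1, hx.2.2.1.1, hx.2.2.2⟩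

theorem mem_cappedSpace {x : PState K} (hx : x ∈ M.stateSpace) {S : ℝ} (hS : x.price ≤ S) :
    x ∈ M.cappedSpace S := ⟨hx.1, hx.2.1, ⟨hx.2.2.1, hS⟩, hx.2.2.2⟩

theorem continuous_bounding (γ : ℝ) : Continuous (M.bounding (K := K) γ) :=
  (continuous_price.mul continuous_inv).mul (Real.continuous_exp.comp
    (continuous_const.mul (continuous_const.sub continuous_time)))

/-- Neither family of points need converge, so continuity at a point is of no use; uniform
continuity on a compact set takes its place. -/
theorem tendsto_sub_of_uniform {ι X : Type*} [PseudoMetricSpace X] {l : Filter ι} {f : X → ℝ}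
    {s : Set X} (hs : IsCompact s) (hf : ContinuousOn f s) {p q : ι → X}
    (hp : ∀ᶠ i in l, p i ∈ s) (hq : ∀ᶠ i in l, q i ∈ s)
    (h : Tendsto (fun i => dist (p i) (q i)) l (𝓝 0)) :
    Tendsto (fun i => f (p i) - f (q i)) l (𝓝 0) := by
  rw [Metric.tendsto_nhds]
  intro ε hε
  obtain ⟨δ, hδ, h2⟩ := Metric.uniformContinuousOn_iff.1
    (hs.uniformContinuousOn_of_continuous hf) ε hε
  filter_upwards [hp, hq, h.eventually (eventually_lt_nhds hδ)] with i h3 h4 h5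
  rw [Real.dist_0_eq_abs]
  exact h2 _ h3 _ h4 h5

namespace Assumption1

variable (h1 : M.Assumption1)

/-- The running reward plus the continuation value, per unit of time. -/
noncomputable def running (h1 : M.Assumption1) (v : PState K → ℝ) (α : ℝ → ℝ) (x : PState K)
    (r : ℝ) : ℝ :=
  Real.exp (-M.ρ * r) * h1.surv α x r *
    (M.gain (α r) * x.price + M.jumpMean v (h1.expFlow α x r) (α r))

/-- The reward of one period plus the continuation value. -/
noncomputable def totalReward (h1 : M.Assumption1) (v : PState K → ℝ) (α : ℝ → ℝ)
    (x : PState K) : ℝ := h1.rewardPart α x + h1.contPart v α x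

include h1

section

variable {α : ℝ → ℝ} {x : PState K} {v : PState K → ℝ} {γ C : ℝ}

theorem measurable_running (hv : Measurable v) (hα : Measurable α) (x : PState K) :
    Measurable (h1.running v α x) :=
  (Measurable.mul (by fun_prop) (h1.measurable_surv hα x)).mul
    (((continuous_gain.measurable.comp hα).mul_const _).add
      ((h1.measurable_jumpMean hv).comp ((h1.measurable_expFlow hα x).prodMk hα)))

theorem abs_jumpMean_expFlow_le (hα : M.IsAdmissible α x) (hx : x ∈ M.stateSpace) (hv : Measurable v)
    (hγ : 0 ≤ γ) (hC : 0 ≤ C) (h : ∀ y ∈ M.stateSpace, |v y| ≤ C * M.bounding γ y) {r : ℝ}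
    (hr : r ∈ Icc 0 (M.T - x.time)) :
    |M.jumpMean v (h1.expFlow α x r) (α r)| ≤ C * h1.jumpRateBound * M.bounding γ x := by
  have hR := h1.jumpRateBound_nonneg
  refine (h1.abs_jumpMean_le (h1.expFlow_mem hα hx hr) (α r) hv hC h).trans
    (mul_le_mul_of_nonneg_left ?_ (by positivity))
  refine (h1.bounding_expFlow_le hα hx hr.1 γ).trans (mul_le_of_le_one_right (bounding_nonneg hx γ) ?_)
  exact Real.exp_le_one_iff.2 (by nlinarith [hr.1])

theorem abs_gain_price_le (hα : M.IsControl α) (hx : x ∈ M.stateSpace) (r : ℝ) :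
    |M.gain (α r) * x.price| ≤ (1 + M.f M.νmax) * M.νmax * x.price := by
  rw [abs_mul, abs_of_nonneg (price_nonneg hx)]
  have := M.f_νmax_nonneg
  exact mul_le_mul_of_nonneg_right ((abs_gain_le (hα.2 r)).trans
    (mul_le_mul_of_nonneg_left (hα.2 r).2 (by positivity))) (price_nonneg hx)

theorem abs_running_le (hα : M.IsAdmissible α x) (hx : x ∈ M.stateSpace) (hv : Measurable v)
    (hγ : 0 ≤ γ) (hC : 0 ≤ C) (h : ∀ y ∈ M.stateSpace, |v y| ≤ C * M.bounding γ y) {r : ℝ}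
    (hr : r ∈ Icc 0 (M.T - x.time)) :
    |h1.running v α x r| ≤ (1 + M.f M.νmax) * M.νmax * x.price
      + C * h1.jumpRateBound * M.bounding γ x := by
  have hd := h1.discount_mem hα.1.1 hx hr.1
  rw [running, abs_mul, abs_of_nonneg hd.1]
  exact (mul_le_of_le_one_left (abs_nonneg _) hd.2).trans ((abs_add_le _ _).trans
    (add_le_add (h1.abs_gain_price_le hα.1 hx r) (h1.abs_jumpMean_expFlow_le hα hx hv hγ hC h hr)))

theorem intervalIntegrable_gain (hα : M.IsAdmissible α x) (hx : x ∈ M.stateSpace) :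
    IntervalIntegrable (fun r => Real.exp (-M.ρ * r) * h1.surv α x r * (M.gain (α r) * x.price))
      volume 0 (M.T - x.time) := by
  refine intervalIntegrable_of_bounded ((Measurable.mul (by fun_prop)
    (h1.measurable_surv hα.1.1 x)).mul ((continuous_gain.measurable.comp hα.1.1).mul_const _))
    (horizon_nonneg hx) (C := (1 + M.f M.νmax) * M.νmax * x.price) fun r hr => ?_
  have hd := h1.discount_mem hα.1.1 hx hr.1
  change |Real.exp (-M.ρ * r) * h1.surv α x r * (M.gain (α r) * x.price)| ≤ _
  rw [abs_mul, abs_of_nonneg hd.1]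
  exact (mul_le_of_le_one_left (abs_nonneg _) hd.2).trans (h1.abs_gain_price_le hα.1 hx r)

theorem totalReward_eq (hα : M.IsAdmissible α x) (hx : x ∈ M.stateSpace) (hv : Measurable v)
    (hγ : 0 ≤ γ) (hC : 0 ≤ C) (h : ∀ y ∈ M.stateSpace, |v y| ≤ C * M.bounding γ y) :
    h1.totalReward v α x = (∫ r in (0 : ℝ)..(M.T - x.time), h1.running v α x r)
      + Real.exp (-M.ρ * (M.T - x.time)) * h1.surv α x (M.T - x.time)
        * (M.hext (h1.expFlow α x (M.T - x.time)).inv * x.price) := by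
  simp only [running, mul_add]
  rw [intervalIntegral.integral_add (h1.intervalIntegrable_gain hα hx)
    (h1.intervalIntegrable_cont hα hx hv hγ hC h), totalReward, rewardPart, contPart]
  ring

theorem totalReward_congr {α' : ℝ → ℝ} (hx : x ∈ M.stateSpace)
    (h : ∀ r ∈ Icc 0 (M.T - x.time), α r = α' r) :
    h1.totalReward v α x = h1.totalReward v α' x := by
  have hL := horizon_nonneg hx
  have hm : M.T - x.time ∈ Icc 0 (M.T - x.time) := ⟨hL, le_rfl⟩
  unfold totalReward rewardPart contPart
  rw [h1.surv_congr h hm, h1.expFlow_congr h hm]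
  have e1 : ∀ (f g : ℝ → ℝ), (∀ r ∈ Icc 0 (M.T - x.time), f r = g r) →
      ∫ r in (0 : ℝ)..(M.T - x.time), f r = ∫ r in (0 : ℝ)..(M.T - x.time), g r := fun f g hfg =>
    intervalIntegral.integral_congr fun r hr => hfg r (by rwa [uIcc_of_le hL] at hr)
  refine congrArg₂ (· + ·) (congrArg₂ (· + ·) ?_ rfl) ?_
  · exact e1 _ _ fun r hr => by rw [h1.surv_congr h hr, h r hr]
  · exact e1 _ _ fun r hr => by rw [h1.surv_congr h hr, h r hr, h1.expFlow_congr h hr]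

theorem abs_totalReward_le (hα : M.IsAdmissible α x) (hx : x ∈ M.stateSpace) (hv : Measurable v)
    (hγ : 0 < γ) (hC : 0 ≤ C) (h : ∀ y ∈ M.stateSpace, |v y| ≤ C * M.bounding γ y) :
    |h1.totalReward v α x| ≤ (2 + M.f M.νmax + C * (h1.jumpRateBound / γ)) * M.bounding γ x := by
  have hf := M.f_νmax_nonneg
  refine (abs_add_le _ _).trans ((add_le_add ((h1.abs_rewardPart_le hα hx).trans
    (mul_le_mul_of_nonneg_left (price_mul_inv_le_bounding hx hγ.le) (by positivity)))
    (h1.abs_contPart_le hα hx hv hγ hC h)).trans (le_of_eq (by ring)))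

end

section Convergence

variable {ι : Type*} {l : Filter ι} {x : PState K} {y : ι → PState K} {α α' : ι → ℝ → ℝ} {d : ι → ℝ}
  {v : PState K → ℝ} {γ C : ℝ}

/-- At a fixed time before the horizon each factor of the integrand is compared separately. The only
unbounded coordinate is the price, which is constant along the flow; bounding it by `x.price + 1`
places all relevant states in a compact set. -/
theorem tendsto_running (h2 : M.Assumption2) (hv : Measurable v) (hcont : ContinuousOn v M.stateSpace)
    (hγ : 0 ≤ γ) (hC : 0 ≤ C) (hvb : ∀ y ∈ M.stateSpace, |v y| ≤ C * M.bounding γ y)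
    (hx : x ∈ M.stateSpace) (hy : ∀ i, y i ∈ M.stateSpace)
    (hlim : Tendsto y l (𝓝 x)) (hα : ∀ i, M.IsAdmissible (α i) x)
    (hα' : ∀ i, M.IsAdmissible (α' i) (y i)) (hd : Tendsto d l (𝓝 0))
    (hαα : ∀ i, ∀ v ∈ Icc 0 M.T, |α' i v - α i v| ≤ d i) {r : ℝ} (hr : 0 ≤ r)
    (hrx : r < M.T - x.time) :
    Tendsto (fun i => h1.running v (α' i) (y i) r - h1.running v (α i) x r) l (𝓝 0) := by
  have htime : Tendsto (fun i => (y i).time) l (𝓝 x.time) := (continuous_time.tendsto x).comp hlim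
  have hprice : Tendsto (fun i => (y i).price) l (𝓝 x.price) :=
    (continuous_price.tendsto x).comp hlim
  have hrT : r ∈ Icc 0 M.T := ⟨hr, by linarith [(time_mem hx).1]⟩
  have hry : ∀ᶠ i in l, r ∈ Icc 0 (M.T - (y i).time) := by
    filter_upwards [(htime.const_sub M.T).eventually (eventually_gt_nhds hrx)] with i hi
    exact ⟨hr, hi.le⟩
  have hpr : ∀ᶠ i in l, (y i).price ≤ x.price + 1 :=
    hprice.eventually (eventually_le_nhds (lt_add_one _))
  have hdα : Tendsto (fun i => dist (α' i r) (α i r)) l (𝓝 0) :=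
    squeeze_zero (fun _ => dist_nonneg) (fun i => hαα i r hrT) hd
  have hgain : Tendsto (fun i => M.gain (α' i r) - M.gain (α i r)) l (𝓝 0) :=
    tendsto_sub_of_uniform (isCompact_Icc (a := 0) (b := M.νmax)) continuous_gain.continuousOn
      (Eventually.of_forall fun i => (hα' i).1.2 r) (Eventually.of_forall fun i => (hα i).1.2 r) hdα
  have hbdy : ∀ᶠ i in l, M.bounding γ (y i) ≤ M.bounding γ x + 1 :=
    (((continuous_bounding γ).tendsto x).comp hlim).eventually (eventually_le_nhds (lt_add_one _))
  have hjm : Tendsto (fun i => M.jumpMean v (h1.expFlow (α' i) (y i) r) (α' i r)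
      - M.jumpMean v (h1.expFlow (α i) x r) (α i r)) l (𝓝 0) := by
    refine tendsto_sub_of_uniform (f := fun p : PState K × ℝ => M.jumpMean v p.1 p.2)
      (p := fun i => (h1.expFlow (α' i) (y i) r, α' i r)) (q := fun i => (h1.expFlow (α i) x r, α i r))
      ((isCompact_cappedSpace (M := M) (x.price + 1)).prod (isCompact_Icc (a := 0) (b := M.νmax)))
      ((h1.continuousOn_jumpMean h2 hv hcont hC hvb).mono
        (prod_mono (cappedSpace_subset _) le_rfl)) ?_ ?_ ?_
    · filter_upwards [hry, hpr] with i h3 h4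
      exact ⟨mem_cappedSpace (h1.expFlow_mem (hα' i) (hy i) h3) h4, (hα' i).1.2 r⟩
    · exact Eventually.of_forall fun i => ⟨mem_cappedSpace (h1.expFlow_mem (hα i) hx ⟨hr, hrx.le⟩)
        (show x.price ≤ x.price + 1 by linarith), (hα i).1.2 r⟩
    · have := (h1.tendsto_dist_expFlow h2 hx hy hlim (fun i => (hα i).1) (fun i => (hα' i).1) hd hαα
        hrT).max hdα
      rw [max_self] at this
      exact this
  refine tendsto_mul_sub_mul (A := 1) (B := (1 + M.f M.νmax) * M.νmax * x.price
      + C * h1.jumpRateBound * M.bounding γ x) ?_ ?_ ?_ ?_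
  · refine Eventually.of_forall fun i => ?_
    have := h1.discount_mem (hα' i).1.1 (hy i) hr
    rw [abs_of_nonneg this.1]; exact this.2
  · exact Eventually.of_forall fun i => (abs_add_le _ _).trans (add_le_add
      (h1.abs_gain_price_le (hα i).1 hx r)
      (h1.abs_jumpMean_expFlow_le (hα i) hx hv hγ hC hvb ⟨hr, hrx.le⟩))
  · simp only [← mul_sub]
    simpa using (h1.tendsto_surv h2 hx hy hlim (fun i => (hα i).1.1) (fun i => (hα' i).1.1) hd hαα
      (v := fun _ => r) (fun _ => hrT)).const_mul (Real.exp (-M.ρ * r))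
  · have hg : Tendsto (fun i => M.gain (α' i r) * (y i).price - M.gain (α i r) * x.price) l (𝓝 0) := by
      refine tendsto_mul_sub_mul (A := (1 + M.f M.νmax) * M.νmax) (B := |x.price|) ?_
        (Eventually.of_forall fun i => le_rfl) hgain (by simpa using hprice.sub_const x.price)
      refine Eventually.of_forall fun i => (abs_gain_le ((hα' i).1.2 r)).trans ?_
      have := M.f_νmax_nonneg
      exact mul_le_mul_of_nonneg_left ((hα' i).1.2 r).2 (by positivity)
    have := hg.add hjm
    rw [add_zero] at this
    exact this.congr fun i => by ring

/-- Here the horizons `T - t` differ as well. The survival probabilities are first compared at the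
horizon of `y i` and then shifted in time with Lipschitz constant `β`. This comparison may use times
beyond the horizon of `x`, where the clamped linear system still makes sense. -/
theorem tendsto_terminal (h2 : M.Assumption2)
    (hx : x ∈ M.stateSpace) (hy : ∀ i, y i ∈ M.stateSpace)
    (hlim : Tendsto y l (𝓝 x)) (hα : ∀ i, M.IsAdmissible (α i) x)
    (hα' : ∀ i, M.IsAdmissible (α' i) (y i)) (hd : Tendsto d l (𝓝 0))
    (hαα : ∀ i, ∀ v ∈ Icc 0 M.T, |α' i v - α i v| ≤ d i) :
    Tendsto (fun i => Real.exp (-M.ρ * (M.T - (y i).time)) * h1.surv (α' i) (y i) (M.T - (y i).time)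
        * (M.hext (h1.expFlow (α' i) (y i) (M.T - (y i).time)).inv * (y i).price)
      - Real.exp (-M.ρ * (M.T - x.time)) * h1.surv (α i) x (M.T - x.time)
        * (M.hext (h1.expFlow (α i) x (M.T - x.time)).inv * x.price)) l (𝓝 0) := by
  have htime : Tendsto (fun i => (y i).time) l (𝓝 x.time) := (continuous_time.tendsto x).comp hlim
  have hprice : Tendsto (fun i => (y i).price) l (𝓝 x.price) :=
    (continuous_price.tendsto x).comp hlim
  have hinv : Tendsto (fun i => (y i).inv) l (𝓝 x.inv) := (continuous_inv.tendsto x).comp hlim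
  have hLx := horizon_nonneg hx
  have hLT : M.T - x.time ∈ Icc 0 M.T := ⟨hLx, by linarith [(time_mem hx).1]⟩
  have hLyT : ∀ i, M.T - (y i).time ∈ Icc 0 M.T := fun i =>
    ⟨horizon_nonneg (hy i), by linarith [(time_mem (hy i)).1]⟩
  have htd : Tendsto (fun i => |x.time - (y i).time|) l (𝓝 0) := by
    simpa using (htime.const_sub x.time).abs
  have hlt : ∀ i, |(M.T - (y i).time) - (M.T - x.time)| = |x.time - (y i).time| := fun i => by
    congr 1; ring
  -- survival probabilities
  have hs1 := h1.tendsto_surv h2 hx hy hlim (fun i => (hα i).1.1) (fun i => (hα' i).1.1) hd hαα hLyT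
  have hs2 : Tendsto (fun i => h1.surv (α i) x (M.T - (y i).time) - h1.surv (α i) x (M.T - x.time))
      l (𝓝 0) := by
    refine squeeze_zero_norm (a := fun i => h1.β * |x.time - (y i).time|) (fun i => ?_)
      (by simpa using htd.const_mul h1.β)
    rw [Real.norm_eq_abs, ← hlt i]
    rcases le_total (M.T - (y i).time) (M.T - x.time) with h | h
    · rw [abs_sub_comm, abs_sub_comm (M.T - (y i).time), abs_of_nonneg (sub_nonneg.2 h)]
      exact h1.abs_surv_sub_le (hα i).1.1 (filt_mem hx) (hLyT i).1 h
    · rw [abs_of_nonneg (sub_nonneg.2 h)]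
      exact h1.abs_surv_sub_le (hα i).1.1 (filt_mem hx) hLT.1 h
  have hs : Tendsto (fun i => h1.surv (α' i) (y i) (M.T - (y i).time)
      - h1.surv (α i) x (M.T - x.time)) l (𝓝 0) := by
    have := hs1.add hs2
    rw [add_zero] at this
    exact this.congr fun i => by ring
  have hsb : ∀ i, |h1.surv (α i) x (M.T - x.time)| ≤ 1 := fun i => by
    rw [abs_of_pos (h1.surv_pos (hα i).1.1 (filt_mem hx) hLx)]
    exact h1.surv_le_one (hα i).1.1 (filt_mem hx) hLx
  have he : Tendsto (fun i => Real.exp (-M.ρ * (M.T - (y i).time))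
      - Real.exp (-M.ρ * (M.T - x.time))) l (𝓝 0) := by
    have hc : Continuous fun t => Real.exp (-M.ρ * (M.T - t)) := by fun_prop
    simpa using ((hc.tendsto x.time).comp htime).sub_const (Real.exp (-M.ρ * (M.T - x.time)))
  have hdisc : ∀ i, |Real.exp (-M.ρ * (M.T - (y i).time))| ≤ 1 := fun i => by
    rw [abs_of_pos (Real.exp_pos _), Real.exp_le_one_iff]
    have := mul_nonneg M.ρ_nonneg (horizon_nonneg (hy i))
    linarith
  -- remaining inventories
  have hmI : ∀ i, (h1.expFlow (α' i) (y i) (M.T - (y i).time)).inv ∈ Icc 0 M.w₀ := fun i =>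
    inv_mem (h1.expFlow_mem (hα' i) (hy i) ⟨horizon_nonneg (hy i), le_rfl⟩)
  have hmI' : ∀ i, (h1.expFlow (α i) x (M.T - x.time)).inv ∈ Icc 0 M.w₀ := fun i =>
    inv_mem (h1.expFlow_mem (hα i) hx ⟨hLx, le_rfl⟩)
  have hdI : Tendsto (fun i => dist (h1.expFlow (α' i) (y i) (M.T - (y i).time)).inv
      (h1.expFlow (α i) x (M.T - x.time)).inv) l (𝓝 0) := by
    have hb : Tendsto (fun i => |(y i).inv - x.inv| + (d i * M.T + M.νmax * |x.time - (y i).time|)) l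
        (𝓝 0) := by
      have a1 : Tendsto (fun i => |(y i).inv - x.inv|) l (𝓝 0) := by
        simpa using (hinv.sub_const x.inv).abs
      simpa using a1.add ((hd.mul_const M.T).add (htd.const_mul M.νmax))
    refine squeeze_zero (fun _ => dist_nonneg) (fun i => ?_) hb
    change dist ((y i).inv - ∫ r in (0 : ℝ)..(M.T - (y i).time), α' i r)
      (x.inv - ∫ r in (0 : ℝ)..(M.T - x.time), α i r) ≤ _
    refine (dist_sub_sub_le _ _ _ _).trans (add_le_add le_rfl ((dist_triangle _
      (∫ r in (0 : ℝ)..(M.T - (y i).time), α i r) _).trans (add_le_add ?_ ?_)))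
    · rw [Real.dist_eq, ← intervalIntegral.integral_sub ((hα' i).1.intervalIntegrable _ _)
        ((hα i).1.intervalIntegrable _ _)]
      refine (intervalIntegral.norm_integral_le_of_norm_le_const
        (f := fun r => α' i r - α i r) (C := d i) fun r hr => hαα i r ?_).trans ?_
      · rw [uIoc_of_le (hLyT i).1] at hr
        exact ⟨hr.1.le, hr.2.trans (hLyT i).2⟩
      · rw [sub_zero, abs_of_nonneg (hLyT i).1]
        refine mul_le_mul_of_nonneg_left (hLyT i).2 ?_
        exact (abs_nonneg _).trans (hαα i 0 ⟨le_rfl, M.T_pos.le⟩)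
    · rw [Real.dist_eq, intervalIntegral.integral_interval_sub_left
        ((hα i).1.intervalIntegrable _ _) ((hα i).1.intervalIntegrable _ _), ← hlt i]
      refine intervalIntegral.norm_integral_le_of_norm_le_const (f := α i) fun r _ => ?_
      rw [Real.norm_eq_abs, abs_of_nonneg ((hα i).1.2 r).1]
      exact ((hα i).1.2 r).2
  have hh := tendsto_sub_of_uniform (isCompact_Icc (a := 0) (b := M.w₀))
    (continuous_hext (M := M)).continuousOn (Eventually.of_forall hmI) (Eventually.of_forall hmI') hdI
  have hhb : ∀ w ∈ Icc 0 M.w₀, |M.hext w| ≤ M.w₀ := fun w hw => by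
    rw [hext_of_mem hw, abs_of_nonneg (h_nonneg hw)]
    exact (M.h_le w hw).trans hw.2
  refine tendsto_mul_sub_mul (A := 1) (B := M.w₀ * x.price) ?_ ?_ ?_ ?_
  · refine Eventually.of_forall fun i => ?_
    have := h1.discount_mem (hα' i).1.1 (hy i) (hLyT i).1
    rw [abs_of_nonneg this.1]; exact this.2
  · refine Eventually.of_forall fun i => ?_
    rw [abs_mul, abs_of_nonneg (price_nonneg hx)]
    exact mul_le_mul_of_nonneg_right (hhb _ (hmI' i)) (price_nonneg hx)
  · exact tendsto_mul_sub_mul (Eventually.of_forall hdisc) (Eventually.of_forall hsb) he hs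
  · exact tendsto_mul_sub_mul (A := M.w₀) (B := |x.price|)
      (Eventually.of_forall fun i => hhb _ (hmI i))
      (Eventually.of_forall fun _ => le_rfl) hh (by simpa using hprice.sub_const x.price)

/-- Dominated convergence on the whole line, with the two horizons encoded by indicators. The
indicators converge except at the single time `T - x.time`, a null set; the uniform bound of the
integrand near `x` provides the majorant. -/
theorem tendsto_totalReward [l.IsCountablyGenerated] (h2 : M.Assumption2) (hv : Measurable v)
    (hcont : ContinuousOn v M.stateSpace)
    (hγ : 0 ≤ γ) (hC : 0 ≤ C) (hvb : ∀ y ∈ M.stateSpace, |v y| ≤ C * M.bounding γ y)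
    (hx : x ∈ M.stateSpace) (hy : ∀ i, y i ∈ M.stateSpace)
    (hlim : Tendsto y l (𝓝 x)) (hα : ∀ i, M.IsAdmissible (α i) x)
    (hα' : ∀ i, M.IsAdmissible (α' i) (y i)) (hd : Tendsto d l (𝓝 0))
    (hαα : ∀ i, ∀ v ∈ Icc 0 M.T, |α' i v - α i v| ≤ d i) :
    Tendsto (fun i => h1.totalReward v (α' i) (y i) - h1.totalReward v (α i) x) l (𝓝 0) := by
  have htime : Tendsto (fun i => (y i).time) l (𝓝 x.time) := (continuous_time.tendsto x).comp hlim
  have hpr : ∀ᶠ i in l, (y i).price ≤ x.price + 1 :=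
    ((continuous_price.tendsto x).comp hlim).eventually (eventually_le_nhds (lt_add_one _))
  have hbdy : ∀ᶠ i in l, M.bounding γ (y i) ≤ M.bounding γ x + 1 :=
    (((continuous_bounding γ).tendsto x).comp hlim).eventually (eventually_le_nhds (lt_add_one _))
  have hνm := M.νmax_pos
  have hfm := M.f_νmax_nonneg
  have hR := h1.jumpRateBound_nonneg
  have hps := price_nonneg hx
  have hbx := bounding_nonneg hx γ
  set B := (1 + M.f M.νmax) * M.νmax * (x.price + 1)
      + C * h1.jumpRateBound * (M.bounding γ x + 1) with hB
  have hB0 : 0 ≤ B := by positivity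
  have hbx' : ∀ i, ∀ r ∈ Icc 0 (M.T - x.time), |h1.running v (α i) x r| ≤ B := fun i r hr => by
    refine (h1.abs_running_le (hα i) hx hv hγ hC hvb hr).trans ?_
    rw [hB]; gcongr <;> linarith
  have hby' : ∀ᶠ i in l, ∀ r ∈ Icc 0 (M.T - (y i).time), |h1.running v (α' i) (y i) r| ≤ B := by
    filter_upwards [hpr, hbdy] with i h3 h4 r hr
    refine (h1.abs_running_le (hα' i) (hy i) hv hγ hC hvb hr).trans ?_
    rw [hB]; gcongr
  -- convergence of the integrals
  set F : ι → ℝ → ℝ := fun i r => (Ioc 0 (M.T - (y i).time)).indicator (h1.running v (α' i) (y i)) r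
    - (Ioc 0 (M.T - x.time)).indicator (h1.running v (α i) x) r with hF
  have hint : Tendsto (fun i => ∫ r, F i r) l (𝓝 (∫ _r : ℝ, (0 : ℝ))) := by
    refine tendsto_integral_filter_of_dominated_convergence
      ((Ioc 0 M.T).indicator fun _ => B + B) ?_ ?_ ?_ ?_
    · exact Eventually.of_forall fun i => (((h1.measurable_running hv (hα' i).1.1 _).indicator
        measurableSet_Ioc).sub ((h1.measurable_running hv (hα i).1.1 _).indicator
        measurableSet_Ioc)).aestronglyMeasurable
    · filter_upwards [hby'] with i hi
      refine Eventually.of_forall fun r => ?_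
      by_cases hr : r ∈ Ioc 0 M.T
      · rw [indicator_of_mem hr]
        refine (abs_sub _ _).trans (add_le_add ?_ ?_)
        · by_cases h : r ∈ Ioc 0 (M.T - (y i).time)
          · rw [indicator_of_mem h]; exact hi r (Ioc_subset_Icc_self h)
          · rw [indicator_of_notMem h, abs_zero]; exact hB0
        · by_cases h : r ∈ Ioc 0 (M.T - x.time)
          · rw [indicator_of_mem h]; exact hbx' i r (Ioc_subset_Icc_self h)
          · rw [indicator_of_notMem h, abs_zero]; exact hB0
      · have a1 : r ∉ Ioc 0 (M.T - (y i).time) := fun h => hr ⟨h.1, h.2.trans (by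
          linarith [(time_mem (hy i)).1])⟩
        have a2 : r ∉ Ioc 0 (M.T - x.time) := fun h => hr ⟨h.1, h.2.trans (by
          linarith [(time_mem hx).1])⟩
        simp only [hF, indicator_of_notMem hr, indicator_of_notMem a1, indicator_of_notMem a2,
          sub_zero, norm_zero, le_refl]
    · exact (integrable_indicator_iff measurableSet_Ioc).2 (integrableOn_const (by simp))
    · have hne : ∀ᵐ r : ℝ, r ≠ M.T - x.time := compl_mem_ae_iff.2 (measure_singleton _)
      filter_upwards [hne] with r hr
      rcases le_or_gt r 0 with hr0 | hr0
      · refine tendsto_const_nhds.congr fun i => ?_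
        simp only [hF]
        rw [indicator_of_notMem (fun h => not_lt.2 hr0 h.1),
          indicator_of_notMem (fun h => not_lt.2 hr0 h.1), sub_zero]
      rcases lt_or_gt_of_ne hr with hlt | hlt
      · refine (h1.tendsto_running h2 hv hcont hγ hC hvb hx hy hlim hα hα' hd hαα hr0.le hlt).congr' ?_
        filter_upwards [(htime.const_sub M.T).eventually (eventually_gt_nhds hlt)] with i hi
        simp only [hF]
        rw [indicator_of_mem (show r ∈ Ioc 0 (M.T - (y i).time) from ⟨hr0, hi.le⟩),
          indicator_of_mem (show r ∈ Ioc 0 (M.T - x.time) from ⟨hr0, hlt.le⟩)]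
      · refine tendsto_const_nhds.congr' ?_
        filter_upwards [(htime.const_sub M.T).eventually (eventually_lt_nhds hlt)] with i hi
        simp only [hF]
        rw [indicator_of_notMem (fun h => not_lt.2 h.2 hi),
          indicator_of_notMem (fun h => not_lt.2 h.2 hlt), sub_zero]
  rw [integral_zero] at hint
  have hterm := h1.tendsto_terminal h2 hx hy hlim hα hα' hd hαα
  have hsum := hint.add hterm
  rw [add_zero] at hsum
  refine hsum.congr' ?_
  filter_upwards [hby'] with i hi
  rw [h1.totalReward_eq (hα i) hx hv hγ hC hvb, h1.totalReward_eq (hα' i) (hy i) hv hγ hC hvb,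
    intervalIntegral.integral_of_le (horizon_nonneg hx),
    intervalIntegral.integral_of_le (horizon_nonneg (hy i)),
    ← integral_indicator measurableSet_Ioc, ← integral_indicator measurableSet_Ioc, hF,
    integral_sub]
  · ring
  · refine (integrable_indicator_iff measurableSet_Ioc).2 ?_
    have := intervalIntegrable_of_bounded (h1.measurable_running hv (hα' i).1.1 (y i))
      (horizon_nonneg (hy i)) hi
    exact (intervalIntegrable_iff_integrableOn_Ioc_of_le (horizon_nonneg (hy i))).1 this
  · refine (integrable_indicator_iff measurableSet_Ioc).2 ?_
    have := intervalIntegrable_of_bounded (h1.measurable_running hv (hα i).1.1 x)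
      (horizon_nonneg hx) (hbx' i)
    exact (intervalIntegrable_iff_integrableOn_Ioc_of_le (horizon_nonneg hx)).1 this

end Convergence

end Assumption1

/-! ### Scaling of controls -/

/-- The factor that makes a rate feasible for `x` feasible for `y`. -/
noncomputable def scale (x y : PState K) : ℝ := min 1 (y.inv / x.inv)

theorem scale_mem {x y : PState K} (hx : x ∈ M.stateSpace) (hy : y ∈ M.stateSpace) :
    scale x y ∈ Icc 0 1 :=
  ⟨le_min zero_le_one (div_nonneg (inv_mem hy).1 (inv_mem hx).1), min_le_left _ _⟩

theorem scale_mul_inv_le {x y : PState K} (hx : x ∈ M.stateSpace) (hy : y ∈ M.stateSpace) :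
    scale x y * x.inv ≤ y.inv := by
  rcases (inv_mem hx).1.eq_or_lt with h | h
  · rw [← h, mul_zero]; exact (inv_mem hy).1
  · calc scale x y * x.inv ≤ y.inv / x.inv * x.inv :=
        mul_le_mul_of_nonneg_right (min_le_right _ _) h.le
      _ = y.inv := div_mul_cancel₀ _ h.ne'

/-- The rate `α`, stopped in `x` and rescaled so as to be feasible in `y`. -/
noncomputable def rescale (M : LiquidationModel K) (α : ℝ → ℝ) (x y : PState K) (v : ℝ) : ℝ :=
  scale x y * M.cut α x v

section Scale

variable {α : ℝ → ℝ} {x y : PState K}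

theorem IsControl.rescale (hα : M.IsControl α) (hx : x ∈ M.stateSpace) (hy : y ∈ M.stateSpace) :
    M.IsControl (M.rescale α x y) := by
  have hs := scale_mem hx hy
  have hc := hα.cut x
  refine ⟨hc.1.const_mul _, fun v => ⟨mul_nonneg hs.1 (hc.2 v).1, ?_⟩⟩
  exact (mul_le_of_le_one_left (hc.2 v).1 hs.2).trans (hc.2 v).2

theorem IsControl.isAdmissible_rescale (hα : M.IsControl α) (hx : x ∈ M.stateSpace)
    (hy : y ∈ M.stateSpace) : M.IsAdmissible (M.rescale α x y) y := by
  refine ⟨hα.rescale hx hy, fun r hr => ?_⟩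
  simp only [LiquidationModel.rescale]
  rw [intervalIntegral.integral_const_mul]
  exact (mul_le_mul_of_nonneg_left (integral_cut_le hα hx hr.1) (scale_mem hx hy).1).trans
    (scale_mul_inv_le hx hy)

/-- Scaling never makes the new inventory run out before the old one would. Were the original rate
still active when `y` is exhausted, then the scaled sales would be below `scale x y * x.inv`, hence
below `y.inv`. So cutting a second time changes nothing up to the horizon. -/
theorem cut_rescale (hα : M.IsControl α) (hx : x ∈ M.stateSpace) (hy : y ∈ M.stateSpace) {r : ℝ}
    (hr : r ∈ Icc 0 (M.T - y.time)) : M.cut (M.rescale α x y) y r = M.rescale α x y r := by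
  have hc := hα.rescale hx hy
  have hs := scale_mem hx hy
  by_cases h : r ≤ M.exitVersion (M.rescale α x y) y
  · exact cut_of_le h
  push Not at h
  rw [cut_of_lt h]
  have hi := integral_exitVersion hc hy (h.trans_le hr.2)
  set τ := M.exitVersion (M.rescale α x y) y with hτ
  have hτ0 : 0 ≤ τ := (exitVersion_mem hc y).1
  rcases hs.1.eq_or_lt with h0 | h0
  · rw [LiquidationModel.rescale, ← h0, zero_mul]
  have hle : M.exitVersion α x ≤ τ := by
    by_contra hlt
    push Not at hlt
    have h3 := (lt_exitVersion hα hτ0 hlt).1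
    simp only [LiquidationModel.rescale] at hi
    rw [intervalIntegral.integral_const_mul, integral_cut_of_le hτ0 hlt.le] at hi
    have h4 := mul_lt_mul_of_pos_left h3 h0
    have h5 := scale_mul_inv_le hx hy
    linarith
  rw [LiquidationModel.rescale, cut_of_lt (hle.trans_lt h), mul_zero]

theorem abs_rescale_sub_le (hα : M.IsControl α) (hx : x ∈ M.stateSpace) (hy : y ∈ M.stateSpace)
    (v : ℝ) : |M.rescale α x y v - M.cut α x v| ≤ (1 - scale x y) * M.νmax := by
  have hs := scale_mem hx hy
  have hc := (hα.cut x).2 v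
  have e : M.rescale α x y v - M.cut α x v = -((1 - scale x y) * M.cut α x v) := by
    rw [LiquidationModel.rescale]; ring
  rw [e, abs_neg, abs_of_nonneg (mul_nonneg (sub_nonneg.2 hs.2) hc.1)]
  exact mul_le_mul_of_nonneg_left hc.2 (sub_nonneg.2 hs.2)

end Scale

/-! ### The Bellman operator -/

instance : Nonempty M.Control :=
  ⟨⟨fun _ => 0, measurable_const, fun _ => ⟨le_rfl, M.νmax_pos.le⟩⟩⟩

/-- Controls are transported in both directions: from the limit `x` to nearby states for lower
semicontinuity of the supremum, and from nearby states to `x` for upper semicontinuity. A positive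
inventory at `x` makes both scaling factors tend to one. -/
theorem Assumption1.tendsto_totalReward_rescale (h1 : M.Assumption1) {ι : Type*} {l : Filter ι}
    [l.IsCountablyGenerated] (h2 : M.Assumption2) {v : PState K → ℝ} (hv : Measurable v)
    (hcont : ContinuousOn v M.stateSpace) {γ C : ℝ}
    (hγ : 0 ≤ γ) (hC : 0 ≤ C) (hvb : ∀ y ∈ M.stateSpace, |v y| ≤ C * M.bounding γ y) {x : PState K}
    (hx : x ∈ M.stateSpace) (hx0 : 0 < x.inv) {y : ι → PState K} (hy : ∀ i, y i ∈ M.stateSpace)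
    (hlim : Tendsto y l (𝓝 x)) {α α' : ι → ℝ → ℝ} (hα : ∀ i, M.IsControl (α i))
    (hα' : ∀ i, M.IsControl (α' i)) :
    Tendsto (fun i => h1.totalReward v (M.cut (M.rescale (α i) x (y i)) (y i)) (y i)
      - h1.totalReward v (M.cut (α i) x) x) l (𝓝 0) ∧
    Tendsto (fun i => h1.totalReward v (M.cut (α' i) (y i)) (y i)
      - h1.totalReward v (M.cut (M.rescale (α' i) (y i) x) x) x) l (𝓝 0) := by
  have hinv : Tendsto (fun i => (y i).inv) l (𝓝 x.inv) := (continuous_inv.tendsto x).comp hlim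
  have hs1 : Tendsto (fun i => (1 - scale x (y i)) * M.νmax) l (𝓝 0) := by
    have : Tendsto (fun i => scale x (y i)) l (𝓝 (min 1 (x.inv / x.inv))) :=
      tendsto_const_nhds.min (hinv.div_const _)
    rw [div_self hx0.ne', min_self] at this
    simpa using (this.const_sub 1).mul_const M.νmax
  have hs2 : Tendsto (fun i => (1 - scale (y i) x) * M.νmax) l (𝓝 0) := by
    have : Tendsto (fun i => scale (y i) x) l (𝓝 (min 1 (x.inv / x.inv))) :=
      tendsto_const_nhds.min (tendsto_const_nhds.div hinv hx0.ne')
    rw [div_self hx0.ne', min_self] at this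
    simpa using (this.const_sub 1).mul_const M.νmax
  constructor
  · refine (h1.tendsto_totalReward h2 hv hcont hγ hC hvb hx hy hlim
      (fun i => (hα i).isAdmissible_cut hx) (fun i => (hα i).isAdmissible_rescale hx (hy i)) hs1
      fun i v _ => abs_rescale_sub_le (hα i) hx (hy i) v).congr fun i => ?_
    rw [h1.totalReward_congr (hy i) fun r hr => cut_rescale (hα i) hx (hy i) hr]
  · refine (h1.tendsto_totalReward h2 hv hcont hγ hC hvb hx hy hlim
      (fun i => (hα' i).isAdmissible_rescale (hy i) hx) (fun i => (hα' i).isAdmissible_cut (hy i)) hs2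
      fun i v _ => ?_).congr fun i => ?_
    · rw [abs_sub_comm]; exact abs_rescale_sub_le (hα' i) (hy i) hx v
    · rw [h1.totalReward_congr hx fun r hr => cut_rescale (hα' i) (hy i) hx hr]

namespace Assumption1

variable (h1 : M.Assumption1)
include h1

section

variable {v v' : PState K → ℝ} {γ C C' : ℝ} {x : PState K}

theorem oneReward_add_QL (hvb : ∀ y ∈ M.stateSpace, |v y| ≤ C * M.bounding γ y)
    (hx : x ∈ M.stateSpace) {α : ℝ → ℝ} (hα : M.IsControl α) :
    M.oneReward x α + M.QL v x α = h1.totalReward v (M.cut α x) x := by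
  rw [h1.oneReward_eq hα hx, h1.QL_eq hα hx (h1.lateral_eq_zero hvb)]
  rfl

theorem bellman_eq (hvb : ∀ y ∈ M.stateSpace, |v y| ≤ C * M.bounding γ y)
    (hx : x ∈ M.stateSpace) :
    M.bellman v x = ⨆ α : M.Control, h1.totalReward v (M.cut α.1 x) x := by
  unfold bellman
  congr 1
  ext α
  exact h1.oneReward_add_QL hvb hx α.isControl

theorem bddAbove_totalReward (hv : Measurable v) (hγ : 0 < γ) (hC : 0 ≤ C)
    (hvb : ∀ y ∈ M.stateSpace, |v y| ≤ C * M.bounding γ y) (hx : x ∈ M.stateSpace) :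
    BddAbove (range fun α : M.Control => h1.totalReward v (M.cut α.1 x) x) := by
  refine ⟨(2 + M.f M.νmax + C * (h1.jumpRateBound / γ)) * M.bounding γ x, ?_⟩
  rintro _ ⟨α, rfl⟩
  exact (le_abs_self _).trans
    (h1.abs_totalReward_le (α.isControl.isAdmissible_cut hx) hx hv hγ hC hvb)

theorem le_bellman (hv : Measurable v) (hγ : 0 < γ) (hC : 0 ≤ C)
    (hvb : ∀ y ∈ M.stateSpace, |v y| ≤ C * M.bounding γ y) (hx : x ∈ M.stateSpace) {α : ℝ → ℝ}
    (hα : M.IsControl α) : h1.totalReward v (M.cut α x) x ≤ M.bellman v x := by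
  rw [h1.bellman_eq hvb hx]
  exact le_ciSup (h1.bddAbove_totalReward hv hγ hC hvb hx) ⟨α, hα⟩

theorem bellman_le (hvb : ∀ y ∈ M.stateSpace, |v y| ≤ C * M.bounding γ y) (hx : x ∈ M.stateSpace)
    {a : ℝ} (h : ∀ α, M.IsControl α → h1.totalReward v (M.cut α x) x ≤ a) : M.bellman v x ≤ a := by
  rw [h1.bellman_eq hvb hx]
  exact ciSup_le fun α => h α.1 α.isControl

theorem exists_lt_totalReward (hvb : ∀ y ∈ M.stateSpace, |v y| ≤ C * M.bounding γ y)
    (hx : x ∈ M.stateSpace) {ε : ℝ} (hε : 0 < ε) :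
    ∃ α : M.Control, M.bellman v x - ε < h1.totalReward v (M.cut α.1 x) x := by
  rw [h1.bellman_eq hvb hx]
  exact exists_lt_of_lt_ciSup (sub_lt_self _ hε)

theorem abs_bellman_le (hv : Measurable v) (hγ : 0 < γ) (hC : 0 ≤ C)
    (hvb : ∀ y ∈ M.stateSpace, |v y| ≤ C * M.bounding γ y) (hx : x ∈ M.stateSpace) :
    |M.bellman v x| ≤ (2 + M.f M.νmax + C * (h1.jumpRateBound / γ)) * M.bounding γ x := by
  have h := fun α (hα : M.IsControl α) => abs_le.1
    (h1.abs_totalReward_le (hα.isAdmissible_cut hx) hx hv hγ hC hvb)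
  refine abs_le.2 ⟨?_, h1.bellman_le hvb hx fun α hα => (h α hα).2⟩
  obtain ⟨α⟩ := (inferInstance : Nonempty M.Control)
  exact (h α.1 α.isControl).1.trans (h1.le_bellman hv hγ hC hvb hx α.isControl)

/-- For a fixed control the rewards of the period cancel and only the continuation of the difference
remains; the bound is uniform in the control and thus survives the suprema. -/
theorem bellman_sub_le (hv : Measurable v) (hv' : Measurable v') (hγ : 0 < γ) (hC : 0 ≤ C)
    (hC' : 0 ≤ C') (hvb : ∀ y ∈ M.stateSpace, |v y| ≤ C * M.bounding γ y)
    (hvb' : ∀ y ∈ M.stateSpace, |v' y| ≤ C' * M.bounding γ y) (hx : x ∈ M.stateSpace) {δ : ℝ}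
    (hδ : 0 ≤ δ) (h : ∀ y ∈ M.stateSpace, |v y - v' y| ≤ δ * M.bounding γ y) :
    |M.bellman v x - M.bellman v' x| ≤ δ * (h1.jumpRateBound / γ) * M.bounding γ x := by
  have key : ∀ α, M.IsControl α → |h1.totalReward v (M.cut α x) x - h1.totalReward v' (M.cut α x) x|
      ≤ δ * (h1.jumpRateBound / γ) * M.bounding γ x := fun α hα => by
    have ha := hα.isAdmissible_cut hx
    rw [totalReward, totalReward, add_sub_add_left_eq_sub,
      h1.contPart_sub ha hx hv hv' hγ.le hC hC' hvb hvb']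
    exact h1.abs_contPart_le ha hx (hv.sub hv') hγ hδ h
  rw [abs_sub_le_iff]
  constructor
  · rw [sub_le_iff_le_add]
    refine h1.bellman_le hvb hx fun α hα => ?_
    linarith [(abs_le.1 (key α hα)).2, h1.le_bellman hv' hγ hC' hvb' hx hα]
  · rw [sub_le_iff_le_add]
    refine h1.bellman_le hvb' hx fun α hα => ?_
    linarith [(abs_le.1 (key α hα)).1, h1.le_bellman hv hγ hC hvb hx hα]

theorem bellman_congr (hvb : ∀ y ∈ M.stateSpace, |v y| ≤ C * M.bounding γ y)
    (h : EqOn v v' M.stateSpace) (hx : x ∈ M.stateSpace) : M.bellman v x = M.bellman v' x := by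
  rw [h1.bellman_eq hvb hx, h1.bellman_eq (v := v') (fun y hy => by rw [← h hy]; exact hvb y hy) hx]
  congr 1
  ext α
  rw [totalReward, totalReward, h1.contPart_congr (α.isControl.isAdmissible_cut hx) hx h]

/-- At zero inventory the dominating function tends to zero. At positive inventory a nearly optimal
control of either state is rescaled to the other, losing little; no optimal control and no
compactness of the controls is needed. -/
theorem continuousOn_bellman (h2 : M.Assumption2) (hv : Measurable v)
    (hcont : ContinuousOn v M.stateSpace) (hγ : 0 < γ) (hC : 0 ≤ C)
    (hvb : ∀ y ∈ M.stateSpace, |v y| ≤ C * M.bounding γ y) :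
    ContinuousOn (M.bellman v) M.stateSpace := by
  rw [continuousOn_iff_continuous_domRestrict, continuous_iff_continuousAt]
  rintro ⟨x, hx⟩
  have hlim : Tendsto (fun y : M.stateSpace => (y : PState K)) (𝓝 ⟨x, hx⟩) (𝓝 x) :=
    continuous_subtype_val.tendsto _
  change Tendsto (fun y : M.stateSpace => M.bellman v y) (𝓝 ⟨x, hx⟩) (𝓝 (M.bellman v x))
  rcases (inv_mem hx).1.eq_or_lt with h0 | h0
  · have hz : M.bounding γ x = 0 := by rw [bounding, ← h0, mul_zero, zero_mul]
    have hTx : M.bellman v x = 0 := by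
      have := h1.abs_bellman_le hv hγ hC hvb hx
      rw [hz, mul_zero] at this
      exact abs_nonpos_iff.1 this
    rw [hTx]
    refine squeeze_zero_norm (fun y => h1.abs_bellman_le hv hγ hC hvb y.2) ?_
    have := (((continuous_bounding (K := K) (M := M) γ).tendsto x).comp hlim).const_mul
      (2 + M.f M.νmax + C * (h1.jumpRateBound / γ))
    rw [hz, mul_zero] at this
    exact this
  · rw [Metric.tendsto_nhds]
    intro ε hε
    obtain ⟨a, ha⟩ := h1.exists_lt_totalReward hvb hx (half_pos hε)
    choose b hb using fun y : M.stateSpace => h1.exists_lt_totalReward hvb y.2 (half_pos hε)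
    obtain ⟨t1, t2⟩ := h1.tendsto_totalReward_rescale h2 hv hcont hγ.le hC hvb hx h0
      (fun y : M.stateSpace => y.2) hlim (α := fun _ => a.1) (α' := fun y => (b y).1)
      (fun _ => a.isControl) (fun y => (b y).isControl)
    have e1 := (Metric.tendsto_nhds.1 t1) (ε / 2) (half_pos hε)
    have e2 := (Metric.tendsto_nhds.1 t2) (ε / 2) (half_pos hε)
    filter_upwards [e1, e2] with y h3 h4
    rw [Real.dist_0_eq_abs, abs_lt] at h3 h4
    rw [Real.dist_eq, abs_lt]
    have h5 := h1.le_bellman hv hγ hC hvb y.2 (a.isControl.rescale hx y.2)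
    have h6 := h1.le_bellman hv hγ hC hvb hx ((b y).isControl.rescale y.2 hx)
    have h7 := hb y
    constructor <;> linarith [h3.1, h4.2]

end

/-! ### The fixed point -/

/-- The iterates of the Bellman operator, set to zero off the state space. -/
noncomputable def iter (M : LiquidationModel K) : ℕ → PState K → ℝ
  | 0 => 0
  | n + 1 => M.stateSpace.indicator (M.bellman (iter M n))

theorem iter_spec (h2 : M.Assumption2) {γ : ℝ} (hγ : 0 < γ) (n : ℕ) :
    Measurable (iter M n) ∧ ContinuousOn (iter M n) M.stateSpace ∧
      ∃ C, 0 ≤ C ∧ ∀ x ∈ M.stateSpace, |iter M n x| ≤ C * M.bounding γ x := by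
  induction n with
  | zero =>
    refine ⟨measurable_const, continuousOn_const, 0, le_rfl, fun x _ => ?_⟩
    simp [iter]
  | succ n ih =>
    obtain ⟨i1, i2, C, hC, i3⟩ := ih
    have hc := h1.continuousOn_bellman h2 i1 i2 hγ hC i3
    refine ⟨?_, hc.congr fun x hx => indicator_of_mem hx _,
      2 + M.f M.νmax + C * (h1.jumpRateBound / γ), ?_, fun x hx => ?_⟩
    · simp only [iter]
      classical
      rw [← piecewise_eq_indicator]
      exact hc.measurable_piecewise continuousOn_const measurableSet_stateSpace
    rotate_left
    · simp only [iter]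
      rw [indicator_of_mem hx]
      exact h1.abs_bellman_le i1 hγ hC i3 hx
    · have := M.f_νmax_nonneg
      have := h1.jumpRateBound_nonneg
      positivity

/-- A rate at which the Bellman operator halves distances. -/
noncomputable def halfRate (h1 : M.Assumption1) : ℝ := 2 * h1.jumpRateBound + 1

theorem halfRate_pos : 0 < h1.halfRate := by
  have := h1.jumpRateBound_nonneg
  unfold halfRate; linarith

theorem jumpRateBound_div_halfRate : h1.jumpRateBound / h1.halfRate ≤ 1 / 2 := by
  rw [div_le_iff₀ h1.halfRate_pos, halfRate]; linarith

theorem iter_of_notMem (n : ℕ) {x : PState K} (hx : x ∉ M.stateSpace) : iter M n x = 0 := by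
  cases n with
  | zero => rfl
  | succ n => exact indicator_of_notMem hx _

theorem bellman_half {v v' : PState K → ℝ} {C C' : ℝ} {x : PState K} (hv : Measurable v)
    (hv' : Measurable v') (hC : 0 ≤ C) (hC' : 0 ≤ C')
    (hvb : ∀ y ∈ M.stateSpace, |v y| ≤ C * M.bounding h1.halfRate y)
    (hvb' : ∀ y ∈ M.stateSpace, |v' y| ≤ C' * M.bounding h1.halfRate y) (hx : x ∈ M.stateSpace)
    {δ : ℝ} (hδ : 0 ≤ δ) (h : ∀ y ∈ M.stateSpace, |v y - v' y| ≤ δ * M.bounding h1.halfRate y) :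
    |M.bellman v x - M.bellman v' x| ≤ δ / 2 * M.bounding h1.halfRate x := by
  refine (h1.bellman_sub_le hv hv' h1.halfRate_pos hC hC' hvb hvb' hx hδ h).trans
    (mul_le_mul_of_nonneg_right ?_ (bounding_nonneg hx _))
  rw [div_eq_mul_one_div δ]
  exact mul_le_mul_of_nonneg_left h1.jumpRateBound_div_halfRate hδ

theorem abs_iter_succ_sub_le (h2 : M.Assumption2) (n : ℕ) : ∀ x ∈ M.stateSpace,
    |iter M n x - iter M (n + 1) x|
      ≤ (2 + M.f M.νmax) * (1 / 2) ^ n * M.bounding h1.halfRate x := by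
  have hf := M.f_νmax_nonneg
  induction n with
  | zero =>
    intro x hx
    have := h1.abs_bellman_le (v := iter M 0) (C := 0) measurable_const h1.halfRate_pos le_rfl
      (fun y _ => by simp [iter]) hx
    rw [zero_mul, add_zero] at this
    simp only [iter] at this ⊢
    rw [indicator_of_mem hx, Pi.zero_apply, zero_sub, abs_neg, pow_zero, mul_one]
    exact this
  | succ n ih =>
    intro x hx
    obtain ⟨i1, -, C, hC, i3⟩ := h1.iter_spec h2 h1.halfRate_pos n
    obtain ⟨j1, -, C', hC', j3⟩ := h1.iter_spec h2 h1.halfRate_pos (n + 1)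
    have := h1.bellman_half i1 j1 hC hC' i3 j3 hx (by positivity) ih
    simp only [iter] at this ⊢
    rw [indicator_of_mem hx, indicator_of_mem hx, pow_succ]
    refine this.trans (le_of_eq (by ring))

/-- Banach's iteration in the weighted norm. The limit is continuous because the weight is locally
bounded, so geometric convergence in the weighted norm is locally uniform convergence. -/
theorem exists_fixedPoint (h2 : M.Assumption2) : ∃ V : PState K → ℝ, Measurable V ∧
    ContinuousOn V M.stateSpace ∧
    (∃ C, 0 ≤ C ∧ ∀ x ∈ M.stateSpace, |V x| ≤ C * M.bounding h1.halfRate x) ∧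
    ∀ x ∈ M.stateSpace, V x = M.bellman V x := by
  have hf := M.f_νmax_nonneg
  set γ := h1.halfRate with hγ
  have hγ0 : 0 < γ := h1.halfRate_pos
  set A := 2 + M.f M.νmax with hA
  have hA0 : 0 ≤ A := by positivity
  have hd : ∀ x ∈ M.stateSpace, ∀ n, dist (iter M n x) (iter M (n + 1) x)
      ≤ (A * M.bounding γ x) * (1 / 2) ^ n := fun x hx n => by
    rw [Real.dist_eq]
    exact (h1.abs_iter_succ_sub_le h2 n x hx).trans (le_of_eq (by ring))
  have hlim : ∀ x, ∃ a, Tendsto (fun n => iter M n x) atTop (𝓝 a) := by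
    intro x
    by_cases hx : x ∈ M.stateSpace
    · exact cauchySeq_tendsto_of_complete
        (cauchySeq_of_le_geometric _ _ (by norm_num) (hd x hx))
    · exact ⟨0, tendsto_const_nhds.congr fun n => (h1.iter_of_notMem n hx).symm⟩
  choose V hV using hlim
  have hclose : ∀ x ∈ M.stateSpace, ∀ n, |iter M n x - V x| ≤ 2 * A * (1 / 2) ^ n * M.bounding γ x :=
    fun x hx n => by
    have := dist_le_of_le_geometric_of_tendsto (1 / 2) _ (by norm_num) (hd x hx) (hV x) n
    rw [Real.dist_eq] at this
    refine this.trans (le_of_eq (by norm_num; ring))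
  have hVm : Measurable V := measurable_of_tendsto_metrizable
    (fun n => (h1.iter_spec h2 hγ0 n).1) (tendsto_pi_nhds.2 hV)
  have hVb : ∀ x ∈ M.stateSpace, |V x| ≤ 2 * A * M.bounding γ x := fun x hx => by
    have := hclose x hx 0
    simpa [iter] using this
  have hgeo : Tendsto (fun n : ℕ => (1 / 2 : ℝ) ^ n) atTop (𝓝 0) :=
    tendsto_pow_atTop_nhds_zero_of_lt_one (by norm_num) (by norm_num)
  refine ⟨V, hVm, ?_, ⟨2 * A, by positivity, hVb⟩, ?_⟩
  · refine continuousOn_of_locally_uniform_approx_of_continuousWithinAt fun x hx u hu => ?_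
    obtain ⟨ε, hε, hεu⟩ := Metric.mem_uniformity_dist.1 hu
    have hz : Tendsto (fun n : ℕ => 2 * A * (1 / 2) ^ n * (M.bounding γ x + 1)) atTop (𝓝 0) := by
      simpa using (hgeo.const_mul (2 * A)).mul_const (M.bounding γ x + 1)
    obtain ⟨n, hn⟩ := (hz.eventually (eventually_lt_nhds hε)).exists
    refine ⟨{y | y ∈ M.stateSpace ∧ M.bounding γ y ≤ M.bounding γ x + 1}, ?_, iter M n,
      (h1.iter_spec h2 hγ0 n).2.1 x hx, fun y hy => hεu ?_⟩
    · exact inter_mem self_mem_nhdsWithin (mem_nhdsWithin_of_mem_nhds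
        (((continuous_bounding γ).tendsto x).eventually (eventually_le_nhds (lt_add_one _))))
    · rw [dist_comm, Real.dist_eq]
      exact (hclose y hy.1 n).trans_lt ((mul_le_mul_of_nonneg_left hy.2 (by positivity)).trans_lt hn)
  · intro x hx
    -- The distance from `V` to its image is routed through the iterate of index `n + 1`, which is
    -- close to `V` and also is the image of an iterate close to `V`.
    have hb : ∀ n, |V x - M.bellman V x| ≤ 2 * A * M.bounding γ x * (1 / 2) ^ n := by
      intro n
      obtain ⟨i1, -, C, hC, i3⟩ := h1.iter_spec h2 hγ0 n
      have a1 := h1.bellman_half i1 hVm hC (by positivity) i3 hVb hx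
        (δ := 2 * A * (1 / 2) ^ n) (by positivity) fun y hy => hclose y hy n
      have a2 := hclose x hx (n + 1)
      have e : iter M (n + 1) x = M.bellman (iter M n) x := indicator_of_mem hx _
      rw [e] at a2
      have a3 := abs_sub_le (V x) (M.bellman (iter M n) x) (M.bellman V x)
      rw [abs_sub_comm] at a2
      refine (a3.trans (add_le_add a2 a1)).trans (le_of_eq ?_)
      rw [pow_succ]; ring
    have hz : Tendsto (fun n : ℕ => 2 * A * M.bounding γ x * (1 / 2) ^ n) atTop (𝓝 0) := by
      simpa using hgeo.const_mul (2 * A * M.bounding γ x)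
    exact sub_eq_zero.1 (abs_nonpos_iff.1 (ge_of_tendsto' hz hb))

/-- Members of `Bb` are measurable on the state space only, so they are first replaced by their
extensions by zero, which the operator does not distinguish. The distance of two fixed points is
then halved indefinitely. -/
theorem fixedPoint_unique {v v' : PState K → ℝ} (hv : v ∈ M.Bb h1.halfRate)
    (hv' : v' ∈ M.Bb h1.halfRate) (hT : ∀ x ∈ M.stateSpace, v x = M.bellman v x)
    (hT' : ∀ x ∈ M.stateSpace, v' x = M.bellman v' x) : EqOn v v' M.stateSpace := by
  classical
  have key : ∀ {v : PState K → ℝ}, v ∈ M.Bb h1.halfRate →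
      (∀ x ∈ M.stateSpace, v x = M.bellman v x) → ∃ w, EqOn v w M.stateSpace ∧ Measurable w ∧
      (∃ C, 0 ≤ C ∧ ∀ x ∈ M.stateSpace, |w x| ≤ C * M.bounding h1.halfRate x) ∧
      ∀ x ∈ M.stateSpace, w x = M.bellman w x := by
    rintro v ⟨hm, C, hC⟩ hT
    have he : EqOn v (M.stateSpace.indicator v) M.stateSpace := fun x hx =>
      (indicator_of_mem hx _).symm
    refine ⟨M.stateSpace.indicator v, he, ?_, ⟨|C|, abs_nonneg _, fun x hx => ?_⟩, fun x hx => ?_⟩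
    · refine measurable_of_restrict_of_restrict_compl (measurableSet_stateSpace (M := M)) ?_ ?_
      · convert! hm using 1
        ext y
        exact indicator_of_mem y.2 _
      · convert! (measurable_const : Measurable fun _ : ↥(M.stateSpace)ᶜ => (0 : ℝ)) using 1
        ext y
        exact indicator_of_notMem y.2 _
    · rw [indicator_of_mem hx]
      exact (hC x hx).trans (mul_le_mul_of_nonneg_right (le_abs_self _) (bounding_nonneg hx _))
    · rw [← he hx, hT x hx]; exact h1.bellman_congr hC he hx
  obtain ⟨w, e, m, ⟨C, hC, b⟩, t⟩ := key hv hT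
  obtain ⟨w', e', m', ⟨C', hC', b'⟩, t'⟩ := key hv' hT'
  have hn : ∀ n : ℕ, ∀ x ∈ M.stateSpace,
      |w x - w' x| ≤ (C + C') * (1 / 2) ^ n * M.bounding h1.halfRate x := by
    intro n
    induction n with
    | zero =>
      intro x hx
      refine (abs_sub _ _).trans ((add_le_add (b x hx) (b' x hx)).trans (le_of_eq (by ring)))
    | succ n ih =>
      intro x hx
      rw [t x hx, t' x hx]
      refine (h1.bellman_half m m' hC hC' b b' hx (by positivity) ih).trans (le_of_eq ?_)
      rw [pow_succ]; ring
  intro x hx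
  rw [e hx, e' hx]
  have hz : Tendsto (fun n : ℕ => (C + C') * (1 / 2) ^ n * M.bounding h1.halfRate x) atTop (𝓝 0) := by
    simpa using ((tendsto_pow_atTop_nhds_zero_of_lt_one (r := (1 / 2 : ℝ)) (by norm_num)
      (by norm_num)).const_mul (C + C')).mul_const (M.bounding h1.halfRate x)
  exact sub_eq_zero.1 (abs_nonpos_iff.1 (ge_of_tendsto' hz fun n => hn n x hx))

end Assumption1

/-- On a bounded horizon the exponential weight lies between 1 and `exp (γ * T)`. So the space does
not depend on the positive weight, and the single value `halfRate` serves for all of them. -/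
theorem Bb_subset {γ γ' : ℝ} (hγ : 0 ≤ γ) (hγ' : 0 ≤ γ') : M.Bb γ ⊆ M.Bb γ' := by
  rintro v ⟨hm, C, hC⟩
  refine ⟨hm, |C| * Real.exp (γ * M.T), fun x hx => ?_⟩
  calc |v x| ≤ C * M.bounding γ x := hC x hx
    _ ≤ |C| * M.bounding γ x := mul_le_mul_of_nonneg_right (le_abs_self _) (bounding_nonneg hx _)
    _ ≤ |C| * (Real.exp (γ * M.T) * (x.price * x.inv)) :=
        mul_le_mul_of_nonneg_left (bounding_le hx hγ) (abs_nonneg _)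
    _ ≤ |C| * (Real.exp (γ * M.T) * M.bounding γ' x) := by
        have := price_mul_inv_le_bounding hx hγ'
        gcongr
    _ = _ := by ring

/-! ### The embedded chain -/

/-- The state at a jump (zero at the cemetery). -/
def chainVal : ChainState K → PState K := Sum.elim id fun _ => 0

theorem measurable_chainVal : Measurable (chainVal (K := K)) :=
  measurable_fun_sum measurable_id measurable_const

theorem measurable_of_sum {X Y Z : Type*} [MeasurableSpace X] [MeasurableSpace Y]
    [MeasurableSpace Z] {f : X → Z} {g : Y → Z} (hf : Measurable f) (hg : Measurable g) :
    Measurable (Sum.elim f g) := measurable_fun_sum hf hg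

/-- The jump times are increasing, and the inventory at the next jump is determined by the rate. -/
def IsTransition (M : LiquidationModel K) (a : PState K → ℝ → ℝ) (z z' : ChainState K) : Prop :=
  z' ∈ range Sum.inl → z ∈ range Sum.inl ∧ chainVal z' ∈ M.stateSpace ∧
    (chainVal z).time < (chainVal z').time ∧ (chainVal z').inv = (chainVal z).inv -
      ∫ r in (0 : ℝ)..((chainVal z').time - (chainVal z).time), M.cut (a (chainVal z)) (chainVal z) r

theorem Strategy.isControl (ν : M.Strategy) (n : ℕ) (x : PState K) : M.IsControl (ν.1 n x) :=
  ⟨(ν.2 n).1.comp (measurable_const.prodMk measurable_id), fun v => (ν.2 n).2 x v⟩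

theorem measurableSet_isTransition {a : PState K → ℝ → ℝ}
    (ha : Measurable (fun y : PState K × ℝ => a y.1 y.2)) (hc : ∀ x, M.IsControl (a x)) :
    MeasurableSet {p : ChainState K × ChainState K | M.IsTransition a p.1 p.2} := by
  have hr : MeasurableSet (range (Sum.inl : PState K → ChainState K)) := measurableSet_range_inl
  have hv1 : Measurable fun p : ChainState K × ChainState K => chainVal p.1 :=
    measurable_chainVal.comp measurable_fst
  have hv2 : Measurable fun p : ChainState K × ChainState K => chainVal p.2 :=
    measurable_chainVal.comp measurable_snd
  have hI : Measurable fun p : ChainState K × ChainState K =>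
      ∫ r in (0 : ℝ)..((chainVal p.2).time - (chainVal p.1).time),
        M.cut (a (chainVal p.1)) (chainVal p.1) r := by
    refine measurable_intervalIntegral_param
      (F := fun (p : ChainState K × ChainState K) r => M.cut (a (chainVal p.1)) (chainVal p.1) r)
      ?_ measurable_const ((measurable_time.comp hv2).sub (measurable_time.comp hv1))
    exact (measurable_cut ha hc).comp ((hv1.comp measurable_fst).prodMk measurable_snd)
  have e : {p : ChainState K × ChainState K | M.IsTransition a p.1 p.2}
      = (Prod.snd ⁻¹' range Sum.inl)ᶜ ∪ ((Prod.fst ⁻¹' range Sum.inl) ∩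
        ({p | chainVal p.2 ∈ M.stateSpace} ∩ ({p | (chainVal p.1).time < (chainVal p.2).time} ∩
        {p | (chainVal p.2).inv = (chainVal p.1).inv -
          ∫ r in (0 : ℝ)..((chainVal p.2).time - (chainVal p.1).time),
            M.cut (a (chainVal p.1)) (chainVal p.1) r}))) := by
    ext p
    simp only [IsTransition, mem_ofPred_eq, mem_union, mem_compl_iff, mem_preimage, mem_inter_iff]
    tauto
  rw [e]
  refine (measurable_snd hr).compl.union ((measurable_fst hr).inter
    ((hv2 measurableSet_stateSpace).inter ((measurableSet_lt (measurable_time.comp hv1)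
      (measurable_time.comp hv2)).inter (measurableSet_eq_fun (measurable_inv.comp hv2)
        ((measurable_inv.comp hv1).sub hI)))))

/-! ### A weight on the chain and its decay -/

theorem integral_exp_neg_le {A γ L : ℝ} (hA : 0 ≤ A) (hγ : 0 < γ) :
    ∫ r in (0 : ℝ)..L, A * Real.exp (-γ * r) ≤ A / γ := by
  have hd : ∀ r ∈ uIcc 0 L, HasDerivAt (fun r => -(A / γ) * Real.exp (-γ * r))
      (A * Real.exp (-γ * r)) r := by
    intro r _
    have := (((hasDerivAt_id r).const_mul (-γ)).exp).const_mul (-(A / γ))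
    exact this.congr_deriv (by simp only [id]; field_simp)
  rw [intervalIntegral.integral_eq_sub_of_hasDerivAt hd
    (Continuous.intervalIntegrable (by fun_prop) _ _)]
  have hpos : 0 ≤ A / γ * Real.exp (-γ * L) := mul_nonneg (div_nonneg hA hγ.le) (Real.exp_pos _).le
  simp only [mul_zero, Real.exp_zero]
  linarith

/-- A Lyapunov function for the embedded chain. -/
noncomputable def weight (M : LiquidationModel K) (γ : ℝ) (x : PState K) : ℝ :=
  (1 + x.price * x.inv) * Real.exp (γ * (M.T - x.time))

/-- The Lyapunov function, extended by zero to the cemetery. -/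
noncomputable def chainWeight (M : LiquidationModel K) (γ : ℝ) : ChainState K → ENNReal :=
  Sum.elim (fun x => ENNReal.ofReal (M.weight γ x)) fun _ => 0

theorem measurable_weight (γ : ℝ) : Measurable (M.weight (K := K) γ) :=
  (measurable_const.add (measurable_price.mul measurable_inv)).mul
    (Real.measurable_exp.comp ((measurable_const.sub measurable_time).const_mul _))

theorem measurable_chainWeight (γ : ℝ) : Measurable (M.chainWeight (K := K) γ) :=
  measurable_of_sum (measurable_weight γ).ennreal_ofReal measurable_const

/-- The summand 1 in the weight matters here: `bounding` may vanish, whereas every live entry of the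
chain contributes at least one, so that the summed weights count jumps. -/
theorem one_le_weight {x : PState K} (hx : x ∈ M.stateSpace) {γ : ℝ} (hγ : 0 ≤ γ) :
    1 ≤ M.weight γ x := by
  have := mul_nonneg (price_nonneg hx) (inv_mem hx).1
  exact one_le_mul_of_one_le_of_one_le (by linarith)
    (Real.one_le_exp (mul_nonneg hγ (horizon_nonneg hx)))

theorem bounding_le_weight (x : PState K) (γ : ℝ) : M.bounding γ x ≤ M.weight γ x := by
  rw [weight, add_mul, one_mul, bounding]
  linarith [Real.exp_pos (γ * (M.T - x.time))]

namespace Assumption1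

variable (h1 : M.Assumption1)
include h1

theorem stepKernel_apply (ν : M.Strategy) (n : ℕ) (z : ChainState K) :
    M.stepKernel (ν.1 n) z = M.stepMeasure (ν.1 n) z := by
  have hm := h1.measurable_stepMeasure (ν.2 n).1 (ν.isControl n)
  have hp := h1.isProbabilityMeasure_stepMeasure (ν.isControl n)
  unfold stepKernel
  rw [dif_pos ⟨hm, hp⟩]
  rfl

theorem isTransition_stepMeasure {a : PState K → ℝ → ℝ}
    (ha : Measurable (fun y : PState K × ℝ => a y.1 y.2)) (hc : ∀ x, M.IsControl (a x))
    (z : ChainState K) : ∀ᵐ z' ∂(M.stepMeasure a z), M.IsTransition a z z' := by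
  have hms : MeasurableSet {z' | M.IsTransition a z z'} :=
    measurable_prodMk_left (measurableSet_isTransition ha hc)
  have hinr : M.IsTransition a z (Sum.inr ()) := fun h => by simp at h
  have hdirac : ∀ᵐ z' ∂(Measure.dirac (Sum.inr () : ChainState K)), M.IsTransition a z z' :=
    (ae_dirac_iff hms).2 hinr
  rcases z with x | z
  · by_cases hx : x ∈ M.stateSpace
    · have hF : Measurable (({z' | M.IsTransition a (Sum.inl x) z'}ᶜ).indicator
          (1 : ChainState K → ENNReal)) := measurable_one.indicator hms.compl
      rw [ae_iff]
      change M.stepMeasure a (Sum.inl x) ({z' | M.IsTransition a (Sum.inl x) z'}ᶜ) = 0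
      rw [← lintegral_indicator_one hms.compl, h1.lintegral_stepMeasure (hc x) hx hF,
        indicator_of_notMem (by simpa using hinr), mul_zero, add_zero]
      refine (setLIntegral_congr_fun measurableSet_Ioc (g := fun _ => 0) fun v hv => ?_).trans
        (by simp)
      have hv' : v ∈ Icc 0 (M.T - x.time) := ⟨hv.1.le, hv.2⟩
      have hz : ∫⁻ y, ({z' | M.IsTransition a (Sum.inl x) z'}ᶜ).indicator 1 (Sum.inl y)
          ∂(M.jumpKer (h1.expFlow (M.cut (a x) x) x v) (M.cut (a x) x v)) = 0 := by
        refine (lintegral_eq_zero_iff (hF.comp measurable_inl)).2 ?_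
        filter_upwards [h1.jumpKer_mem (h1.expFlow_cut_mem (hc x) hx hv') (M.cut (a x) x v)] with y hy
        refine indicator_of_notMem ?_ _
        rw [notMem_compl_iff]
        intro _
        have ht : y.time = x.time + v := hy.2.1
        refine ⟨⟨x, rfl⟩, hy.1, ?_, ?_⟩
        · change x.time < y.time
          rw [ht]; linarith [hv.1]
        · change y.inv = x.inv - ∫ r in (0 : ℝ)..(y.time - x.time), M.cut (a x) x r
          rw [ht, add_sub_cancel_left]
          exact hy.2.2
      simp only [hz, mul_zero]
    · simpa only [stepMeasure, if_neg hx] using hdirac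
  · exact hdirac

theorem weight_jumpTo_le {x : PState K} (hx : x ∈ M.stateSpace) (ν γ : ℝ) {z : ℝ}
    (hz : z ∈ M.etaQ.support) :
    M.weight γ (M.jumpTo x ν z) ≤ M.weight γ x * h1.jumpBound := by
  have h := h1.jump_le z hz
  have hb := h1.one_le_jumpBound
  have hp := mul_nonneg (price_nonneg hx) (inv_mem hx).1
  have hE := (Real.exp_pos (γ * (M.T - x.time))).le
  have e : M.weight γ (M.jumpTo x ν z)
      = (1 + (x.price * x.inv) * (1 + z)) * Real.exp (γ * (M.T - x.time)) := by
    simp only [weight, jumpTo, PState.price, PState.inv, PState.time]; ring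
  have e2 : M.weight γ x * h1.jumpBound
      = ((1 + x.price * x.inv) * h1.jumpBound) * Real.exp (γ * (M.T - x.time)) := by
    rw [weight]; ring
  rw [e, e2]
  refine mul_le_mul_of_nonneg_right ?_ hE
  have := mul_le_mul_of_nonneg_left h.2 hp
  linarith

theorem weight_expFlow_le {α : ℝ → ℝ} {x : PState K} (hα : M.IsControl α)
    (hx : x ∈ M.stateSpace) {r : ℝ} (hr : 0 ≤ r) (γ : ℝ) :
    M.weight γ (h1.expFlow α x r) ≤ M.weight γ x * Real.exp (-γ * r) := by
  have e : Real.exp (γ * (M.T - (x.time + r)))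
      = Real.exp (γ * (M.T - x.time)) * Real.exp (-γ * r) := by
    rw [← Real.exp_add]; congr 1; ring
  change (1 + x.price * (x.inv - ∫ r in (0 : ℝ)..r, α r)) * Real.exp (γ * (M.T - (x.time + r))) ≤ _
  rw [e, weight, ← mul_assoc]
  have := mul_nonneg (price_nonneg hx) (hα.integral_nonneg hr)
  refine mul_le_mul_of_nonneg_right (mul_le_mul_of_nonneg_right ?_ (Real.exp_pos _).le)
    (Real.exp_pos _).le
  rw [mul_sub]; linarith

theorem weight_nonneg {x : PState K} (hx : x ∈ M.stateSpace) (γ : ℝ) : 0 ≤ M.weight γ x :=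
  mul_nonneg (add_nonneg zero_le_one (mul_nonneg (price_nonneg hx) (inv_mem hx).1))
    (Real.exp_pos _).le

/-- The same estimate as for the continuation operator: decay at rate `halfRate` along the flow
against growth by `jumpRateBound`. The cemetery has weight zero and contributes nothing. -/
theorem lintegral_chainWeight_le {a : PState K → ℝ → ℝ} (hc : ∀ x, M.IsControl (a x))
    (z : ChainState K) :
    ∫⁻ z', M.chainWeight h1.halfRate z' ∂(M.stepMeasure a z) ≤ 2⁻¹ * M.chainWeight h1.halfRate z := by
  set γ := h1.halfRate with hγ
  have hγ0 : 0 < γ := h1.halfRate_pos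
  have hR := h1.jumpRateBound_nonneg
  have h0 : ∫⁻ z', M.chainWeight γ z' ∂(Measure.dirac (Sum.inr () : ChainState K)) = 0 := by
    rw [lintegral_dirac' _ (measurable_chainWeight γ)]; rfl
  rcases z with x | z
  swap
  · exact h0.le.trans bot_le
  by_cases hx : x ∈ M.stateSpace
  swap
  · simp only [stepMeasure, if_neg hx, h0]; exact bot_le
  have hα := (hc x).cut x
  have hL := horizon_nonneg hx
  have hW := h1.weight_nonneg hx γ
  rw [h1.lintegral_stepMeasure (hc x) hx (measurable_chainWeight γ)]
  have hinr : M.chainWeight γ (Sum.inr ()) = 0 := rfl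
  rw [hinr, mul_zero, add_zero]
  have hcont : Continuous fun v => M.weight γ x * h1.jumpRateBound * Real.exp (-γ * v) := by fun_prop
  calc _ ≤ ∫⁻ v in Ioc 0 (M.T - x.time),
        ENNReal.ofReal (M.weight γ x * h1.jumpRateBound * Real.exp (-γ * v)) := by
        refine setLIntegral_mono hcont.measurable.ennreal_ofReal fun v hv => ?_
        have hmem := h1.expFlow_cut_mem (hc x) hx (⟨hv.1.le, hv.2⟩ : v ∈ Icc 0 (M.T - x.time))
        have hb : ∫⁻ y, M.chainWeight γ (Sum.inl y)
            ∂(M.jumpKer (h1.expFlow (M.cut (a x) x) x v) (M.cut (a x) x v))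
            ≤ ENNReal.ofReal (M.weight γ x * Real.exp (-γ * v)) * ENNReal.ofReal h1.jumpRateBound := by
          refine h1.lintegral_jumpKer_le hmem _ ((measurable_chainWeight γ).comp measurable_inl)
            fun z hz => ?_
          rw [← ENNReal.ofReal_mul (mul_nonneg hW (Real.exp_pos _).le)]
          refine ENNReal.ofReal_le_ofReal ((h1.weight_jumpTo_le hmem _ γ hz).trans ?_)
          exact mul_le_mul_of_nonneg_right (h1.weight_expFlow_le hα hx hv.1.le γ)
            (zero_le_one.trans h1.one_le_jumpBound)
        have hs : ENNReal.ofReal (h1.surv (M.cut (a x) x) x v) ≤ 1 := by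
          rw [← ENNReal.ofReal_one]
          exact ENNReal.ofReal_le_ofReal (h1.surv_le_one hα.1 (filt_mem hx) hv.1.le)
        refine (mul_le_mul' hs hb).trans (le_of_eq ?_)
        rw [one_mul, ← ENNReal.ofReal_mul (mul_nonneg hW (Real.exp_pos _).le)]
        congr 1; ring
    _ = ENNReal.ofReal (∫ v in (0 : ℝ)..(M.T - x.time),
          M.weight γ x * h1.jumpRateBound * Real.exp (-γ * v)) := by
        rw [intervalIntegral.integral_of_le hL, ofReal_integral_eq_lintegral_ofReal]
        · exact (hcont.integrableOn_Icc).mono_set Ioc_subset_Icc_self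
        · exact Eventually.of_forall fun v => by positivity
    _ ≤ ENNReal.ofReal (2⁻¹ * M.weight γ x) := by
        refine ENNReal.ofReal_le_ofReal ((integral_exp_neg_le (by positivity) hγ0).trans ?_)
        rw [mul_div_assoc, mul_comm]
        refine mul_le_mul_of_nonneg_right (h1.jumpRateBound_div_halfRate.trans (by norm_num)) hW
    _ = 2⁻¹ * ENNReal.ofReal (M.weight γ x) := by
        rw [ENNReal.ofReal_mul (by norm_num), ENNReal.ofReal_inv_of_pos two_pos, ENNReal.ofReal_ofNat]

/-! ### The law of the chain -/

instance (ν : M.Strategy) (x : PState K) : IsProbabilityMeasure (M.law ν x) := by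
  unfold law; infer_instance

omit h1 in
theorem map_law_zero (ν : M.Strategy) (x : PState K) :
    (M.law ν x).map (fun z => z 0) = Measure.dirac (Sum.inl x) := by
  have h : (M.law ν x).map (Preorder.frestrictLe 0) = _ :=
    Kernel.traj_map_frestrictLe_apply (X := fun _ => ChainState K) (κ := M.histKernel ν) 0 0
      (fun _ => Sum.inl x)
  rw [Kernel.partialTraj_self, Kernel.id_apply] at h
  have e : (fun z : ℕ → ChainState K => z 0)
      = (fun w : (Π _ : Finset.Iic 0, ChainState K) => w ⟨0, Finset.mem_Iic.2 le_rfl⟩) ∘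
        (Preorder.frestrictLe 0) := rfl
  rw [e, ← Measure.map_map (by fun_prop) (by fun_prop), h, Measure.map_dirac' (by fun_prop)]

omit h1 in
-- The construction of the trajectory measure gives the joint law of the whole history and the next
-- entry. Since `histKernel` looks only at the last entry of the history, projecting to that entry
-- yields the one-step Markov property.
theorem map_law_pair (ν : M.Strategy) (x : PState K) (n : ℕ) :
    (M.law ν x).map (fun z => (z n, z (n + 1)))
      = ((M.law ν x).map (fun z => z n)) ⊗ₘ (M.stepKernel (ν.1 n)) := by
  have e1 := Kernel.partialTraj_compProd_eq_map_traj (X := fun _ => ChainState K)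
    (κ := M.histKernel ν) (Nat.zero_le n) (x₀ := fun _ => Sum.inl x)
  have e2 := Kernel.traj_map_frestrictLe_apply (X := fun _ => ChainState K) (κ := M.histKernel ν) 0 n
      (fun _ => Sum.inl x)
  rw [← e2] at e1
  change ((M.law ν x).map (Preorder.frestrictLe n)) ⊗ₘ (M.histKernel ν n)
    = (M.law ν x).map (fun z => (Preorder.frestrictLe n z, z (n + 1))) at e1
  have hp : Measurable (fun w : (Π _ : Finset.Iic n, ChainState K) =>
      w ⟨n, Finset.mem_Iic.2 le_rfl⟩) := measurable_pi_apply _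
  have hfr : Measurable (Preorder.frestrictLe (π := fun _ => ChainState K) n) := by fun_prop
  ext s hs
  have hs' := (hp.prodMap measurable_id : Measurable (Prod.map _ (id : ChainState K → _))) hs
  have e3 : (M.law ν x).map (fun z => (z n, z (n + 1))) s
      = ((M.law ν x).map (fun z => (Preorder.frestrictLe n z, z (n + 1))))
        (Prod.map (fun w : (Π _ : Finset.Iic n, ChainState K) => w ⟨n, Finset.mem_Iic.2 le_rfl⟩) id
          ⁻¹' s) := by
    rw [Measure.map_apply (by fun_prop) hs, Measure.map_apply (by fun_prop) hs']
    rfl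
  rw [e3, ← e1, Measure.compProd_apply hs', Measure.compProd_apply hs,
    lintegral_map (Kernel.measurable_kernel_prodMk_left hs') hfr,
    lintegral_map (Kernel.measurable_kernel_prodMk_left hs) (by fun_prop)]
  rfl

theorem lintegral_law_chainWeight_le (ν : M.Strategy) (x : PState K) (n : ℕ) :
    ∫⁻ z, M.chainWeight h1.halfRate (z n) ∂(M.law ν x)
      ≤ 2⁻¹ ^ n * ENNReal.ofReal (M.weight h1.halfRate x) := by
  have hm := measurable_chainWeight (M := M) h1.halfRate
  induction n with
  | zero =>
    have : ∫⁻ z, M.chainWeight h1.halfRate (z 0) ∂(M.law ν x)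
        = ∫⁻ z, M.chainWeight h1.halfRate z ∂((M.law ν x).map (fun z => z 0)) :=
      (lintegral_map hm (by fun_prop)).symm
    rw [this, map_law_zero, lintegral_dirac' _ hm, pow_zero, one_mul]
    rfl
  | succ n ih =>
    have : ∫⁻ z, M.chainWeight h1.halfRate (z (n + 1)) ∂(M.law ν x)
        = ∫⁻ p, M.chainWeight h1.halfRate p.2 ∂((M.law ν x).map (fun z => (z n, z (n + 1)))) :=
      (lintegral_map (g := fun z : ℕ → ChainState K => (z n, z (n + 1)))
        (hm.comp measurable_snd) (by fun_prop)).symm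
    rw [this, map_law_pair, Measure.lintegral_compProd (f := fun p => M.chainWeight h1.halfRate p.2)
      (hm.comp measurable_snd),
      lintegral_map (f := fun z => ∫⁻ y, M.chainWeight h1.halfRate y ∂(M.stepKernel (ν.1 n) z))
        (g := fun z : ℕ → ChainState K => z n) hm.lintegral_kernel (measurable_pi_apply n)]
    simp only [h1.stepKernel_apply]
    calc _ ≤ ∫⁻ z, 2⁻¹ * M.chainWeight h1.halfRate (z n) ∂(M.law ν x) :=
          lintegral_mono fun z => h1.lintegral_chainWeight_le (ν.isControl n) _
      _ = 2⁻¹ * ∫⁻ z, M.chainWeight h1.halfRate (z n) ∂(M.law ν x) :=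
          lintegral_const_mul _ (hm.comp (by fun_prop))
      _ ≤ 2⁻¹ * (2⁻¹ ^ n * ENNReal.ofReal (M.weight h1.halfRate x)) := mul_le_mul' le_rfl ih
      _ = _ := by rw [pow_succ]; ring

/-- Trajectories of the embedded chain with increasing jump times and finitely many jumps. -/
structure _root_.LiquidationModel.IsGood (M : LiquidationModel K) (ν : M.Strategy) (x : PState K)
    (z : ℕ → ChainState K) : Prop where
  zero : z 0 = Sum.inl x
  trans : ∀ n, M.IsTransition (ν.1 n) (z n) (z (n + 1))
  finite : ∃ n, z n ∉ range Sum.inl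

theorem ae_isTransition (ν : M.Strategy) (x : PState K) (n : ℕ) :
    ∀ᵐ z ∂(M.law ν x), M.IsTransition (ν.1 n) (z n) (z (n + 1)) := by
  have hms := measurableSet_isTransition (ν.2 n).1 (ν.isControl n)
  have hmap : ∀ᵐ p ∂((M.law ν x).map (fun z => (z n, z (n + 1)))), M.IsTransition (ν.1 n) p.1 p.2 := by
    rw [map_law_pair]
    refine Measure.ae_compProd_of_ae_ae hms (Eventually.of_forall fun z => ?_)
    rw [h1.stepKernel_apply]
    exact h1.isTransition_stepMeasure (ν.2 n).1 (ν.isControl n) z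
  exact (ae_map_iff (by fun_prop) hms).1 hmap

/-- The expected weights form a geometric series, so the sum of the weights along a trajectory is
almost surely finite. As each live entry has weight at least one, the chain must reach the cemetery:
there is no accumulation of jumps. -/
theorem ae_isGood (ν : M.Strategy) {x : PState K} (hx : x ∈ M.stateSpace) :
    ∀ᵐ z ∂(M.law ν x), M.IsGood ν x z := by
  have hm := measurable_chainWeight (M := M) h1.halfRate
  have h0 : ∀ᵐ z ∂(M.law ν x), z 0 = Sum.inl x := by
    have : ∀ᵐ y ∂((M.law ν x).map (fun z => z 0)), y = Sum.inl x := by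
      rw [map_law_zero]
      have hs : MeasurableSet {y : ChainState K | y = Sum.inl x} := by
        have : MeasurableSet ((Sum.inl : PState K → ChainState K) '' {x}) :=
          (measurableSet_singleton x).inl_image
        rwa [image_singleton] at this
      exact (ae_dirac_iff hs).2 rfl
    exact ae_of_ae_map (f := fun z : ℕ → ChainState K => z 0)
      (measurable_pi_apply 0).aemeasurable this
  have htrans := ae_all_iff.2 (h1.ae_isTransition ν x)
  have hsum : ∫⁻ z, ∑' n, M.chainWeight h1.halfRate (z n) ∂(M.law ν x) ≠ ⊤ := by
    rw [lintegral_tsum (f := fun n (z : ℕ → ChainState K) => M.chainWeight h1.halfRate (z n))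
      fun n => (hm.comp (measurable_pi_apply n)).aemeasurable]
    refine ne_top_of_le_ne_top ?_ (ENNReal.tsum_le_tsum fun n =>
      h1.lintegral_law_chainWeight_le ν x n)
    rw [ENNReal.tsum_mul_right, ENNReal.tsum_geometric]
    refine ENNReal.mul_ne_top ?_ ENNReal.ofReal_ne_top
    simp
  have hfin := ae_lt_top (Measurable.tsum fun n =>
    hm.comp (measurable_pi_apply n)) hsum
  filter_upwards [h0, htrans, hfin] with z hz0 hzt hzf
  refine ⟨hz0, hzt, ?_⟩
  by_contra! hcon
  have hmem : ∀ n, chainVal (z n) ∈ M.stateSpace := by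
    intro n
    cases n with
    | zero => rw [hz0]; exact hx
    | succ n => exact (hzt n (hcon (n + 1))).2.1
  have hge : ∀ n, 1 ≤ M.chainWeight h1.halfRate (z n) := by
    intro n
    obtain ⟨y, hy⟩ := hcon n
    have h2 := hmem n
    rw [← hy] at h2 ⊢
    change 1 ≤ ENNReal.ofReal (M.weight h1.halfRate y)
    rw [ENNReal.one_le_ofReal]
    exact one_le_weight h2 h1.halfRate_pos.le
  have : (∑' _n : ℕ, (1 : ENNReal)) ≤ ∑' n, M.chainWeight h1.halfRate (z n) :=
    ENNReal.tsum_le_tsum hge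
  rw [ENNReal.tsum_const_eq_top_of_ne_zero one_ne_zero] at this
  exact not_lt.2 this hzf

end Assumption1

/-! ### The proceeds along a trajectory -/

theorem ae_eq_of_eqOn_Ico {f g : ℝ → ℝ} {c d : ℝ} (h : ∀ r ∈ Ico c d, f r = g r) :
    ∀ᵐ r, r ∈ Ioc c d → f r = g r := by
  have hne : ∀ᵐ r : ℝ, r ≠ d := compl_mem_ae_iff.2 (measure_singleton _)
  filter_upwards [hne] with r hr h2
  exact h r ⟨h2.1.le, lt_of_le_of_ne h2.2 hr⟩

theorem integral_congr_Ico {f g : ℝ → ℝ} {c d : ℝ} (hcd : c ≤ d) (h : ∀ r ∈ Ico c d, f r = g r) :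
    ∫ r in c..d, f r = ∫ r in c..d, g r :=
  intervalIntegral.integral_congr_ae (by rw [uIoc_of_le hcd]; exact ae_eq_of_eqOn_Ico h)

theorem intervalIntegrable_congr_Ico {f g : ℝ → ℝ} {c d : ℝ} (hcd : c ≤ d)
    (h : ∀ r ∈ Ico c d, f r = g r) (hg : IntervalIntegrable g volume c d) :
    IntervalIntegrable f volume c d := by
  rw [intervalIntegrable_iff_integrableOn_Ioc_of_le hcd] at hg ⊢
  refine hg.congr ?_
  rw [Filter.EventuallyEq, ae_restrict_iff' measurableSet_Ioc]
  exact (ae_eq_of_eqOn_Ico h).mono fun r hr h2 => (hr h2).symm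

/-- The time of a jump (the horizon at the cemetery). -/
def chainTime (M : LiquidationModel K) : ChainState K → ℝ := Sum.elim PState.time fun _ => M.T

/-- The discounted proceeds of one period started in `x`, up to the next entry of the chain. -/
noncomputable def periodGain (M : LiquidationModel K) (a : PState K → ℝ → ℝ) (x : PState K)
    (z' : ChainState K) : ℝ :=
  ∫ r in (0 : ℝ)..(M.chainTime z' - x.time),
    Real.exp (-M.ρ * r) * (M.gain (M.cut (a x) x r) * x.price)

/-- The discounted value of the terminal inventory, if there is no further jump. -/
noncomputable def endGain (M : LiquidationModel K) (a : PState K → ℝ → ℝ) (x : PState K) :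
    ChainState K → ℝ :=
  Sum.elim (fun _ => 0) fun _ => Real.exp (-M.ρ * (M.T - x.time)) *
    (M.hext (x.inv - ∫ r in (0 : ℝ)..(M.T - x.time), M.cut (a x) x r) * x.price)

/-- The reward of one step of the chain. -/
noncomputable def stepReward (M : LiquidationModel K) (a : PState K → ℝ → ℝ) (z z' : ChainState K) :
    ℝ :=
  Sum.elim (fun x => M.periodGain a x z' + M.endGain a x z') (fun _ => 0) z

/-- The discount factor at an entry of the chain. -/
noncomputable def chainDisc (M : LiquidationModel K) (t : ℝ) (z : ChainState K) : ℝ :=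
  Real.exp (-M.ρ * (M.chainTime z - t))

namespace IsGood

variable {ν : M.Strategy} {x : PState K} {z : ℕ → ChainState K}

theorem alive_of_le (hz : M.IsGood ν x z) {k m : ℕ} (hkm : k ≤ m) (hm : z m ∈ range Sum.inl) :
    z k ∈ range Sum.inl := by
  induction m, hkm using Nat.le_induction with
  | base => exact hm
  | succ m _ ih => exact ih (hz.trans m hm).1

theorem mem_stateSpace (hz : M.IsGood ν x z) (hx : x ∈ M.stateSpace) {k : ℕ} {y : PState K}
    (hk : z k = Sum.inl y) : y ∈ M.stateSpace := by
  cases k with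
  | zero =>
    rw [hz.zero] at hk
    rwa [← Sum.inl.inj hk]
  | succ k =>
    have := (hz.trans k ⟨y, hk.symm⟩).2.1
    rwa [hk] at this

theorem chainTime_le (hz : M.IsGood ν x z) (hx : x ∈ M.stateSpace) (k : ℕ) :
    M.chainTime (z k) ≤ M.T := by
  rcases h : z k with y | y
  · exact (time_mem (hz.mem_stateSpace hx h)).2
  · exact le_rfl

theorem chainTime_lt_succ (hz : M.IsGood ν x z) {k : ℕ} {y : PState K}
    (hk : z (k + 1) = Sum.inl y) : M.chainTime (z k) < y.time := by
  obtain ⟨⟨y', hy'⟩, -, h, -⟩ := hz.trans k ⟨y, hk.symm⟩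
  rw [hk, ← hy'] at h
  rw [← hy']
  exact h

theorem chainTime_le_succ (hz : M.IsGood ν x z) (hx : x ∈ M.stateSpace) (k : ℕ) :
    M.chainTime (z k) ≤ M.chainTime (z (k + 1)) := by
  rcases h : z (k + 1) with y | y
  · exact (hz.chainTime_lt_succ h).le
  · exact hz.chainTime_le hx k

theorem chainTime_mono (hz : M.IsGood ν x z) (hx : x ∈ M.stateSpace) :
    Monotone fun k => M.chainTime (z k) := monotone_nat_of_le_succ (hz.chainTime_le_succ hx)

/-- Jump times are increasing along a good trajectory, so an index beyond `k` with time at most `r`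
would force the next jump to have occurred by `r`. -/
theorem jumpCount_eq (hz : M.IsGood ν x z) (hx : x ∈ M.stateSpace) {k : ℕ} {y : PState K}
    (hk : z k = Sum.inl y) {r : ℝ} (hr : y.time ≤ r)
    (hr' : ∀ y', z (k + 1) = Sum.inl y' → r < y'.time) : jumpCount z r = k := by
  refine IsGreatest.csSup_eq ⟨⟨y, hk, hr⟩, ?_⟩
  rintro m ⟨y', hm, hmr⟩
  by_contra! hlt
  obtain ⟨y'', hy''⟩ := hz.alive_of_le (Nat.succ_le_of_lt hlt) ⟨y', hm.symm⟩
  have h1 := hr' y'' hy''.symm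
  have h2 := hz.chainTime_mono hx (Nat.succ_le_of_lt hlt)
  simp only [← hy'', hm, Nat.succ_eq_add_one] at h2
  change y''.time ≤ y'.time at h2
  linarith

end IsGood

theorem rate_nonneg (ν : M.Strategy) (z : ℕ → ChainState K) (r : ℝ) : 0 ≤ M.rate ν z r := by
  unfold rate
  split
  · unfold stopped
    split_ifs
    · exact ((ν.2 _).2 _ _).1
    · exact le_rfl
  · exact le_rfl

namespace IsGood

variable {ν : M.Strategy} {x : PState K} {z : ℕ → ChainState K}

theorem rate_path_eq (h1 : M.Assumption1) (hz : M.IsGood ν x z) (hx : x ∈ M.stateSpace) {k : ℕ}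
    {y : PState K} (hk : z k = Sum.inl y) {r : ℝ} (hr : r ∈ Icc y.time M.T)
    (hr' : ∀ y', z (k + 1) = Sum.inl y' → r < y'.time) :
    M.rate ν z r = M.cut (ν.1 k y) y (r - y.time) ∧ (M.path ν z r).price = y.price ∧
      (M.path ν z r).inv = y.inv - ∫ v in (0 : ℝ)..(r - y.time), M.cut (ν.1 k y) y v := by
  have hj := hz.jumpCount_eq hx hk hr.1 hr'
  have hy := hz.mem_stateSpace hx hk
  have hc := ν.isControl k y
  have hp : M.path ν z r = h1.expFlow (M.cut (ν.1 k y) y) y (r - y.time) := by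
    simp only [path, hj, hk]
    rw [h1.stopped_eq hc hy, h1.flow_eq (hc.cut y) hy ⟨sub_nonneg.2 hr.1, by linarith [hr.2]⟩]
  refine ⟨?_, by rw [hp]; rfl, by rw [hp]; rfl⟩
  simp only [rate, hj, hk]
  rw [h1.stopped_eq hc hy]

/-- At the right endpoint the path already belongs to the next period. The formula extends to the
closed interval because the inventory is not changed by a jump, as recorded in the transition. -/
theorem inv_path_eq (h1 : M.Assumption1) (hz : M.IsGood ν x z) (hx : x ∈ M.stateSpace) {k : ℕ}
    {y : PState K} (hk : z k = Sum.inl y) {r : ℝ} (hr : r ∈ Icc y.time (M.chainTime (z (k + 1)))) :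
    (M.path ν z r).inv = y.inv - ∫ v in (0 : ℝ)..(r - y.time), M.cut (ν.1 k y) y v := by
  have hrT : r ≤ M.T := hr.2.trans (hz.chainTime_le hx _)
  by_cases h : ∀ y', z (k + 1) = Sum.inl y' → r < y'.time
  · exact (hz.rate_path_eq h1 hx hk ⟨hr.1, hrT⟩ h).2.2
  push Not at h
  obtain ⟨y', hy', hle⟩ := h
  have hr2 := hr.2
  rw [hy'] at hr2
  have hre : r = y'.time := le_antisymm hr2 hle
  have h2 := (hz.rate_path_eq h1 hx hy' ⟨hle, hrT⟩ fun y'' hy'' => by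
    have := hz.chainTime_lt_succ hy''
    rw [hy'] at this
    exact hr2.trans_lt this).2.2
  have h3 := (hz.trans k ⟨y', hy'.symm⟩).2.2.2
  rw [hk, hy'] at h3
  change y'.inv = y.inv - ∫ r in (0 : ℝ)..(y'.time - y.time), M.cut (ν.1 k y) y r at h3
  rw [h2, hre, sub_self, intervalIntegral.integral_same, sub_zero, h3]

theorem rate_price_eq (h1 : M.Assumption1) (hz : M.IsGood ν x z) (hx : x ∈ M.stateSpace) {k : ℕ}
    {y : PState K} (hk : z k = Sum.inl y) {r : ℝ} (hr : r ∈ Ico y.time (M.chainTime (z (k + 1)))) :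
    M.rate ν z r = M.cut (ν.1 k y) y (r - y.time) ∧ (M.path ν z r).price = y.price := by
  have h := hz.rate_path_eq h1 hx hk (r := r) ⟨hr.1, hr.2.le.trans (hz.chainTime_le hx _)⟩
    fun y' hy' => by
      have := hr.2
      rwa [hy'] at this
  exact ⟨h.1, h.2.1⟩

theorem inv_path_nonneg (h1 : M.Assumption1) (hz : M.IsGood ν x z) (hx : x ∈ M.stateSpace) {k : ℕ}
    {y : PState K} (hk : z k = Sum.inl y) {r : ℝ} (hr : r ∈ Icc y.time (M.chainTime (z (k + 1)))) :
    0 ≤ (M.path ν z r).inv := by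
  rw [hz.inv_path_eq h1 hx hk hr, sub_nonneg]
  exact integral_cut_le (ν.isControl k y) (hz.mem_stateSpace hx hk) (sub_nonneg.2 hr.1)

/-- The discounted flow of proceeds. -/
noncomputable def _root_.LiquidationModel.proceeds (M : LiquidationModel K) (ν : M.Strategy) (t : ℝ)
    (z : ℕ → ChainState K) (r : ℝ) : ℝ :=
  Real.exp (-M.ρ * (r - t)) * M.rate ν z r * (M.path ν z r).price * (1 - M.f (M.rate ν z r))

theorem proceeds_eq (h1 : M.Assumption1) (hz : M.IsGood ν x z) (hx : x ∈ M.stateSpace) {k : ℕ}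
    {y : PState K} (hk : z k = Sum.inl y) {r : ℝ} (hr : r ∈ Ico y.time (M.chainTime (z (k + 1)))) :
    M.proceeds ν x.time z r = M.chainDisc x.time (z k) * (Real.exp (-M.ρ * (r - y.time)) *
      (M.gain (M.cut (ν.1 k y) y (r - y.time)) * y.price)) := by
  obtain ⟨e1, e2⟩ := hz.rate_price_eq h1 hx hk hr
  have hd : Real.exp (-M.ρ * (r - x.time))
      = M.chainDisc x.time (z k) * Real.exp (-M.ρ * (r - y.time)) := by
    rw [chainDisc, ← Real.exp_add, hk]
    congr 1
    change _ = -M.ρ * (y.time - x.time) + _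
    ring
  rw [proceeds, e1, e2, gain_of_mem (((ν.isControl k y).cut y).2 _), hd]
  ring

theorem segment (h1 : M.Assumption1) (hz : M.IsGood ν x z) (hx : x ∈ M.stateSpace) (k : ℕ) {d : ℝ}
    (hd : d ∈ Icc (M.chainTime (z k)) (M.chainTime (z (k + 1)))) :
    IntervalIntegrable (M.rate ν z) volume (M.chainTime (z k)) d ∧
    IntervalIntegrable (M.proceeds ν x.time z) volume (M.chainTime (z k)) d ∧
    (M.path ν z d).inv = (M.path ν z (M.chainTime (z k))).inv
      - ∫ r in (M.chainTime (z k))..d, M.rate ν z r := by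
  rcases hk : z k with y | u
  · rw [hk] at hd
    change d ∈ Icc y.time _ at hd
    change IntervalIntegrable _ volume y.time d ∧ IntervalIntegrable _ volume y.time d ∧
      _ = (M.path ν z y.time).inv - ∫ r in y.time..d, M.rate ν z r
    have hc := (ν.isControl k y).cut y
    have e : ∀ r ∈ Ico y.time d, M.rate ν z r = M.cut (ν.1 k y) y (r - y.time) :=
      fun r hr => (hz.rate_price_eq h1 hx hk ⟨hr.1, hr.2.trans_le hd.2⟩).1
    have e' : ∀ r ∈ Ico y.time d, M.proceeds ν x.time z r = _ :=
      fun r hr => hz.proceeds_eq h1 hx hk ⟨hr.1, hr.2.trans_le hd.2⟩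
    refine ⟨intervalIntegrable_congr_Ico hd.1 e ?_, intervalIntegrable_congr_Ico hd.1 e' ?_, ?_⟩
    · have := (hc.intervalIntegrable 0 (d - y.time)).comp_sub_right y.time
      simpa using this
    · have hb : IntervalIntegrable (fun v => Real.exp (-M.ρ * v) *
          (M.gain (M.cut (ν.1 k y) y v) * y.price)) volume 0 (d - y.time) := by
        refine intervalIntegrable_of_bounded (Measurable.mul (by fun_prop)
          ((continuous_gain.measurable.comp hc.1).mul_const _)) (sub_nonneg.2 hd.1)
          (C := (1 + M.f M.νmax) * M.νmax * y.price) fun v hv => ?_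
        have hy := hz.mem_stateSpace hx hk
        change |Real.exp (-M.ρ * v) * (M.gain (M.cut (ν.1 k y) y v) * y.price)| ≤ _
        rw [abs_mul, abs_of_pos (Real.exp_pos _)]
        refine (mul_le_of_le_one_left (abs_nonneg _) (Real.exp_le_one_iff.2 ?_)).trans
          (h1.abs_gain_price_le hc hy v)
        have := mul_nonneg M.ρ_nonneg hv.1
        linarith
      have := (hb.comp_sub_right y.time).const_mul (M.chainDisc x.time (z k))
      simpa using this
    · rw [hz.inv_path_eq h1 hx hk hd, hz.inv_path_eq h1 hx hk ⟨le_rfl, hd.1.trans hd.2⟩, sub_self,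
        intervalIntegral.integral_same, sub_zero, integral_congr_Ico hd.1 e,
        intervalIntegral.integral_comp_sub_right (fun v => M.cut (ν.1 k y) y v), sub_self]
  -- The cemetery is absorbing and carries the time `T`, so the segment degenerates to a point.
  · have hk' : z (k + 1) ∉ range Sum.inl := fun h => by
      obtain ⟨y, hy⟩ := (hz.trans k h).1
      rw [hk] at hy
      cases hy
    have hT : M.chainTime (z (k + 1)) = M.T := by
      rcases h : z (k + 1) with y | u
      · exact absurd ⟨y, h.symm⟩ hk'
      · rfl
    rw [hT, hk] at hd
    have : d = M.T := le_antisymm hd.2 hd.1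
    subst this
    change IntervalIntegrable _ volume M.T M.T ∧ IntervalIntegrable _ volume M.T M.T ∧
      (M.path ν z M.T).inv = (M.path ν z M.T).inv - ∫ r in M.T..M.T, M.rate ν z r
    simp

theorem segment_proceeds (h1 : M.Assumption1) (hz : M.IsGood ν x z) (hx : x ∈ M.stateSpace) (k : ℕ) :
    ∫ r in (M.chainTime (z k))..(M.chainTime (z (k + 1))), M.proceeds ν x.time z r
      = M.chainDisc x.time (z k) * Sum.elim (fun y => M.periodGain (ν.1 k) y (z (k + 1)))
        (fun _ => 0) (z k) := by
  have hle := hz.chainTime_le_succ hx k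
  rcases hk : z k with y | u
  · rw [hk] at hle
    change y.time ≤ _ at hle
    change ∫ r in y.time.._, _ = _
    rw [integral_congr_Ico hle fun r hr => hz.proceeds_eq h1 hx hk hr,
      intervalIntegral.integral_const_mul, hk,
      intervalIntegral.integral_comp_sub_right (fun v => Real.exp (-M.ρ * v) *
      (M.gain (M.cut (ν.1 k y) y v) * y.price)), sub_self]
    rfl
  · have hle' := hz.chainTime_le hx (k + 1)
    rw [hk] at hle
    change M.T ≤ _ at hle
    change ∫ r in M.T.._, _ = _ * 0
    rw [le_antisymm hle' hle, intervalIntegral.integral_same, mul_zero]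

theorem global (h1 : M.Assumption1) (hz : M.IsGood ν x z) (hx : x ∈ M.stateSpace) (k : ℕ) :
    IntervalIntegrable (M.rate ν z) volume x.time (M.chainTime (z k)) ∧
    IntervalIntegrable (M.proceeds ν x.time z) volume x.time (M.chainTime (z k)) ∧
    (∀ r ∈ Icc x.time (M.chainTime (z k)), (M.path ν z r).inv
      = (M.path ν z x.time).inv - ∫ v in x.time..r, M.rate ν z v) ∧
    ∫ r in x.time..(M.chainTime (z k)), M.proceeds ν x.time z r = ∑ j ∈ Finset.range k,
      M.chainDisc x.time (z j) * Sum.elim (fun y => M.periodGain (ν.1 j) y (z (j + 1)))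
        (fun _ => 0) (z j) := by
  have h0 : M.chainTime (z 0) = x.time := by rw [hz.zero]; rfl
  induction k with
  | zero =>
    rw [h0]
    refine ⟨IntervalIntegrable.refl, IntervalIntegrable.refl, fun r hr => ?_, by simp⟩
    rw [le_antisymm hr.2 hr.1, intervalIntegral.integral_same, sub_zero]
  | succ k ih =>
    obtain ⟨i1, i2, i3, i4⟩ := ih
    have hle := hz.chainTime_le_succ hx k
    have h0k : x.time ≤ M.chainTime (z k) := by
      rw [← h0]; exact hz.chainTime_mono hx (Nat.zero_le k)
    obtain ⟨s1, s2, -⟩ := hz.segment h1 hx k ⟨hle, le_rfl⟩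
    refine ⟨i1.trans s1, i2.trans s2, fun r hr => ?_, ?_⟩
    · rcases le_total r (M.chainTime (z k)) with h | h
      · exact i3 r ⟨hr.1, h⟩
      · obtain ⟨t1, -, t3⟩ := hz.segment h1 hx k ⟨h, hr.2⟩
        rw [t3, i3 _ ⟨h0k, le_rfl⟩, sub_sub, intervalIntegral.integral_add_adjacent_intervals i1 t1]
    · rw [Finset.sum_range_succ, ← i4, ← hz.segment_proceeds h1 hx k,
        intervalIntegral.integral_add_adjacent_intervals i2 s2]

/-- There is exactly one passage from a live entry to the cemetery; it is the only step at which the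
terminal inventory is paid out. -/
theorem exists_last (hz : M.IsGood ν x z) {N : ℕ} (hN : z N ∉ range Sum.inl) :
    ∃ n < N, ∃ y, z n = Sum.inl y ∧ z (n + 1) ∉ range Sum.inl ∧
      ∀ j, j ≠ n → z j ∉ range Sum.inl ∨ z (j + 1) ∈ range Sum.inl := by
  classical
  have hex : ∃ n, z n ∉ range Sum.inl := ⟨N, hN⟩
  have hspec := Nat.find_spec hex
  have hmin := fun m => Nat.find_min hex (m := m)
  set n := Nat.find hex with hn
  have hn0 : n ≠ 0 := fun h => hspec (by rw [h, hz.zero]; exact ⟨x, rfl⟩)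
  obtain ⟨m, hm⟩ := Nat.exists_eq_succ_of_ne_zero hn0
  rw [hm] at hspec
  have hma := not_not.1 (hmin m (by omega))
  obtain ⟨y, hy⟩ := hma
  refine ⟨m, ?_, y, hy.symm, hspec, fun j hj => ?_⟩
  · have : n ≤ N := Nat.find_min' hex hN
    omega
  · rcases lt_or_gt_of_ne hj with h | h
    · right; exact not_not.1 (hmin (j + 1) (by omega))
    · left; exact fun hj' => hspec (hz.alive_of_le h hj')

/-- The payoff stops at the liquidation time while the sum runs up to the horizon. Nothing is lost:
once the inventory is zero, nonnegative sales that keep it nonnegative vanish almost everywhere, and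
`h 0 = 0`. -/
theorem payoff_eq (h1 : M.Assumption1) (hz : M.IsGood ν x z) (hx : x ∈ M.stateSpace) {N : ℕ}
    (hN : z N ∉ range Sum.inl) : M.payoff ν x.time z = ∑ k ∈ Finset.range N,
      M.chainDisc x.time (z k) * M.stepReward (ν.1 k) (z k) (z (k + 1)) := by
  have hxT : x.time ≤ M.T := (time_mem hx).2
  have hT : ∀ {m : ℕ}, z m ∉ range Sum.inl → M.chainTime (z m) = M.T := by
    intro m hm
    rcases h : z m with y | u
    · exact absurd ⟨y, h.symm⟩ hm
    · rfl
  obtain ⟨g1, g2, g3, g4⟩ := hz.global h1 hx N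
  rw [hT hN] at g1 g2 g3 g4
  obtain ⟨n, hnN, y, hy, hn1, hlast⟩ := hz.exists_last hN
  have hyS := hz.mem_stateSpace hx hy
  have hyT : y.time ≤ M.T := (time_mem hyS).2
  -- the terminal state
  obtain ⟨-, p2, p3⟩ := hz.rate_path_eq h1 hx hy ⟨hyT, le_rfl⟩
    fun y' hy' => absurd ⟨y', hy'.symm⟩ hn1
  -- nonnegativity of the inventory
  have hnn : ∀ r ∈ Icc x.time M.T, 0 ≤ (M.path ν z r).inv := by
    have key : ∀ k, ∀ r ∈ Icc x.time (M.chainTime (z k)), 0 ≤ (M.path ν z r).inv := by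
      intro k
      induction k with
      | zero =>
        intro r hr
        refine hz.inv_path_nonneg h1 hx hz.zero ⟨hr.1, ?_⟩
        exact hr.2.trans (hz.chainTime_le_succ hx 0)
      | succ k ih =>
        intro r hr
        rcases le_total r (M.chainTime (z k)) with h | h
        · exact ih r ⟨hr.1, h⟩
        · rcases hk : z k with y' | u
          · rw [hk] at h
            exact hz.inv_path_nonneg h1 hx hk ⟨h, hr.2⟩
          · rw [hk] at h ih
            exact ih r ⟨hr.1, hr.2.trans (hz.chainTime_le hx _)⟩
    intro r hr
    exact key N r (by rwa [hT hN])
  have hTw : (M.path ν z M.T).inv ∈ Icc 0 M.w₀ := by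
    refine ⟨hnn M.T ⟨hxT, le_rfl⟩, ?_⟩
    rw [p3]
    exact (sub_le_self _ (((ν.isControl n y).cut y).integral_nonneg (sub_nonneg.2 hyT))).trans
      (inv_mem hyS).2
  -- the sum
  have hsum : ∑ k ∈ Finset.range N,
      M.chainDisc x.time (z k) * M.stepReward (ν.1 k) (z k) (z (k + 1))
      = (∫ r in x.time..M.T, M.proceeds ν x.time z r) + Real.exp (-M.ρ * (M.T - x.time))
        * M.h (M.path ν z M.T).inv * (M.path ν z M.T).price := by
    have e : ∀ k, M.chainDisc x.time (z k) * M.stepReward (ν.1 k) (z k) (z (k + 1))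
        = M.chainDisc x.time (z k) * Sum.elim (fun y => M.periodGain (ν.1 k) y (z (k + 1)))
          (fun _ => 0) (z k) + M.chainDisc x.time (z k) *
          Sum.elim (fun y => M.endGain (ν.1 k) y (z (k + 1))) (fun _ => 0) (z k) := by
      intro k
      rw [← mul_add, stepReward]
      rcases z k with y | u <;> simp
    simp only [e]
    rw [Finset.sum_add_distrib, ← g4]
    congr 1
    rw [Finset.sum_eq_single n]
    · rcases hzn : z (n + 1) with y' | u
      · exact absurd ⟨y', hzn.symm⟩ hn1
      rw [hy]
      change Real.exp (-M.ρ * (y.time - x.time)) * (Real.exp (-M.ρ * (M.T - y.time)) *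
        (M.hext (y.inv - ∫ r in (0 : ℝ)..(M.T - y.time), M.cut (ν.1 n y) y r) * y.price)) = _
      rw [← p3, hext_of_mem hTw, p2, ← mul_assoc, ← Real.exp_add, ← mul_assoc]
      congr 3
      ring
    · intro j _ hj
      rcases hlast j hj with h | h
      · rcases hzj : z j with y' | u
        · exact absurd ⟨y', hzj.symm⟩ h
        · exact mul_zero _
      · obtain ⟨y', hy'⟩ := h
        rw [← hy']
        rcases z j with y'' | u <;> exact mul_zero _
    · intro h
      exact absurd (Finset.mem_range.2 hnN) h
  rw [hsum]
  -- liquidation time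
  set A : Set ℝ := {r ∈ Icc x.time M.T | (M.path ν z r).inv ≤ 0} ∪ {M.T} with hA
  set τ := M.liqTime ν x.time z with hτ
  have hcontI : ContinuousOn (fun r => (M.path ν z r).inv) (Icc x.time M.T) := by
    have h := intervalIntegral.continuousOn_primitive_interval' g1 left_mem_uIcc
    rw [uIcc_of_le hxT] at h
    exact (continuousOn_const.sub h).congr fun r hr => g3 r hr
  have hAcl : IsClosed A := by
    refine IsClosed.union ?_ isClosed_singleton
    have := hcontI.preimage_isClosed_of_isClosed isClosed_Icc (isClosed_Iic (a := (0 : ℝ)))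
    exact this
  have hAsub : A ⊆ Icc x.time M.T := by
    rintro r (hr | hr)
    · exact hr.1
    · rw [mem_singleton_iff.1 hr]; exact ⟨hxT, le_rfl⟩
  have hτA : τ ∈ A := hAcl.csInf_mem ⟨M.T, Or.inr rfl⟩ ⟨x.time, fun r hr => (hAsub hr).1⟩
  have hτI := hAsub hτA
  change (∫ r in x.time..τ, M.proceeds ν x.time z r) + Real.exp (-M.ρ * (τ - x.time))
      * M.h (M.path ν z τ).inv * (M.path ν z τ).price = _
  by_cases hτT : τ = M.T
  · rw [hτT]
  have hτ0 : (M.path ν z τ).inv = 0 := by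
    rcases hτA with h | h
    · exact le_antisymm h.2 (hnn τ hτI)
    · exact absurd h hτT
  have gτ : IntervalIntegrable (M.rate ν z) volume x.time τ :=
    g1.mono_set (by rw [uIcc_of_le hxT, uIcc_of_le hτI.1]; exact Icc_subset_Icc_right hτI.2)
  have gτT : IntervalIntegrable (M.rate ν z) volume τ M.T :=
    g1.mono_set (by rw [uIcc_of_le hxT, uIcc_of_le hτI.2]; exact Icc_subset_Icc_left hτI.1)
  have pτ : IntervalIntegrable (M.proceeds ν x.time z) volume x.time τ :=
    g2.mono_set (by rw [uIcc_of_le hxT, uIcc_of_le hτI.1]; exact Icc_subset_Icc_right hτI.2)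
  have pτT : IntervalIntegrable (M.proceeds ν x.time z) volume τ M.T :=
    g2.mono_set (by rw [uIcc_of_le hxT, uIcc_of_le hτI.2]; exact Icc_subset_Icc_left hτI.1)
  -- The terminal inventory is minus the sales after `τ`. It is nonnegative and so are the sales,
  -- hence both are zero.
  have hIT : (M.path ν z M.T).inv = -∫ r in τ..M.T, M.rate ν z r := by
    have a1 := g3 τ hτI
    have a2 := g3 M.T ⟨hxT, le_rfl⟩
    rw [← intervalIntegral.integral_add_adjacent_intervals gτ gτT] at a2
    linarith
  have hint0 : 0 ≤ ∫ r in τ..M.T, M.rate ν z r :=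
    intervalIntegral.integral_nonneg hτI.2 fun r _ => rate_nonneg ν z r
  have hz0 : ∫ r in τ..M.T, M.rate ν z r = 0 := by
    have := hTw.1
    linarith
  have hae : ∀ᵐ r ∂(volume.restrict (Ioc τ M.T)), M.rate ν z r = 0 := by
    rw [intervalIntegral.integral_of_le hτI.2] at hz0
    exact (setIntegral_eq_zero_iff_of_nonneg_ae (Eventually.of_forall fun r => rate_nonneg ν z r)
      ((intervalIntegrable_iff_integrableOn_Ioc_of_le hτI.2).1 gτT)).1 hz0
  have hP0 : ∫ r in τ..M.T, M.proceeds ν x.time z r = 0 := by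
    rw [intervalIntegral.integral_of_le hτI.2]
    refine integral_eq_zero_of_ae ?_
    filter_upwards [hae] with r hr
    simp only [proceeds, hr, mul_zero, zero_mul, Pi.zero_apply]
  have hIT0 : (M.path ν z M.T).inv = 0 := by rw [hIT, hz0, neg_zero]
  rw [← intervalIntegral.integral_add_adjacent_intervals pτ pτT, hP0, hτ0, hIT0, M.h_zero]
  ring

end IsGood

/-! ### Integration over one step of the chain -/

/-- The family of measures is bounded only on `s`. Setting it to zero elsewhere gives a finite
kernel without changing the measure, so that the integral against a composition of kernels can be
disintegrated. -/
theorem integral_bind_restrict {X Y : Type*} [MeasurableSpace X] [MeasurableSpace Y] {μ : Measure X}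
    [SFinite μ] {κ : X → Measure Y} (hκ : Measurable κ) {s : Set X} (hs : MeasurableSet s)
    {B : ENNReal} (hB : B ≠ ⊤) (hb : ∀ x ∈ s, κ x univ ≤ B) {G : Y → ℝ}
    (hG : Integrable G ((μ.restrict s).bind κ)) :
    ∫ y, G y ∂((μ.restrict s).bind κ) = ∫ x in s, ∫ y, G y ∂(κ x) ∂μ := by
  let η : Kernel X Y := ⟨s.indicator κ, hκ.indicator hs⟩
  have hη : IsFiniteKernel η := ⟨⟨B, hB.lt_top, fun x => by
    change (s.indicator κ x) univ ≤ B
    by_cases hx : x ∈ s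
    · rw [indicator_of_mem hx]; exact hb x hx
    · rw [indicator_of_notMem hx]; exact bot_le⟩⟩
  have e : (μ.restrict s).bind κ = (η ∘ₖ Kernel.const Unit (μ.restrict s)) () := by
    rw [Kernel.comp_apply, Kernel.const_apply]
    refine Measure.bind_congr_right ?_
    filter_upwards [ae_restrict_mem hs] with x hx
    exact (indicator_of_mem hx κ).symm
  rw [e] at hG ⊢
  rw [Kernel.integral_comp hG, Kernel.const_apply]
  refine setIntegral_congr_fun hs fun x hx => ?_
  change ∫ y, G y ∂(s.indicator κ x) = _
  rw [indicator_of_mem hx]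

theorem measurable_chainTime : Measurable (M.chainTime (K := K)) :=
  measurable_of_sum measurable_time measurable_const

theorem measurable_chainDisc (t : ℝ) : Measurable (M.chainDisc (K := K) t) :=
  Real.measurable_exp.comp ((measurable_chainTime.sub_const t).const_mul _)

section

variable {a : PState K → ℝ → ℝ}

theorem measurable_periodGain (ha : Measurable (fun y : PState K × ℝ => a y.1 y.2))
    (hc : ∀ x, M.IsControl (a x)) :
    Measurable fun p : PState K × ChainState K => M.periodGain a p.1 p.2 := by
  refine measurable_intervalIntegral_param (F := fun (p : PState K × ChainState K) r =>
    Real.exp (-M.ρ * r) * (M.gain (M.cut (a p.1) p.1 r) * p.1.price)) ?_ measurable_const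
    ((measurable_chainTime.comp measurable_snd).sub (measurable_time.comp measurable_fst))
  have hm : Measurable fun q : (PState K × ChainState K) × ℝ => (q.1.1, q.2) := by fun_prop
  exact (Real.measurable_exp.comp (measurable_snd.const_mul _)).mul
    ((continuous_gain.measurable.comp ((measurable_cut ha hc).comp hm)).mul
      (measurable_price.comp (measurable_fst.comp measurable_fst)))

theorem measurable_endGain (ha : Measurable (fun y : PState K × ℝ => a y.1 y.2))
    (hc : ∀ x, M.IsControl (a x)) :
    Measurable fun p : PState K × ChainState K => M.endGain a p.1 p.2 := by
  have hI : Measurable fun x : PState K => ∫ r in (0 : ℝ)..(M.T - x.time), M.cut (a x) x r :=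
    measurable_intervalIntegral_param (F := fun (x : PState K) r => M.cut (a x) x r)
      (measurable_cut ha hc) measurable_const (measurable_const.sub measurable_time)
  have hE : Measurable fun x : PState K => Real.exp (-M.ρ * (M.T - x.time)) *
      (M.hext (x.inv - ∫ r in (0 : ℝ)..(M.T - x.time), M.cut (a x) x r) * x.price) :=
    (Real.measurable_exp.comp ((measurable_const.sub measurable_time).const_mul _)).mul
      ((continuous_hext.measurable.comp (measurable_inv.sub hI)).mul measurable_price)
  have hs : MeasurableSet (range (Sum.inl : PState K → ChainState K)) := measurableSet_range_inl
  have e : (fun p : PState K × ChainState K => M.endGain a p.1 p.2)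
      = (Prod.snd ⁻¹' range (Sum.inl : PState K → ChainState K))ᶜ.indicator
        fun p => Real.exp (-M.ρ * (M.T - p.1.time)) *
      (M.hext (p.1.inv - ∫ r in (0 : ℝ)..(M.T - p.1.time), M.cut (a p.1) p.1 r) * p.1.price) := by
    ext ⟨x, z⟩
    rcases z with y | u
    · rw [indicator_of_notMem (by simp)]; rfl
    · rw [indicator_of_mem (by simp)]; rfl
  rw [e]
  exact (hE.comp measurable_fst).indicator (measurable_snd hs).compl

theorem measurable_stepReward (ha : Measurable (fun y : PState K × ℝ => a y.1 y.2))
    (hc : ∀ x, M.IsControl (a x)) :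
    Measurable fun p : ChainState K × ChainState K => M.stepReward a p.1 p.2 := by
  have hs : MeasurableSet (range (Sum.inl : PState K → ChainState K)) := measurableSet_range_inl
  have e : (fun p : ChainState K × ChainState K => M.stepReward a p.1 p.2)
      = (Prod.fst ⁻¹' range (Sum.inl : PState K → ChainState K)).indicator
        fun p => M.periodGain a (chainVal p.1) p.2 + M.endGain a (chainVal p.1) p.2 := by
    ext ⟨z, z'⟩
    rcases z with y | u
    · rw [indicator_of_mem (by simp)]; rfl
    · rw [indicator_of_notMem (by simp)]; rfl
  rw [e]
  have hm : Measurable fun p : ChainState K × ChainState K => (chainVal p.1, p.2) :=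
    (measurable_chainVal.comp measurable_fst).prodMk measurable_snd
  exact (((measurable_periodGain ha hc).comp hm).add ((measurable_endGain ha hc).comp hm)).indicator
    (measurable_fst hs)

end

/-- Extension of a function on the states by zero to the cemetery. -/
def chainExt (v : PState K → ℝ) : ChainState K → ℝ := Sum.elim v fun _ => 0

theorem measurable_chainExt {v : PState K → ℝ} (hv : Measurable v) : Measurable (chainExt v) :=
  measurable_of_sum hv measurable_const

namespace Assumption1

variable (h1 : M.Assumption1)
include h1

theorem abs_stepReward_le {a : PState K → ℝ → ℝ} {x : PState K} (hα : M.IsControl (a x))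
    (hx : x ∈ M.stateSpace) {z' : ChainState K} (hz : M.chainTime z' ∈ Icc x.time M.T) :
    |M.stepReward a (Sum.inl x) z'| ≤ (2 + M.f M.νmax) * (x.price * x.inv) := by
  have hs := price_nonneg hx
  have hF := M.f_νmax_nonneg
  have hc := hα.cut x
  have hexp : ∀ {r : ℝ}, 0 ≤ r → Real.exp (-M.ρ * r) ≤ 1 := fun hr =>
    Real.exp_le_one_iff.2 (by have := mul_nonneg M.ρ_nonneg hr; linarith)
  have hd : 0 ≤ M.chainTime z' - x.time := sub_nonneg.2 hz.1
  have a1 : |M.periodGain a x z'| ≤ (1 + M.f M.νmax) * x.price * x.inv := by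
    have : |M.periodGain a x z'| ≤ ∫ r in (0 : ℝ)..(M.chainTime z' - x.time),
        ((1 + M.f M.νmax) * x.price) * M.cut (a x) x r := by
      refine intervalIntegral.norm_integral_le_of_norm_le (f := fun r => Real.exp (-M.ρ * r)
        * (M.gain (M.cut (a x) x r) * x.price)) hd (Eventually.of_forall fun r hr => ?_)
        ((hc.intervalIntegrable _ _).const_mul _)
      rw [Real.norm_eq_abs, abs_mul, abs_of_pos (Real.exp_pos _), abs_mul, abs_of_nonneg hs]
      calc _ ≤ 1 * ((1 + M.f M.νmax) * M.cut (a x) x r * x.price) :=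
            mul_le_mul (hexp hr.1.le) (mul_le_mul_of_nonneg_right (abs_gain_le (hc.2 r)) hs)
              (mul_nonneg (abs_nonneg _) hs) zero_le_one
        _ = _ := by ring
    refine this.trans ?_
    rw [intervalIntegral.integral_const_mul]
    exact mul_le_mul_of_nonneg_left (integral_cut_le hα hx hd) (by positivity)
  have a2 : |M.endGain a x z'| ≤ x.price * x.inv := by
    rcases z' with y | u
    · change |(0 : ℝ)| ≤ _
      rw [abs_zero]; exact mul_nonneg hs (inv_mem hx).1
    · have hL := horizon_nonneg hx
      have hle := integral_cut_le hα hx hL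
      have h0 := hc.integral_nonneg hL
      have hw : x.inv - ∫ r in (0 : ℝ)..(M.T - x.time), M.cut (a x) x r ∈ Icc 0 M.w₀ :=
        ⟨sub_nonneg.2 hle, by linarith [(inv_mem hx).2]⟩
      change |Real.exp (-M.ρ * (M.T - x.time)) *
        (M.hext (x.inv - ∫ r in (0 : ℝ)..(M.T - x.time), M.cut (a x) x r) * x.price)| ≤ _
      rw [hext_of_mem hw, abs_mul, abs_of_pos (Real.exp_pos _),
        abs_of_nonneg (mul_nonneg (h_nonneg hw) hs), mul_comm x.price]
      calc _ ≤ 1 * (x.inv * x.price) := mul_le_mul (hexp hL)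
            (mul_le_mul_of_nonneg_right ((M.h_le _ hw).trans (sub_le_self _ h0)) hs)
            (mul_nonneg (h_nonneg hw) hs) zero_le_one
        _ = _ := one_mul _
  refine (abs_add_le _ _).trans ?_
  linarith

theorem integral_nextJump {α : ℝ → ℝ} {x : PState K} (hα : M.IsAdmissible α x)
    (hx : x ∈ M.stateSpace) {G : PState K → ℝ} (hG : Integrable G (M.nextJump α x)) :
    ∫ y, G y ∂(M.nextJump α x) = ∫ v in (0 : ℝ)..(M.T - x.time),
      h1.surv α x v * ∫ y, G y ∂(M.jumpKer (h1.expFlow α x v) (α v)) := by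
  have hmeas := h1.measurable_smul_jumpKer hα.1.1 x
  rw [h1.nextJump_eq hα.1 hx] at hG ⊢
  rw [integral_bind_restrict hmeas measurableSet_Ioc
    (B := 1 * (ENNReal.ofReal 1 * ENNReal.ofReal h1.jumpRateBound)) (by finiteness) ?_ hG,
    intervalIntegral.integral_of_le (horizon_nonneg hx)]
  · refine setIntegral_congr_fun measurableSet_Ioc fun v hv => ?_
    rw [integral_smul_measure, ENNReal.toReal_ofReal (h1.surv_pos hα.1.1 (filt_mem hx) hv.1.le).le,
      smul_eq_mul]
  · intro v hv
    rw [Measure.smul_apply, smul_eq_mul]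
    refine mul_le_mul' ?_ ?_
    · rw [← ENNReal.ofReal_one]
      exact ENNReal.ofReal_le_ofReal (h1.surv_le_one hα.1.1 (filt_mem hx) hv.1.le)
    · rw [← lintegral_one]
      refine h1.lintegral_jumpKer_le (h1.expFlow_mem hα hx ⟨hv.1.le, hv.2⟩) _ measurable_const
        fun z _ => ?_
      rw [ENNReal.ofReal_one, one_mul, ENNReal.one_le_ofReal]
      exact h1.one_le_jumpBound

theorem integrable_of_le_chainWeight {a : PState K → ℝ → ℝ} (hc : ∀ x, M.IsControl (a x))
    {z : ChainState K} {G : ChainState K → ℝ} (hG : Measurable G) {A B : ℝ}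
    (h : ∀ᵐ z' ∂(M.stepMeasure a z),
      ‖G z'‖ₑ ≤ ENNReal.ofReal A + ENNReal.ofReal B * M.chainWeight h1.halfRate z') :
    Integrable G (M.stepMeasure a z) := by
  have := h1.isProbabilityMeasure_stepMeasure hc z
  refine ⟨hG.aestronglyMeasurable, ?_⟩
  refine (lintegral_mono_ae h).trans_lt ?_
  rw [lintegral_add_left measurable_const, lintegral_const, lintegral_const_mul _
    (measurable_chainWeight _)]
  have h2 : ∫⁻ z', M.chainWeight h1.halfRate z' ∂(M.stepMeasure a z) ≠ ⊤ := by
    refine ne_top_of_le_ne_top ?_ (h1.lintegral_chainWeight_le hc z)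
    refine ENNReal.mul_ne_top (by simp) ?_
    rcases z with x | u
    · exact ENNReal.ofReal_ne_top
    · exact ENNReal.zero_ne_top
  rw [measure_univ, mul_one]
  exact ENNReal.add_lt_top.2 ⟨ENNReal.ofReal_lt_top,
    ENNReal.mul_lt_top ENNReal.ofReal_lt_top h2.lt_top⟩

theorem integral_stepMeasure {a : PState K → ℝ → ℝ} {x : PState K} (hα : M.IsControl (a x))
    (hx : x ∈ M.stateSpace) {G : ChainState K → ℝ} (hGm : Measurable G)
    (hG : Integrable G (M.stepMeasure a (Sum.inl x))) :
    ∫ z, G z ∂(M.stepMeasure a (Sum.inl x)) = (∫ v in (0 : ℝ)..(M.T - x.time),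
      h1.surv (M.cut (a x) x) x v * ∫ y, G (Sum.inl y)
        ∂(M.jumpKer (h1.expFlow (M.cut (a x) x) x v) (M.cut (a x) x v)))
      + h1.surv (M.cut (a x) x) x (M.T - x.time) * G (Sum.inr ()) := by
  have hs := (h1.surv_pos (hα.cut x).1 (filt_mem hx) (horizon_nonneg hx)).le
  rw [h1.stepMeasure_inl hα hx] at hG ⊢
  have g1 := hG.left_of_add_measure
  have g2 := hG.right_of_add_measure
  rw [integral_add_measure g1 g2, integral_map measurable_inl.aemeasurable
    hGm.aestronglyMeasurable, integral_smul_measure, integral_dirac' _ _ hGm.stronglyMeasurable,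
    ENNReal.toReal_ofReal hs, smul_eq_mul,
    h1.integral_nextJump (hα.isAdmissible_cut hx) hx (G := fun y => G (Sum.inl y))]
  exact (integrable_map_measure hGm.aestronglyMeasurable measurable_inl.aemeasurable).1 g1

end Assumption1

theorem chainDisc_mem {t : ℝ} {z : ChainState K} (h : t ≤ M.chainTime z) :
    0 ≤ M.chainDisc t z ∧ M.chainDisc t z ≤ 1 :=
  ⟨(Real.exp_pos _).le, Real.exp_le_one_iff.2 (by
    have := mul_nonneg M.ρ_nonneg (sub_nonneg.2 h); linarith)⟩

theorem IsTransition.chainTime_mem {a : PState K → ℝ → ℝ} {x : PState K} {z' : ChainState K}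
    (hx : x ∈ M.stateSpace) (h : M.IsTransition a (Sum.inl x) z') :
    M.chainTime z' ∈ Icc x.time M.T := by
  rcases z' with y | u
  · obtain ⟨-, h2, h3, -⟩ := h ⟨y, rfl⟩
    exact ⟨h3.le, (time_mem h2).2⟩
  · exact ⟨(time_mem hx).2, le_rfl⟩

namespace Assumption1

variable (h1 : M.Assumption1)
include h1

/-- The extension to the chain of a function dominated by `b` is dominated by the weight. -/
theorem enorm_chainExt_le {v : PState K → ℝ} {C : ℝ} (hC : 0 ≤ C)
    (h : ∀ y ∈ M.stateSpace, |v y| ≤ C * M.bounding h1.halfRate y) {z : ChainState K}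
    (hz : ∀ y, z = Sum.inl y → y ∈ M.stateSpace) {t : ℝ} (ht : t ≤ M.chainTime z) :
    ‖M.chainDisc t z * chainExt v z‖ₑ ≤ ENNReal.ofReal C * M.chainWeight h1.halfRate z := by
  rcases z with y | u
  · have hy := hz y rfl
    have hd := chainDisc_mem ht
    change _ ≤ ENNReal.ofReal C * ENNReal.ofReal (M.weight h1.halfRate y)
    rw [← ENNReal.ofReal_mul hC, Real.enorm_eq_ofReal_abs]
    refine ENNReal.ofReal_le_ofReal ?_
    rw [abs_mul, abs_of_nonneg hd.1]
    refine (mul_le_of_le_one_left (abs_nonneg _) hd.2).trans ((h y hy).trans ?_)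
    exact mul_le_mul_of_nonneg_left (bounding_le_weight y _) hC
  · change ‖M.chainDisc t (Sum.inr u) * 0‖ₑ ≤ _
    simp

theorem integrable_step {a : PState K → ℝ → ℝ}
    (ha : Measurable (fun y : PState K × ℝ => a y.1 y.2)) (hc : ∀ x, M.IsControl (a x))
    {x : PState K} (hx : x ∈ M.stateSpace) {v : PState K → ℝ} (hv : Measurable v) {C : ℝ}
    (hC : 0 ≤ C) (h : ∀ y ∈ M.stateSpace, |v y| ≤ C * M.bounding h1.halfRate y) :
    Measurable (fun z' => M.stepReward a (Sum.inl x) z' + M.chainDisc x.time z' * chainExt v z') ∧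
    Integrable (fun z' => M.stepReward a (Sum.inl x) z' + M.chainDisc x.time z' * chainExt v z')
      (M.stepMeasure a (Sum.inl x)) := by
  have hm : Measurable fun z' =>
      M.stepReward a (Sum.inl x) z' + M.chainDisc x.time z' * chainExt v z' :=
    ((measurable_stepReward ha hc).comp measurable_prodMk_left).add
      ((measurable_chainDisc _).mul (measurable_chainExt hv))
  refine ⟨hm, h1.integrable_of_le_chainWeight hc hm
    (A := (2 + M.f M.νmax) * (x.price * x.inv)) (B := C) ?_⟩
  filter_upwards [h1.isTransition_stepMeasure ha hc (Sum.inl x)] with z' hz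
  have ht := hz.chainTime_mem hx
  refine (enorm_add_le _ _).trans (add_le_add ?_ (h1.enorm_chainExt_le hC h ?_ ht.1))
  · rw [Real.enorm_eq_ofReal_abs]
    exact ENNReal.ofReal_le_ofReal (h1.abs_stepReward_le (hc x) hx ht)
  · rintro y rfl
    exact (hz ⟨y, rfl⟩).2.1

theorem jumpKer_real_univ {α : ℝ → ℝ} (hα : M.IsControl α) {x : PState K} (hx : x ∈ M.stateSpace)
    {v : ℝ} (hv : 0 ≤ v) :
    (M.jumpKer (h1.expFlow α x v) (α v)).real univ = h1.flowRate α x v := by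
  rw [Measure.real, h1.jumpKer_univ (x := h1.expFlow α x v)
    (h1.filtFlow_mem hα.1 (filt_mem hx) hv)]
  exact ENNReal.toReal_ofReal (h1.flowRate_nonneg hα.1 (filt_mem hx) hv)

theorem integrable_jumpKer {x : PState K} (hx : x ∈ M.stateSpace) (ν : ℝ) {v : PState K → ℝ}
    (hv : Measurable v) {γ C : ℝ} (hC : 0 ≤ C)
    (h : ∀ y ∈ M.stateSpace, |v y| ≤ C * M.bounding γ y) : Integrable v (M.jumpKer x ν) := by
  have hb := bounding_nonneg hx γ
  refine ⟨hv.aestronglyMeasurable, ?_⟩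
  refine lt_of_le_of_lt ?_ (ENNReal.mul_lt_top (ENNReal.ofReal_lt_top (r := C * M.bounding γ x))
    (ENNReal.ofReal_lt_top (r := h1.jumpRateBound)))
  have hms : Measurable (M.stateSpace.indicator fun y => ‖v y‖ₑ) :=
    hv.enorm.indicator measurableSet_stateSpace
  have e : ∫⁻ y, ‖v y‖ₑ ∂(M.jumpKer x ν)
      = ∫⁻ y, M.stateSpace.indicator (fun y => ‖v y‖ₑ) y ∂(M.jumpKer x ν) := by
    refine lintegral_congr_ae ?_
    filter_upwards [h1.jumpKer_mem hx ν] with y hy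
    rw [indicator_of_mem hy.1]
  rw [e]
  refine h1.lintegral_jumpKer_le hx ν hms fun z hz => ?_
  by_cases hmem : M.jumpTo x ν z ∈ M.stateSpace
  · rw [indicator_of_mem hmem, Real.enorm_eq_ofReal_abs, ← ENNReal.ofReal_mul (mul_nonneg hC hb)]
    refine ENNReal.ofReal_le_ofReal ((h _ hmem).trans ?_)
    have e2 : M.bounding γ (M.jumpTo x ν z) = M.bounding γ x * (1 + z) := by
      simp only [bounding, jumpTo, PState.price, PState.inv, PState.time]; ring
    rw [e2, ← mul_assoc]
    exact mul_le_mul_of_nonneg_left (h1.jump_le z hz).2 (mul_nonneg hC hb)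
  · rw [indicator_of_notMem hmem]; exact bot_le

/-- The mean of the proceeds of one period and of the continuation value is the total reward of the
decision model. -/
theorem integral_step {a : PState K → ℝ → ℝ}
    (ha : Measurable (fun y : PState K × ℝ => a y.1 y.2)) (hc : ∀ x, M.IsControl (a x))
    {x : PState K} (hx : x ∈ M.stateSpace) {v : PState K → ℝ} (hv : Measurable v) {C : ℝ}
    (hC : 0 ≤ C) (h : ∀ y ∈ M.stateSpace, |v y| ≤ C * M.bounding h1.halfRate y) :
    ∫ z', (M.stepReward a (Sum.inl x) z' + M.chainDisc x.time z' * chainExt v z')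
      ∂(M.stepMeasure a (Sum.inl x)) = h1.totalReward v (M.cut (a x) x) x := by
  obtain ⟨hm, hint⟩ := h1.integrable_step ha hc hx hv hC h
  rw [h1.integral_stepMeasure (hc x) hx hm hint]
  have hadm := (hc x).isAdmissible_cut hx
  set α := M.cut (a x) x with hαdef
  have hα : M.IsControl α := (hc x).cut x
  set L := M.T - x.time with hLdef
  have hL : 0 ≤ L := horizon_nonneg hx
  set D : ℝ → ℝ := fun r => Real.exp (-M.ρ * r) * (M.gain (α r) * x.price) with hD
  have hDm : Measurable D := Measurable.mul (by fun_prop)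
    ((continuous_gain.measurable.comp hα.1).mul_const _)
  have hDb : ∀ r ∈ Icc 0 L, |D r| ≤ (1 + M.f M.νmax) * M.νmax * x.price := fun r hr => by
    rw [hD]
    change |Real.exp (-M.ρ * r) * (M.gain (α r) * x.price)| ≤ _
    rw [abs_mul, abs_of_pos (Real.exp_pos _)]
    refine (mul_le_of_le_one_left (abs_nonneg _) (Real.exp_le_one_iff.2 ?_)).trans
      (h1.abs_gain_price_le hα hx r)
    have := mul_nonneg M.ρ_nonneg hr.1
    linarith
  set R : ℝ → ℝ := fun r => 0 + ∫ s in (0 : ℝ)..r, D s with hR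
  have hRp : IsPrim R D L := IsPrim.of_measurable 0 hDm hL hDb
  have hR0 : R 0 = 0 := by simp [hR]
  have hSp := h1.surv_isPrim hα.1 (filt_mem hx) hL
  -- Integration by parts: the gain `R` accumulated up to the jump, averaged over the jump time,
  -- together with the surviving part `R L * surv L`, equals the integral of the gain density
  -- weighted with the survival probability.
  have hprod := hRp.mul hL hSp
  have hparts := hprod.eq L ⟨hL, le_rfl⟩
  rw [hR0, zero_mul, zero_add] at hparts
  have hinner : ∀ r ∈ Ioc 0 L, ∫ y, (M.stepReward a (Sum.inl x) (Sum.inl y)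
      + M.chainDisc x.time (Sum.inl y) * chainExt v (Sum.inl y)) ∂(M.jumpKer (h1.expFlow α x r) (α r))
      = R r * h1.flowRate α x r + Real.exp (-M.ρ * r) * M.jumpMean v (h1.expFlow α x r) (α r) := by
    intro r hr
    have hmem := h1.expFlow_cut_mem (hc x) hx (Ioc_subset_Icc_self hr)
    rw [← hαdef] at hmem
    have hfin : IsFiniteMeasure (M.jumpKer (h1.expFlow α x r) (α r)) :=
      ⟨by rw [h1.jumpKer_univ (filt_mem hmem)]; exact ENNReal.ofReal_lt_top⟩
    have e : ∫ y, (M.stepReward a (Sum.inl x) (Sum.inl y)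
        + M.chainDisc x.time (Sum.inl y) * chainExt v (Sum.inl y))
          ∂(M.jumpKer (h1.expFlow α x r) (α r))
        = ∫ y, (R r + Real.exp (-M.ρ * r) * v y) ∂(M.jumpKer (h1.expFlow α x r) (α r)) := by
      refine integral_congr_ae ?_
      filter_upwards [h1.jumpKer_mem hmem (α r)] with y hy
      have ht : y.time - x.time = r := by
        rw [hy.2.1]; change x.time + r - x.time = r; ring
      change (∫ s in (0 : ℝ)..(y.time - x.time), D s) + 0
        + Real.exp (-M.ρ * (y.time - x.time)) * v y = _
      simp only [ht, add_zero, hR, zero_add]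
    rw [e, integral_add (integrable_const _)
      ((h1.integrable_jumpKer hmem _ hv hC h).const_mul _), integral_const, integral_const_mul,
      h1.jumpKer_real_univ hα hx hr.1.le, smul_eq_mul, mul_comm (R r)]
    rfl
  have hend : M.stepReward a (Sum.inl x) (Sum.inr ())
      + M.chainDisc x.time (Sum.inr ()) * chainExt v (Sum.inr ())
      = R L + Real.exp (-M.ρ * L) * (M.hext (h1.expFlow α x L).inv * x.price) := by
    change (∫ s in (0 : ℝ)..L, D s) + Real.exp (-M.ρ * L) *
      (M.hext (x.inv - ∫ r in (0 : ℝ)..L, α r) * x.price) + _ * (0 : ℝ) = _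
    simp only [mul_zero, add_zero, hR, zero_add]
    rfl
  have hic := h1.intervalIntegrable_cont hadm hx hv h1.halfRate_pos.le hC h
  have hig := h1.intervalIntegrable_gain hadm hx
  have hi : IntervalIntegrable (fun r => R r * (h1.flowRate α x r * h1.surv α x r)) volume 0 L := by
    refine (hig.sub hprod.integrable).congr fun r _ => ?_
    simp only [hD]
    ring
  have e1 : ∫ r in (0 : ℝ)..L, h1.surv α x r * ∫ y, (M.stepReward a (Sum.inl x) (Sum.inl y)
      + M.chainDisc x.time (Sum.inl y) * chainExt v (Sum.inl y)) ∂(M.jumpKer (h1.expFlow α x r) (α r))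
      = (∫ r in (0 : ℝ)..L, R r * (h1.flowRate α x r * h1.surv α x r)) + h1.contPart v α x := by
    rw [contPart, ← intervalIntegral.integral_add hi hic]
    refine intervalIntegral.integral_congr_ae ?_
    rw [uIoc_of_le hL]
    refine Eventually.of_forall fun r hr => ?_
    rw [hinner r hr]
    ring
  have e2 : ∫ r in (0 : ℝ)..L, (D r * h1.surv α x r + R r * -(h1.flowRate α x r * h1.surv α x r))
      = (∫ r in (0 : ℝ)..L, Real.exp (-M.ρ * r) * h1.surv α x r * (M.gain (α r) * x.price))
        - ∫ r in (0 : ℝ)..L, R r * (h1.flowRate α x r * h1.surv α x r) := by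
    rw [← intervalIntegral.integral_sub hig hi]
    refine intervalIntegral.integral_congr fun r _ => ?_
    simp only [hD]
    ring
  rw [e1, hend, totalReward, rewardPart]
  rw [e2] at hparts
  linear_combination hparts

end Assumption1

/-! ### The reward of a strategy -/

/-- The discounted reward of the `n`-th period. -/
noncomputable def stageReward (M : LiquidationModel K) (ν : M.Strategy) (t : ℝ) (n : ℕ)
    (z : ℕ → ChainState K) : ℝ :=
  M.chainDisc t (z n) * M.stepReward (ν.1 n) (z n) (z (n + 1))

/-- The discounted value of a function at the `n`-th jump. -/
noncomputable def stageValue (M : LiquidationModel K) (v : PState K → ℝ) (t : ℝ) (n : ℕ)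
    (z : ℕ → ChainState K) : ℝ :=
  M.chainDisc t (z n) * chainExt v (z n)

theorem measurable_stageReward (ν : M.Strategy) (t : ℝ) (n : ℕ) :
    Measurable (M.stageReward ν t n) := by
  have hp : Measurable fun z : ℕ → ChainState K => (z n, z (n + 1)) := by fun_prop
  exact (((measurable_chainDisc t).comp measurable_fst).mul
    (measurable_stepReward (ν.2 n).1 (ν.isControl n))).comp hp

theorem measurable_stageValue {v : PState K → ℝ} (hv : Measurable v) (t : ℝ) (n : ℕ) :
    Measurable (M.stageValue v t n) :=
  ((measurable_chainDisc t).mul (measurable_chainExt hv)).comp (measurable_pi_apply n)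

theorem IsGood.time_le_chainTime {ν : M.Strategy} {x : PState K} {z : ℕ → ChainState K}
    (hz : M.IsGood ν x z) (hx : x ∈ M.stateSpace) (n : ℕ) : x.time ≤ M.chainTime (z n) := by
  have h := hz.chainTime_mono hx (Nat.zero_le n)
  simp only [hz.zero] at h
  exact h

theorem IsGood.payoff_eq_tsum {ν : M.Strategy} {x : PState K} {z : ℕ → ChainState K}
    (hz : M.IsGood ν x z) (h1 : M.Assumption1) (hx : x ∈ M.stateSpace) :
    M.payoff ν x.time z = ∑' n, M.stageReward ν x.time n z := by
  obtain ⟨N, hN⟩ := hz.finite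
  rw [hz.payoff_eq h1 hx hN, tsum_eq_sum (s := Finset.range N)]
  · rfl
  · intro n hn
    have hNn : N ≤ n := by simpa using hn
    rcases h : z n with y | u
    · exact absurd (hz.alive_of_le hNn ⟨y, h.symm⟩) hN
    · rw [stageReward, h]
      exact mul_zero _

namespace Assumption1

variable (h1 : M.Assumption1)
include h1

theorem enorm_stageReward_le {ν : M.Strategy} {x : PState K} {z : ℕ → ChainState K}
    (hz : M.IsGood ν x z) (hx : x ∈ M.stateSpace) (n : ℕ) :
    ‖M.stageReward ν x.time n z‖ₑ
      ≤ ENNReal.ofReal (2 + M.f M.νmax) * M.chainWeight h1.halfRate (z n) := by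
  have hd := chainDisc_mem (hz.time_le_chainTime hx n)
  have hF := M.f_νmax_nonneg
  have htr := hz.trans n
  rw [stageReward]
  rcases h : z n with y | u
  · have hy := hz.mem_stateSpace hx h
    rw [h] at htr hd
    change _ ≤ _ * ENNReal.ofReal (M.weight h1.halfRate y)
    rw [← ENNReal.ofReal_mul (by linarith), Real.enorm_eq_ofReal_abs]
    refine ENNReal.ofReal_le_ofReal ?_
    rw [abs_mul, abs_of_nonneg hd.1]
    refine (mul_le_of_le_one_left (abs_nonneg _) hd.2).trans
      ((h1.abs_stepReward_le (ν.isControl n y) hy (htr.chainTime_mem hy)).trans ?_)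
    exact mul_le_mul_of_nonneg_left ((price_mul_inv_le_bounding hy h1.halfRate_pos.le).trans
      (bounding_le_weight y _)) (by linarith)
  · change ‖_ * (0 : ℝ)‖ₑ ≤ _
    simp

theorem integrable_law {ν : M.Strategy} {x : PState K} (hx : x ∈ M.stateSpace) (n : ℕ)
    {F : (ℕ → ChainState K) → ℝ} (hF : Measurable F) {C : ℝ} (hC : 0 ≤ C)
    (h : ∀ᵐ z ∂(M.law ν x), ‖F z‖ₑ ≤ ENNReal.ofReal C * M.chainWeight h1.halfRate (z n)) :
    Integrable F (M.law ν x) ∧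
      ∫ z, ‖F z‖ ∂(M.law ν x) ≤ C * M.weight h1.halfRate x * (1 / 2) ^ n := by
  have hW := h1.weight_nonneg hx h1.halfRate
  have hle : ∫⁻ z, ‖F z‖ₑ ∂(M.law ν x)
      ≤ ENNReal.ofReal (C * M.weight h1.halfRate x * (1 / 2) ^ n) := by
    refine (lintegral_mono_ae h).trans ?_
    have hm : Measurable fun z : ℕ → ChainState K => M.chainWeight h1.halfRate (z n) :=
      (measurable_chainWeight _).comp (measurable_pi_apply n)
    rw [lintegral_const_mul _ hm]
    refine (mul_le_mul' le_rfl (h1.lintegral_law_chainWeight_le ν x n)).trans (le_of_eq ?_)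
    rw [ENNReal.ofReal_mul (mul_nonneg hC hW), ENNReal.ofReal_mul hC, ENNReal.ofReal_pow (by norm_num),
      one_div, ENNReal.ofReal_inv_of_pos two_pos, ENNReal.ofReal_ofNat]
    ring
  refine ⟨⟨hF.aestronglyMeasurable, hle.trans_lt ENNReal.ofReal_lt_top⟩, ?_⟩
  rw [integral_norm_eq_lintegral_enorm hF.aestronglyMeasurable]
  exact ENNReal.toReal_le_of_le_ofReal (by positivity) hle

theorem integrable_stageReward (ν : M.Strategy) {x : PState K} (hx : x ∈ M.stateSpace) (n : ℕ) :
    Integrable (M.stageReward ν x.time n) (M.law ν x) ∧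
      ∫ z, ‖M.stageReward ν x.time n z‖ ∂(M.law ν x)
        ≤ (2 + M.f M.νmax) * M.weight h1.halfRate x * (1 / 2) ^ n :=
  h1.integrable_law hx n (measurable_stageReward ν _ n) (by linarith [M.f_νmax_nonneg])
    ((h1.ae_isGood ν hx).mono fun _ hz => h1.enorm_stageReward_le hz hx n)

theorem summable_stageReward (ν : M.Strategy) {x : PState K} (hx : x ∈ M.stateSpace) :
    Summable fun n => ∫ z, ‖M.stageReward ν x.time n z‖ ∂(M.law ν x) :=
  Summable.of_nonneg_of_le (fun _ => integral_nonneg fun _ => norm_nonneg _)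
    (fun n => (h1.integrable_stageReward ν hx n).2)
    ((summable_geometric_of_lt_one (by norm_num) (by norm_num)).mul_left _)

/-- Measurability of the payoff is not checked from its definition. It agrees almost surely with a
series of measurable stage rewards that is absolutely summable in mean. -/
theorem integrable_payoff (ν : M.Strategy) {x : PState K} (hx : x ∈ M.stateSpace) :
    Integrable (M.payoff ν x.time) (M.law ν x) := by
  have h : Integrable (fun z => ∑' n, M.stageReward ν x.time n z) (M.law ν x) := by
    have hm := fun n => (measurable_stageReward ν x.time n)
    have hsum : ∫⁻ z, ∑' n, ‖M.stageReward ν x.time n z‖ₑ ∂(M.law ν x) ≠ ⊤ := by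
      rw [lintegral_tsum fun n => (hm n).enorm.aemeasurable]
      have e : ∀ n, ∫⁻ z, ‖M.stageReward ν x.time n z‖ₑ ∂(M.law ν x)
          = ENNReal.ofReal (∫ z, ‖M.stageReward ν x.time n z‖ ∂(M.law ν x)) := fun n => by
        rw [ofReal_integral_norm_eq_lintegral_enorm (h1.integrable_stageReward ν hx n).1]
      simp only [e]
      exact (h1.summable_stageReward ν hx).tsum_ofReal_ne_top
    refine ⟨(Measurable.tsum hm).aestronglyMeasurable, lt_of_le_of_lt (lintegral_mono fun z => ?_)
      hsum.lt_top⟩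
    exact enorm_tsum_le_tsum_enorm
  refine h.congr ?_
  filter_upwards [h1.ae_isGood ν hx] with z hz
  exact (hz.payoff_eq_tsum h1 hx).symm

theorem hasSum_reward (ν : M.Strategy) {x : PState K} (hx : x ∈ M.stateSpace) :
    HasSum (fun n => ∫ z, M.stageReward ν x.time n z ∂(M.law ν x)) (M.reward ν x) := by
  have e : M.reward ν x = ∫ z, ∑' n, M.stageReward ν x.time n z ∂(M.law ν x) :=
    integral_congr_ae ((h1.ae_isGood ν hx).mono fun z hz => hz.payoff_eq_tsum h1 hx)
  rw [e]
  exact hasSum_integral_of_summable_integral_norm (fun n => (h1.integrable_stageReward ν hx n).1)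
    (h1.summable_stageReward ν hx)

/-! ### Verification: rewards of strategies against the fixed point -/

section Value

variable {v : PState K → ℝ} {C : ℝ} {x : PState K}

theorem integrable_stageValue (ν : M.Strategy) (hx : x ∈ M.stateSpace) (hv : Measurable v)
    (hC : 0 ≤ C) (h : ∀ y ∈ M.stateSpace, |v y| ≤ C * M.bounding h1.halfRate y) (n : ℕ) :
    Integrable (M.stageValue v x.time n) (M.law ν x) ∧
      ∫ z, ‖M.stageValue v x.time n z‖ ∂(M.law ν x) ≤ C * M.weight h1.halfRate x * (1 / 2) ^ n :=
  h1.integrable_law hx n (measurable_stageValue hv _ n) hC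
    ((h1.ae_isGood ν hx).mono fun _ hz => h1.enorm_chainExt_le hC h
      (fun _ hy => hz.mem_stateSpace hx hy) (hz.time_le_chainTime hx n))

theorem tendsto_stageValue (ν : M.Strategy) (hx : x ∈ M.stateSpace) (hv : Measurable v)
    (hC : 0 ≤ C) (h : ∀ y ∈ M.stateSpace, |v y| ≤ C * M.bounding h1.halfRate y) :
    Tendsto (fun n => ∫ z, M.stageValue v x.time n z ∂(M.law ν x)) atTop (𝓝 0) := by
  refine squeeze_zero_norm (fun n => (norm_integral_le_integral_norm _).trans
    (h1.integrable_stageValue ν hx hv hC h n).2) ?_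
  have := (tendsto_pow_atTop_nhds_zero_of_lt_one (r := (1 / 2 : ℝ)) (by norm_num)
    (by norm_num)).const_mul (C * M.weight h1.halfRate x)
  simpa using this

theorem integral_stageValue_zero (ν : M.Strategy) (hx : x ∈ M.stateSpace) :
    ∫ z, M.stageValue v x.time 0 z ∂(M.law ν x) = v x := by
  have e : ∫ z, M.stageValue v x.time 0 z ∂(M.law ν x) = ∫ _, v x ∂(M.law ν x) := by
    refine integral_congr_ae ?_
    filter_upwards [h1.ae_isGood ν hx] with z hz
    rw [stageValue, hz.zero]
    change Real.exp (-M.ρ * (x.time - x.time)) * v x = v x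
    rw [sub_self, mul_zero, Real.exp_zero, one_mul]
  rw [e, integral_const, probReal_univ, one_smul]

/-- Conditioning on the `n`-th entry reduces the claim to `integral_step`, because the discount
factor at the next jump splits into the one at the current jump and the one for the period in
between. -/
theorem integral_stage (ν : M.Strategy) (hx : x ∈ M.stateSpace) (hv : Measurable v)
    (hC : 0 ≤ C) (h : ∀ y ∈ M.stateSpace, |v y| ≤ C * M.bounding h1.halfRate y) (n : ℕ) :
    Integrable (fun z : ℕ → ChainState K => M.chainDisc x.time (z n) *
      chainExt (fun y => h1.totalReward v (M.cut (ν.1 n y) y) y) (z n)) (M.law ν x) ∧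
    (∫ z, M.stageReward ν x.time n z ∂(M.law ν x))
        + ∫ z, M.stageValue v x.time (n + 1) z ∂(M.law ν x)
      = ∫ z, M.chainDisc x.time (z n) *
        chainExt (fun y => h1.totalReward v (M.cut (ν.1 n y) y) y) (z n) ∂(M.law ν x) := by
  have ha := (ν.2 n).1
  have hc := ν.isControl n
  set H : ChainState K × ChainState K → ℝ := fun p =>
    M.chainDisc x.time p.1 * M.stepReward (ν.1 n) p.1 p.2 + M.chainDisc x.time p.2 * chainExt v p.2
    with hH
  have hHm : Measurable H :=
    (((measurable_chainDisc _).comp measurable_fst).mul (measurable_stepReward ha hc)).add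
      (((measurable_chainDisc _).mul (measurable_chainExt hv)).comp measurable_snd)
  have hpair : Measurable fun z : ℕ → ChainState K => (z n, z (n + 1)) := by fun_prop
  have i1 := (h1.integrable_stageReward ν hx n).1
  have i2 := (h1.integrable_stageValue ν hx hv hC h (n + 1)).1
  have hint : Integrable H ((M.law ν x).map (fun z => (z n, z (n + 1)))) :=
    (integrable_map_measure hHm.aestronglyMeasurable hpair.aemeasurable).2 (i1.add i2)
  have e1 : (∫ z, M.stageReward ν x.time n z ∂(M.law ν x))
      + ∫ z, M.stageValue v x.time (n + 1) z ∂(M.law ν x)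
      = ∫ p, H p ∂((M.law ν x).map (fun z => (z n, z (n + 1)))) := by
    rw [← integral_add i1 i2, integral_map hpair.aemeasurable hHm.aestronglyMeasurable]
    rfl
  rw [map_law_pair] at hint e1
  have hint2 : Integrable (fun z => ∫ z', H (z, z') ∂(M.stepKernel (ν.1 n) z))
      ((M.law ν x).map fun z => z n) := by
    have := (Measure.integrable_compProd_iff hint.aestronglyMeasurable).1 hint
    refine this.2.mono' ?_ (Eventually.of_forall fun z => norm_integral_le_integral_norm _)
    exact hHm.stronglyMeasurable.integral_kernel_prod_right'.aestronglyMeasurable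
  have hin : ∀ᵐ z ∂(M.law ν x), ∫ z', H (z n, z') ∂(M.stepKernel (ν.1 n) (z n))
      = M.chainDisc x.time (z n) *
        chainExt (fun y => h1.totalReward v (M.cut (ν.1 n y) y) y) (z n) := by
    filter_upwards [h1.ae_isGood ν hx] with z hz
    rw [h1.stepKernel_apply]
    rcases hzn : z n with y | u
    · have hy := hz.mem_stateSpace hx hzn
      change _ = _ * h1.totalReward v (M.cut (ν.1 n y) y) y
      rw [← h1.integral_step ha hc hy hv hC h, ← integral_const_mul]
      refine integral_congr_ae (Eventually.of_forall fun z' => ?_)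
      have hd : M.chainDisc x.time z' = M.chainDisc x.time (Sum.inl y) * M.chainDisc y.time z' := by
        rw [chainDisc, chainDisc, chainDisc, ← Real.exp_add]
        congr 1
        change _ = -M.ρ * (y.time - x.time) + _
        ring
      simp only [hH]
      rw [hd]
      ring
    -- In the cemetery the next entry is again the cemetery, and both terms vanish by the extension
    -- by zero.
    · change ∫ z', H (Sum.inr u, z') ∂(Measure.dirac (Sum.inr ())) = _ * (0 : ℝ)
      rw [integral_dirac' (fun z' => H (Sum.inr u, z')) _
        (hHm.comp measurable_prodMk_left).stronglyMeasurable, mul_zero]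
      change _ * (0 : ℝ) + _ * (0 : ℝ) = 0
      simp
  have hpn : Measurable fun z : ℕ → ChainState K => z n := measurable_pi_apply n
  refine ⟨((integrable_map_measure hint2.aestronglyMeasurable hpn.aemeasurable).1 hint2).congr hin, ?_⟩
  rw [e1, Measure.integral_compProd hint,
    integral_map hpn.aemeasurable hint2.aestronglyMeasurable]
  exact integral_congr_ae hin

/-- By the Bellman equation any rate yields at most the fixed point, so each stage reward is at most
the decrease of the expected discounted value. The sum telescopes, and the remainder tends to zero
with the weights. -/
theorem reward_le (ν : M.Strategy) (hx : x ∈ M.stateSpace) (hv : Measurable v)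
    (hC : 0 ≤ C) (h : ∀ y ∈ M.stateSpace, |v y| ≤ C * M.bounding h1.halfRate y)
    (hT : ∀ y ∈ M.stateSpace, v y = M.bellman v y) : M.reward ν x ≤ v x := by
  have hstep : ∀ n, ∫ z, M.stageReward ν x.time n z ∂(M.law ν x)
      ≤ (∫ z, M.stageValue v x.time n z ∂(M.law ν x))
        - ∫ z, M.stageValue v x.time (n + 1) z ∂(M.law ν x) := by
    intro n
    obtain ⟨i, e⟩ := h1.integral_stage ν hx hv hC h n
    rw [le_sub_iff_add_le, e]
    refine integral_mono_ae i (h1.integrable_stageValue ν hx hv hC h n).1 ?_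
    filter_upwards [h1.ae_isGood ν hx] with z hz
    refine mul_le_mul_of_nonneg_left ?_ (Real.exp_pos _).le
    rcases hzn : z n with y | u
    · have hy := hz.mem_stateSpace hx hzn
      change h1.totalReward v (M.cut (ν.1 n y) y) y ≤ v y
      rw [hT y hy]
      exact h1.le_bellman hv h1.halfRate_pos hC h hy (ν.isControl n y)
    · exact le_rfl
  have hsum : ∀ N, ∑ n ∈ Finset.range N, ∫ z, M.stageReward ν x.time n z ∂(M.law ν x)
      ≤ v x - ∫ z, M.stageValue v x.time N z ∂(M.law ν x) := by
    intro N
    refine (Finset.sum_le_sum fun n _ => hstep n).trans (le_of_eq ?_)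
    rw [Finset.sum_range_sub', h1.integral_stageValue_zero ν hx]
  have l1 := (h1.hasSum_reward ν hx).tendsto_sum_nat
  have l2 := (h1.tendsto_stageValue ν hx hv hC h).const_sub (v x)
  rw [sub_zero] at l2
  exact le_of_tendsto_of_tendsto' l1 l2 hsum

/-- The same telescoping with a loss of `ε * bounding` per period. Measuring the loss by the
bounding function makes it geometrically small in the period, and the factor 2 is the sum of the
geometric series. -/
theorem le_reward (ν : M.Strategy) (hx : x ∈ M.stateSpace) (hv : Measurable v)
    (hC : 0 ≤ C) (h : ∀ y ∈ M.stateSpace, |v y| ≤ C * M.bounding h1.halfRate y) {ε : ℝ} (hε : 0 ≤ ε)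
    (hν : ∀ n, ∀ y ∈ M.stateSpace,
      v y - ε * M.bounding h1.halfRate y ≤ h1.totalReward v (M.cut (ν.1 n y) y) y) :
    v x - ε * M.weight h1.halfRate x * 2 ≤ M.reward ν x := by
  have hW := h1.weight_nonneg hx h1.halfRate
  have hbd : ∀ y ∈ M.stateSpace, |M.bounding h1.halfRate y| ≤ 1 * M.bounding h1.halfRate y :=
    fun y hy => by rw [one_mul, abs_of_nonneg (bounding_nonneg hy _)]
  have hstep : ∀ n, (∫ z, M.stageValue v x.time n z ∂(M.law ν x))
        - (∫ z, M.stageValue v x.time (n + 1) z ∂(M.law ν x))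
        - ε * M.weight h1.halfRate x * (1 / 2) ^ n
      ≤ ∫ z, M.stageReward ν x.time n z ∂(M.law ν x) := by
    intro n
    obtain ⟨i, e⟩ := h1.integral_stage ν hx hv hC h n
    have ib := h1.integrable_stageValue ν hx (measurable_bounding h1.halfRate) zero_le_one hbd n
    have iv := (h1.integrable_stageValue ν hx hv hC h n).1
    have hb : ∫ z, M.stageValue (M.bounding h1.halfRate) x.time n z ∂(M.law ν x)
        ≤ 1 * M.weight h1.halfRate x * (1 / 2) ^ n :=
      (le_abs_self _).trans ((norm_integral_le_integral_norm _).trans ib.2)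
    have hm : (∫ z, M.stageValue v x.time n z ∂(M.law ν x))
        - ε * ∫ z, M.stageValue (M.bounding h1.halfRate) x.time n z ∂(M.law ν x)
        ≤ ∫ z, M.chainDisc x.time (z n) *
          chainExt (fun y => h1.totalReward v (M.cut (ν.1 n y) y) y) (z n) ∂(M.law ν x) := by
      rw [← integral_const_mul, ← integral_sub iv (ib.1.const_mul ε)]
      refine integral_mono_ae (iv.sub (ib.1.const_mul ε)) i ?_
      filter_upwards [h1.ae_isGood ν hx] with z hz
      have e2 : M.stageValue v x.time n z - ε * M.stageValue (M.bounding h1.halfRate) x.time n z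
          = M.chainDisc x.time (z n) *
            (chainExt v (z n) - ε * chainExt (M.bounding h1.halfRate) (z n)) := by
        simp only [stageValue]; ring
      change M.stageValue v x.time n z - ε * M.stageValue (M.bounding h1.halfRate) x.time n z ≤ _
      rw [e2]
      refine mul_le_mul_of_nonneg_left ?_ (Real.exp_pos _).le
      rcases hzn : z n with y | u
      · exact hν n y (hz.mem_stateSpace hx hzn)
      · change (0 : ℝ) - ε * 0 ≤ 0
        simp
    have := mul_le_mul_of_nonneg_left hb hε
    linarith
  have hsum : ∀ N, v x - (∫ z, M.stageValue v x.time N z ∂(M.law ν x))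
        - ∑ n ∈ Finset.range N, ε * M.weight h1.halfRate x * (1 / 2) ^ n
      ≤ ∑ n ∈ Finset.range N, ∫ z, M.stageReward ν x.time n z ∂(M.law ν x) := by
    intro N
    refine le_trans (le_of_eq ?_) (Finset.sum_le_sum fun n _ => hstep n)
    rw [Finset.sum_sub_distrib, Finset.sum_range_sub', h1.integral_stageValue_zero ν hx]
  have l1 := (h1.hasSum_reward ν hx).tendsto_sum_nat
  have l2 := (h1.tendsto_stageValue ν hx hv hC h).const_sub (v x)
  have l3 := (hasSum_geometric_two.mul_left (ε * M.weight h1.halfRate x)).tendsto_sum_nat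
  have l4 := l2.sub l3
  rw [sub_zero] at l4
  exact le_of_tendsto_of_tendsto' l4 l1 hsum

end Value

end Assumption1

/-! ### Nearly optimal strategies -/

theorem measurable_scale (x : PState K) : Measurable (scale x) := by
  unfold scale
  have := measurable_inv (K := K)
  fun_prop

namespace Assumption1

variable (h1 : M.Assumption1)
include h1

section

variable {v : PState K → ℝ} {C ε : ℝ}

/-- One control that is strictly within the tolerance at `x`, rescaled to the neighbouring
inventories, stays within the tolerance nearby by continuity. Positive price and inventory make the
tolerance positive. -/
theorem exists_nearly_optimal_nhds (h2 : M.Assumption2) (hv : Measurable v)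
    (hcont : ContinuousOn v M.stateSpace) (hC : 0 ≤ C)
    (h : ∀ y ∈ M.stateSpace, |v y| ≤ C * M.bounding h1.halfRate y)
    (hT : ∀ y ∈ M.stateSpace, v y = M.bellman v y) (hε : 0 < ε) {x : PState K}
    (hx : x ∈ M.stateSpace) (hx0 : 0 < x.inv) (hx1 : 0 < x.price) :
    ∃ U : Set (PState K), IsOpen U ∧ x ∈ U ∧ ∃ g : PState K → ℝ → ℝ,
      Measurable (fun y : PState K × ℝ => g y.1 y.2) ∧ (∀ y, M.IsControl (g y)) ∧
      ∀ y ∈ U ∩ M.stateSpace,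
        v y - ε * M.bounding h1.halfRate y ≤ h1.totalReward v (M.cut (g y) y) y := by
  classical
  have hb : 0 < M.bounding h1.halfRate x := mul_pos (mul_pos hx1 hx0) (Real.exp_pos _)
  obtain ⟨α, hα⟩ := h1.exists_lt_totalReward h hx (mul_pos hε hb)
  rw [← hT x hx] at hα
  have hl := (h1.tendsto_totalReward_rescale (ι := M.stateSpace) (l := 𝓝 ⟨x, hx⟩) h2 hv hcont
    h1.halfRate_pos.le hC h hx hx0 (y := Subtype.val) (fun y => y.2)
    (continuous_subtype_val.tendsto _) (α := fun _ => α.1) (α' := fun _ => α.1)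
    (fun _ => α.isControl) fun _ => α.isControl).1
  have hvl : Tendsto (fun y : M.stateSpace => v y - ε * M.bounding h1.halfRate y) (𝓝 ⟨x, hx⟩)
      (𝓝 (v x - ε * M.bounding h1.halfRate x)) :=
    ((continuousOn_iff_continuous_domRestrict.1 hcont).tendsto ⟨x, hx⟩).sub
      ((((continuous_bounding h1.halfRate).comp continuous_subtype_val).tendsto ⟨x, hx⟩).const_mul ε)
  have hsub := hvl.sub hl
  rw [sub_zero] at hsub
  have hev := hsub.eventually (eventually_lt_nhds hα)
  obtain ⟨U, hU, hUo, hxU⟩ := eventually_nhds_iff.1 hev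
  obtain ⟨W, hWo, rfl⟩ := isOpen_induced_iff.1 hUo
  refine ⟨W, hWo, hxU, fun y r => if y ∈ M.stateSpace then M.rescale α.1 x y r else 0, ?_, ?_, ?_⟩
  · refine Measurable.ite (measurable_fst measurableSet_stateSpace) ?_ measurable_const
    exact ((measurable_scale x).comp measurable_fst).mul
      ((α.isControl.cut x).1.comp measurable_snd)
  · intro y
    by_cases hy : y ∈ M.stateSpace
    · simp only [if_pos hy]
      exact α.isControl.rescale hx hy
    · simp only [if_neg hy]
      exact ⟨measurable_const, fun _ => ⟨le_rfl, (div_pos M.w₀_pos M.T_pos).le.trans M.lt_νmax.le⟩⟩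
  · rintro y ⟨hyW, hy⟩
    simp only [if_pos hy]
    have := hU ⟨y, hy⟩ hyW
    simp only at this
    linarith

/-- In place of a measurable selection theorem: where price and inventory are positive, countably
many of the local neighbourhoods suffice, and the local choices are glued along the disjointed
cover. On the rest of the state space `bounding` is zero, everything vanishes and the zero rate will
do. -/
theorem exists_nearly_optimal (h2 : M.Assumption2) (hv : Measurable v)
    (hcont : ContinuousOn v M.stateSpace) (hC : 0 ≤ C)
    (h : ∀ y ∈ M.stateSpace, |v y| ≤ C * M.bounding h1.halfRate y)
    (hT : ∀ y ∈ M.stateSpace, v y = M.bellman v y) (hε : 0 < ε) :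
    ∃ ν : M.Strategy, ∀ n, ∀ y ∈ M.stateSpace,
      v y - ε * M.bounding h1.halfRate y ≤ h1.totalReward v (M.cut (ν.1 n y) y) y := by
  suffices hs : ∃ g : PState K → ℝ → ℝ, Measurable (fun y : PState K × ℝ => g y.1 y.2) ∧
      (∀ y, M.IsControl (g y)) ∧ ∀ y ∈ M.stateSpace,
        v y - ε * M.bounding h1.halfRate y ≤ h1.totalReward v (M.cut (g y) y) y by
    obtain ⟨g, g1, g2, g3⟩ := hs
    exact ⟨⟨fun _ => g, fun _ => ⟨g1, fun y => (g2 y).2⟩⟩, fun _ => g3⟩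
  have hzero : M.IsControl fun _ => (0 : ℝ) :=
    ⟨measurable_const, fun _ => ⟨le_rfl, (div_pos M.w₀_pos M.T_pos).le.trans M.lt_νmax.le⟩⟩
  have hbdry : ∀ y ∈ M.stateSpace, ¬(0 < y.inv ∧ 0 < y.price) → ∀ α, M.IsControl α →
      v y - ε * M.bounding h1.halfRate y ≤ h1.totalReward v (M.cut α y) y := by
    intro y hy hn α hα
    have hb : M.bounding h1.halfRate y = 0 := by
      rw [bounding]
      rcases not_and_or.1 hn with h0 | h0
      · rw [le_antisymm (not_lt.1 h0) (inv_mem hy).1, mul_zero, zero_mul]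
      · rw [le_antisymm (not_lt.1 h0) (price_nonneg hy), zero_mul, zero_mul]
    have e1 := h y hy
    have e2 := h1.abs_totalReward_le (hα.isAdmissible_cut hy) hy hv h1.halfRate_pos hC h
    rw [hb, mul_zero] at e1 e2 ⊢
    rw [abs_nonpos_iff.1 e1, abs_nonpos_iff.1 e2, sub_zero]
  set P : Set (PState K) := {y | y ∈ M.stateSpace ∧ 0 < y.inv ∧ 0 < y.price} with hP
  have hPm : MeasurableSet P := measurableSet_stateSpace.inter
    ((measurableSet_lt measurable_const measurable_inv).inter
      (measurableSet_lt measurable_const measurable_price))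
  have hloc := fun x : P => h1.exists_nearly_optimal_nhds h2 hv hcont hC h hT hε x.2.1 x.2.2.1 x.2.2.2
  choose U hUo hxU g hgm hgc hg using hloc
  obtain ⟨t, htc, ht⟩ := TopologicalSpace.countable_cover_nhds
    (f := fun x : P => (Subtype.val ⁻¹' U x : Set P))
    fun x => ((hUo x).preimage continuous_subtype_val).mem_nhds (hxU x)
  rcases t.eq_empty_or_nonempty with rfl | htn
  · refine ⟨fun _ _ => 0, measurable_const, fun _ => hzero, fun y hy => hbdry y hy (fun hy' => ?_) _ hzero⟩
    have : (⟨y, hy, hy'⟩ : P) ∈ (univ : Set P) := trivial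
    rw [← ht] at this
    simp at this
  obtain ⟨e, rfl⟩ := htc.exists_eq_range htn
  -- Index 0 is reserved for the complement of `P`, with the zero rate, so that the pieces cover the
  -- whole space and the glued rate is a control everywhere.
  let s : ℕ → Set (PState K) := fun n => Nat.casesOn n Pᶜ fun n => U (e n) ∩ P
  let G : ℕ → PState K → ℝ → ℝ := fun n => Nat.casesOn n (fun _ _ => 0) fun n => g (e n)
  have hsm : ∀ n, MeasurableSet (s n) := fun n => by
    cases n with
    | zero => exact hPm.compl
    | succ n => exact (hUo _).measurableSet.inter hPm
  have hGm : ∀ n, Measurable fun y : PState K × ℝ => G n y.1 y.2 := fun n => by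
    cases n with
    | zero => exact measurable_const
    | succ n => exact hgm _
  have hGc : ∀ n y, M.IsControl (G n y) := fun n => by
    cases n with
    | zero => exact fun _ => hzero
    | succ n => exact hgc _
  have hG : ∀ n, ∀ y ∈ s n, y ∈ M.stateSpace →
      v y - ε * M.bounding h1.halfRate y ≤ h1.totalReward v (M.cut (G n y) y) y := fun n => by
    cases n with
    | zero => exact fun y hy hyS => hbdry y hyS (fun h' => hy ⟨hyS, h'⟩) _ hzero
    | succ n => exact fun y hy hyS => hg _ y ⟨hy.1, hyS⟩
  have hcov : ∀ y, ∃ n, y ∈ disjointed s n := by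
    intro y
    rw [← mem_iUnion, iUnion_disjointed, mem_iUnion]
    by_cases hy : y ∈ P
    · have : (⟨y, hy⟩ : P) ∈ (univ : Set P) := trivial
      rw [← ht] at this
      simp only [biUnion_range, mem_iUnion] at this
      obtain ⟨n, hn⟩ := this
      exact ⟨n + 1, hn, hy⟩
    · exact ⟨0, hy⟩
  obtain ⟨F, hF, hFe⟩ := exists_measurable_piecewise (fun n => disjointed s n ×ˢ (univ : Set ℝ))
    (fun n => (MeasurableSet.disjointed hsm n).prod MeasurableSet.univ)
    (fun n (y : PState K × ℝ) => G n y.1 y.2) hGm fun i j hij y hy =>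
      absurd hy.2.1 (disjoint_left.1 (disjoint_disjointed s hij) hy.1.1)
  have hval : ∀ y n, y ∈ disjointed s n → (fun r => F (y, r)) = G n y :=
    fun y n hy => funext fun r => hFe n ⟨hy, trivial⟩
  refine ⟨fun y r => F (y, r), hF, fun y => ?_, fun y hy => ?_⟩
  · obtain ⟨n, hn⟩ := hcov y
    change M.IsControl fun r => F (y, r)
    rw [hval y n hn]
    exact hGc n y
  · obtain ⟨n, hn⟩ := hcov y
    change _ ≤ h1.totalReward v (M.cut (fun r => F (y, r)) y) y
    rw [hval y n hn]
    exact hG n y (disjointed_subset s n hn) hy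

/-! ### The terminal condition and the identification of the value function -/

theorem totalReward_terminal {α : ℝ → ℝ} (hα : M.IsControl α) {x : PState K}
    (hx : x ∈ M.stateSpace) (hT : x.time = M.T) :
    h1.totalReward v α x = x.price * M.h x.inv := by
  have e : (h1.expFlow α x 0).inv = x.inv := by
    change x.inv - ∫ r in (0 : ℝ)..0, α r = x.inv
    rw [intervalIntegral.integral_same, sub_zero]
  rw [totalReward, rewardPart, contPart, hT, sub_self, intervalIntegral.integral_same,
    intervalIntegral.integral_same, mul_zero, Real.exp_zero, h1.surv_zero hα.1 (filt_mem hx), e,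
    hext_of_mem (inv_mem hx)]
  ring

/-- The value function is the fixed point of the maximal reward operator. -/
theorem value_eq (h2 : M.Assumption2) (hv : Measurable v)
    (hcont : ContinuousOn v M.stateSpace) (hC : 0 ≤ C)
    (h : ∀ y ∈ M.stateSpace, |v y| ≤ C * M.bounding h1.halfRate y)
    (hT : ∀ y ∈ M.stateSpace, v y = M.bellman v y) {x : PState K} (hx : x ∈ M.stateSpace) :
    M.value x = v x := by
  -- The bound on the supremum requires at least one strategy.
  have hne : Nonempty M.Strategy :=
    ⟨(h1.exists_nearly_optimal h2 hv hcont hC h hT one_pos).choose⟩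
  have hW := zero_lt_one.trans_le (one_le_weight hx h1.halfRate_pos.le)
  refine le_antisymm (ciSup_le fun ν => h1.reward_le ν hx hv hC h hT) (le_of_forall_pos_le_add
    fun ε hε => ?_)
  -- The tolerance is divided by the factor that `le_reward` produces, so that the total loss is
  -- `ε`.
  obtain ⟨ν, hν⟩ := h1.exists_nearly_optimal h2 hv hcont hC h hT
    (div_pos hε (mul_pos hW two_pos) : 0 < ε / (M.weight h1.halfRate x * 2))
  have hle := h1.le_reward ν hx hv hC h (div_pos hε (mul_pos hW two_pos)).le hν
  have e : ε / (M.weight h1.halfRate x * 2) * M.weight h1.halfRate x * 2 = ε := by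
    field_simp
  rw [e] at hle
  have hsup : M.reward ν x ≤ M.value x :=
    le_ciSup (f := fun ν => M.reward ν x)
      ⟨v x, by rintro _ ⟨ν, rfl⟩; exact h1.reward_le ν hx hv hC h hT⟩ ν
  linarith

end

end Assumption1

end LiquidationModel

/-! ### The theorem -/

theorem theorem4p1 {K : ℕ} (M : LiquidationModel K)
    (h1 : M.Assumption1) (h2 : M.Assumption2) :
    -- the objects are well defined: flow, controlled process, expected proceeds, supremum
    (∀ x ∈ M.stateSpace, ∀ α : M.Control, ∃ y, M.IsFlow α.1 x y ∧
      ∀ y', M.IsFlow α.1 x y' → Set.EqOn y' y (Set.Icc 0 (M.T - x.time))) ∧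
    (∀ (ν : M.Strategy) (n : ℕ), Measurable (M.stepMeasure (ν.1 n)) ∧
      ∀ z, MeasureTheory.IsProbabilityMeasure (M.stepMeasure (ν.1 n) z)) ∧
    (∀ x ∈ M.stateSpace,
      (∀ ν : M.Strategy, MeasureTheory.Integrable (M.payoff ν x.time) (M.law ν x)) ∧
      BddAbove (Set.range fun ν : M.Strategy => M.reward ν x)) ∧
    -- continuity and boundary values
    ContinuousOn M.value M.stateSpace ∧
    (∀ x ∈ M.lateral, M.value x = 0) ∧
    (∀ x ∈ M.terminal, M.value x = x.price * M.h x.inv) ∧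
    -- the decision model is contracting for large weights
    (∃ γ₀ > 0, ∀ γ ≥ γ₀, M.IsContracting γ) ∧
    -- the value function is the unique fixed point of the maximal reward operator
    (∀ γ > 0, M.value ∈ M.Bb γ ∧
      (∀ x ∈ M.stateSpace, M.value x = M.bellman M.value x) ∧
      ∀ v ∈ M.Bb γ, (∀ x ∈ M.stateSpace, v x = M.bellman v x) →
        Set.EqOn v M.value M.stateSpace) := by
  obtain ⟨V, hVm, hVc, ⟨C, hC, hVb⟩, hVT⟩ := h1.exists_fixedPoint h2
  have hval : ∀ x ∈ M.stateSpace, M.value x = V x := fun x hx =>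
    h1.value_eq h2 hVm hVc hC hVb hVT hx
  have hvalb : ∀ x ∈ M.stateSpace, |M.value x| ≤ C * M.bounding h1.halfRate x := fun x hx => by
    rw [hval x hx]; exact hVb x hx
  have hBb : M.value ∈ M.Bb h1.halfRate := by
    refine ⟨?_, C, hvalb⟩
    have e : (fun x : M.stateSpace => M.value x) = fun x : M.stateSpace => V x :=
      funext fun x => hval x x.2
    rw [e]
    exact hVm.comp measurable_subtype_coe
  have hvalT : ∀ x ∈ M.stateSpace, M.value x = M.bellman M.value x := fun x hx => by
    rw [hval x hx, hVT x hx]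
    exact h1.bellman_congr hVb (fun y hy => (hval y hy).symm) hx
  refine ⟨fun x hx α => ⟨h1.expFlow α.1 x, h1.isFlow_expFlow α.isControl hx, fun y' hy' =>
      h1.isFlow_unique α.isControl hx hy' (h1.isFlow_expFlow α.isControl hx)⟩,
    fun ν n => ⟨h1.measurable_stepMeasure (ν.2 n).1 (ν.isControl n),
      h1.isProbabilityMeasure_stepMeasure (ν.isControl n)⟩,
    fun x hx => ⟨fun ν => h1.integrable_payoff ν hx, V x, ?_⟩,
    hVc.congr hval, fun x hx => ?_, fun x hx => ?_,
    ⟨h1.jumpRateBound + 1, by linarith [h1.jumpRateBound_nonneg], fun γ hγ => h1.isContracting hγ⟩,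
    fun γ hγ => ⟨LiquidationModel.Bb_subset h1.halfRate_pos.le hγ.le hBb, hvalT, fun v hv hvT =>
      h1.fixedPoint_unique (LiquidationModel.Bb_subset hγ.le h1.halfRate_pos.le hv) hBb hvT hvalT⟩⟩
  · rintro _ ⟨ν, rfl⟩
    exact h1.reward_le ν hx hVm hC hVb hVT
  · exact h1.lateral_eq_zero hvalb x hx
  · obtain ⟨hxS, hxT⟩ := hx
    rw [hvalT x hxS, h1.bellman_eq hvalb hxS]
    -- At the horizon no time is left to sell, so the reward does not depend on the control and the
    -- supremum is over a constant.
    have e : ∀ α : M.Control, h1.totalReward M.value (M.cut α.1 x) x = x.price * M.h x.inv := by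
      intro α
      rw [h1.totalReward_terminal (α.isControl.cut x) hxS hxT]
    simp only [e, ciSup_const]
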